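/- **Conventions.** All parameters are functions of $\kappa\in\mathbb N$: integers $n=n(\kappa)\ge 1$, $N=N(\kappa)\ge 2$, $\ell=\ell(\kappa)$ and a real number $r=r(\kappa)>1$. For $s>0$ put $\rho_s(j)=\exp(-\pi j^2/s^2)$, and let $D_{\mathbb Z,s}$ be the distribution on $\mathbb Z$ with mass proportional to $\rho_s$. *Search $\mathrm{LWE}_{n,N,\alpha}^{\ell}$* ($0<\alpha<1$): for a uniformly random secret $\mathbf s\in\mathbb Z_N^n$, the input consists of $\ell$ independent samples $(\mathbf a,\langle \mathbf a,\mathbf s\rangle+e)\in\mathbb Z_N^n\times\mathbb Z_N$ with $\mathbf a$ uniform in $\mathbb Z_N^n$ and $e\sim D_{\mathbb Z,\alpha N}$. An oracle (a randomized map from inputs to $\mathbb Z_N^n$) solves the problem if, for all large $\kappa$, it outputs $\mathbf s$ with probability at least $C\,(n\log N)^{-d}$, for some constants $C>0$ and $d$. *Search $\mathrm{G\text{-}EDCP}_{n,N,r}^{\ell}$*: for a fixed $\mathbf s\in\mathbb Z_N^n$ and arbitrary $\mathbf x_1,\dots,\mathbf x_\ell\in\mathbb Z_N^n$, the input consists of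 the $\ell$ quantum states (normalization omitted) $$\sum_{j\in\mathbb Z}\rho_r(j)\,|j\rangle\,|\mathbf x_k+j\,\mathbf s \bmod N\rangle ,\qquad k=1,\dots,\ell .$$ An algorithm solves the problem if, for all large $\kappa$ and for all $\mathbf s,\mathbf x_1,\dots,\mathbf x_\ell$, it outputs $\mathbf s$ with probability at least $C\,(n\log N)^{-d}$, for some constants $C>0$ and $d$. *Quantum algorithms* are fixed programs, independent of $\kappa$, of a classically controlled quantum machine: integer arithmetic charged by bit length, exact real arithmetic in gate angles and in tests, Hadamard, phase and rotation gates on single qubits, coherent evaluation $|u\rangle|z\rangle\mapsto|u\rangle|z\oplus f(u)\rangle$ of integer arithmetic expressions $f$ charged by bit length, measurements of qubits, and oracle calls on classical inputs charged by their length. The program is given $\kappa,n,N,\ell,r$. **Theorem (EDCP $\le$ LWE).** There is a quantum oracle algorithm $R$ with the following property. Let $n$, $N$, $\ell$, $r$ be as above, where $n$, $\log N$ and $\ell$ are bounded by polynomials in $\kappa$, and suppose that $\ell=\Omega(\kappa)$, $r=\Omega(\sqrt\kappa)$ and $N/r=\Omega(\sqrt\kappa)$. Then $R$ is a reduction from $\mathrm{G\text{-}EDCP}_{n,N,r}^{\ell}$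 to $\mathrm{LWE}_{n,N,\alpha}^{\ell}$ with $\alpha=1/r$: on $\mathrm{G\text{-}EDCP}_{n,N,r}^{\ell}$ inputs the run-time of $R$ is bounded by a polynomial in $\kappa$, and for every oracle $O$ that solves search $\mathrm{LWE}_{n,N,\alpha}^{\ell}$, the algorithm $R$ with oracle $O$ solves search $\mathrm{G\text{-}EDCP}_{n,N,r}^{\ell}$. -/

import Mathlib

open Asymptotics Filter

noncomputable section

namespace QRed

-- Gaussians and the search version of LWE

/-- The Gaussian weight `ρ_s(j) = exp (-π j² / s²)` on the integers. -/
def rho (s : ℝ) (j : ℤ) : ℝ := Real.exp (-Real.pi * (j : ℝ) ^ 2 / s ^ 2)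

theorem rho_pos (s : ℝ) (j : ℤ) : 0 < rho s j := Real.exp_pos _

theorem summable_rho {s : ℝ} (hs : s ≠ 0) : Summable (rho s) := by
  have h := HurwitzKernelBounds.summable_f_int 0 0 (t := 1 / s ^ 2) (by positivity)
  refine h.congr fun j => ?_
  simp only [HurwitzKernelBounds.f_int, rho, pow_zero, one_mul, add_zero]
  congr 1
  ring

/-- The discrete Gaussian distribution `D_{ℤ,s}`: the mass at `j` is `ρ_s(j) / ∑ i, ρ_s(i)`
(and, for the degenerate parameter `s = 0`, the point mass at `0`). -/
def discreteGaussian (s : ℝ) : PMF ℤ :=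
  if hs : s = 0 then PMF.pure 0 else
    PMF.normalize (fun j => ENNReal.ofReal (rho s j))
      (fun h => (ENNReal.ofReal_pos.2 (rho_pos s 0)).ne' (ENNReal.tsum_eq_zero.1 h 0))
      (summable_rho hs).tsum_ofReal_ne_top

/-- One LWE sample `(a, ⟨a, s⟩ + e)` for the secret `s`, with `a` uniform in `ℤ_N^n` and the
error `e` drawn from `D_{ℤ, α N}`. -/
def lweSample (n N : ℕ) [NeZero N] (α : ℝ) (s : Fin n → ZMod N) :
    PMF ((Fin n → ZMod N) × ZMod N) :=
  (PMF.uniformOfFintype (Fin n → ZMod N)).bind fun a =>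
    (discreteGaussian (α * N)).map fun e => (a, ∑ i, a i * s i + (e : ZMod N))

/-- A (possibly randomized) procedure that receives `m` pairs `(a, b) ∈ ℤ_N^n × ℤ_N` and answers
with an element of `ℤ_N^n`. Every call uses fresh randomness. -/
abbrev Oracle (n N m : ℕ) : Type :=
  (Fin m → (Fin n → ZMod N) × ZMod N) → PMF (Fin n → ZMod N)

/-- The probability that `O` outputs the secret, over a uniform secret, `m` independent LWE
samples for this secret, and the randomness of `O`. -/
def lweSuccess (n N m : ℕ) [NeZero N] (α : ℝ) (O : Oracle n N m) : ℝ :=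
  ∑ s : Fin n → ZMod N, (PMF.uniformOfFintype (Fin n → ZMod N) s).toReal *
    ∑ q : Fin m → (Fin n → ZMod N) × ZMod N,
      (∏ k, (lweSample n N α s (q k)).toReal) * (O q s).toReal

-- The machine model: a random access machine with classical control over a quantum memory

/-- The classical memory: integer arrays, `M a i` being entry `i` of array `a`. A program names
finitely many arrays; the indices are computed at run time. -/
abbrev Mem : Type := ℕ → ℕ → ℤ

/-- A computational basis state of the quantum memory. Quantum register `b` holds the natural
number `x b`, its binary digits being the values of the qubits of the register; only finitely
many qubits are `1`. -/
abbrev Basis : Type := ℕ →₀ ℕ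

/-- A (not necessarily normalized) pure state of the quantum memory, by its amplitudes. -/
abbrev QState : Type := Basis → ℂ

/-- The number of binary digits of `|z|`. -/
def bitlen (z : ℤ) : ℕ := z.natAbs.size

/-- The integer arithmetic operations (division and remainder are those of `Int`). -/
inductive Op
  | add | sub | mul | div | mod

def Op.eval : Op → ℤ → ℤ → ℤ
  | .add, u, v => u + v
  | .sub, u, v => u - v
  | .mul, u, v => u * v
  | .div, u, v => u / v
  | .mod, u, v => u % v

/-- Classical integer expressions: constants, memory cells (entry `i` of array `a`), bit length,
arithmetic. -/
inductive Expr
  | const (z : ℤ)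
  | cell (a : ℕ) (i : Expr)
  | bitlen (e : Expr)
  | bin (o : Op) (e f : Expr)

def Expr.eval (M : Mem) : Expr → ℤ
  | .const z => z
  | .cell a i => M a (i.eval M).toNat
  | .bitlen e => (QRed.bitlen (e.eval M) : ℤ)
  | .bin o e f => o.eval (e.eval M) (f.eval M)

/-- The number of bit operations charged for an evaluation: addressing and copying are linear in
the bit lengths involved, an arithmetic operation costs the product of the operand lengths. -/
def Expr.cost (M : Mem) : Expr → ℕ
  | .const z => QRed.bitlen z + 1
  | .cell a i => i.cost M + QRed.bitlen (i.eval M) + QRed.bitlen (M a (i.eval M).toNat) + 1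
  | .bitlen e => e.cost M + QRed.bitlen (e.eval M) + 1
  | .bin _ e f => e.cost M + f.cost M + (QRed.bitlen (e.eval M) + 1) * (QRed.bitlen (f.eval M) + 1)

/-- Integer expressions that are evaluated in superposition: classical expressions, the number in
the lowest `w` qubits of register `b`, arithmetic. -/
inductive QExpr
  | cl (e : Expr)
  | reg (b w : Expr)
  | bin (o : Op) (f g : QExpr)

def QExpr.eval (M : Mem) (x : Basis) : QExpr → ℤ
  | .cl e => e.eval M
  | .reg b w => ((x (b.eval M).toNat % 2 ^ (w.eval M).toNat : ℕ) : ℤ)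
  | .bin o f g => o.eval (f.eval M x) (g.eval M x)

/-- An upper bound for the bit length of the value on every basis state. -/
def QExpr.width (M : Mem) : QExpr → ℕ
  | .cl e => QRed.bitlen (e.eval M)
  | .reg _ w => (w.eval M).toNat
  | .bin _ f g => f.width M + g.width M + 1

def QExpr.cost (M : Mem) : QExpr → ℕ
  | .cl e => e.cost M
  | .reg b w => b.cost M + w.cost M + (w.eval M).toNat + 1
  | .bin _ f g => f.cost M + g.cost M + (f.width M + 1) * (g.width M + 1)

/-- Real expressions, used for the angles of gates and in tests. `param` is the real parameter of
the problem instance. Real numbers are computed with exactly, and are never stored. -/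
inductive RExpr
  | int (e : Expr)
  | param
  | pi
  | add (t u : RExpr)
  | sub (t u : RExpr)
  | mul (t u : RExpr)
  | div (t u : RExpr)
  | exp (t : RExpr)
  | arccos (t : RExpr)

def RExpr.eval (M : Mem) (r : ℝ) : RExpr → ℝ
  | .int e => (e.eval M : ℝ)
  | .param => r
  | .pi => Real.pi
  | .add t u => t.eval M r + u.eval M r
  | .sub t u => t.eval M r - u.eval M r
  | .mul t u => t.eval M r * u.eval M r
  | .div t u => t.eval M r / u.eval M r
  | .exp t => Real.exp (t.eval M r)
  | .arccos t => Real.arccos (t.eval M r)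

/-- A real operation is charged one unit. -/
def RExpr.cost (M : Mem) : RExpr → ℕ
  | .int e => e.cost M + 1
  | .param => 1
  | .pi => 1
  | .add t u => t.cost M + u.cost M + 1
  | .sub t u => t.cost M + u.cost M + 1
  | .mul t u => t.cost M + u.cost M + 1
  | .div t u => t.cost M + u.cost M + 1
  | .exp t => t.cost M + 1
  | .arccos t => t.cost M + 1

/-- The value of qubit `i` of register `b`. -/
def qbit (x : Basis) (b i : ℕ) : Bool := (x b).testBit i

/-- The basis state with qubit `i` of register `b` flipped. -/
def flipBit (x : Basis) (b i : ℕ) : Basis := x.update b (x b ^^^ 2 ^ i)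

/-- Row and column index of a gate for the value of a qubit. -/
def bitIdx (v : Bool) : Fin 2 := if v then 1 else 0

/-- The one-qubit gate `U` on qubit `i` of register `b`. -/
def applyGate (U : Matrix (Fin 2) (Fin 2) ℂ) (b i : ℕ) (ψ : QState) : QState := fun x =>
  U (bitIdx (qbit x b i)) (bitIdx (qbit x b i)) * ψ x +
    U (bitIdx (qbit x b i)) (bitIdx (!qbit x b i)) * ψ (flipBit x b i)

def hadamardGate : Matrix (Fin 2) (Fin 2) ℂ :=
  ((1 / Real.sqrt 2 : ℝ) : ℂ) • !![1, 1; 1, -1]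

def phaseGate (θ : ℝ) : Matrix (Fin 2) (Fin 2) ℂ := !![1, 0; 0, Complex.exp (θ * Complex.I)]

def rotGate (θ : ℝ) : Matrix (Fin 2) (Fin 2) ℂ :=
  !![(Real.cos θ : ℂ), -(Real.sin θ : ℂ); (Real.sin θ : ℂ), (Real.cos θ : ℂ)]

/-- The value of `f` is XORed into the lowest `w` qubits of register `b` (a negative value in
two's complement). While `f` is evaluated, register `b` reads as `0`, so that the map is an
involution on the basis states. -/
def xorBasis (M : Mem) (b w : ℕ) (f : QExpr) (x : Basis) : Basis :=
  x.update b (x b ^^^ (f.eval M (x.erase b) % 2 ^ w).toNat)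

/-- The unnormalized state after qubit `i` of register `b` was measured with outcome `v`. -/
def project (b i : ℕ) (v : Bool) (ψ : QState) : QState := fun x =>
  if qbit x b i = v then ψ x else 0

/-- A configuration: classical memory, unnormalized state of the quantum memory (its squared norm
is the probability that the computation has taken this branch), and the time used so far. -/
structure Config where
  mem : Mem
  amp : QState
  time : ℕ

def Config.tick (c : Config) (t : ℕ) : Config := { c with time := c.time + t }

def Mem.write (M : Mem) (a i : ℕ) (z : ℤ) : Mem := Function.update M a (Function.update (M a) i z)

/-- Programs. All loops are bounded: `loop e p` runs `p` as many times as the value of `e` says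
when the loop is entered. -/
inductive Prog
  | skip
  | assign (a : ℕ) (i e : Expr)
  | seq (p q : Prog)
  | ifPos (e : Expr) (p q : Prog)
  | ifRealPos (t : RExpr) (p q : Prog)
  | loop (e : Expr) (p : Prog)
  | hadamard (b i : Expr)
  | phase (b i : Expr) (t : RExpr)
  | rot (b i : Expr) (t : RExpr)
  | xor (b w : Expr) (f : QExpr)
  | measure (b i : Expr) (a : ℕ) (d : Expr)
  | query

/-- The oracle input in array `1`: pair `k` consists of the `n + 1` entries from `k (n + 1)` on,
read modulo `N`. -/
def readQuery (n N m : ℕ) (M : Mem) : Fin m → (Fin n → ZMod N) × ZMod N := fun k =>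
  (fun i => (M 1 (k * (n + 1) + i) : ZMod N), (M 1 (k * (n + 1) + n) : ZMod N))

/-- The oracle answer is written to array `2`. -/
def writeAnswer {n N : ℕ} (M : Mem) (t : Fin n → ZMod N) : Mem :=
  Function.update M 2 fun i => if h : i < n then ((t ⟨i, h⟩).val : ℤ) else M 2 i

/-- An oracle call is charged for the length of its input and of its answer. -/
def queryCost (n N m : ℕ) (M : Mem) : ℕ :=
  ∑ i ∈ Finset.range (m * (n + 1)), (bitlen (M 1 i) + 1) + n * (N.size + 1) + 1

/-- The branches in which a program can end: a measurement branches over its two outcomes, an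
oracle call over all answers. -/
def Prog.run {n N m : ℕ} [NeZero N] (r : ℝ) (O : Oracle n N m) :
    Prog → Config → Multiset Config
  | .skip => fun c => {c.tick 1}
  | .assign a i e => fun c =>
      {{ mem := c.mem.write a (i.eval c.mem).toNat (e.eval c.mem)
         amp := c.amp
         time := c.time + i.cost c.mem + e.cost c.mem + 1 }}
  | .seq p q => fun c => (p.run r O c).bind (q.run r O)
  | .ifPos e p q => fun c =>
      if 0 < e.eval c.mem then p.run r O (c.tick (e.cost c.mem + 1))
      else q.run r O (c.tick (e.cost c.mem + 1))
  | .ifRealPos t p q => fun c =>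
      if 0 < t.eval c.mem r then p.run r O (c.tick (t.cost c.mem + 1))
      else q.run r O (c.tick (t.cost c.mem + 1))
  | .loop e p => fun c =>
      (fun S : Multiset Config => S.bind fun d => p.run r O (d.tick 1))^[(e.eval c.mem).toNat]
        {c.tick (e.cost c.mem + 1)}
  | .hadamard b i => fun c =>
      {{ mem := c.mem
         amp := applyGate hadamardGate (b.eval c.mem).toNat (i.eval c.mem).toNat c.amp
         time := c.time + b.cost c.mem + i.cost c.mem + 1 }}
  | .phase b i t => fun c =>
      {{ mem := c.mem
         amp := applyGate (phaseGate (t.eval c.mem r)) (b.eval c.mem).toNat (i.eval c.mem).toNat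
           c.amp
         time := c.time + b.cost c.mem + i.cost c.mem + t.cost c.mem + 1 }}
  | .rot b i t => fun c =>
      {{ mem := c.mem
         amp := applyGate (rotGate (t.eval c.mem r)) (b.eval c.mem).toNat (i.eval c.mem).toNat
           c.amp
         time := c.time + b.cost c.mem + i.cost c.mem + t.cost c.mem + 1 }}
  | .xor b w f => fun c =>
      {{ mem := c.mem
         amp := fun x => c.amp (xorBasis c.mem (b.eval c.mem).toNat (w.eval c.mem).toNat f x)
         time := c.time + b.cost c.mem + w.cost c.mem + (w.eval c.mem).toNat + f.cost c.mem + 1 }}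
  | .measure b i a d => fun c =>
      (Finset.univ : Finset Bool).val.map fun v =>
        { mem := c.mem.write a (d.eval c.mem).toNat (if v then 1 else 0)
          amp := project (b.eval c.mem).toNat (i.eval c.mem).toNat v c.amp
          time := c.time + b.cost c.mem + i.cost c.mem + d.cost c.mem + 1 }
  | .query => fun c =>
      (Finset.univ : Finset (Fin n → ZMod N)).val.map fun t =>
        { mem := writeAnswer c.mem t
          amp := fun x => (Real.sqrt (O (readQuery n N m c.mem) t).toReal : ℂ) * c.amp x
          time := c.time + queryCost n N m c.mem }

-- The search version of the Gaussian Extrapolated Dihedral Coset Problem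

/-- The basis state `|j_0⟩|x_0 + j_0 s⟩ ... |j_{ℓ-1}⟩|x_{ℓ-1} + j_{ℓ-1} s⟩`. The `k`-th state
occupies the `n + 1` registers from `k (n + 1)` on: first the integer `j_k` (in the usual encoding
`0, -1, 1, -2, 2, ...` of the integers by natural numbers), then the coordinates of
`x_k + j_k s mod N`, represented in `{0, ..., N - 1}`. -/
def edcpBasis {n N ℓ : ℕ} (x : Fin ℓ → Fin n → ZMod N) (s : Fin n → ZMod N) (j : Fin ℓ → ℤ) :
    Basis :=
  ∑ k : Fin ℓ, (Finsupp.single (k * (n + 1)) (Equiv.intEquivNat (j k)) +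
    ∑ i : Fin n, Finsupp.single (k * (n + 1) + 1 + i) (x k i + (j k : ZMod N) * s i).val)

/-- The tensor product over `k < ℓ` of the normalized EDCP states
`∑ j, f j |j⟩|x_k + j s mod N⟩`, all other qubits being `0`. -/
def edcpState {n N ℓ : ℕ} (f : ℤ → ℝ) (x : Fin ℓ → Fin n → ZMod N) (s : Fin n → ZMod N) :
    QState := fun y =>
  if y = edcpBasis x s (fun k => Equiv.intEquivNat.symm (y (k * (n + 1)))) then
    ∏ k : Fin ℓ, ((f (Equiv.intEquivNat.symm (y (k * (n + 1)))) /
      Real.sqrt (∑' j : ℤ, f j ^ 2) : ℝ) : ℂ)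
  else 0

/-- Initially array `0` holds `κ, n, N, ℓ`, every other memory cell is `0`, and the quantum memory
holds the `ℓ` Gaussian EDCP states. -/
def initConfig {n N ℓ : ℕ} (κ : ℕ) (r : ℝ) (x : Fin ℓ → Fin n → ZMod N) (s : Fin n → ZMod N) :
    Config where
  mem := fun a i => if a = 0 then (([κ, n, N, ℓ].getD i 0 : ℕ) : ℤ) else 0
  amp := edcpState (rho r) x s
  time := 0

/-- The probability that `R`, with access to `O`, outputs `s` (in the first `n` entries of array
`3`, read modulo `N`) on the `ℓ` Gaussian EDCP states for `s` and the offsets `x`. -/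
def edcpSuccess {n N ℓ : ℕ} [NeZero N] (R : Prog) (κ : ℕ) (r : ℝ) (O : Oracle n N ℓ)
    (x : Fin ℓ → Fin n → ZMod N) (s : Fin n → ZMod N) : ℝ :=
  ((R.run r O (initConfig κ r x s)).map fun c =>
    if (fun i : Fin n => (c.mem 3 i : ZMod N)) = s then ∑' y, ‖c.amp y‖ ^ 2 else 0).sum

-- Solving a problem, and polynomial time

/-- `f` is bounded by a polynomial in `κ`. -/
def PolyBounded (f : ℕ → ℕ) : Prop := ∃ T : Polynomial ℕ, ∀ κ, f κ ≤ T.eval κ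

/-- The family `O` solves search `LWE_{n,N,α}^m`: for all large `κ` it outputs the secret with
probability at least an inverse polynomial in `n log N`. -/
def SolvesLWE (n N m : ℕ → ℕ) [∀ κ, NeZero (N κ)] (α : ℕ → ℝ)
    (O : ∀ κ, Oracle (n κ) (N κ) (m κ)) : Prop :=
  ∃ C : ℝ, 0 < C ∧ ∃ d : ℕ, ∀ᶠ κ in atTop,
    C / (n κ * Real.log (N κ)) ^ d ≤ lweSuccess (n κ) (N κ) (m κ) (α κ) (O κ)

/-- The program `R` with access to the family `O` solves search `G-EDCP_{n,N,r}^ℓ`: for all large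
`κ`, and for every secret and all offsets, it outputs the secret with probability at least an
inverse polynomial in `n log N`. -/
def SolvesGEDCP (n N ℓ : ℕ → ℕ) [∀ κ, NeZero (N κ)] (r : ℕ → ℝ) (R : Prog)
    (O : ∀ κ, Oracle (n κ) (N κ) (ℓ κ)) : Prop :=
  ∃ C : ℝ, 0 < C ∧ ∃ d : ℕ, ∀ᶠ κ in atTop,
    ∀ (s : Fin (n κ) → ZMod (N κ)) (x : Fin (ℓ κ) → Fin (n κ) → ZMod (N κ)),
      C / (n κ * Real.log (N κ)) ^ d ≤ edcpSuccess R κ (r κ) (O κ) x s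

/-- On `G-EDCP_{n,N,r}^ℓ` inputs the run-time of `R` is bounded by a polynomial in `κ`, in all
branches, for every oracle, every secret and all offsets. -/
def RunsInPolyTime (n N ℓ : ℕ → ℕ) [∀ κ, NeZero (N κ)] (r : ℕ → ℝ) (R : Prog) : Prop :=
  ∃ T : Polynomial ℕ, ∀ (κ : ℕ) (O : Oracle (n κ) (N κ) (ℓ κ)) (s : Fin (n κ) → ZMod (N κ))
    (x : Fin (ℓ κ) → Fin (n κ) → ZMod (N κ)),
      ∀ c ∈ R.run (r κ) O (initConfig κ (r κ) x s), c.time ≤ T.eval κ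

/-- `R` is a polynomial-time reduction from `G-EDCP_{n,N,r}^ℓ` to `LWE_{n,N,α}^m`, with `m = ℓ`:
it runs in polynomial time and, given any oracle that solves the latter, solves the former. -/
def IsReduction (n N ℓ : ℕ → ℕ) [∀ κ, NeZero (N κ)] (r α : ℕ → ℝ) (R : Prog) : Prop :=
  RunsInPolyTime n N ℓ r R ∧
    ∀ O : ∀ κ, Oracle (n κ) (N κ) (ℓ κ), SolvesLWE n N ℓ α O → SolvesGEDCP n N ℓ r R O

end QRed

end

/-! Fourier sampling turns an EDCP state into an LWE sample. Measuring the coset register in the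
Fourier basis of ℤ_N^n yields a uniform vector a and leaves, up to a phase that absorbs the offset
x, the state ∑_j ρ_r(j) e(j⟨a,s⟩/N)|j⟩, where e(θ) = exp(2πiθ). A Fourier transform modulo a large
power of two W in the first register then yields c with amplitude proportional, by Poisson summation
(`tsum_rho_mul_ee`), to ∑_k exp(-π r²(k+θ)²) with θ = c/W + ⟨a,s⟩/N. Thus -cN/W equals ⟨a,s⟩ modulo
N up to an almost continuous Gaussian error of width N/(√2 r). A classical rejection sampler
replaces -cN/W by an integer b from a discrete Gaussian of width N/(√2 r) around it. Completing the
square (`gauss_mul_gauss`) writes the joint weight of c and e = b - ⟨a,s⟩ as ρ_{N/r}(e) times a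
Gaussian factor whose sum over c hardly depends on e. So e has almost the law D_{ℤ,N/r}, which is
LWE noise for α = 1/r. Finally (a, b + ⟨a,t⟩) with random t is a sample for the secret s + t, so an
oracle that succeeds on average over secrets helps for every fixed s.

N need not be a power of two, so the Fourier measurements are done by bitwise phase estimation of
the cyclic shift with a single ancilla. Characters are eigenvectors of the shift, hence each branch
multiplies each Fourier coefficient by an explicit scalar `phaseAmp` (`reaches_phaseEstimation`).

Success is only ever bounded from below. For every tuple C of outcomes one branch is followed, and
its weight is bounded below by a single Fourier coefficient through Cauchy–Schwarz
(`sq_norm_fourier_le`), taken at the frequencies nearest to C; amplitudes outside a finite box are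
dropped (`le_edcpSuccess_reduction`). What remains is a weight `idealWeight` on pairs of outcome and
sampled value that lies below the weight obtained from the program (`idealWeight_le_jointWeight`),
has image at most 1 + 4ε times the LWE distribution (`sum_idealWeight_ite_le`), and has total mass
at least 1 - 8ε (`le_sum_idealWeight`). A pointwise upper bound together with almost full mass
forces closeness, also for ℓ-fold products: the success of the oracle drops by at most (1+4ε)^ℓ -
(1-8ε)^ℓ ≤ 16εℓ (`sum_prod_sub_le`, `pow_sub_pow_le`). The growth conditions allow ε = 6 exp(-δκ),
which beats every inverse polynomial in κ.

For the running time, the main part only stores copies and remainders and has small loop counts, so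
memory cells keep their bit length and each syntactic construct contributes a polynomial
(`Prog.exists_time_bound`); the computation of the parameters is executed explicitly
(`exists_setup_bound`). -/

noncomputable section

namespace QRed

/-! ### Branches of a program -/

section Branches

variable {n N m : ℕ} [NeZero N] {r : ℝ} {O : Oracle n N m}

/-- The sum of `F` over the branches of a program. -/
def Prog.expect (r : ℝ) (O : Oracle n N m) (p : Prog) (F : Config → ℝ) (c : Config) : ℝ :=
  ((p.run r O c).map F).sum

theorem Prog.expect_nonneg {p : Prog} {F : Config → ℝ} (hF : ∀ c, 0 ≤ F c) (c : Config) :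
    0 ≤ p.expect r O F c := by
  refine Multiset.sum_nonneg fun x hx => ?_
  obtain ⟨d, -, rfl⟩ := Multiset.mem_map.1 hx
  exact hF d

theorem sum_map_bind (S : Multiset Config) (f : Config → Multiset Config) (F : Config → ℝ) :
    ((S.bind f).map F).sum = (S.map fun c => ((f c).map F).sum).sum := by
  rw [Multiset.map_bind, Multiset.sum_bind]

theorem Prog.expect_seq (p q : Prog) (F : Config → ℝ) (c : Config) :
    (p.seq q).expect r O F c = p.expect r O (q.expect r O F) c := by
  simp only [Prog.expect, Prog.run]
  exact sum_map_bind _ _ _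

theorem Prog.expect_mono {p : Prog} {F G : Config → ℝ} (h : ∀ c, F c ≤ G c) (c : Config) :
    p.expect r O F c ≤ p.expect r O G c :=
  Multiset.sum_map_le_sum_map _ _ fun d _ => h d

/-- A loop pushes a multiset of branches forwards; dually, its expectation pulls the function `F`
backwards, one application of the body at a time. The induction peels off the last round. In this
form a lower bound for the body can be iterated. -/
theorem Prog.expect_loop (e : Expr) (p : Prog) (F : Config → ℝ) (c : Config) :
    (Prog.loop e p).expect r O F c =
      (fun (G : Config → ℝ) d => p.expect r O G (d.tick 1))^[(e.eval c.mem).toNat] F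
        (c.tick (e.cost c.mem + 1)) := by
  have key : ∀ (k : ℕ) (F : Config → ℝ) (S : Multiset Config),
      (((fun S : Multiset Config => S.bind fun d => p.run r O (d.tick 1))^[k] S).map F).sum =
      (S.map ((fun (G : Config → ℝ) d => p.expect r O G (d.tick 1))^[k] F)).sum := by
    intro k
    induction k with
    | zero => intro F S; rfl
    | succ k ih =>
      intro F S
      rw [Function.iterate_succ_apply', sum_map_bind, Function.iterate_succ_apply]
      exact ih _ _
  simp only [Prog.expect, Prog.run]
  rw [key]
  simp [Prog.expect]

/-- Finitely many different branches contribute at most the sum over all branches. -/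
theorem sum_le_expect {ι : Type*} [Fintype ι] {p : Prog} {c : Config} {F : Config → ℝ}
    (hF : ∀ c, 0 ≤ F c) (f : ι → Config) (hf : Function.Injective f)
    (hm : ∀ i, f i ∈ p.run r O c) : ∑ i, F (f i) ≤ p.expect r O F c := by
  -- Injectivity makes the chosen branches free of duplicates, so inclusion of multisets reduces to
  -- membership, however often a branch occurs in the run.
  have hle : (Finset.univ : Finset ι).val.map f ≤ p.run r O c := by
    rw [Multiset.le_iff_subset ((Multiset.nodup_map_iff_of_injective hf).2 Finset.univ.nodup)]
    intro d hd
    obtain ⟨i, -, rfl⟩ := Multiset.mem_map.1 hd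
    exact hm i
  obtain ⟨t, ht⟩ := Multiset.le_iff_exists_add.1 hle
  have h0 : 0 ≤ (t.map F).sum := by
    refine Multiset.sum_nonneg fun x hx => ?_
    obtain ⟨d, -, rfl⟩ := Multiset.mem_map.1 hx
    exact hF d
  simp only [Prog.expect, ht, Multiset.map_add, Multiset.sum_add, Multiset.map_map]
  exact le_add_of_nonneg_right h0

/-- Whatever the time, some branch of `p` ends in memory and amplitudes that satisfy `Q`. -/
def Reaches (r : ℝ) (O : Oracle n N m) (p : Prog) (M : Mem) (ψ : QState)
    (Q : Mem → QState → Prop) : Prop :=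
  ∀ t, ∃ c ∈ p.run r O ⟨M, ψ, t⟩, Q c.mem c.amp

theorem Reaches.mono {p : Prog} {M : Mem} {ψ : QState} {Q Q' : Mem → QState → Prop}
    (h : Reaches r O p M ψ Q) (hQ : ∀ M' ψ', Q M' ψ' → Q' M' ψ') : Reaches r O p M ψ Q' :=
  fun t => (h t).imp fun _ hc => ⟨hc.1, hQ _ _ hc.2⟩

theorem Reaches.seq {p q : Prog} {M : Mem} {ψ : QState} {Q Q' : Mem → QState → Prop}
    (h : Reaches r O p M ψ Q) (hq : ∀ M' ψ', Q M' ψ' → Reaches r O q M' ψ' Q') :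
    Reaches r O (p.seq q) M ψ Q' := by
  intro t
  obtain ⟨c, hc, hQ⟩ := h t
  obtain ⟨d, hd, hQ'⟩ := hq _ _ hQ c.time
  exact ⟨d, Multiset.mem_bind.2 ⟨c, hc, hd⟩, hQ'⟩

theorem reaches_assign {a : ℕ} {i e : Expr} {M : Mem} {ψ : QState} {Q : Mem → QState → Prop}
    (h : Q (M.write a (i.eval M).toNat (e.eval M)) ψ) : Reaches r O (.assign a i e) M ψ Q :=
  fun _ => ⟨_, Multiset.mem_singleton_self _, h⟩

theorem reaches_hadamard {b i : Expr} {M : Mem} {ψ : QState} {Q : Mem → QState → Prop}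
    (h : Q M (applyGate hadamardGate (b.eval M).toNat (i.eval M).toNat ψ)) :
    Reaches r O (.hadamard b i) M ψ Q :=
  fun _ => ⟨_, Multiset.mem_singleton_self _, h⟩

theorem reaches_phase {b i : Expr} {θ : RExpr} {M : Mem} {ψ : QState}
    {Q : Mem → QState → Prop}
    (h : Q M (applyGate (phaseGate (θ.eval M r)) (b.eval M).toNat (i.eval M).toNat ψ)) :
    Reaches r O (.phase b i θ) M ψ Q :=
  fun _ => ⟨_, Multiset.mem_singleton_self _, h⟩

theorem reaches_xor {b w : Expr} {f : QExpr} {M : Mem} {ψ : QState} {Q : Mem → QState → Prop}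
    (h : Q M fun x => ψ (xorBasis M (b.eval M).toNat (w.eval M).toNat f x)) :
    Reaches r O (.xor b w f) M ψ Q :=
  fun _ => ⟨_, Multiset.mem_singleton_self _, h⟩

theorem reaches_measure {b i d : Expr} {a : ℕ} (v : Bool) {M : Mem} {ψ : QState}
    {Q : Mem → QState → Prop}
    (h : Q (M.write a (d.eval M).toNat (if v then 1 else 0))
      (project (b.eval M).toNat (i.eval M).toNat v ψ)) :
    Reaches r O (.measure b i a d) M ψ Q :=
  fun t => ⟨{ mem := M.write a (d.eval M).toNat (if v then 1 else 0)
              amp := project (b.eval M).toNat (i.eval M).toNat v ψ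
              time := t + b.cost M + i.cost M + d.cost M + 1 },
    by simp only [Prog.run]; exact Multiset.mem_map.2 ⟨v, Finset.mem_univ v, rfl⟩, h⟩

theorem reaches_ifPos {e : Expr} {p q : Prog} {M : Mem} {ψ : QState} {Q : Mem → QState → Prop}
    (hp : 0 < e.eval M → Reaches r O p M ψ Q) (hq : ¬ 0 < e.eval M → Reaches r O q M ψ Q) :
    Reaches r O (.ifPos e p q) M ψ Q := by
  intro t
  by_cases h : 0 < e.eval M
  · simpa [Prog.run, h, Config.tick] using hp h _
  · simpa [Prog.run, h, Config.tick] using hq h _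

theorem reaches_loop {e : Expr} {p : Prog} {M : Mem} {ψ : QState} {K : ℕ}
    (hK : (e.eval M).toNat = K) {Q : Mem → QState → Prop} (I : ℕ → Mem → QState → Prop)
    (h0 : I 0 M ψ) (hs : ∀ k < K, ∀ M' ψ', I k M' ψ' → Reaches r O p M' ψ' (I (k + 1)))
    (hQ : ∀ M' ψ', I K M' ψ' → Q M' ψ') : Reaches r O (.loop e p) M ψ Q := by
  intro t
  have key : ∀ k ≤ K, ∃ c ∈ (fun S : Multiset Config => S.bind fun d => p.run r O (d.tick 1))^[k]
      {Config.tick ⟨M, ψ, t⟩ (e.cost M + 1)}, I k c.mem c.amp := by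
    intro k
    induction k with
    | zero => exact fun _ => ⟨_, Multiset.mem_singleton_self _, h0⟩
    | succ k ih =>
      intro hk
      obtain ⟨c, hc, hI⟩ := ih (by omega)
      obtain ⟨d, hd, hI'⟩ := hs k (by omega) _ _ hI (c.time + 1)
      refine ⟨d, ?_, hI'⟩
      rw [Function.iterate_succ_apply']
      exact Multiset.mem_bind.2 ⟨c, hc, hd⟩
  obtain ⟨c, hc, hI⟩ := key K le_rfl
  refine ⟨c, ?_, hQ _ _ hI⟩
  simp only [Prog.run, hK]
  exact hc

end Branches

/-! ### Square summability is preserved -/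

section Summability

theorem flipBit_flipBit (x : Basis) (b i : ℕ) : flipBit (flipBit x b i) b i = x := by
  simp [flipBit]

/-- The target register is erased before `f` is evaluated, so both applications XOR the same number.
-/
theorem xorBasis_xorBasis (M : Mem) (b w : ℕ) (f : QExpr) (x : Basis) :
    xorBasis M b w f (xorBasis M b w f x) = x := by
  simp [xorBasis]

/-- The success probability is defined by `∑'`, which is `0` for a divergent family. Bounding it
below by a finite partial sum therefore needs square summability in every final branch. -/
def SqSummable (ψ : QState) : Prop := Summable fun x => ‖ψ x‖ ^ 2

theorem SqSummable.comp_involutive {ψ : QState} (h : SqSummable ψ) {f : Basis → Basis}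
    (hf : Function.Involutive f) : SqSummable fun x => ψ (f x) :=
  (hf.toPerm.summable_iff (f := fun x => ‖ψ x‖ ^ 2)).2 h

theorem SqSummable.of_le_add {ψ φ₁ φ₂ : QState} (h₁ : SqSummable φ₁) (h₂ : SqSummable φ₂)
    (C : ℝ) (h : ∀ x, ‖ψ x‖ ≤ C * (‖φ₁ x‖ + ‖φ₂ x‖)) : SqSummable ψ := by
  refine Summable.of_nonneg_of_le (fun x => by positivity) (fun x => ?_)
    ((Summable.add h₁ h₂).mul_left (2 * C ^ 2))
  calc ‖ψ x‖ ^ 2 ≤ (C * (‖φ₁ x‖ + ‖φ₂ x‖)) ^ 2 := by gcongr; exact h x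
    _ ≤ 2 * C ^ 2 * (‖φ₁ x‖ ^ 2 + ‖φ₂ x‖ ^ 2) := by
      nlinarith [mul_nonneg (sq_nonneg C) (sq_nonneg (‖φ₁ x‖ - ‖φ₂ x‖))]

theorem SqSummable.applyGate {ψ : QState} (h : SqSummable ψ) (U : Matrix (Fin 2) (Fin 2) ℂ)
    (b i : ℕ) : SqSummable (applyGate U b i ψ) := by
  refine SqSummable.of_le_add h (h.comp_involutive (f := fun x => flipBit x b i) fun x => flipBit_flipBit x b i)
    (∑ k, ∑ l, ‖U k l‖) fun x => ?_
  have hU : ∀ k l, ‖U k l‖ ≤ ∑ k, ∑ l, ‖U k l‖ := fun k l =>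
    (Finset.single_le_sum (f := fun l => ‖U k l‖) (fun _ _ => norm_nonneg _)
      (Finset.mem_univ l)).trans
    (Finset.single_le_sum (f := fun k => ∑ l, ‖U k l‖)
      (fun _ _ => Finset.sum_nonneg fun _ _ => norm_nonneg _) (Finset.mem_univ k))
  rw [QRed.applyGate, mul_add]
  refine (norm_add_le _ _).trans (add_le_add ?_ ?_) <;> rw [norm_mul] <;>
    exact mul_le_mul_of_nonneg_right (hU _ _) (norm_nonneg _)

theorem SqSummable.of_norm_le {ψ φ : QState} (h : SqSummable φ) (C : ℝ)
    (hle : ∀ x, ‖ψ x‖ ≤ C * ‖φ x‖) : SqSummable ψ := by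
  refine Summable.of_nonneg_of_le (fun x => by positivity) (fun x => ?_) (h.mul_left (C ^ 2))
  rw [← mul_pow]
  gcongr
  exact hle x

theorem SqSummable.project {ψ : QState} (h : SqSummable ψ) (b i : ℕ) (v : Bool) :
    SqSummable (project b i v ψ) := by
  refine h.of_norm_le 1 fun x => ?_
  rw [QRed.project]
  split_ifs <;> simp

theorem SqSummable.run {n N m : ℕ} [NeZero N] {r : ℝ} {O : Oracle n N m} (p : Prog) :
    ∀ {c : Config}, SqSummable c.amp → ∀ d ∈ p.run r O c, SqSummable d.amp := by
  induction p with
  | skip => intro c h d hd; rw [Multiset.mem_singleton.1 hd]; exact h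
  | assign => intro c h d hd; rw [Multiset.mem_singleton.1 hd]; exact h
  | seq p q hp hq =>
    intro c h d hd
    obtain ⟨c', hc', hd⟩ := Multiset.mem_bind.1 hd
    exact hq (hp h _ hc') _ hd
  | ifPos e p q hp hq =>
    intro c h d hd
    simp only [Prog.run] at hd
    split_ifs at hd
    · exact hp (c := c.tick _) h _ hd
    · exact hq (c := c.tick _) h _ hd
  | ifRealPos e p q hp hq =>
    intro c h d hd
    simp only [Prog.run] at hd
    split_ifs at hd
    · exact hp (c := c.tick _) h _ hd
    · exact hq (c := c.tick _) h _ hd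
  | loop e p hp =>
    intro c h
    simp only [Prog.run]
    generalize (e.eval c.mem).toNat = k
    induction k with
    | zero => intro d hd; rw [Multiset.mem_singleton.1 hd]; exact h
    | succ k ih =>
      intro d hd
      rw [Function.iterate_succ_apply'] at hd
      obtain ⟨c', hc', hd⟩ := Multiset.mem_bind.1 hd
      exact hp (c := c'.tick 1) (show SqSummable c'.amp from ih _ hc') _ hd
  | hadamard => intro c h d hd; rw [Multiset.mem_singleton.1 hd]; exact h.applyGate _ _ _
  | phase => intro c h d hd; rw [Multiset.mem_singleton.1 hd]; exact h.applyGate _ _ _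
  | rot => intro c h d hd; rw [Multiset.mem_singleton.1 hd]; exact h.applyGate _ _ _
  | xor b w f =>
    intro c h d hd; rw [Multiset.mem_singleton.1 hd]
    exact h.comp_involutive (xorBasis_xorBasis _ _ _ f)
  | measure =>
    intro c h d hd
    simp only [Prog.run] at hd
    obtain ⟨v, -, rfl⟩ := Multiset.mem_map.1 hd
    exact h.project _ _ _
  | query =>
    intro c h d hd
    simp only [Prog.run] at hd
    obtain ⟨v, -, rfl⟩ := Multiset.mem_map.1 hd
    exact h.of_norm_le _ fun x => (norm_mul _ _).le

end Summability

/-! ### Classical randomized programs -/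

/-- Entry `0` of array `a`, used as a variable. -/
abbrev var (a : ℕ) : Expr := .cell a (.const 0)

/-- Entry `i` of array `0`, which holds the parameters. -/
abbrev prm (i : ℤ) : Expr := .cell 0 (.const i)

/-- Classical programs with coin tosses. -/
inductive CProg
  | skip
  | assign (a : ℕ) (i e : Expr)
  | seq (p q : CProg)
  | ifPos (e : Expr) (p q : CProg)
  | ifRealPos (t : RExpr) (p q : CProg)
  | loop (e : Expr) (p : CProg)
  | coin (a : ℕ)
  | bern (t : RExpr) (a : ℕ)
  | query

/-- Measurement of the ancilla qubit into the variable `a`, followed by a reset of the qubit. -/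
def readout (a : ℕ) : Prog :=
  (Prog.measure (prm 6) (.const 0) a (.const 0)).seq
    (.xor (prm 6) (.const 1) (.cl (var a)))

/-- Rotation by θ gives the outcome `1` probability sin² θ. The choice θ = arccos(1 - 2t)/2 makes
this (1 - cos(2θ))/2 = t for t in [0, 1]. -/
def CProg.compile : CProg → Prog
  | .skip => .skip
  | .assign a i e => .assign a i e
  | .seq p q => .seq p.compile q.compile
  | .ifPos e p q => .ifPos e p.compile q.compile
  | .ifRealPos t p q => .ifRealPos t p.compile q.compile
  | .loop e p => .loop e p.compile
  | .coin a => (Prog.hadamard (prm 6) (.const 0)).seq (readout a)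
  | .bern t a => (Prog.rot (prm 6) (.const 0)
      (.div (.arccos (.sub (.int (.const 1)) (.mul (.int (.const 2)) t))) (.int (.const 2)))).seq
      (readout a)
  | .query => .query

/-- The parameters are never overwritten. -/
def CProg.KeepsParams : CProg → Prop
  | .skip => True
  | .assign a _ _ => a ≠ 0
  | .seq p q => p.KeepsParams ∧ q.KeepsParams
  | .ifPos _ p q => p.KeepsParams ∧ q.KeepsParams
  | .ifRealPos _ p q => p.KeepsParams ∧ q.KeepsParams
  | .loop _ p => p.KeepsParams
  | .coin a => a ≠ 0
  | .bern _ a => a ≠ 0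
  | .query => True

/-- The probability that a biased coin with parameter `p` shows `1`. -/
def bernProb (p : ℝ) : ℝ := (1 - Real.cos (Real.arccos (1 - 2 * p))) / 2

/-- The formula in `bernProb` is what the rotation produces for every real parameter, also where
`arccos` clamps. Hence the semantics of `bern` carries no side condition, and the range is needed
only here. -/
theorem bernProb_eq {p : ℝ} (h0 : 0 ≤ p) (h1 : p ≤ 1) : bernProb p = p := by
  rw [bernProb, Real.cos_arccos (by linarith) (by linarith)]
  ring

theorem bernProb_nonneg (p : ℝ) : 0 ≤ bernProb p := by
  have := Real.cos_le_one (Real.arccos (1 - 2 * p))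
  rw [bernProb]; linarith

theorem bernProb_le_one (p : ℝ) : bernProb p ≤ 1 := by
  have := Real.neg_one_le_cos (Real.arccos (1 - 2 * p))
  rw [bernProb]; linarith

/-- The expected value of `G` on the final memory. -/
def CProg.wp {n N m : ℕ} [NeZero N] (r : ℝ) (O : Oracle n N m) :
    CProg → (Mem → ℝ) → Mem → ℝ
  | .skip, G, M => G M
  | .assign a i e, G, M => G (M.write a (i.eval M).toNat (e.eval M))
  | .seq p q, G, M => p.wp r O (q.wp r O G) M
  | .ifPos e p q, G, M => if 0 < e.eval M then p.wp r O G M else q.wp r O G M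
  | .ifRealPos t p q, G, M => if 0 < t.eval M r then p.wp r O G M else q.wp r O G M
  | .loop e p, G, M => (p.wp r O)^[(e.eval M).toNat] G M
  | .coin a, G, M => 1 / 2 * G (M.write a 0 1) + 1 / 2 * G (M.write a 0 0)
  | .bern t a, G, M => bernProb (t.eval M r) * G (M.write a 0 1) +
      (1 - bernProb (t.eval M r)) * G (M.write a 0 0)
  | .query, G, M => ∑ t, (O (readQuery n N m M) t).toReal * G (writeAnswer M t)

section Wp

variable {n N m : ℕ} [NeZero N] {r : ℝ} {O : Oracle n N m}

theorem CProg.wp_mono (p : CProg) : ∀ {G G' : Mem → ℝ}, (∀ M, G M ≤ G' M) →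
    ∀ M, p.wp r O G M ≤ p.wp r O G' M := by
  induction p with
  | skip => exact fun h M => h M
  | assign => exact fun h M => h _
  | seq p q hp hq => exact fun h M => hp (hq h) M
  | ifPos e p q hp hq => 
    intro G G' h M; simp only [wp]; split_ifs; exacts [hp h M, hq h M]
  | ifRealPos e p q hp hq => 
    intro G G' h M; simp only [wp]; split_ifs; exacts [hp h M, hq h M]
  | loop e p hp =>
    intro G G' h M
    simp only [wp]
    generalize (e.eval M).toNat = k
    induction k generalizing G G' with
    | zero => exact h M
    | succ k ih => exact ih (hp h)
  | coin a => intro G G' h M; simp only [wp]; gcongr <;> exact h _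
  | bern t a =>
    intro G G' h M
    simp only [wp]
    have h1 := bernProb_nonneg (t.eval M r)
    have h2 := bernProb_le_one (t.eval M r)
    exact add_le_add (mul_le_mul_of_nonneg_left (h _) h1)
      (mul_le_mul_of_nonneg_left (h _) (sub_nonneg.2 h2))
  | query =>
    intro G G' h M
    simp only [wp]
    gcongr
    exact h _

theorem CProg.wp_zero (p : CProg) : p.wp r O (fun _ => 0) = fun _ => 0 := by
  induction p with
  | skip => rfl
  | assign => rfl
  | seq p q hp hq => funext M; simp [wp, hp, hq]
  | ifPos e p q hp hq => funext M; simp [wp, hp, hq]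
  | ifRealPos e p q hp hq => funext M; simp [wp, hp, hq]
  | loop e p hp =>
    funext M; simp only [wp]; rw [Function.iterate_fixed hp]
  | coin => funext M; simp [wp]
  | bern => funext M; simp [wp]
  | query => funext M; simp [wp]

theorem CProg.wp_nonneg (p : CProg) {G : Mem → ℝ} (h : ∀ M, 0 ≤ G M) (M : Mem) :
    0 ≤ p.wp r O G M := by
  have := p.wp_mono (r := r) (O := O) h M
  rwa [p.wp_zero] at this

/-- The squared norm of a state on the basis states `B`. -/
def wt (B : Finset Basis) (ψ : QState) : ℝ := ∑ x ∈ B, ‖ψ x‖ ^ 2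

theorem wt_nonneg (B : Finset Basis) (ψ : QState) : 0 ≤ wt B ψ :=
  Finset.sum_nonneg fun _ _ => by positivity

/-- As far as `B` is concerned, the ancilla qubit is in the state `0`. -/
def Fresh (B : Finset Basis) (u : ℕ) (ψ : QState) : Prop := ∀ x ∈ B, ψ (x.update u 1) = 0

open Classical in
/-- The weight of a configuration in the computation of expected values. -/
def gain (B : Finset Basis) (u : ℕ) (G : Mem → ℝ) (c : Config) : ℝ :=
  if c.mem 0 6 = u ∧ Fresh B u c.amp then G c.mem * wt B c.amp else 0

theorem gain_nonneg (B : Finset Basis) (u : ℕ) {G : Mem → ℝ} (h : ∀ M, 0 ≤ G M) (c : Config) :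
    0 ≤ gain B u G c := by
  rw [gain]
  split_ifs
  · exact mul_nonneg (h _) (wt_nonneg _ _)
  · exact le_rfl

theorem gain_congr {B : Finset Basis} {u : ℕ} {G G' : Mem → ℝ} {c c' : Config}
    (hm : c.mem 0 6 = c'.mem 0 6) (ha : c.amp = c'.amp) (hG : G c.mem = G' c'.mem) :
    gain B u G c = gain B u G' c' := by
  by_cases h : c.mem 0 6 = u ∧ Fresh B u c.amp
  · rw [gain, gain, if_pos h, if_pos (by rwa [← hm, ← ha]), ha, hG]
  · rw [gain, gain, if_neg h, if_neg (by rwa [← hm, ← ha])]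

theorem update_of_eq {x : Basis} {u z : ℕ} (h : x u = z) : x.update u z = x := by
  rw [← h]; exact Finsupp.update_self _ _

theorem write_same (M : Mem) (a i : ℕ) (z : ℤ) : M.write a i z a i = z := by simp [Mem.write]

theorem write_of_ne (M : Mem) {a b : ℕ} (i j : ℕ) (z : ℤ) (h : b ≠ a) :
    M.write a i z b j = M b j := by simp [Mem.write, h]

/-- After outcome v the surviving amplitudes have ancilla v, and XORing the recorded bit resets it
to 0. Each of the two branches is fresh again, with the weight that the amplitudes with ancilla v
had before. -/
theorem expect_readout {B : Finset Basis} {u a : ℕ} (ha : a ≠ 0) (hB : ∀ x ∈ B, x u = 0)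
    {G : Mem → ℝ} {M : Mem} (hc : M 0 6 = u) (ψ : QState) (t : ℕ) :
    (readout a).expect r O (gain B u G) ⟨M, ψ, t⟩ =
      G (M.write a 0 1) * ∑ x ∈ B, ‖ψ (x.update u 1)‖ ^ 2 +
      G (M.write a 0 0) * ∑ x ∈ B, ‖ψ x‖ ^ 2 := by
  have hw : ∀ z : ℤ, M.write a 0 z 0 6 = u := fun z => by
    rw [write_of_ne _ _ _ _ ha.symm, hc]
  have hx0 : ∀ (x : Basis) (z : ℕ), x.erase u u = 0 := fun x z => by simp
  have key : ∀ v : Bool, ∀ t, gain B u G ⟨M.write a 0 (if v then 1 else 0),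
      fun x => project u 0 v ψ (xorBasis (M.write a 0 (if v then 1 else 0)) u 1
        (.cl (var a)) x), t⟩ = G (M.write a 0 (if v then 1 else 0)) *
        ∑ x ∈ B, ‖ψ (x.update u (if v then 1 else 0))‖ ^ 2 := by
    intro v t
    have hxor : ∀ x ∈ B, xorBasis (M.write a 0 (if v then 1 else 0)) u 1 (.cl (var a)) x =
        x.update u (if v then 1 else 0) := by
      intro x hx
      cases v <;> simp [xorBasis, QExpr.eval, Expr.eval, write_same, hB x hx]
    have hxor' : ∀ x ∈ B, xorBasis (M.write a 0 (if v then 1 else 0)) u 1 (.cl (var a))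
        (x.update u 1) = x.update u (if v then 0 else 1) := by
      intro x hx
      cases v <;> simp [xorBasis, QExpr.eval, Expr.eval, write_same]
    rw [gain, if_pos]
    · congr 1
      refine Finset.sum_congr rfl fun x hx => ?_
      simp only [hxor x hx]
      cases v <;> simp [project, qbit]
    · refine ⟨hw _, fun x hx => ?_⟩
      simp only [hxor' x hx]
      cases v <;> simp [project, qbit]
  have h0 : ∑ x ∈ B, ‖ψ x‖ ^ 2 = ∑ x ∈ B, ‖ψ (x.update u 0)‖ ^ 2 :=
    Finset.sum_congr rfl fun x hx => by rw [update_of_eq (hB x hx)]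
  have k1 := key true
  have k0 := key false
  simp only [if_true, Bool.false_eq_true, if_false] at k1 k0
  rw [readout, Prog.expect_seq, h0]
  simp only [Prog.expect, Prog.run, Expr.eval, Multiset.map_map, Multiset.map_singleton,
    Multiset.sum_singleton, Function.comp_def]
  simp only [Fintype.univ_bool, Finset.insert_val, Finset.singleton_val]
  simp [k1, k0, hc, hw]

/-- The classical part touches only the ancilla, so the unmeasured data registers merely carry a
weight, which coins and oracle calls multiply by probabilities. An inequality suffices because
`gain` is zero on configurations without a fresh ancilla, where nothing has to be shown. -/
theorem CProg.le_expect_compile {B : Finset Basis} {u : ℕ} (hB : ∀ x ∈ B, x u = 0) (p : CProg) :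
    p.KeepsParams → ∀ {G : Mem → ℝ}, (∀ M, 0 ≤ G M) → ∀ c,
      gain B u (p.wp r O G) c ≤ p.compile.expect r O (gain B u G) c := by
  have tick : ∀ (G : Mem → ℝ) (c : Config) (t : ℕ), gain B u G (c.tick t) = gain B u G c :=
    fun _ _ _ => rfl
  -- On a fresh ancilla only the first column of the gate acts, so the weights of the two outcomes
  -- are its squared entries.
  have rdo : ∀ (a : ℕ) (G : Mem → ℝ) (U : Matrix (Fin 2) (Fin 2) ℂ) (ψ : QState), Fresh B u ψ →
      (∑ x ∈ B, ‖applyGate U u 0 ψ (x.update u 1)‖ ^ 2 = ‖U 1 0‖ ^ 2 * wt B ψ) ∧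
      ∑ x ∈ B, ‖applyGate U u 0 ψ x‖ ^ 2 = ‖U 0 0‖ ^ 2 * wt B ψ := by
    intro a G U ψ hψ
    simp only [wt, Finset.mul_sum]
    refine ⟨Finset.sum_congr rfl fun x hx => ?_, Finset.sum_congr rfl fun x hx => ?_⟩
    · have : applyGate U u 0 ψ (x.update u 1) = U 1 0 * ψ x := by
        simp [applyGate, qbit, bitIdx, flipBit, hψ x hx, update_of_eq (hB x hx)]
      rw [this, norm_mul, mul_pow]
    · have : applyGate U u 0 ψ x = U 0 0 * ψ x := by
        simp [applyGate, qbit, bitIdx, flipBit, hB x hx, hψ x hx]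
      rw [this, norm_mul, mul_pow]
  induction p with
  | skip =>
    intro _ G hG c
    simp only [compile, Prog.expect, Prog.run, Multiset.map_singleton, Multiset.sum_singleton]
    exact (gain_congr rfl rfl rfl).le
  | assign a i e =>
    intro ha G hG c
    simp only [compile, Prog.expect, Prog.run, Multiset.map_singleton, Multiset.sum_singleton]
    exact (gain_congr (c := c) (c' := ⟨c.mem.write a (i.eval c.mem).toNat (e.eval c.mem), c.amp, _⟩)
      (write_of_ne c.mem _ _ _ (Ne.symm ha)).symm rfl rfl).le
  | seq p q hp hq =>
    intro h G hG c
    rw [compile, Prog.expect_seq]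
    exact (hp h.1 (q.wp_nonneg hG) c).trans (Prog.expect_mono (hq h.2 hG) c)
  | ifPos e p q hp hq =>
    intro h G hG c
    have h1 := hp h.1 hG (c.tick (e.cost c.mem + 1))
    have h2 := hq h.2 hG (c.tick (e.cost c.mem + 1))
    by_cases he : 0 < e.eval c.mem
    · simp only [compile, Prog.expect, Prog.run, if_pos he]
      exact (gain_congr rfl rfl (if_pos he)).le.trans h1
    · simp only [compile, Prog.expect, Prog.run, if_neg he]
      exact (gain_congr rfl rfl (if_neg he)).le.trans h2
  | ifRealPos e p q hp hq =>
    intro h G hG c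
    have h1 := hp h.1 hG (c.tick (e.cost c.mem + 1))
    have h2 := hq h.2 hG (c.tick (e.cost c.mem + 1))
    by_cases he : 0 < e.eval c.mem r
    · simp only [compile, Prog.expect, Prog.run, if_pos he]
      exact (gain_congr rfl rfl (if_pos he)).le.trans h1
    · simp only [compile, Prog.expect, Prog.run, if_neg he]
      exact (gain_congr rfl rfl (if_neg he)).le.trans h2
  | loop e p hp =>
    intro h G hG c
    rw [compile, Prog.expect_loop]
    -- The induction allows an arbitrary `F` above the gain, because the iterated expectations are
    -- no longer of the form `gain`.
    have key : ∀ (k : ℕ) (G : Mem → ℝ) (F : Config → ℝ), (∀ M, 0 ≤ G M) →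
        (∀ c, gain B u G c ≤ F c) → ∀ c, gain B u ((p.wp r O)^[k] G) c ≤
        (fun (G : Config → ℝ) d => p.compile.expect r O G (d.tick 1))^[k] F c := by
      intro k
      induction k with
      | zero => exact fun _ _ _ h c => h c
      | succ k ih =>
        intro G F hG hF c
        exact ih _ _ (p.wp_nonneg hG) (fun d => (hp h hG (d.tick 1)).trans
          (Prog.expect_mono hF _)) c
    have := key (e.eval c.mem).toNat G (gain B u G) hG (fun _ => le_rfl)
      (c.tick (e.cost c.mem + 1))
    refine le_trans (le_of_eq ?_) this
    rfl
  | coin a =>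
    intro ha G hG c
    by_cases hc : c.mem 0 6 = u ∧ Fresh B u c.amp
    · rw [compile, Prog.expect_seq]
      simp only [Prog.expect.eq_1 r O (.hadamard _ _), Prog.run, Multiset.map_singleton,
        Multiset.sum_singleton]
      rw [expect_readout ha hB hc.1]
      have := rdo a G hadamardGate c.amp hc.2
      simp only [Expr.eval, Int.toNat_zero, Int.reduceToNat, hc.1, Int.toNat_natCast]
      rw [this.1, this.2, gain, if_pos hc]
      simp only [wp, hadamardGate]
      simp
      apply le_of_eq
      ring
    · rw [gain, if_neg hc]
      exact Prog.expect_nonneg (gain_nonneg _ _ hG) _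
  | bern t a =>
    intro ha G hG c
    by_cases hc : c.mem 0 6 = u ∧ Fresh B u c.amp
    · rw [compile, Prog.expect_seq]
      simp only [Prog.expect.eq_1 r O (.rot _ _ _), Prog.run, Multiset.map_singleton,
        Multiset.sum_singleton]
      rw [expect_readout ha hB hc.1]
      simp only [RExpr.eval]
      have := rdo a G (rotGate (Real.arccos (1 - 2 * t.eval c.mem r) / 2)) c.amp hc.2
      simp only [Expr.eval, Int.toNat_zero, Int.reduceToNat, hc.1, Int.toNat_natCast,
        Int.cast_one, Int.cast_ofNat]
      rw [this.1, this.2, gain, if_pos hc]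
      have hs : Real.sin (Real.arccos (1 - 2 * t.eval c.mem r) / 2) ^ 2 =
          bernProb (t.eval c.mem r) := by
        rw [Real.sin_sq_eq_half_sub, bernProb, mul_div_cancel₀ _ two_ne_zero]; ring
      have hcs : Real.cos (Real.arccos (1 - 2 * t.eval c.mem r) / 2) ^ 2 =
          1 - bernProb (t.eval c.mem r) := by
        rw [Real.cos_sq', hs]
      simp only [wp, rotGate, Matrix.of_apply, Matrix.cons_val', Matrix.cons_val_zero,
        Matrix.cons_val_one, Matrix.cons_val_fin_one, Complex.norm_real, Real.norm_eq_abs, sq_abs,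
        hs, hcs]
      apply le_of_eq
      ring
    · rw [gain, if_neg hc]
      exact Prog.expect_nonneg (gain_nonneg _ _ hG) _
  | query =>
    intro _ G hG c
    by_cases hc : c.mem 0 6 = u ∧ Fresh B u c.amp
    · simp only [compile, Prog.expect, Prog.run, Multiset.map_map, Function.comp_def]
      rw [gain, if_pos hc]
      simp only [wp, Finset.sum_mul]
      refine Finset.sum_le_sum fun t _ => ?_
      rw [gain, if_pos]
      · apply le_of_eq
        simp only [wt, norm_mul, mul_pow, ← Finset.mul_sum, Complex.norm_real, Real.norm_eq_abs,
          sq_abs]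
        rw [Real.sq_sqrt ENNReal.toReal_nonneg]
        ring
      · refine ⟨?_, fun x hx => ?_⟩
        · simpa [writeAnswer] using hc.1
        · simp [hc.2 x hx]
    · rw [gain, if_neg hc]
      exact Prog.expect_nonneg (gain_nonneg _ _ hG) _

end Wp

/-! ### Running time of programs with bounded memory -/

/-- Values that stay bounded: small constants, copies, and remainders modulo `N` or `W`. -/
def Expr.bounded : Expr → Bool
  | .const z => z.natAbs ≤ 1
  | .cell _ _ => true
  | .bin .mod _ (.cell 0 (.const 2)) => true
  | .bin .mod _ (.cell 0 (.const 5)) => true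
  | _ => false

/-- Expressions for loop counts and register widths: the constant `1` and the small parameters. -/
def Expr.small : Expr → Bool
  | .const z => z = 1
  | .cell 0 (.const z) => z = 1 ∨ z = 3 ∨ z = 4 ∨ z = 6 ∨ z = 7
  | _ => false

def QExpr.safe : QExpr → Bool
  | .cl _ => true
  | .reg _ w => w.small
  | .bin _ f g => f.safe && g.safe

def Prog.safe : Prog → Bool
  | .skip => true
  | .assign a _ e => a ≠ 0 && e.bounded
  | .seq p q => p.safe && q.safe
  | .ifPos _ p q => p.safe && q.safe
  | .ifRealPos _ p q => p.safe && q.safe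
  | .loop e p => e.small && p.safe
  | .hadamard _ _ => true
  | .phase _ _ _ => true
  | .rot _ _ _ => true
  | .xor _ w f => w.small && f.safe
  | .measure _ _ a _ => a ≠ 0
  | .query => true

/-- All memory cells have at most `X` binary digits, and the parameters are as expected. -/
structure BoundedMem (n N m X : ℕ) (M : Mem) : Prop where
  cell : ∀ a i, bitlen (M a i) ≤ X
  hN : M 0 2 = N
  hW : M 0 5 ≠ 0
  small : ∀ i ∈ [1, 3, 4, 6, 7], (M 0 i).toNat ≤ X
  hn : n ≤ X
  hR : m * (n + 1) ≤ X
  pos : 1 ≤ X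

theorem bitlen_le_of_natAbs_le {z y : ℤ} (h : z.natAbs ≤ y.natAbs) : bitlen z ≤ bitlen y :=
  Nat.size_le_size h

theorem bitlen_mul (u v : ℤ) : bitlen (u * v) ≤ bitlen u + bitlen v := by
  rw [bitlen, Nat.size_le, Int.natAbs_mul, pow_add]
  exact Nat.mul_lt_mul'' (Nat.lt_size_self _) (Nat.lt_size_self _)

theorem bitlen_add (u v : ℤ) : bitlen (u + v) ≤ bitlen u + bitlen v + 1 := by
  rw [bitlen, Nat.size_le]
  have h1 : u.natAbs < 2 ^ bitlen u := Nat.lt_size_self _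
  have h2 : v.natAbs < 2 ^ bitlen v := Nat.lt_size_self _
  have h3 : 2 ^ bitlen u ≤ 2 ^ (bitlen u + bitlen v) := Nat.pow_le_pow_right two_pos (by omega)
  have h4 : 2 ^ bitlen v ≤ 2 ^ (bitlen u + bitlen v) := Nat.pow_le_pow_right two_pos (by omega)
  have h5 : (u + v).natAbs ≤ u.natAbs + v.natAbs := Int.natAbs_add_le u v
  rw [pow_succ]
  omega

theorem bitlen_neg (u : ℤ) : bitlen (-u) = bitlen u := by simp [bitlen]

theorem bitlen_op (o : Op) (u v : ℤ) : bitlen (o.eval u v) ≤ bitlen u + bitlen v + 1 := by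
  cases o with
  | add => exact bitlen_add u v
  | sub => simpa [Op.eval, sub_eq_add_neg, bitlen_neg] using bitlen_add u (-v)
  | mul => exact (bitlen_mul u v).trans (Nat.le_succ _)
  | div =>
    have : (u / v).natAbs ≤ u.natAbs := Int.natAbs_ediv_le_natAbs u v
    have := bitlen_le_of_natAbs_le this
    simp only [Op.eval]
    omega
  | mod =>
    simp only [Op.eval]
    by_cases hv : v = 0
    · subst hv; simpa using Nat.le_succ_of_le (Nat.le_add_right _ _)
    · have : (u % v).natAbs ≤ v.natAbs := by
        have h1 := Int.emod_nonneg u hv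
        have h2 := Int.emod_lt_abs u hv
        rw [Int.abs_eq_natAbs] at h2
        omega
      have := bitlen_le_of_natAbs_le this
      omega

theorem bitlen_small {z : ℤ} (h : z.natAbs ≤ 1) : bitlen z ≤ 1 :=
  (bitlen_le_of_natAbs_le (y := 1) h).trans (by simp [bitlen])

theorem size_le_self (k : ℕ) : k.size ≤ k := Nat.size_le.2 Nat.lt_two_pow_self

theorem bitlen_emod {u v : ℤ} (hv : v ≠ 0) : bitlen (u % v) ≤ bitlen v := by
  apply bitlen_le_of_natAbs_le
  have h1 := Int.emod_nonneg u hv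
  have h2 := Int.emod_lt_abs u hv
  rw [Int.abs_eq_natAbs] at h2
  omega

section Bounds

variable {n N m : ℕ}

/-- The polynomial depends on the syntax alone and is uniform in all parameters. Only a bound on the
cells is assumed, so that it also applies during `setup`, before the parameters are in place. -/
theorem Expr.exists_bound_of_cell (e : Expr) : ∃ T : Polynomial ℕ, ∀ {X M},
    (∀ a i, QRed.bitlen (M a i) ≤ X) →
    QRed.bitlen (e.eval M) ≤ T.eval X ∧ e.cost M ≤ T.eval X := by
  induction e with
  | const z =>
    refine ⟨.C (QRed.bitlen z + 1), @fun X M h => ?_⟩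
    simp [eval, cost]
  | cell a i ih =>
    obtain ⟨T, hT⟩ := ih
    refine ⟨2 * T + .X + 1, @fun X M h => ?_⟩
    obtain ⟨h1, h2⟩ := hT h
    have := h a (i.eval M).toNat
    simp only [eval, cost, Polynomial.eval_add, Polynomial.eval_mul, Polynomial.eval_ofNat,
      Polynomial.eval_X, Polynomial.eval_one]
    constructor <;> omega
  | bitlen e ih =>
    obtain ⟨T, hT⟩ := ih
    refine ⟨2 * T + 1, @fun X M h => ?_⟩
    obtain ⟨h1, h2⟩ := hT h
    have : QRed.bitlen (QRed.bitlen (e.eval M) : ℤ) ≤ QRed.bitlen (e.eval M) :=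
      size_le_self _
    simp only [eval, cost, Polynomial.eval_add, Polynomial.eval_mul, Polynomial.eval_ofNat,
      Polynomial.eval_one]
    constructor <;> omega
  | bin o e f he hf =>
    obtain ⟨T, hT⟩ := he
    obtain ⟨S, hS⟩ := hf
    refine ⟨T + S + (T + 1) * (S + 1), @fun X M h => ?_⟩
    obtain ⟨h1, h2⟩ := hT h
    obtain ⟨h3, h4⟩ := hS h
    have := bitlen_op o (e.eval M) (f.eval M)
    have h5 : (QRed.bitlen (e.eval M) + 1) * (QRed.bitlen (f.eval M) + 1) ≤
      (T.eval X + 1) * (S.eval X + 1) := by gcongr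
    simp only [eval, cost, Polynomial.eval_add, Polynomial.eval_mul, Polynomial.eval_one]
    constructor
    · nlinarith
    · omega

theorem Expr.exists_bound (e : Expr) : ∃ T : Polynomial ℕ, ∀ {n N m X M}, BoundedMem n N m X M →
    QRed.bitlen (e.eval M) ≤ T.eval X ∧ e.cost M ≤ T.eval X := by
  obtain ⟨T, hT⟩ := e.exists_bound_of_cell
  exact ⟨T, fun h => hT h.cell⟩

theorem RExpr.exists_bound (t : RExpr) : ∃ T : Polynomial ℕ, ∀ {n N m X M}, BoundedMem n N m X M →
    t.cost M ≤ T.eval X := by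
  induction t with
  | int e =>
    obtain ⟨T, hT⟩ := e.exists_bound
    exact ⟨T + 1, @fun n N m X M h => by simpa [cost] using (hT h).2⟩
  | param => exact ⟨1, @fun n N m X M h => by simp [cost]⟩
  | pi => exact ⟨1, @fun n N m X M h => by simp [cost]⟩
  | add t u ht hu | sub t u ht hu | mul t u ht hu | div t u ht hu =>
    obtain ⟨T, hT⟩ := ht
    obtain ⟨S, hS⟩ := hu
    exact ⟨T + S + 1, @fun n N m X M h => by simpa [cost] using add_le_add (hT h) (hS h)⟩
  | exp t ht | arccos t ht =>
    obtain ⟨T, hT⟩ := ht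
    exact ⟨T + 1, @fun n N m X M h => by simpa [cost] using hT h⟩

theorem Expr.toNat_le_of_small {e : Expr} (he : e.small = true) {X : ℕ} {M : Mem}
    (h : BoundedMem n N m X M) : (e.eval M).toNat ≤ X := by
  unfold small at he
  split at he
  · simp only [decide_eq_true_eq] at he
    subst he
    exact h.pos
  · rename_i z
    have := h.small z.toNat
    simp only [decide_eq_true_eq] at he
    refine this ?_
    rcases he with rfl | rfl | rfl | rfl | rfl <;> decide
  · simp at he

theorem QExpr.exists_bound (f : QExpr) (hf : f.safe = true) : ∃ T : Polynomial ℕ, ∀ {n N m X M},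
    BoundedMem n N m X M → f.width M ≤ T.eval X ∧ f.cost M ≤ T.eval X := by
  induction f with
  | cl e => exact e.exists_bound
  | reg b w =>
    obtain ⟨T, hT⟩ := b.exists_bound
    obtain ⟨S, hS⟩ := w.exists_bound
    refine ⟨T + S + .X + 1, @fun n N m X M h => ?_⟩
    have h1 := (hT h).2
    have h2 := (hS h).2
    have h3 := Expr.toNat_le_of_small hf h
    simp only [width, cost, Polynomial.eval_add, Polynomial.eval_X, Polynomial.eval_one]
    constructor <;> omega
  | bin o f g ihf ihg =>
    simp only [safe, Bool.and_eq_true] at hf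
    obtain ⟨T, hT⟩ := ihf hf.1
    obtain ⟨S, hS⟩ := ihg hf.2
    refine ⟨T + S + (T + 1) * (S + 1), @fun n N m X M h => ?_⟩
    obtain ⟨h1, h2⟩ := hT h
    obtain ⟨h3, h4⟩ := hS h
    have h5 : (f.width M + 1) * (g.width M + 1) ≤ (T.eval X + 1) * (S.eval X + 1) := by gcongr
    simp only [width, cost, Polynomial.eval_add, Polynomial.eval_mul, Polynomial.eval_one]
    constructor
    · nlinarith
    · omega

theorem BoundedMem.write {X : ℕ} {M : Mem} (h : BoundedMem n N m X M) {a i : ℕ} {z : ℤ}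
    (ha : a ≠ 0) (hz : bitlen z ≤ X) : BoundedMem n N m X (M.write a i z) where
  cell b j := by
    by_cases hb : b = a
    · subst hb
      by_cases hj : j = i
      · subst hj; rwa [write_same]
      · simpa [Mem.write, hj] using h.cell b j
    · rw [write_of_ne _ _ _ _ hb]; exact h.cell b j
  hN := by rw [write_of_ne _ _ _ _ ha.symm]; exact h.hN
  hW := by rw [write_of_ne _ _ _ _ ha.symm]; exact h.hW
  small j hj := by rw [write_of_ne _ _ _ _ ha.symm]; exact h.small j hj
  hn := h.hn
  hR := h.hR
  pos := h.pos

/-- This keeps the bound `X` unchanged through all loop rounds: a stored value is a small constant,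
a copy, or a remainder modulo `N` or `W`, so that nothing grows by iteration. -/
theorem Expr.bitlen_le_of_bounded [NeZero N] {e : Expr} (he : e.bounded = true) {X : ℕ} {M : Mem}
    (h : BoundedMem n N m X M) : QRed.bitlen (e.eval M) ≤ X := by
  unfold bounded at he
  split at he
  · simp only [decide_eq_true_eq] at he
    exact (bitlen_small he).trans h.pos
  · exact h.cell _ _
  · refine (bitlen_emod ?_).trans (h.cell 0 2)
    have : M 0 2 ≠ 0 := by rw [h.hN]; exact_mod_cast NeZero.ne N
    exact this
  · exact (bitlen_emod h.hW).trans (h.cell 0 5)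
  · simp at he

theorem BoundedMem.writeAnswer [NeZero N] {X : ℕ} {M : Mem} (h : BoundedMem n N m X M)
    (t : Fin n → ZMod N) : BoundedMem n N m X (writeAnswer M t) where
  cell b j := by
    by_cases hb : b = 2
    · subst hb
      simp only [QRed.writeAnswer, Function.update_self]
      split_ifs with hj
      · have h1 := h.cell 0 2
        rw [h.hN] at h1
        refine le_trans (bitlen_le_of_natAbs_le ?_) h1
        simpa only [Int.natAbs_natCast] using (ZMod.val_lt (t ⟨j, hj⟩)).le
      · exact h.cell 2 j
    · simpa [QRed.writeAnswer, hb] using h.cell b j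
  hN := by simpa [QRed.writeAnswer] using h.hN
  hW := by simpa [QRed.writeAnswer] using h.hW
  small j hj := by simpa [QRed.writeAnswer] using h.small j hj
  hn := h.hn
  hR := h.hR
  pos := h.pos

theorem queryCost_le {X : ℕ} {M : Mem} (h : BoundedMem n N m X M) :
    queryCost n N m M ≤ X * (X + 1) + X * (X + 1) + 1 := by
  have h1 : ∑ i ∈ Finset.range (m * (n + 1)), (bitlen (M 1 i) + 1) ≤ X * (X + 1) := by
    refine (Finset.sum_le_card_nsmul _ _ (X + 1) fun i _ => ?_).trans ?_
    · simpa using h.cell 1 i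
    · simpa using Nat.mul_le_mul_right (X + 1) h.hR
  have h2 : N.size ≤ X := by
    have := h.cell 0 2
    rw [h.hN] at this
    simpa [bitlen] using this
  have h3 := Nat.mul_le_mul h.hn (Nat.succ_le_succ h2)
  simp only [queryCost, Nat.succ_eq_add_one] at h3 ⊢
  omega

end Bounds

/-- A program that uses bounded memory and few loop rounds runs in polynomial time. -/
theorem Prog.exists_time_bound (p : Prog) (hp : p.safe = true) :
    ∃ T : Polynomial ℕ, ∀ (n N m : ℕ) [NeZero N] (r : ℝ) (O : Oracle n N m) (X : ℕ) (c : Config),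
      BoundedMem n N m X c.mem → ∀ d ∈ p.run r O c, BoundedMem n N m X d.mem ∧
        d.time ≤ c.time + T.eval X := by
  induction p with
  | skip =>
    refine ⟨1, fun n N m _ r O X c h d hd => ?_⟩
    rw [Multiset.mem_singleton.1 hd]
    exact ⟨h, by simp [Config.tick]⟩
  | assign a i e =>
    simp only [safe, Bool.and_eq_true, decide_eq_true_eq] at hp
    obtain ⟨T, hT⟩ := i.exists_bound
    obtain ⟨S, hS⟩ := e.exists_bound
    refine ⟨T + S + 1, fun n N m _ r O X c h d hd => ?_⟩
    rw [Multiset.mem_singleton.1 hd]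
    refine ⟨h.write hp.1 (Expr.bitlen_le_of_bounded hp.2 h), ?_⟩
    have h1 := (hT h).2
    have h2 := (hS h).2
    simp only [Polynomial.eval_add, Polynomial.eval_one]
    omega
  | seq p q ihp ihq =>
    simp only [safe, Bool.and_eq_true] at hp
    obtain ⟨T, hT⟩ := ihp hp.1
    obtain ⟨S, hS⟩ := ihq hp.2
    refine ⟨T + S, fun n N m _ r O X c h d hd => ?_⟩
    obtain ⟨c', hc', hd⟩ := Multiset.mem_bind.1 hd
    obtain ⟨h1, h2⟩ := hT n N m r O X c h c' hc'
    obtain ⟨h3, h4⟩ := hS n N m r O X c' h1 d hd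
    refine ⟨h3, ?_⟩
    simp only [Polynomial.eval_add]
    omega
  | ifPos e p q ihp ihq =>
    simp only [safe, Bool.and_eq_true] at hp
    obtain ⟨T, hT⟩ := ihp hp.1
    obtain ⟨S, hS⟩ := ihq hp.2
    obtain ⟨E, hE⟩ := e.exists_bound
    refine ⟨E + T + S + 1, fun n N m _ r O X c h d hd => ?_⟩
    have h0 := (hE h).2
    simp only [Prog.run] at hd
    simp only [Polynomial.eval_add, Polynomial.eval_one]
    split_ifs at hd
    · obtain ⟨h1, h2⟩ := hT n N m r O X (c.tick _) h d hd
      simp only [Config.tick] at h2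
      exact ⟨h1, by omega⟩
    · obtain ⟨h1, h2⟩ := hS n N m r O X (c.tick _) h d hd
      simp only [Config.tick] at h2
      exact ⟨h1, by omega⟩
  | ifRealPos e p q ihp ihq =>
    simp only [safe, Bool.and_eq_true] at hp
    obtain ⟨T, hT⟩ := ihp hp.1
    obtain ⟨S, hS⟩ := ihq hp.2
    obtain ⟨E, hE⟩ := e.exists_bound
    refine ⟨E + T + S + 1, fun n N m _ r O X c h d hd => ?_⟩
    have h0 := hE h
    simp only [Prog.run] at hd
    simp only [Polynomial.eval_add, Polynomial.eval_one]
    split_ifs at hd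
    · obtain ⟨h1, h2⟩ := hT n N m r O X (c.tick _) h d hd
      simp only [Config.tick] at h2
      exact ⟨h1, by omega⟩
    · obtain ⟨h1, h2⟩ := hS n N m r O X (c.tick _) h d hd
      simp only [Config.tick] at h2
      exact ⟨h1, by omega⟩
  | loop e p ihp =>
    simp only [safe, Bool.and_eq_true] at hp
    obtain ⟨T, hT⟩ := ihp hp.2
    obtain ⟨E, hE⟩ := e.exists_bound
    refine ⟨E + 1 + .X * (T + 1), fun n N m _ r O X c h => ?_⟩
    have h0 := (hE h).2
    have h1 := Expr.toNat_le_of_small hp.1 h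
    simp only [Prog.run]
    have key : ∀ k, ∀ d ∈ (fun S : Multiset Config => S.bind fun d => p.run r O (d.tick 1))^[k]
        {c.tick (e.cost c.mem + 1)}, BoundedMem n N m X d.mem ∧
          d.time ≤ c.time + (e.cost c.mem + 1) + k * (T.eval X + 1) := by
      intro k
      induction k with
      | zero =>
        intro d hd
        rw [Multiset.mem_singleton.1 hd]
        exact ⟨h, by simp [Config.tick]⟩
      | succ k ih =>
        intro d hd
        rw [Function.iterate_succ_apply'] at hd
        obtain ⟨c', hc', hd⟩ := Multiset.mem_bind.1 hd
        obtain ⟨h2, h3⟩ := ih c' hc'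
        obtain ⟨h4, h5⟩ := hT n N m r O X (c'.tick 1) h2 d hd
        refine ⟨h4, ?_⟩
        simp only [Config.tick] at h5
        rw [add_mul, one_mul]
        omega
    intro d hd
    obtain ⟨h2, h3⟩ := key _ d hd
    refine ⟨h2, ?_⟩
    have h4 := Nat.mul_le_mul_right (T.eval X + 1) h1
    simp only [Polynomial.eval_add, Polynomial.eval_mul, Polynomial.eval_X, Polynomial.eval_one]
    omega
  | hadamard b i =>
    obtain ⟨T, hT⟩ := b.exists_bound
    obtain ⟨S, hS⟩ := i.exists_bound
    refine ⟨T + S + 1, fun n N m _ r O X c h d hd => ?_⟩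
    rw [Multiset.mem_singleton.1 hd]
    refine ⟨h, ?_⟩
    have h1 := (hT h).2
    have h2 := (hS h).2
    simp only [Polynomial.eval_add, Polynomial.eval_one]
    omega
  | phase b i t | rot b i t =>
    obtain ⟨T, hT⟩ := b.exists_bound
    obtain ⟨S, hS⟩ := i.exists_bound
    obtain ⟨E, hE⟩ := t.exists_bound
    refine ⟨T + S + E + 1, fun n N m _ r O X c h d hd => ?_⟩
    rw [Multiset.mem_singleton.1 hd]
    refine ⟨h, ?_⟩
    have h1 := (hT h).2
    have h2 := (hS h).2
    have h3 := hE h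
    simp only [Polynomial.eval_add, Polynomial.eval_one]
    omega
  | xor b w f =>
    simp only [safe, Bool.and_eq_true] at hp
    obtain ⟨T, hT⟩ := b.exists_bound
    obtain ⟨S, hS⟩ := w.exists_bound
    obtain ⟨E, hE⟩ := f.exists_bound hp.2
    refine ⟨T + S + .X + E + 1, fun n N m _ r O X c h d hd => ?_⟩
    rw [Multiset.mem_singleton.1 hd]
    refine ⟨h, ?_⟩
    have h1 := (hT h).2
    have h2 := (hS h).2
    have h3 := (hE h).2
    have h4 := Expr.toNat_le_of_small hp.1 h
    simp only [Polynomial.eval_add, Polynomial.eval_one, Polynomial.eval_X]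
    omega
  | measure b i a d' =>
    simp only [safe, decide_eq_true_eq] at hp
    obtain ⟨T, hT⟩ := b.exists_bound
    obtain ⟨S, hS⟩ := i.exists_bound
    obtain ⟨E, hE⟩ := d'.exists_bound
    refine ⟨T + S + E + 1, fun n N m _ r O X c h d hd => ?_⟩
    simp only [Prog.run] at hd
    obtain ⟨v, -, rfl⟩ := Multiset.mem_map.1 hd
    refine ⟨h.write hp ((bitlen_small (by split_ifs <;> simp)).trans h.pos), ?_⟩
    have h1 := (hT h).2
    have h2 := (hS h).2
    have h3 := (hE h).2
    simp only [Polynomial.eval_add, Polynomial.eval_one]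
    omega
  | query =>
    refine ⟨.X * (.X + 1) + .X * (.X + 1) + 1, fun n N m _ r O X c h d hd => ?_⟩
    simp only [Prog.run] at hd
    obtain ⟨v, -, rfl⟩ := Multiset.mem_map.1 hd
    refine ⟨h.writeAnswer v, ?_⟩
    simpa using queryCost_le h

/-! ### The reduction

Parameters (array `0`): `κ, n, N, ℓ`, the precision `w`, `W = 2 ^ w`, the number `R` of data
registers, and the number of rounds of the rejection sampler. Register `R` holds the ancilla qubit,
register `R + 1` is scratch space. Array `4` holds the random shift of the secret, array `5` the
measurement outcomes. -/

instance : Add Expr := ⟨.bin .add⟩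
instance : Sub Expr := ⟨.bin .sub⟩
instance : Mul Expr := ⟨.bin .mul⟩
instance : Div Expr := ⟨.bin .div⟩
instance : Mod Expr := ⟨.bin .mod⟩
instance : Neg Expr := ⟨fun e => .bin .sub (.const 0) e⟩
instance : Coe ℤ Expr := ⟨.const⟩
instance : Add QExpr := ⟨.bin .add⟩
instance : Sub QExpr := ⟨.bin .sub⟩
instance : Mul QExpr := ⟨.bin .mul⟩
instance : Div QExpr := ⟨.bin .div⟩
instance : Mod QExpr := ⟨.bin .mod⟩
instance : Coe Expr QExpr := ⟨.cl⟩
instance : Mul RExpr := ⟨.mul⟩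
instance : Div RExpr := ⟨.div⟩
instance : Sub RExpr := ⟨.sub⟩
instance : Coe Expr RExpr := ⟨.int⟩

@[simp] theorem Expr.eval_const (M : Mem) (z : ℤ) : (Expr.const z).eval M = z := rfl
@[simp] theorem Expr.eval_cell (M : Mem) (a : ℕ) (i : Expr) :
    (Expr.cell a i).eval M = M a (i.eval M).toNat := rfl
@[simp] theorem Expr.eval_bitlen (M : Mem) (e : Expr) :
    (Expr.bitlen e).eval M = (QRed.bitlen (e.eval M) : ℤ) := rfl
@[simp] theorem Expr.eval_add (M : Mem) (e f : Expr) : (e + f).eval M = e.eval M + f.eval M := rfl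
@[simp] theorem Expr.eval_sub (M : Mem) (e f : Expr) : (e - f).eval M = e.eval M - f.eval M := rfl
@[simp] theorem Expr.eval_mul (M : Mem) (e f : Expr) : (e * f).eval M = e.eval M * f.eval M := rfl
@[simp] theorem Expr.eval_div (M : Mem) (e f : Expr) : (e / f).eval M = e.eval M / f.eval M := rfl
@[simp] theorem Expr.eval_mod (M : Mem) (e f : Expr) : (e % f).eval M = e.eval M % f.eval M := rfl
@[simp] theorem Expr.eval_neg (M : Mem) (e : Expr) : (-e).eval M = -e.eval M := 
  (zero_sub (e.eval M))
@[simp] theorem QExpr.eval_cl (M : Mem) (x : Basis) (e : Expr) :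
    (QExpr.cl e).eval M x = e.eval M := rfl
@[simp] theorem QExpr.eval_add (M : Mem) (x : Basis) (e f : QExpr) :
    (e + f).eval M x = e.eval M x + f.eval M x := rfl
@[simp] theorem QExpr.eval_sub (M : Mem) (x : Basis) (e f : QExpr) :
    (e - f).eval M x = e.eval M x - f.eval M x := rfl
@[simp] theorem QExpr.eval_mul (M : Mem) (x : Basis) (e f : QExpr) :
    (e * f).eval M x = e.eval M x * f.eval M x := rfl
@[simp] theorem QExpr.eval_div (M : Mem) (x : Basis) (e f : QExpr) :
    (e / f).eval M x = e.eval M x / f.eval M x := rfl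
@[simp] theorem QExpr.eval_mod (M : Mem) (x : Basis) (e f : QExpr) :
    (e % f).eval M x = e.eval M x % f.eval M x := rfl
@[simp] theorem RExpr.eval_int (M : Mem) (r : ℝ) (e : Expr) :
    (RExpr.int e).eval M r = (e.eval M : ℝ) := rfl
@[simp] theorem RExpr.eval_param (M : Mem) (r : ℝ) : RExpr.param.eval M r = r := rfl
@[simp] theorem RExpr.eval_pi (M : Mem) (r : ℝ) : RExpr.pi.eval M r = Real.pi := rfl
@[simp] theorem RExpr.eval_mul (M : Mem) (r : ℝ) (s t : RExpr) :
    (s * t).eval M r = s.eval M r * t.eval M r := rfl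
@[simp] theorem RExpr.eval_div (M : Mem) (r : ℝ) (s t : RExpr) :
    (s / t).eval M r = s.eval M r / t.eval M r := rfl
@[simp] theorem RExpr.eval_sub (M : Mem) (r : ℝ) (s t : RExpr) :
    (s - t).eval M r = s.eval M r - t.eval M r := rfl
@[simp] theorem RExpr.eval_exp (M : Mem) (r : ℝ) (t : RExpr) :
    (RExpr.exp t).eval M r = Real.exp (t.eval M r) := rfl

abbrev int (z : ℤ) : Expr := .const z

/-- Computation of the parameters. -/
def setup : Prog :=
  (Prog.assign 0 (int 4) (int 3 * .bitlen (prm 2) + int 2 * prm 0 +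
    .bitlen (prm 3 * (prm 1 + int 1)) + int 8)).seq <|
  (Prog.assign 0 (int 5) (int 1)).seq <|
  (Prog.loop (prm 4) (.assign 0 (int 5) (int 2 * prm 5))).seq <|
  (Prog.assign 0 (int 6) (prm 3 * (prm 1 + int 1))).seq <|
  (Prog.assign 0 (int 7) (int 32 * (prm 0 * prm 0)))

/-- The content of the register whose number is in variable `6`. -/
abbrev dataReg : QExpr := .reg (var 6) (prm 4)
/-- The scratch register. -/
abbrev scratch : Expr := prm 6 + int 1
abbrev scratchReg : QExpr := .reg scratch (prm 4)
/-- The ancilla qubit. -/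
abbrev ancilla : QExpr := .reg (prm 6) (int 1)

/-- The integer with the code in the data register. -/
def decodeExpr : QExpr :=
  (.cl (int 1) - .cl (int 2) * (dataReg % .cl (int 2))) *
    ((dataReg + .cl (int 1)) / .cl (int 2))

/-- The code of the representative in `{-W/2, ..., W/2 - 1}` of the scratch register. -/
def encodeExpr : QExpr :=
  (.cl (int 1) - scratchReg / .cl (prm 5 / int 2)) * (.cl (int 2) * scratchReg) +
    scratchReg / .cl (prm 5 / int 2) * (.cl (int 2) * (.cl (prm 5) - scratchReg) - .cl (int 1))

/-- Moves the content of the scratch register to the data register, which contains `0`. -/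
def moveBack : Prog :=
  (Prog.xor (var 6) (prm 4) scratchReg).seq (.xor scratch (prm 4) dataReg)

/-- Replaces a code of an integer by its residue modulo `W`. -/
def decodeStep : Prog :=
  (Prog.xor scratch (prm 4) decodeExpr).seq <|
  (Prog.xor (var 6) (prm 4) encodeExpr).seq moveBack

def decodeAll : Prog :=
  (Prog.assign 6 (int 0) (int 0)).seq <|
  .loop (prm 3) (decodeStep.seq (.assign 6 (int 0) ((var 6 + (prm 1 + int 1)) % prm 5)))

/-- Shift of the data register by `W / (2 q)` modulo the variable `7` if the ancilla is `1`. -/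
def shiftStep : Prog :=
  (Prog.xor scratch (prm 4)
    ((dataReg + .cl (prm 5 / (int 2 * var 9)) * ancilla) % .cl (var 7))).seq <|
  (Prog.xor (var 6) (prm 4)
    ((scratchReg - .cl (prm 5 / (int 2 * var 9)) * ancilla) % .cl (var 7))).seq moveBack

/-- One step of phase estimation for the cyclic shift of the data register. -/
def phaseStep : Prog :=
  (Prog.hadamard (prm 6) (int 0)).seq <|
  shiftStep.seq <|
  (Prog.phase (prm 6) (int 0) (.int (int 0) - .pi * .int (var 8) / .int (var 9))).seq <|
  (Prog.hadamard (prm 6) (int 0)).seq <|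
  (readout 10).seq <|
  (Prog.assign 8 (int 0) ((var 8 + var 10 * var 9) % prm 5)).seq <|
  (Prog.assign 9 (int 0) ((int 2 * var 9) % prm 5))

def phaseEstimation : Prog :=
  (Prog.assign 8 (int 0) (int 0)).seq <|
  (Prog.assign 9 (int 0) (int 1)).seq <|
  .loop (prm 4) phaseStep

def measureAll : Prog :=
  (Prog.assign 6 (int 0) (int 0)).seq <|
  .loop (prm 6) <|
    (Prog.ifPos (var 6 % (prm 1 + int 1)) (.assign 7 (int 0) (prm 2))
      (.assign 7 (int 0) (prm 5))).seq <|
    phaseEstimation.seq <|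
    (Prog.assign 5 (var 6) (var 8)).seq <|
    (.assign 6 (int 0) ((var 6 + int 1) % prm 5))

/-- A uniformly random number below `W`. -/
def uniform : CProg :=
  (CProg.assign 17 (int 0) (int 0)).seq <|
  .loop (prm 4) ((CProg.coin 10).seq
    (.assign 17 (int 0) ((int 2 * var 17 + var 10) % prm 5)))

def sampleShift : CProg :=
  (CProg.assign 6 (int 0) (int 0)).seq <|
  .loop (prm 1) <| uniform.seq <|
    (CProg.assign 4 (var 6) (var 17 % prm 2)).seq <|
    .assign 6 (int 0) ((var 6 + int 1) % prm 5)

/-- The least power of two that is at least `4 κ N / r`. -/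
def window : CProg :=
  (CProg.assign 11 (int 0) (int 1)).seq <|
  .loop (prm 4) <|
    .ifRealPos (.int (int 4) * .int (prm 0) * .int (prm 2) / .param - .int (var 11))
      (.assign 11 (int 0) ((int 2 * var 11) % prm 5)) .skip

/-- The candidate proposed by the rejection sampler. -/
def candidate : Expr :=
  (-(.cell 5 (var 12) * prm 2)) / prm 5 - var 11 / int 2 + var 17 % var 11

/-- One round of the rejection sampler. -/
def rejectionRound : CProg :=
  uniform.seq <|
  (CProg.bern (.exp (.int (int 0) - .int (int 2) * .pi *
    (.int (candidate * prm 5 + .cell 5 (var 12) * prm 2) * .param / .int (prm 2 * prm 5)) *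
    (.int (candidate * prm 5 + .cell 5 (var 12) * prm 2) * .param / .int (prm 2 * prm 5))))
    10).seq <|
  .ifPos (var 10) ((CProg.assign 15 (int 0) (int 1)).seq
    (.assign 16 (int 0) (candidate % prm 2))) .skip

def rejection : CProg :=
  (CProg.assign 15 (int 0) (int 0)).seq <|
  (CProg.assign 16 (int 0) (int 0)).seq <|
  .loop (prm 7) (.ifPos (var 15) .skip rejectionRound)

/-- The vector of the sample, and its inner product with the shift. -/
def vectorPart : CProg :=
  (CProg.assign 14 (int 0) (int 0)).seq <|
  (CProg.assign 6 (int 0) (int 0)).seq <|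
  .loop (prm 1) <|
    (CProg.assign 1 (var 12 + var 6)
      (((int 2 * .cell 5 (var 12 + int 1 + var 6) * prm 2 + prm 5) / (int 2 * prm 5)) %
        prm 2)).seq <|
    (CProg.assign 14 (int 0) ((var 14 + .cell 1 (var 12 + var 6) * .cell 4 (var 6)) % prm 2)).seq <|
    .assign 6 (int 0) ((var 6 + int 1) % prm 5)

def sampleAll : CProg :=
  (CProg.assign 12 (int 0) (int 0)).seq <|
  .loop (prm 3) <|
    vectorPart.seq <|
    rejection.seq <|
    (CProg.assign 1 (var 12 + prm 1) ((var 16 + var 14) % prm 2)).seq <|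
    .assign 12 (int 0) ((var 12 + (prm 1 + int 1)) % prm 5)

def output : CProg :=
  (CProg.assign 6 (int 0) (int 0)).seq <|
  .loop (prm 1) <|
    (CProg.assign 3 (var 6) ((.cell 2 (var 6) - .cell 4 (var 6)) % prm 2)).seq <|
    .assign 6 (int 0) ((var 6 + int 1) % prm 5)

def postprocess : CProg :=
  sampleShift.seq <| window.seq <| sampleAll.seq <| CProg.query.seq output

def mainPart : Prog := decodeAll.seq (measureAll.seq postprocess.compile)

def reduction : Prog := setup.seq mainPart

/-- `setup` is left out: it writes to array `0` and doubles a cell in a loop, so its cost is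
computed separately. -/
theorem safe_mainPart : mainPart.safe = true := by decide

theorem keepsParams_postprocess : postprocess.KeepsParams := by
  simp [postprocess, sampleShift, window, sampleAll, output, uniform, rejection, rejectionRound,
    vectorPart, CProg.KeepsParams]

/-! ### The parameters -/

/-- The precision used by the reduction. -/
def precision (κ n N ℓ : ℕ) : ℕ := 3 * N.size + 2 * κ + (ℓ * (n + 1)).size + 8

/-- The parameters computed by `setup`. -/
def params (κ n N ℓ : ℕ) : ℕ → ℤ := fun i =>
  (([κ, n, N, ℓ, precision κ n N ℓ, 2 ^ precision κ n N ℓ, ℓ * (n + 1), 32 * (κ * κ)].getD i 0 : ℕ)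
    : ℤ)

/-- The memory after `setup`. -/
def paramMem (κ n N ℓ : ℕ) : Mem := fun a => if a = 0 then params κ n N ℓ else 0

/-- A bound for the parameters and for the bit length of memory cells. -/
def memBound (κ n N ℓ : ℕ) : ℕ :=
  κ + n + N.size + ℓ + precision κ n N ℓ + ℓ * (n + 1) + 32 * (κ * κ) + 1

/-- The memory during `setup`, as a list of the entries of array `0`. -/
def listMem (l : List ℕ) : Mem := fun a i => if a = 0 then ((l.getD i 0 : ℕ) : ℤ) else 0

theorem bitlen_listMem_le {l : List ℕ} {X : ℕ} (h : ∀ k ∈ l, k.size ≤ X) (a i : ℕ) :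
    bitlen (listMem l a i) ≤ X := by
  simp only [listMem]
  split_ifs
  · rw [bitlen, Int.natAbs_natCast]
    by_cases hi : i < l.length
    · rw [List.getD_eq_getElem _ _ hi]
      exact h _ (List.getElem_mem hi)
    · rw [List.getD_eq_default _ _ (not_lt.1 hi)]
      simp
  · simp [bitlen]

theorem write_listMem (l : List ℕ) (i z : ℕ) (hi : i < l.length) :
    (listMem l).write 0 i z = listMem (l.set i z) := by
  funext a j
  by_cases ha : a = 0
  · subst ha
    by_cases hj : j = i
    · subst hj; simp [Mem.write, listMem, hi]
    · simp [Mem.write, listMem, hj, Ne.symm hj]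
  · simp [Mem.write, listMem, ha]

/-- Missing entries read as `0`. A list may thus be lengthened before its next entry is written. -/
theorem listMem_append_zero (l : List ℕ) : listMem (l ++ [0]) = listMem l := by
  funext a j
  by_cases ha : a = 0
  · subst ha
    simp only [listMem, if_true]
    rcases lt_trichotomy j l.length with h | h | h
    · rw [List.getD_append _ _ _ _ h]
    · subst h; simp
    · rw [List.getD_eq_default _ _ (by simp; omega), List.getD_eq_default _ _ (by omega)]
  · simp [listMem, ha]

/-! ### Effect and cost of the computation of the parameters -/

section Setup

variable {n N m : ℕ} [NeZero N] {r : ℝ} {O : Oracle n N m}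

theorem exists_assign_bound (a : ℕ) (i e : Expr) : ∃ T : Polynomial ℕ,
    ∀ {n N m : ℕ} [NeZero N] (r : ℝ) (O : Oracle n N m) {X : ℕ} {M : Mem} (ψ : QState) (t : ℕ),
    (∀ a i, bitlen (M a i) ≤ X) → ∃ t' ≤ t + T.eval X, (Prog.assign a i e).run r O ⟨M, ψ, t⟩ =
      {⟨M.write a (i.eval M).toNat (e.eval M), ψ, t'⟩} := by
  obtain ⟨T, hT⟩ := i.exists_bound_of_cell
  obtain ⟨S, hS⟩ := e.exists_bound_of_cell
  refine ⟨T + S + 1, fun r O X M ψ t h => ⟨_, ?_, rfl⟩⟩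
  have h1 := (hT h).2
  have h2 := (hS h).2
  simp only [Polynomial.eval_add, Polynomial.eval_one]
  omega

/-- Without measurements and queries there is exactly one final branch, so the program can simply be
executed. In the doubling loop the cell holds 2^k with k ≤ w, whose bit length stays polynomial
although its value does not. -/
theorem exists_setup_bound : ∃ T : Polynomial ℕ,
    ∀ {n N ℓ : ℕ} [NeZero N] (κ : ℕ) (r : ℝ) (O : Oracle n N ℓ) (ψ : QState),
      ∃ t ≤ T.eval (memBound κ n N ℓ),
        setup.run r O ⟨listMem [κ, n, N, ℓ], ψ, 0⟩ = {⟨paramMem κ n N ℓ, ψ, t⟩} := by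
  obtain ⟨T₁, h₁⟩ := exists_assign_bound 0 (int 4) (int 3 * .bitlen (prm 2) + int 2 * prm 0 +
    .bitlen (prm 3 * (prm 1 + int 1)) + int 8)
  obtain ⟨T₂, h₂⟩ := exists_assign_bound 0 (int 5) (int 1)
  obtain ⟨T₃, h₃⟩ := exists_assign_bound 0 (int 5) (int 2 * prm 5)
  obtain ⟨T₄, h₄⟩ := exists_assign_bound 0 (int 6) (prm 3 * (prm 1 + int 1))
  obtain ⟨T₅, h₅⟩ := exists_assign_bound 0 (int 7) (int 32 * (prm 0 * prm 0))
  obtain ⟨T₆, h₆⟩ := (prm 4).exists_bound_of_cell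
  refine ⟨T₁ + T₂ + (T₆ + 1 + .X * (T₃ + 1)) + T₄ + T₅, fun {n N ℓ} _ κ r O ψ => ?_⟩
  set X := memBound κ n N ℓ with hX
  set w := precision κ n N ℓ with hw
  have hwX : w + 1 ≤ X := by simp only [hX, memBound]; omega
  have b : ∀ k ∈ [κ, n, N, ℓ, w, ℓ * (n + 1), 32 * (κ * κ)], k.size ≤ X := by
    have e := size_le_self
    have := e κ; have := e n; have := e ℓ; have := e w; have := e (ℓ * (n + 1))
    have := e (32 * (κ * κ))
    simp only [List.mem_cons, List.not_mem_nil, or_false, hX, memBound]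
    rintro k (rfl | rfl | rfl | rfl | rfl | rfl | rfl) <;> omega
  have hp : ∀ k ≤ w, (2 ^ k).size ≤ X := fun k hk => by rw [Nat.size_pow]; omega
  have bl : ∀ k ≤ w, ∀ a i, bitlen (listMem [κ, n, N, ℓ, w, 2 ^ k] a i) ≤ X := by
    intro k hk
    apply bitlen_listMem_le
    intro j hj
    simp only [List.mem_cons, List.not_mem_nil, or_false] at hj
    rcases hj with rfl | rfl | rfl | rfl | rfl | rfl
    on_goal 6 => exact hp k hk
    all_goals exact b _ (by simp)
  have b6 : ∀ a i, bitlen (listMem [κ, n, N, ℓ, w, 2 ^ w, ℓ * (n + 1)] a i) ≤ X := by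
    apply bitlen_listMem_le
    intro j hj
    simp only [List.mem_cons, List.not_mem_nil, or_false] at hj
    rcases hj with rfl | rfl | rfl | rfl | rfl | rfl | rfl
    on_goal 6 => exact hp w le_rfl
    all_goals exact b _ (by simp)
  obtain ⟨t₁, ht₁, e₁⟩ := h₁ r O (X := X) (M := listMem [κ, n, N, ℓ]) ψ 0
    (bitlen_listMem_le fun j hj => b j (by simp at hj ⊢; tauto))
  obtain ⟨t₂, ht₂, e₂⟩ := h₂ r O (X := X) (M := listMem [κ, n, N, ℓ, w]) ψ t₁
    (bitlen_listMem_le fun j hj => b j (by simp at hj ⊢; tauto))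
  have c₁ : (listMem [κ, n, N, ℓ]).write 0 ((int 4).eval (listMem [κ, n, N, ℓ])).toNat
      ((int 3 * .bitlen (prm 2) + int 2 * prm 0 +
        .bitlen (prm 3 * (prm 1 + int 1)) + int 8 : Expr).eval (listMem [κ, n, N, ℓ])) =
      listMem [κ, n, N, ℓ, w] := by
    have : ((int 3 * .bitlen (prm 2) + int 2 * prm 0 +
        .bitlen (prm 3 * (prm 1 + int 1)) + int 8 : Expr).eval (listMem [κ, n, N, ℓ])) = (w : ℤ) := by
      have e1 : ((ℓ : ℤ) * (n + 1)).natAbs = ℓ * (n + 1) := by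
        rw [show ((ℓ : ℤ) * (n + 1)) = ((ℓ * (n + 1) : ℕ) : ℤ) by push_cast; ring]
        exact Int.natAbs_natCast _
      simp [listMem, hw, precision, bitlen, e1]
    rw [this, ← listMem_append_zero]
    exact write_listMem _ 4 w (by simp)
  have c₂ : (listMem [κ, n, N, ℓ, w]).write 0 ((int 5).eval (listMem [κ, n, N, ℓ, w])).toNat
      ((int 1).eval (listMem [κ, n, N, ℓ, w])) = listMem [κ, n, N, ℓ, w, 2 ^ 0] := by
    rw [← listMem_append_zero]
    exact write_listMem _ 5 1 (by simp)
  have c₃ : ∀ k, (listMem [κ, n, N, ℓ, w, 2 ^ k]).write 0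
      ((int 5).eval (listMem [κ, n, N, ℓ, w, 2 ^ k])).toNat
      ((int 2 * prm 5 : Expr).eval (listMem [κ, n, N, ℓ, w, 2 ^ k])) =
      listMem [κ, n, N, ℓ, w, 2 ^ (k + 1)] := by
    intro k
    have := write_listMem [κ, n, N, ℓ, w, 2 ^ k] 5 (2 ^ (k + 1)) (by simp)
    refine Eq.trans ?_ this
    congr 1
    simp [listMem, pow_succ, mul_comm]
  have key : ∀ k ≤ w, ∃ t ≤ t₂ + (T₆.eval X + 1) + k * (T₃.eval X + 1),
      (fun S : Multiset Config => S.bind fun d =>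
        (Prog.assign 0 (int 5) (int 2 * prm 5)).run r O (d.tick 1))^[k]
      {Config.tick ⟨listMem [κ, n, N, ℓ, w, 2 ^ 0], ψ, t₂⟩
        ((prm 4).cost (listMem [κ, n, N, ℓ, w, 2 ^ 0]) + 1)} =
      {⟨listMem [κ, n, N, ℓ, w, 2 ^ k], ψ, t⟩} := by
    intro k
    induction k with
    | zero =>
      intro _
      refine ⟨_, ?_, rfl⟩
      have := (h₆ (bl 0 (Nat.zero_le _))).2
      simp only []
      omega
    | succ k ih =>
      intro hk
      obtain ⟨t, ht, e⟩ := ih (by omega)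
      obtain ⟨t', ht', e'⟩ := h₃ r O ψ (t + 1) (bl k (by omega))
      refine ⟨t', ?_, ?_⟩
      · rw [add_mul, one_mul]; omega
      · rw [Function.iterate_succ_apply', e, Multiset.singleton_bind]
        simp only [Config.tick]
        rw [e', c₃]
  obtain ⟨t₃, ht₃, e₃⟩ := key w le_rfl
  obtain ⟨t₄, ht₄, e₄⟩ := h₄ r O ψ t₃ (bl w le_rfl)
  have c₄ : (listMem [κ, n, N, ℓ, w, 2 ^ w]).write 0
      ((int 6).eval (listMem [κ, n, N, ℓ, w, 2 ^ w])).toNat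
      ((prm 3 * (prm 1 + int 1) : Expr).eval (listMem [κ, n, N, ℓ, w, 2 ^ w])) =
      listMem [κ, n, N, ℓ, w, 2 ^ w, ℓ * (n + 1)] := by
    rw [← listMem_append_zero]
    have := write_listMem ([κ, n, N, ℓ, w, 2 ^ w] ++ [0]) 6 (ℓ * (n + 1)) (by simp)
    refine Eq.trans ?_ this
    congr 1
  obtain ⟨t₅, ht₅, e₅⟩ := h₅ r O ψ t₄ b6
  have c₅ : (listMem [κ, n, N, ℓ, w, 2 ^ w, ℓ * (n + 1)]).write 0
      ((int 7).eval (listMem [κ, n, N, ℓ, w, 2 ^ w, ℓ * (n + 1)])).toNat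
      ((int 32 * (prm 0 * prm 0) : Expr).eval (listMem [κ, n, N, ℓ, w, 2 ^ w, ℓ * (n + 1)])) =
      paramMem κ n N ℓ := by
    rw [← listMem_append_zero]
    have := write_listMem ([κ, n, N, ℓ, w, 2 ^ w, ℓ * (n + 1)] ++ [0]) 7 (32 * (κ * κ)) (by simp)
    refine Eq.trans ?_ (this.trans ?_)
    · congr 1
    · funext a i
      simp only [listMem, paramMem]
      split_ifs <;> rfl
  refine ⟨t₅, ?_, ?_⟩
  · have : w * (T₃.eval X + 1) ≤ X * (T₃.eval X + 1) := Nat.mul_le_mul_right _ (by omega)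
    simp only [Polynomial.eval_add, Polynomial.eval_mul, Polynomial.eval_X, Polynomial.eval_one]
    omega
  · have h4 : ((prm 4).eval (listMem [κ, n, N, ℓ, w, 2 ^ 0])).toNat = w := by
      simp [listMem]
    simp only [setup, Prog.run.eq_3, e₁, c₁, Multiset.singleton_bind, e₂, c₂]
    rw [Prog.run.eq_6]
    simp only [h4, e₃, Multiset.singleton_bind, e₄, c₄, e₅, c₅]

end Setup

theorem boundedMem_paramMem (κ n N ℓ : ℕ) :
    BoundedMem n N ℓ (memBound κ n N ℓ) (paramMem κ n N ℓ) where
  cell a i := by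
    have : paramMem κ n N ℓ = listMem [κ, n, N, ℓ, precision κ n N ℓ,
        2 ^ precision κ n N ℓ, ℓ * (n + 1), 32 * (κ * κ)] := by
      funext a i
      simp only [listMem, paramMem]
      split_ifs <;> rfl
    rw [this]
    refine bitlen_listMem_le ?_ a i
    have e := size_le_self
    have := e κ; have := e n; have := e ℓ; have := e (precision κ n N ℓ); have := e (ℓ * (n + 1))
    have := e (32 * (κ * κ))
    have hs : (2 ^ precision κ n N ℓ).size = precision κ n N ℓ + 1 := Nat.size_pow
    simp only [List.mem_cons, List.not_mem_nil, or_false, memBound]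
    rintro k (rfl | rfl | rfl | rfl | rfl | rfl | rfl | rfl) <;> omega
  hN := rfl
  hW := by simp [paramMem, params]
  small i hi := by
    simp only [List.mem_cons, List.not_mem_nil, or_false] at hi
    have : ∀ k : ℕ, ((k : ℤ)).toNat = k := fun _ => rfl
    rcases hi with rfl | rfl | rfl | rfl | rfl <;>
    · simp only [paramMem, params, memBound, if_true]
      simp only [this, List.getD_cons_succ, List.getD_cons_zero]
      omega
  hn := by simp only [memBound]; omega
  hR := by simp only [memBound]; omega
  pos := by simp only [memBound]; omega

/-! ### Polynomial running time -/

theorem PolyBounded.mono {f g : ℕ → ℕ} (hg : PolyBounded g) (h : ∀ κ, f κ ≤ g κ) :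
    PolyBounded f := hg.imp fun _ hT κ => (h κ).trans (hT κ)

theorem PolyBounded.add {f g : ℕ → ℕ} (hf : PolyBounded f) (hg : PolyBounded g) :
    PolyBounded fun κ => f κ + g κ := by
  obtain ⟨T, hT⟩ := hf
  obtain ⟨S, hS⟩ := hg
  exact ⟨T + S, fun κ => by simpa using add_le_add (hT κ) (hS κ)⟩

theorem PolyBounded.mul {f g : ℕ → ℕ} (hf : PolyBounded f) (hg : PolyBounded g) :
    PolyBounded fun κ => f κ * g κ := by
  obtain ⟨T, hT⟩ := hf
  obtain ⟨S, hS⟩ := hg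
  exact ⟨T * S, fun κ => by simpa using Nat.mul_le_mul (hT κ) (hS κ)⟩

theorem polyBounded_const (c : ℕ) : PolyBounded fun _ => c := ⟨.C c, fun κ => by simp⟩

theorem polyBounded_id : PolyBounded fun κ => κ := ⟨.X, fun κ => by simp⟩

theorem eval_mono (T : Polynomial ℕ) {x y : ℕ} (h : x ≤ y) : T.eval x ≤ T.eval y := by
  induction T using Polynomial.induction_on' with
  | add p q hp hq => simpa using add_le_add hp hq
  | monomial k a => simpa using Nat.mul_le_mul_left _ (Nat.pow_le_pow_left h k)

theorem polyBounded_size {N : ℕ → ℕ} (hN : PolyBounded fun κ => Nat.log 2 (N κ)) :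
    PolyBounded fun κ => (N κ).size := by
  refine (hN.add (polyBounded_const 1)).mono fun κ => ?_
  rw [Nat.size_le]
  exact Nat.lt_pow_succ_log_self (by norm_num) _

theorem polyBounded_memBound {n N ℓ : ℕ → ℕ} (hn : PolyBounded n)
    (hN : PolyBounded fun κ => Nat.log 2 (N κ)) (hℓ : PolyBounded ℓ) :
    PolyBounded fun κ => memBound κ (n κ) (N κ) (ℓ κ) := by
  have hR : PolyBounded fun κ => ℓ κ * (n κ + 1) := hℓ.mul (hn.add (polyBounded_const 1))
  have hs := polyBounded_size hN
  have hw : PolyBounded fun κ => precision κ (n κ) (N κ) (ℓ κ) :=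
    (((((polyBounded_const 3).mul hs).add ((polyBounded_const 2).mul polyBounded_id)).add hR).add
      (polyBounded_const 8)).mono fun κ => by
        have := size_le_self (ℓ κ * (n κ + 1))
        simp only [precision]
        omega
  exact ((((((polyBounded_id.add hn).add hs).add hℓ).add hw).add hR).add
    ((polyBounded_const 32).mul (polyBounded_id.mul polyBounded_id))).add (polyBounded_const 1)

theorem initConfig_eq {n N ℓ : ℕ} (κ : ℕ) (r : ℝ) (x : Fin ℓ → Fin n → ZMod N)
    (s : Fin n → ZMod N) :
    initConfig κ r x s = ⟨listMem [κ, n, N, ℓ], edcpState (rho r) x s, 0⟩ := rfl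

theorem runsInPolyTime_reduction {n N ℓ : ℕ → ℕ} [∀ κ, NeZero (N κ)] (r : ℕ → ℝ)
    (hn : PolyBounded n) (hN : PolyBounded fun κ => Nat.log 2 (N κ)) (hℓ : PolyBounded ℓ) :
    RunsInPolyTime n N ℓ r reduction := by
  obtain ⟨T, hT⟩ := exists_setup_bound
  obtain ⟨S, hS⟩ := mainPart.exists_time_bound safe_mainPart
  obtain ⟨B, hB⟩ := polyBounded_memBound hn hN hℓ
  refine ⟨(T + S).comp B, fun κ O s x c hc => ?_⟩
  obtain ⟨t, ht, e⟩ := hT κ (r κ) O (edcpState (rho (r κ)) x s)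
  replace hc : c ∈ (setup.run (r κ) O (initConfig κ (r κ) x s)).bind (mainPart.run (r κ) O) := hc
  rw [initConfig_eq, e, Multiset.singleton_bind] at hc
  have h := (hS _ _ _ (r κ) O _ ⟨paramMem κ (n κ) (N κ) (ℓ κ), edcpState (rho (r κ)) x s, t⟩
    (boundedMem_paramMem κ (n κ) (N κ) (ℓ κ)) c hc).2
  have h1 := eval_mono T (hB κ)
  have h2 := eval_mono S (hB κ)
  simp only [Polynomial.eval_comp, Polynomial.eval_add]
  simp only [] at h h1 h2
  omega

/-! ### Basis states of data registers, ancilla and scratch register -/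

/-- An assignment of different registers below `u` to the indices. -/
structure IsLayout {ι : Type*} (reg : ι → ℕ) (u : ℕ) : Prop where
  inj : Function.Injective reg
  lt : ∀ p, reg p < u

section States

variable {ι : Type*} [Fintype ι] {reg : ι → ℕ} {u : ℕ}

/-- The basis state with `v p` in register `reg p`, the ancilla `a` in register `u`, and `b` in the
scratch register `u + 1`. -/
def st (reg : ι → ℕ) (u : ℕ) (v : ι → ℕ) (a b : ℕ) : Basis :=
  ∑ p, Finsupp.single (reg p) (v p) + Finsupp.single u a + Finsupp.single (u + 1) b

theorem sum_single_apply (h : IsLayout reg u) (v : ι → ℕ) (p : ι) :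
    (∑ q, Finsupp.single (reg q) (v q) : Basis) (reg p) = v p := by
  classical
  rw [Finsupp.finsetSum_apply, Finset.sum_eq_single p]
  · simp
  · intro q _ hq
    rw [Finsupp.single_apply, if_neg (h.inj.ne hq)]
  · simp

theorem sum_single_apply_of_ne (v : ι → ℕ) {j : ℕ} (hj : ∀ p, reg p ≠ j) :
    (∑ q, Finsupp.single (reg q) (v q) : Basis) j = 0 := by
  rw [Finsupp.finsetSum_apply]
  exact Finset.sum_eq_zero fun q _ => by rw [Finsupp.single_apply, if_neg (hj q)]

theorem st_reg (h : IsLayout reg u) (v : ι → ℕ) (a b : ℕ)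
    (p : ι) : st reg u v a b (reg p) = v p := by
  have := h.lt p
  rw [st, Finsupp.add_apply, Finsupp.add_apply, sum_single_apply h, Finsupp.single_apply,
    Finsupp.single_apply, if_neg (by omega), if_neg (by omega)]
  simp

theorem st_ancilla (h : IsLayout reg u) (v : ι → ℕ) (a b : ℕ) : st reg u v a b u = a := by
  rw [st, Finsupp.add_apply, Finsupp.add_apply, sum_single_apply_of_ne _ fun p => (h.lt p).ne,
    Finsupp.single_apply, Finsupp.single_apply, if_pos rfl, if_neg (by omega)]
  simp

theorem st_scratch (h : IsLayout reg u) (v : ι → ℕ) (a b : ℕ) : st reg u v a b (u + 1) = b := by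
  rw [st, Finsupp.add_apply, Finsupp.add_apply,
    sum_single_apply_of_ne _ fun p => ((h.lt p).trans (Nat.lt_succ_self u)).ne,
    Finsupp.single_apply, Finsupp.single_apply, if_pos rfl, if_neg (by omega)]
  simp

theorem st_of_ne (v : ι → ℕ) (a b : ℕ)
    {j : ℕ} (hj : ∀ p, reg p ≠ j) (hu : j ≠ u) (hz : j ≠ u + 1) :
    st reg u v a b j = 0 := by
  rw [st, Finsupp.add_apply, Finsupp.add_apply, sum_single_apply_of_ne _ hj,
    Finsupp.single_apply, Finsupp.single_apply, if_neg hu.symm, if_neg hz.symm]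
  rfl

theorem eq_st (h : IsLayout reg u) (v : ι → ℕ) (a b : ℕ)
    {x : Basis} (hr : ∀ p, x (reg p) = v p) (hu : x u = a) (hz : x (u + 1) = b)
    (h0 : ∀ j, (∀ p, reg p ≠ j) → j ≠ u → j ≠ u + 1 → x j = 0) : x = st reg u v a b := by
  ext j
  by_cases h1 : j = u
  · rw [h1, hu, st_ancilla h]
  by_cases h2 : j = u + 1
  · rw [h2, hz, st_scratch h]
  by_cases h3 : ∀ p, reg p ≠ j
  · rw [h0 j h3 h1 h2, st_of_ne _ _ _ h3 h1 h2]
  · push Not at h3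
    obtain ⟨p, rfl⟩ := h3
    rw [hr, st_reg h]

theorem st_update_ancilla (h : IsLayout reg u) (v : ι → ℕ) (a b : ℕ)
    (k : ℕ) : (st reg u v a b).update u k = st reg u v k b := by
  refine eq_st h _ _ _ (fun p => ?_) ?_ ?_ fun j h1 h2 h3 => ?_
  · simpa [(h.lt p).ne] using st_reg h v a b p
  · simp
  · simpa using st_scratch h v a b
  · simpa [h2] using st_of_ne v a b h1 h2 h3

theorem st_update_scratch (h : IsLayout reg u) (v : ι → ℕ) (a b : ℕ)
    (k : ℕ) : (st reg u v a b).update (u + 1) k = st reg u v a k := by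
  refine eq_st h _ _ _ (fun p => ?_) ?_ ?_ fun j h1 h2 h3 => ?_
  · simpa [((h.lt p).trans (Nat.lt_succ_self u)).ne] using st_reg h v a b p
  · simpa using st_ancilla h v a b
  · simp
  · simpa [h3] using st_of_ne v a b h1 h2 h3

theorem st_update_reg [DecidableEq ι] (h : IsLayout reg u) (v : ι → ℕ) (a b : ℕ)
    (p : ι) (k : ℕ) :
    (st reg u v a b).update (reg p) k = st reg u (Function.update v p k) a b := by
  have := h.lt p
  refine eq_st h _ _ _ (fun q => ?_) ?_ ?_ fun j h1 h2 h3 => ?_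
  · by_cases hq : q = p
    · subst hq; simp
    · simpa [hq, h.inj.ne hq] using st_reg h v a b q
  · simpa [(h.lt p).ne'] using st_ancilla h v a b
  · simpa [show u + 1 ≠ reg p by omega] using st_scratch h v a b
  · simpa [(h1 p).symm] using st_of_ne v a b h1 h2 h3

theorem erase_eq_update (x : Basis) (j : ℕ) : x.erase j = x.update j 0 := by
  ext i
  by_cases hi : i = j <;> simp [hi, Finsupp.erase]

theorem st_injective (h : IsLayout reg u) (a b : ℕ) :
    Function.Injective fun v : ι → ℕ => st reg u v a b := fun v v' hv => by
  funext p
  rw [← st_reg h v a b p, ← st_reg h v' a b p]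
  exact congrArg (fun x : Basis => x (reg p)) hv

end States

/-! ### Computation in place -/

/-- Replaces the content `h` of the data register by `F h`, where `G` is the inverse of `F`. -/
def inPlace (F G : QExpr) : Prog :=
  (Prog.xor scratch (prm 4) F).seq <| (Prog.xor (var 6) (prm 4) G).seq moveBack

section InPlace

variable {ι : Type*} [Fintype ι] {reg : ι → ℕ} {u w : ℕ}
  {n N m : ℕ} [NeZero N] {r : ℝ} {O : Oracle n N m}

/-- What the quantum part has to know about the memory. -/
structure QMem (u w : ℕ) (M : Mem) : Prop where
  prec : M 0 4 = w
  modulus : M 0 5 = 2 ^ w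
  anc : M 0 6 = u

theorem QMem.scratch {M : Mem} (hM : QMem u w M) : (scratch.eval M).toNat = u + 1 := by
  simp only [Expr.eval_add, Expr.eval_cell, Expr.eval_const]
  simp only [Int.reduceToNat, hM.anc]
  omega

theorem QMem.prec_eval {M : Mem} (hM : QMem u w M) : ((prm 4).eval M).toNat = w := by
  simp only [Expr.eval_cell, Expr.eval_const]
  simp only [Int.reduceToNat, hM.prec]
  omega

theorem eval_dataReg (hl : IsLayout reg u) {M : Mem} (hM : QMem u w M) {p : ι} (hp : M 6 0 = reg p)
    (v : ι → ℕ) (a b : ℕ) : dataReg.eval M (st reg u v a b) = ((v p % 2 ^ w : ℕ) : ℤ) := by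
  simp only [QExpr.eval, hM.prec_eval]
  simp only [Expr.eval_cell, Expr.eval_const, Int.toNat_zero, hp, Int.toNat_natCast, st_reg hl]

theorem eval_scratchReg (hl : IsLayout reg u) {M : Mem} (hM : QMem u w M)
    (v : ι → ℕ) (a b : ℕ) : scratchReg.eval M (st reg u v a b) = ((b % 2 ^ w : ℕ) : ℤ) := by
  simp only [QExpr.eval, hM.prec_eval, hM.scratch, st_scratch hl]

theorem eval_ancilla (hl : IsLayout reg u) {M : Mem} (hM : QMem u w M)
    (v : ι → ℕ) (a b : ℕ) : ancilla.eval M (st reg u v a b) = ((a % 2 : ℕ) : ℤ) := by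
  have : ((prm 6).eval M).toNat = u := by
    simp only [Expr.eval_cell, Expr.eval_const]
    simp only [Int.reduceToNat, hM.anc]
    omega
  simp only [QExpr.eval, this, st_ancilla hl]
  simp

theorem xorBasis_scratch (hl : IsLayout reg u) (M : Mem) (f : QExpr) (v : ι → ℕ) (a b : ℕ) :
    xorBasis M (u + 1) w f (st reg u v a b) =
      st reg u v a (b ^^^ (f.eval M (st reg u v a 0) % 2 ^ w).toNat) := by
  rw [xorBasis, erase_eq_update, st_update_scratch hl, st_update_scratch hl, st_scratch hl]

theorem xorBasis_reg [DecidableEq ι] (hl : IsLayout reg u) (M : Mem) (f : QExpr) (v : ι → ℕ) (a b : ℕ) (p : ι) :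
    xorBasis M (reg p) w f (st reg u v a b) = st reg u (Function.update v p
      (v p ^^^ (f.eval M (st reg u (Function.update v p 0) a b) % 2 ^ w).toNat)) a b := by
  rw [xorBasis, erase_eq_update, st_update_reg hl, st_update_reg hl, st_reg hl]

theorem toNat_mod_two_pow {y : ℕ} (hy : y < 2 ^ w) :
    (((y % 2 ^ w : ℕ) : ℤ) % 2 ^ w).toNat = y := by
  rw [Nat.mod_eq_of_lt hy, Int.emod_eq_of_lt (by positivity) (by exact_mod_cast hy)]
  simp

/-- A reversible in-place map: compute F(h) into the scratch register, cancel h by XORing G of the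
result, then move the result over. No bijectivity is required; the new amplitude is described only
at those contents for which `F` and `G` are inverse to each other. -/
theorem reaches_inPlace [DecidableEq ι] (hl : IsLayout reg u) {M : Mem} (hM : QMem u w M) {p : ι}
    (hp : M 6 0 = reg p) {F G : QExpr} {ψ : QState} {Q : Mem → QState → Prop}
    (hQ : ∀ ψ', (∀ v a h, v p < 2 ^ w →
      (F.eval M (st reg u (Function.update v p h) a 0) % 2 ^ w).toNat = v p →
      (G.eval M (st reg u (Function.update v p 0) a (v p)) % 2 ^ w).toNat = h →
      ψ' (st reg u v a 0) = ψ (st reg u (Function.update v p h) a 0)) → Q M ψ') :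
    Reaches r O (inPlace F G) M ψ Q := by
  have hd : ((var 6).eval M).toNat = reg p := by simp [hp]
  refine Reaches.seq (Q := fun M' ψ' => M' = M ∧ ψ' = fun x => ψ (xorBasis M (u + 1) w F x))
    (reaches_xor ⟨rfl, by rw [hM.scratch, hM.prec_eval]⟩) ?_
  rintro _ _ ⟨h₁, h₂⟩
  rw [h₁, h₂]
  refine Reaches.seq (Q := fun M' ψ' => M' = M ∧ ψ' = fun x => ψ (xorBasis M (u + 1) w F
    (xorBasis M (reg p) w G x))) (reaches_xor ⟨rfl, by rw [hd, hM.prec_eval]⟩) ?_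
  rintro _ _ ⟨h₁, h₂⟩
  rw [h₁, h₂]
  refine Reaches.seq (Q := fun M' ψ' => M' = M ∧ ψ' = fun x => ψ (xorBasis M (u + 1) w F
    (xorBasis M (reg p) w G (xorBasis M (reg p) w scratchReg x))))
    (reaches_xor ⟨rfl, by rw [hd, hM.prec_eval]⟩) ?_
  rintro _ _ ⟨h₁, h₂⟩
  rw [h₁, h₂]
  refine reaches_xor (hQ _ fun v a h hv hF hG => ?_)
  rw [hM.scratch, hM.prec_eval]
  congr 1
  -- Amplitudes are pulled back, so the four XORs act on the basis state in reverse order: the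
  -- scratch register becomes `v p`, the data register is cleared, it becomes `h`, and the scratch
  -- register is cleared.
  rw [xorBasis_scratch hl, eval_dataReg hl hM hp, toNat_mod_two_pow hv, Nat.zero_xor,
    xorBasis_reg hl, eval_scratchReg hl hM, toNat_mod_two_pow hv, Nat.xor_self,
    xorBasis_reg hl]
  simp only [Function.update_idem, hG, Function.update_self, Nat.zero_xor]
  rw [xorBasis_scratch hl, hF, Nat.xor_self]

end InPlace

/-! ### One step of phase estimation -/

/-- The contents of the data registers, register `p` being below `md p`. -/
abbrev grid {ι : Type*} [Fintype ι] [DecidableEq ι] (md : ι → ℕ) : Finset (ι → ℕ) :=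
  Fintype.piFinset fun p => Finset.range (md p)

/-- The character `x ↦ exp (2 π i x)` of the reals. -/
def ee (x : ℝ) : ℂ := Complex.exp ((2 * Real.pi * x : ℝ) * Complex.I)

theorem ee_add (x y : ℝ) : ee (x + y) = ee x * ee y := by
  rw [ee, ee, ee, ← Complex.exp_add]
  congr 1
  push_cast
  ring

theorem ee_int (k : ℤ) : ee k = 1 := by
  rw [ee, ← Complex.exp_int_mul_two_pi_mul_I k]
  congr 1
  push_cast
  ring

theorem norm_ee (x : ℝ) : ‖ee x‖ = 1 := Complex.norm_exp_ofReal_mul_I _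

theorem ee_add_int (x : ℝ) (k : ℤ) : ee (x + k) = ee x := by rw [ee_add, ee_int, mul_one]

/-- Two reals that differ by an integer have the same character value. -/
theorem ee_congr {x y : ℝ} (k : ℤ) (h : x = y + k) : ee x = ee y := by rw [h, ee_add_int]

theorem ee_half : ee (1 / 2) = -1 := by
  rw [ee, ← Complex.exp_pi_mul_I]
  congr 1
  push_cast
  ring

/-- The residue of `y - d` modulo `k`. -/
def shiftBack (d k y : ℕ) : ℕ := (((y : ℤ) - d) % k).toNat

theorem shiftBack_lt {d k y : ℕ} (hk : 0 < k) : shiftBack d k y < k := by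
  have h1 := Int.emod_nonneg ((y : ℤ) - d) (b := (k : ℤ)) (by omega)
  have h2 := Int.emod_lt_of_pos ((y : ℤ) - d) (b := (k : ℤ)) (by omega)
  rw [shiftBack]
  omega

theorem coe_shiftBack {d k y : ℕ} (hk : 0 < k) : (shiftBack d k y : ℤ) = ((y : ℤ) - d) % k :=
  Int.toNat_of_nonneg (Int.emod_nonneg _ (by omega))

theorem shiftBack_add {d k y : ℕ} (hy : y < k) : ((shiftBack d k y : ℤ) + d) % k = y := by
  rw [coe_shiftBack (by omega), Int.emod_add_emod, sub_add_cancel]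
  exact Int.emod_eq_of_lt (by omega) (by omega)

theorem shiftBack_add_mod {d k y : ℕ} (hy : y < k) : shiftBack d k ((y + d) % k) = y := by
  have : (shiftBack d k ((y + d) % k) : ℤ) = y := by
    rw [coe_shiftBack (by omega)]
    push_cast
    rw [Int.emod_sub_emod, add_sub_cancel_right]
    exact Int.emod_eq_of_lt (by omega) (by omega)
  exact_mod_cast this

section PhaseStep

variable {ι : Type*} [Fintype ι] [DecidableEq ι] {reg : ι → ℕ} {u w : ℕ} {md : ι → ℕ}
  {n N m : ℕ} [NeZero N] {r : ℝ} {O : Oracle n N m}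

/-- The ancilla is in the state `0`. -/
def AncZero (reg : ι → ℕ) (u : ℕ) (md : ι → ℕ) (ψ : QState) : Prop :=
  ∀ v ∈ grid md, ψ (st reg u v 1 0) = 0

/-- The shift is by `d` times the ancilla, hence a controlled shift. Pulling back turns addition of
`d` into `shiftBack`. -/
theorem reaches_shiftStep (hl : IsLayout reg u) {M : Mem} (hM : QMem u w M) {p : ι}
    (hp : M 6 0 = reg p) (hmd : M 7 0 = md p) (hle : md p ≤ 2 ^ w) {d : ℕ}
    (hd : (prm 5 / (int 2 * var 9) : Expr).eval M = d) {ψ : QState}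
    {Q : Mem → QState → Prop}
    (hQ : ∀ ψ', (∀ v ∈ grid md, ψ' (st reg u v 0 0) = ψ (st reg u v 0 0) ∧
      ψ' (st reg u v 1 0) =
        ψ (st reg u (Function.update v p (shiftBack d (md p) (v p))) 1 0)) → Q M ψ') :
    Reaches r O shiftStep M ψ Q := by
  refine reaches_inPlace hl hM hp fun ψ' hψ' => hQ ψ' fun v hv => ?_
  have hv : v p < md p := Finset.mem_range.1 (Fintype.mem_piFinset.1 hv p)
  have hmd' : (var 7).eval M = md p := by simp [hmd]
  have e : ∀ y : ℕ, y < md p → ((y : ℤ) % 2 ^ w).toNat = y := fun y hy => by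
    have : y < 2 ^ w := hy.trans_le hle
    rw [Int.emod_eq_of_lt (by positivity) (by exact_mod_cast this)]
    simp
  constructor
  · refine (hψ' v 0 (v p) (hv.trans_le hle) ?_ ?_).trans (by rw [Function.update_eq_self])
    · rw [QExpr.eval_mod, QExpr.eval_add, QExpr.eval_mul, eval_dataReg hl hM hp,
        eval_ancilla hl hM, QExpr.eval_cl, QExpr.eval_cl, hd, hmd', Function.update_self,
        Nat.mod_eq_of_lt (hv.trans_le hle)]
      simp only [Nat.zero_mod, Nat.cast_zero, mul_zero, add_zero]
      rw [Int.emod_eq_of_lt (b := (md p : ℤ)) (by omega) (by omega), e _ hv]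
    · rw [QExpr.eval_mod, QExpr.eval_sub, QExpr.eval_mul, eval_scratchReg hl hM,
        eval_ancilla hl hM, QExpr.eval_cl, QExpr.eval_cl, hd, hmd',
        Nat.mod_eq_of_lt (hv.trans_le hle)]
      simp only [Nat.zero_mod, Nat.cast_zero, mul_zero, sub_zero]
      rw [Int.emod_eq_of_lt (b := (md p : ℤ)) (by omega) (by omega), e _ hv]
  · have hs := shiftBack_lt (d := d) (y := v p) (show 0 < md p by omega)
    refine hψ' v 1 _ (hv.trans_le hle) ?_ ?_
    · rw [QExpr.eval_mod, QExpr.eval_add, QExpr.eval_mul, eval_dataReg hl hM hp,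
        eval_ancilla hl hM, QExpr.eval_cl, QExpr.eval_cl, hd, hmd', Function.update_self,
        Nat.mod_eq_of_lt (hs.trans_le hle)]
      simp only [Nat.one_mod, Nat.cast_one, mul_one]
      rw [shiftBack_add hv, e _ hv]
    · rw [QExpr.eval_mod, QExpr.eval_sub, QExpr.eval_mul, eval_scratchReg hl hM,
        eval_ancilla hl hM, QExpr.eval_cl, QExpr.eval_cl, hd, hmd',
        Nat.mod_eq_of_lt (hv.trans_le hle)]
      simp only [Nat.one_mod, Nat.cast_one, mul_one]
      rw [← coe_shiftBack (by omega), e _ hs]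

theorem flipBit_st (hl : IsLayout reg u) (v : ι → ℕ) (a b : ℕ) :
    flipBit (st reg u v a b) u 0 = st reg u v (a ^^^ 1) b := by
  rw [flipBit, st_ancilla hl, st_update_ancilla hl, pow_zero]

theorem applyGate_st_zero (hl : IsLayout reg u) (U : Matrix (Fin 2) (Fin 2) ℂ) (ψ : QState)
    (v : ι → ℕ) (b : ℕ) : applyGate U u 0 ψ (st reg u v 0 b) =
      U 0 0 * ψ (st reg u v 0 b) + U 0 1 * ψ (st reg u v 1 b) := by
  simp [applyGate, flipBit_st hl, qbit, st_ancilla hl, bitIdx]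

theorem applyGate_st_one (hl : IsLayout reg u) (U : Matrix (Fin 2) (Fin 2) ℂ) (ψ : QState)
    (v : ι → ℕ) (b : ℕ) : applyGate U u 0 ψ (st reg u v 1 b) =
      U 1 1 * ψ (st reg u v 1 b) + U 1 0 * ψ (st reg u v 0 b) := by
  simp [applyGate, flipBit_st hl, qbit, st_ancilla hl, bitIdx]

/-- A bit as a number. -/
abbrev bit (v : Bool) : ℕ := if v then 1 else 0

theorem reaches_readout (hl : IsLayout reg u) {M : Mem} (hM : QMem u w M) {a : ℕ} (ha : a ≠ 0)
    (β : Bool) {ψ : QState} {Q : Mem → QState → Prop}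
    (hQ : ∀ ψ', (∀ v, ψ' (st reg u v 0 0) = ψ (st reg u v (bit β) 0)) → AncZero reg u md ψ' →
      Q (M.write a 0 (bit β)) ψ') :
    Reaches r O (readout a) M ψ Q := by
  have hu : ∀ M : Mem, M 0 6 = u → ((prm 6).eval M).toNat = u := fun M h => by
    simp only [Expr.eval_cell, Expr.eval_const]
    simp only [Int.reduceToNat, h, Int.toNat_natCast]
  have hc : (((if β then 1 else 0 : ℤ)) : ℤ) = ((bit β : ℕ) : ℤ) := by cases β <;> rfl
  refine Reaches.seq (Q := fun M' ψ' => M' = M.write a 0 (bit β) ∧ ψ' = project u 0 β ψ)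
    (reaches_measure β ⟨?_, ?_⟩) ?_
  · rw [← hc]; rfl
  · rw [hu M hM.anc]; rfl
  rintro _ _ ⟨h₁, h₂⟩
  rw [h₁, h₂]
  refine reaches_xor ?_
  rw [hu _ (by rw [write_of_ne _ _ _ _ ha.symm, hM.anc])]
  have hx : ∀ v k, xorBasis (M.write a 0 (bit β)) u ((Expr.const 1).eval
      (M.write a 0 (bit β))).toNat (.cl (var a)) (st reg u v k 0) =
      st reg u v (k ^^^ bit β) 0 := by
    intro v k
    rw [xorBasis, st_update_ancilla hl, st_ancilla hl]
    cases β <;> simp [QExpr.eval, write_same, bit]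
  apply hQ
  · intro v
    rw [hx, Nat.zero_xor, project, if_pos]
    cases β <;> simp [qbit, st_ancilla hl, bit]
  · intro v _
    beta_reduce
    rw [hx, project, if_neg]
    cases β <;> simp [qbit, st_ancilla hl, bit]

theorem QMem.write {M : Mem} (hM : QMem u w M) {a : ℕ} (ha : a ≠ 0) (i : ℕ) (z : ℤ) :
    QMem u w (M.write a i z) where
  prec := by rw [write_of_ne _ _ _ _ ha.symm, hM.prec]
  modulus := by rw [write_of_ne _ _ _ _ ha.symm, hM.modulus]
  anc := by rw [write_of_ne _ _ _ _ ha.symm, hM.anc]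

theorem QMem.modulus_eval {M : Mem} (hM : QMem u w M) : (prm 5).eval M = 2 ^ w := hM.modulus

theorem QMem.anc_eval {M : Mem} (hM : QMem u w M) : ((prm 6).eval M).toNat = u := by
  simp only [Expr.eval_cell, Expr.eval_const]
  simp only [Int.reduceToNat, hM.anc, Int.toNat_natCast]

/-- Phase estimation with one reused ancilla, lowest bit first. The shift by 2^(w-1-k) moves bit k
of the phase to the first binary place; the rotation by -πc/2^k removes the bits c already found.
With S the shift of register `p`, the branch β applies ½(1 + ζS), where outcome `1` changes the sign
of ζ, which amounts to adding 2^k to c. -/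
theorem reaches_phaseStep (hl : IsLayout reg u) {M : Mem} (hM : QMem u w M) {p : ι}
    (hp : M 6 0 = reg p) (hmd : M 7 0 = md p) (hle : md p ≤ 2 ^ w) {c k : ℕ} (hk : k < w)
    (hc : M 8 0 = c) (hck : c < 2 ^ k) (hq : M 9 0 = 2 ^ k) (β : Bool) {ψ : QState}
    (hψ : AncZero reg u md ψ) {Q : Mem → QState → Prop}
    (hQ : ∀ ψ', (∀ v ∈ grid md, ψ' (st reg u v 0 0) =
        1 / 2 * (ψ (st reg u v 0 0) + ee (-((c + bit β * 2 ^ k : ℕ) / 2 ^ (k + 1))) *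
          ψ (st reg u (Function.update v p (shiftBack (2 ^ (w - 1 - k)) (md p) (v p))) 0 0))) →
      AncZero reg u md ψ' →
      Q (((M.write 10 0 (bit β)).write 8 0 (c + bit β * 2 ^ k : ℕ)).write 9 0
        (2 ^ (k + 1) % 2 ^ w)) ψ') :
    Reaches r O phaseStep M ψ Q := by
  have hd : (prm 5 / (int 2 * var 9) : Expr).eval M = ((2 ^ (w - 1 - k) : ℕ) : ℤ) := by
    rw [Expr.eval_div, hM.modulus_eval]
    simp only [Expr.eval_mul, Expr.eval_cell, Expr.eval_const, Int.toNat_zero, hq]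
    have : (2 : ℤ) ^ w = 2 ^ (w - 1 - k) * (2 * 2 ^ k) := by
      rw [← pow_succ', ← pow_add]
      congr 1
      omega
    rw [this, Int.mul_ediv_cancel _ (by positivity)]
    push_cast
    rfl
  refine Reaches.seq (Q := fun M' ψ' => M' = M ∧ ψ' = applyGate hadamardGate u 0 ψ)
    (reaches_hadamard ⟨rfl, by rw [hM.anc_eval]; rfl⟩) ?_
  rintro _ _ ⟨h₁, h₂⟩
  rw [h₁, h₂]
  refine Reaches.seq (Q := fun M' ψ' => M' = M ∧ ∀ v ∈ grid md,
    ψ' (st reg u v 0 0) = applyGate hadamardGate u 0 ψ (st reg u v 0 0) ∧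
      ψ' (st reg u v 1 0) = applyGate hadamardGate u 0 ψ (st reg u (Function.update v p
        (shiftBack (2 ^ (w - 1 - k)) (md p) (v p))) 1 0))
    (reaches_shiftStep hl hM hp hmd hle hd fun ψ' h => ⟨rfl, h⟩) ?_
  rintro _ ψ₂ ⟨h₁, h₂⟩
  rw [h₁]
  refine Reaches.seq (Q := fun M' ψ' => M' = M ∧
      ψ' = applyGate (phaseGate (-(Real.pi * c / 2 ^ k))) u 0 ψ₂)
    (reaches_phase ⟨rfl, ?_⟩) ?_
  · rw [hM.anc_eval]
    simp [hc, hq]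
  rintro _ _ ⟨h₃, h₄⟩
  rw [h₃, h₄]
  refine Reaches.seq (Q := fun M' ψ' => M' = M ∧ ψ' = applyGate hadamardGate u 0
    (applyGate (phaseGate (-(Real.pi * c / 2 ^ k))) u 0 ψ₂))
    (reaches_hadamard ⟨rfl, by rw [hM.anc_eval]; rfl⟩) ?_
  rintro _ _ ⟨h₅, h₆⟩
  rw [h₅, h₆]
  refine Reaches.seq (Q := fun M' ψ' => M' = M.write 10 0 (bit β) ∧ AncZero reg u md ψ' ∧
      ∀ v, ψ' (st reg u v 0 0) = applyGate hadamardGate u 0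
        (applyGate (phaseGate (-(Real.pi * c / 2 ^ k))) u 0 ψ₂) (st reg u v (bit β) 0))
    (reaches_readout hl hM (by norm_num) β fun ψ' h₁ h₂ => ⟨rfl, h₂, h₁⟩) ?_
  rintro _ ψ₅ ⟨h₇, h₈, h₉⟩
  rw [h₇]
  have hsum : c + bit β * 2 ^ k < 2 ^ (k + 1) := by
    have : bit β ≤ 1 := by cases β <;> simp [bit]
    rw [pow_succ]
    nlinarith
  have hsum' : c + bit β * 2 ^ k < 2 ^ w :=
    hsum.trans_le (Nat.pow_le_pow_right two_pos hk)
  have hM' := hM.write (a := 10) (by norm_num) 0 (bit β)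
  refine Reaches.seq (Q := fun M' ψ' => M' = (M.write 10 0 (bit β)).write 8 0
    (c + bit β * 2 ^ k : ℕ) ∧ ψ' = ψ₅) (reaches_assign ⟨?_, rfl⟩) ?_
  · congr 1
    rw [Expr.eval_mod, hM'.modulus_eval, Expr.eval_add, Expr.eval_mul]
    simp only [Expr.eval_cell, Expr.eval_const, Int.toNat_zero, write_same,
      write_of_ne _ _ _ _ (show 8 ≠ 10 by norm_num), write_of_ne _ _ _ _ (show 9 ≠ 10 by norm_num),
      hc, hq]
    rw [Int.emod_eq_of_lt (by positivity) (by exact_mod_cast hsum')]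
    push_cast
    rfl
  rintro _ _ ⟨h₁₀, h₁₁⟩
  rw [h₁₀, h₁₁]
  have hM'' := hM'.write (a := 8) (by norm_num) 0 (c + bit β * 2 ^ k : ℕ)
  refine reaches_assign ?_
  rw [Expr.eval_mod, hM''.modulus_eval, Expr.eval_mul]
  simp only [Expr.eval_cell, Expr.eval_const, Int.toNat_zero,
    write_of_ne _ _ _ _ (show 9 ≠ 8 by norm_num), write_of_ne _ _ _ _ (show 9 ≠ 10 by norm_num),
    hq, ← pow_succ']
  refine hQ ψ₅ (fun v hv => ?_) h₈
  have hw : Function.update v p (shiftBack (2 ^ (w - 1 - k)) (md p) (v p)) ∈ grid md := by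
    rw [Fintype.mem_piFinset] at hv ⊢
    intro q
    by_cases hqp : q = p
    · subst hqp
      have := Finset.mem_range.1 (hv q)
      rw [Function.update_self, Finset.mem_range]
      exact shiftBack_lt (by omega)
    · rw [Function.update_of_ne hqp]
      exact hv q
  have k0 : ψ₂ (st reg u v 0 0) = ((1 / Real.sqrt 2 : ℝ) : ℂ) * ψ (st reg u v 0 0) := by
    rw [(h₂ v hv).1, applyGate_st_zero hl, hψ v hv]
    simp [hadamardGate]
  have k1 : ψ₂ (st reg u v 1 0) = ((1 / Real.sqrt 2 : ℝ) : ℂ) *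
      ψ (st reg u (Function.update v p (shiftBack (2 ^ (w - 1 - k)) (md p) (v p))) 0 0) := by
    rw [(h₂ v hv).2, applyGate_st_one hl, hψ _ hw]
    simp [hadamardGate]
  have hs : ((1 / Real.sqrt 2 : ℝ) : ℂ) * ((1 / Real.sqrt 2 : ℝ) : ℂ) = 1 / 2 := by
    rw [← Complex.ofReal_mul, div_mul_div_comm, one_mul, Real.mul_self_sqrt (by norm_num)]
    norm_num
  have hph : Complex.exp (((-(Real.pi * c / 2 ^ k) : ℝ) : ℂ) * Complex.I) =
      ee (-((c : ℝ) / 2 ^ (k + 1))) := by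
    rw [ee]
    congr 3
    rw [pow_succ]
    field_simp
  rw [h₉]
  cases β
  · simp only [bit, Bool.false_eq_true, if_false, zero_mul, add_zero]
    rw [applyGate_st_zero hl, applyGate_st_zero hl, applyGate_st_one hl, k0, k1]
    simp only [hadamardGate, phaseGate, hph, Matrix.smul_apply, Matrix.of_apply, Matrix.cons_val',
      Matrix.cons_val_zero, Matrix.cons_val_one, Matrix.cons_val_fin_one, smul_eq_mul]
    linear_combination (ψ (st reg u v 0 0) + ee (-((c : ℝ) / 2 ^ (k + 1))) *
      ψ (st reg u (Function.update v p (shiftBack (2 ^ (w - 1 - k)) (md p) (v p))) 0 0)) * hs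
  · simp only [bit, if_true, one_mul]
    have he : ee (-(((c + 2 ^ k : ℕ) : ℝ) / 2 ^ (k + 1))) = -ee (-((c : ℝ) / 2 ^ (k + 1))) := by
      rw [show -ee (-((c : ℝ) / 2 ^ (k + 1))) = ee (-((c : ℝ) / 2 ^ (k + 1))) * ee (1 / 2) by
        rw [ee_half, mul_neg_one], ← ee_add]
      refine ee_congr (-1) ?_
      push_cast
      rw [pow_succ]
      field_simp
      ring
    rw [applyGate_st_one hl, applyGate_st_zero hl, applyGate_st_one hl, k0, k1, he]
    simp only [hadamardGate, phaseGate, hph, Matrix.smul_apply, Matrix.of_apply, Matrix.cons_val',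
      Matrix.cons_val_zero, Matrix.cons_val_one, Matrix.cons_val_fin_one, smul_eq_mul]
    linear_combination (ψ (st reg u v 0 0) - ee (-((c : ℝ) / 2 ^ (k + 1))) *
      ψ (st reg u (Function.update v p (shiftBack (2 ^ (w - 1 - k)) (md p) (v p))) 0 0)) * hs

end PhaseStep

/-! ### Measuring all data registers in the Fourier basis -/

/-- `M'` agrees with `M` outside the arrays in `A`. -/
def AgreeOff (A : Finset ℕ) (M M' : Mem) : Prop := ∀ a ∉ A, M' a = M a

theorem AgreeOff.refl (A : Finset ℕ) (M : Mem) : AgreeOff A M M := fun _ _ => rfl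

theorem AgreeOff.trans {A : Finset ℕ} {M M' M'' : Mem} (h : AgreeOff A M M')
    (h' : AgreeOff A M' M'') : AgreeOff A M M'' := fun a ha => (h' a ha).trans (h a ha)

theorem AgreeOff.mono {A B : Finset ℕ} {M M' : Mem} (h : AgreeOff A M M') (hAB : A ⊆ B) :
    AgreeOff B M M' := fun a ha => h a fun h' => ha (hAB h')

theorem AgreeOff.write {A : Finset ℕ} {M M' : Mem} (h : AgreeOff A M M') {a : ℕ} (ha : a ∈ A)
    (i : ℕ) (z : ℤ) : AgreeOff A M (M'.write a i z) := fun b hb => by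
  rw [Mem.write, Function.update_of_ne (by rintro rfl; exact hb ha), h b hb]

theorem QMem.of_eq {u w : ℕ} {M M' : Mem} (h : QMem u w M) (e : M' 0 = M 0) : QMem u w M' :=
  ⟨by rw [e, h.prec], by rw [e, h.modulus], by rw [e, h.anc]⟩

/-- The amplitude with which phase estimation with `w` bits yields an outcome that deviates from
the phase by `θ`. -/
def phaseAmp (w : ℕ) (θ : ℝ) : ℂ := ∏ i ∈ Finset.range w, 1 / 2 * (1 + ee (2 ^ (w - 1 - i) * θ))

section Fourier

variable {ι : Type*} [Fintype ι] [DecidableEq ι] {reg : ι → ℕ} {u w : ℕ} {md : ι → ℕ}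
  {n N m : ℕ} [NeZero N] {r : ℝ} {O : Oracle n N m}

/-- A character of the group of register contents. -/
def chi (md a v : ι → ℕ) : ℂ := ∏ p, ee (a p * v p / md p)

/-- The coefficient of the state at the character `chi md a`. -/
def fourier (reg : ι → ℕ) (u : ℕ) (md a : ι → ℕ) (ψ : QState) : ℂ :=
  ∑ v ∈ grid md, ψ (st reg u v 0 0) * chi md a v

theorem update_mem_grid {v : ι → ℕ} (hv : v ∈ grid md) {p : ι} {y : ℕ} (hy : y < md p) :
    Function.update v p y ∈ grid md := by
  rw [Fintype.mem_piFinset] at hv ⊢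
  intro q
  by_cases hqp : q = p
  · subst hqp
    rwa [Function.update_self, Finset.mem_range]
  · rw [Function.update_of_ne hqp]
    exact hv q

theorem lt_of_mem_grid {v : ι → ℕ} (hv : v ∈ grid md) (p : ι) : v p < md p :=
  Finset.mem_range.1 (Fintype.mem_piFinset.1 hv p)

/-- Characters are eigenfunctions of cyclic shifts. -/
theorem chi_shiftBack (a : ι → ℕ) {v : ι → ℕ} (hv : v ∈ grid md) (p : ι) (d : ℕ) :
    chi md a v = chi md a (Function.update v p (shiftBack d (md p) (v p))) *
      ee (a p * d / md p) := by
  have hy := lt_of_mem_grid hv p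
  have h0 : 0 < md p := by omega
  rw [chi, chi, Fintype.prod_eq_mul_prod_compl p, Fintype.prod_eq_mul_prod_compl p, mul_right_comm]
  congr 1
  · rw [Function.update_self, ← ee_add]
    obtain ⟨t, ht⟩ : ∃ t : ℤ, (v p : ℤ) = (shiftBack d (md p) (v p) : ℤ) + d + md p * t := by
      refine ⟨-(((shiftBack d (md p) (v p) : ℤ) + d) / md p), ?_⟩
      have h1 := shiftBack_add (d := d) hy
      have h2 := Int.emod_add_mul_ediv ((shiftBack d (md p) (v p) : ℤ) + d) (md p)
      rw [h1] at h2
      linear_combination h2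
    refine ee_congr (a p * t) ?_
    have ht' : (v p : ℝ) = (shiftBack d (md p) (v p) : ℝ) + d + md p * t := by exact_mod_cast ht
    have h0' : (md p : ℝ) ≠ 0 := by positivity
    rw [ht']
    push_cast
    field_simp
  · refine Finset.prod_congr rfl fun q hq => ?_
    have : q ≠ p := by simpa using hq
    rw [Function.update_of_ne this]

/-- Moving the shift from the state to the character, by reindexing along the inverse shift,
produces the eigenvalue. Hence the operator ½(1 + ζS) acts on each Fourier coefficient as a scalar.
-/
theorem fourier_step (a : ι → ℕ) (p : ι) (d : ℕ) (ζ : ℂ) {ψ ψ' : QState}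
    (h : ∀ v ∈ grid md, ψ' (st reg u v 0 0) = 1 / 2 * (ψ (st reg u v 0 0) +
      ζ * ψ (st reg u (Function.update v p (shiftBack d (md p) (v p))) 0 0))) :
    fourier reg u md a ψ' =
      1 / 2 * (1 + ζ * ee (a p * d / md p)) * fourier reg u md a ψ := by
  have key : ∑ v ∈ grid md, ψ (st reg u (Function.update v p (shiftBack d (md p) (v p))) 0 0) *
      chi md a v = ee (a p * d / md p) * fourier reg u md a ψ := by
    rw [fourier, Finset.mul_sum]
    refine Finset.sum_bij' (fun v _ => Function.update v p (shiftBack d (md p) (v p)))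
      (fun v _ => Function.update v p ((v p + d) % md p)) (fun v hv => ?_) (fun v hv => ?_)
      (fun v hv => ?_) (fun v hv => ?_) fun v hv => ?_
    · exact update_mem_grid hv (shiftBack_lt ((Nat.zero_le _).trans_lt (lt_of_mem_grid hv p)))
    · exact update_mem_grid hv (Nat.mod_lt _ ((Nat.zero_le _).trans_lt (lt_of_mem_grid hv p)))
    · simp only [Function.update_self, Function.update_idem]
      have h1 := shiftBack_add (d := d) (lt_of_mem_grid hv p)
      rw [show (shiftBack d (md p) (v p) + d) % md p = v p by exact_mod_cast h1,
        Function.update_eq_self]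
    · simp only [Function.update_self, Function.update_idem]
      rw [shiftBack_add_mod (lt_of_mem_grid hv p), Function.update_eq_self]
    · rw [chi_shiftBack a hv p d]
      ring
  have : fourier reg u md a ψ' = ∑ v ∈ grid md, (1 / 2 * (ψ (st reg u v 0 0) * chi md a v) +
      1 / 2 * ζ * (ψ (st reg u (Function.update v p (shiftBack d (md p) (v p))) 0 0) *
        chi md a v)) := by
    rw [fourier]
    refine Finset.sum_congr rfl fun v hv => ?_
    rw [h v hv]
    ring
  rw [this, Finset.sum_add_distrib, ← Finset.mul_sum, ← Finset.mul_sum, key, ← fourier]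
  ring

/-- Every number C below 2^w occurs as the outcome of some branch, namely the one that follows the
binary digits of C. The scalars of the `w` steps multiply to `phaseAmp`. -/
theorem reaches_phaseEstimation (hl : IsLayout reg u) {M : Mem} (hM : QMem u w M) {p : ι}
    (hp : M 6 0 = reg p) (hmd : M 7 0 = md p) (hle : md p ≤ 2 ^ w) {C : ℕ} (hC : C < 2 ^ w)
    (a : ι → ℕ) (hw : 0 < w) {ψ : QState} (hψ : AncZero reg u md ψ) :
    Reaches r O phaseEstimation M ψ fun M' ψ' => AgreeOff {8, 9, 10} M M' ∧ M' 8 0 = C ∧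
      AncZero reg u md ψ' ∧ fourier reg u md a ψ' =
        phaseAmp w (a p / md p - C / 2 ^ w) * fourier reg u md a ψ := by
  set θ : ℝ := a p / md p - C / 2 ^ w with hθ
  refine Reaches.seq (Q := fun M' ψ' => M' = M.write 8 0 0 ∧ ψ' = ψ)
    (reaches_assign ⟨rfl, rfl⟩) ?_
  rintro _ _ ⟨h₁, h₂⟩
  rw [h₁, h₂]
  refine Reaches.seq (Q := fun M' ψ' => M' = (M.write 8 0 0).write 9 0 1 ∧ ψ' = ψ)
    (reaches_assign ⟨rfl, rfl⟩) ?_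
  rintro _ _ ⟨h₁, h₂⟩
  rw [h₁, h₂]
  have hM' := (hM.write (a := 8) (by norm_num) 0 0).write (a := 9) (by norm_num) 0 1
  -- The remainder modulo 2^w matters only for k = w: after the last round the cell has wrapped to
  -- `0`, and it is not read again.
  refine reaches_loop (K := w) hM'.prec_eval (fun k M' ψ' => AgreeOff {8, 9, 10} M M' ∧
    M' 8 0 = (C % 2 ^ k : ℕ) ∧ M' 9 0 = 2 ^ k % 2 ^ w ∧ AncZero reg u md ψ' ∧
    fourier reg u md a ψ' = (∏ i ∈ Finset.range k, 1 / 2 * (1 + ee (2 ^ (w - 1 - i) * θ))) *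
      fourier reg u md a ψ) ?_ ?_ ?_
  · refine ⟨((AgreeOff.refl _ _).write (by decide) _ _).write (by decide) _ _, ?_, ?_, hψ, ?_⟩
    · rw [write_of_ne _ _ _ _ (by norm_num), write_same, pow_zero, Nat.mod_one]
      rfl
    · rw [write_same, pow_zero]
      rw [Int.emod_eq_of_lt (by norm_num)]
      exact_mod_cast Nat.one_lt_two_pow hw.ne'
    · simp
  · rintro k hk M₁ ψ₁ ⟨hA, h8, h9, hz, hf⟩
    have hM₁ := hM.of_eq (hA 0 (by decide))
    have h9' : M₁ 9 0 = 2 ^ k := by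
      rw [h9]
      exact Int.emod_eq_of_lt (by positivity) (pow_lt_pow_right₀ (by norm_num) hk)
    refine reaches_phaseStep hl hM₁ (by rw [hA 6 (by decide), hp]) (by rw [hA 7 (by decide), hmd])
      hle hk h8 (Nat.mod_lt _ (by positivity)) h9' (C.testBit k) hz fun ψ' hψ' hz' => ?_
    have hbit : C % 2 ^ k + bit (C.testBit k) * 2 ^ k = C % 2 ^ (k + 1) := by
      rw [Nat.mod_pow_succ, ← Nat.toNat_testBit]
      cases C.testBit k <;> simp [bit]
    refine ⟨((hA.write (by decide) _ _).write (by decide) _ _).write (by decide) _ _, ?_,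
      write_same _ _ _ _, hz', ?_⟩
    · rw [write_of_ne _ _ _ _ (by norm_num), write_same, hbit]
    · rw [fourier_step a p _ _ hψ', hf, Finset.prod_range_succ, ← ee_add, hbit]
      -- The digits of `C` above position k change the phase by an integer, so the partial outcome
      -- may be replaced by the full one.
      have : ee (-((C % 2 ^ (k + 1) : ℕ) / 2 ^ (k + 1)) +
          a p * (2 ^ (w - 1 - k) : ℕ) / md p) = ee (2 ^ (w - 1 - k) * θ) := by
        refine ee_congr ((C / 2 ^ (k + 1) : ℕ) : ℤ) ?_
        have h1 : (C : ℝ) = (C % 2 ^ (k + 1) : ℕ) + 2 ^ (k + 1) * (C / 2 ^ (k + 1) : ℕ) := by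
          exact_mod_cast (Nat.mod_add_div C (2 ^ (k + 1))).symm
        have h2 : (2 : ℝ) ^ w = 2 ^ (w - 1 - k) * 2 ^ (k + 1) := by
          rw [← pow_add]
          congr 1
          omega
        rw [hθ, h2, mul_sub, ← mul_div_assoc, ← mul_div_assoc,
          mul_div_mul_left _ _ (by positivity), h1, Int.cast_natCast, Nat.cast_pow, Nat.cast_ofNat]
        field_simp
        ring
      rw [this]
      ring
  · rintro M₁ ψ₁ ⟨hA, h8, -, hz, hf⟩
    exact ⟨hA, by rw [h8, Nat.mod_eq_of_lt hC], hz, hf⟩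

end Fourier

/-! ### The registers of the problem instance -/

/-- The register of coordinate `p.2` of sample `p.1`; coordinate `0` is the integer `j`. -/
def blockReg (n ℓ : ℕ) (p : Fin ℓ × Fin (n + 1)) : ℕ := p.1 * (n + 1) + p.2

/-- The sizes of the registers after decoding. -/
def blockMod (W N : ℕ) {n ℓ : ℕ} (p : Fin ℓ × Fin (n + 1)) : ℕ := if p.2 = 0 then W else N

theorem blockReg_div (n ℓ : ℕ) (p : Fin ℓ × Fin (n + 1)) : blockReg n ℓ p / (n + 1) = p.1 := by
  rw [blockReg, add_comm, Nat.add_mul_div_right _ _ (Nat.succ_pos n),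
    Nat.div_eq_of_lt p.2.isLt, zero_add]

theorem blockReg_mod (n ℓ : ℕ) (p : Fin ℓ × Fin (n + 1)) : blockReg n ℓ p % (n + 1) = p.2 := by
  rw [blockReg, add_comm, Nat.add_mul_mod_self_right, Nat.mod_eq_of_lt p.2.isLt]

theorem isLayout_blockReg (n ℓ : ℕ) : IsLayout (blockReg n ℓ) (ℓ * (n + 1)) where
  inj p q h := by
    have h1 := blockReg_div n ℓ p
    have h2 := blockReg_mod n ℓ p
    rw [h, blockReg_div] at h1
    rw [h, blockReg_mod] at h2
    exact Prod.ext (Fin.ext h1.symm) (Fin.ext h2.symm)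
  lt p := by
    have h1 := p.1.isLt
    have h2 := p.2.isLt
    calc blockReg n ℓ p < p.1 * (n + 1) + (n + 1) := by rw [blockReg]; omega
      _ = (p.1 + 1) * (n + 1) := by ring
      _ ≤ ℓ * (n + 1) := Nat.mul_le_mul_right _ h1

theorem exists_blockReg_eq {n ℓ j : ℕ} (hj : j < ℓ * (n + 1)) : ∃ p, blockReg n ℓ p = j :=
  ⟨(⟨j / (n + 1), Nat.div_lt_of_lt_mul (by rwa [mul_comm])⟩, ⟨j % (n + 1), Nat.mod_lt _ (by omega)⟩),
    by rw [blockReg, mul_comm]; exact Nat.div_add_mod _ _⟩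

theorem lt_two_pow_precision (κ n N ℓ : ℕ) : ℓ * (n + 1) < 2 ^ precision κ n N ℓ :=
  (Nat.lt_size_self _).trans_le (Nat.pow_le_pow_right two_pos (by rw [precision]; omega))

theorem N_lt_two_pow_precision (κ n N ℓ : ℕ) : N < 2 ^ precision κ n N ℓ :=
  (Nat.lt_size_self _).trans_le (Nat.pow_le_pow_right two_pos (by rw [precision]; omega))

theorem precision_pos (κ n N ℓ : ℕ) : 0 < precision κ n N ℓ := by rw [precision]; omega

section Measure

variable {κ n N ℓ : ℕ}

theorem QMem.of_params {M : Mem} (h : M 0 = params κ n N ℓ) :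
    QMem (ℓ * (n + 1)) (precision κ n N ℓ) M where
  prec := by rw [h]; rfl
  modulus := by rw [h]; simp [params]
  anc := by rw [h]; rfl

theorem prm_one {M : Mem} (h : M 0 = params κ n N ℓ) : (prm 1).eval M = n := by
  simp [h, params]

theorem prm_two {M : Mem} (h : M 0 = params κ n N ℓ) : (prm 2).eval M = N := by
  simp [h, params]

theorem prm_three {M : Mem} (h : M 0 = params κ n N ℓ) : (prm 3).eval M = ℓ := by
  simp [h, params]

theorem prm_four {M : Mem} (h : M 0 = params κ n N ℓ) :
    (prm 4).eval M = precision κ n N ℓ := by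
  simp [h, params]

theorem prm_five {M : Mem} (h : M 0 = params κ n N ℓ) :
    (prm 5).eval M = (2 ^ precision κ n N ℓ : ℕ) := by
  simp [h, params]

theorem prm_six {M : Mem} (h : M 0 = params κ n N ℓ) :
    (prm 6).eval M = (ℓ * (n + 1) : ℕ) := by
  simp [h, params]

theorem prm_seven {M : Mem} (h : M 0 = params κ n N ℓ) :
    (prm 7).eval M = (32 * (κ * κ) : ℕ) := by
  simp [h, params]

theorem emod_precision {k : ℕ} (hk : k < 2 ^ precision κ n N ℓ) :
    ((k : ℤ) % (2 ^ precision κ n N ℓ : ℕ)) = k :=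
  Int.emod_eq_of_lt (by omega) (by exact_mod_cast hk)

variable [NeZero N] {r : ℝ} {O : Oracle n N ℓ}

/-- Estimation in one register multiplies the coefficient at `chi md a` by a scalar and leaves the
ancilla clean, so the factors of the registers accumulate. Whether a register has modulus W or N is
read off from its index modulo n + 1. -/
theorem reaches_measureAll {M : Mem} (hM : M 0 = params κ n N ℓ) {C : Fin ℓ × Fin (n + 1) → ℕ}
    (hC : ∀ p, C p < 2 ^ precision κ n N ℓ) (a : Fin ℓ × Fin (n + 1) → ℕ) {ψ : QState}
    (hψ : AncZero (blockReg n ℓ) (ℓ * (n + 1)) (blockMod (2 ^ precision κ n N ℓ) N) ψ) :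
    Reaches r O measureAll M ψ fun M' ψ' => AgreeOff {5, 6, 7, 8, 9, 10} M M' ∧
      (∀ p, M' 5 (blockReg n ℓ p) = C p) ∧
      AncZero (blockReg n ℓ) (ℓ * (n + 1)) (blockMod (2 ^ precision κ n N ℓ) N) ψ' ∧
      fourier (blockReg n ℓ) (ℓ * (n + 1)) (blockMod (2 ^ precision κ n N ℓ) N) a ψ' =
        (∏ p, phaseAmp (precision κ n N ℓ) (a p / blockMod (2 ^ precision κ n N ℓ) N p -
          C p / 2 ^ precision κ n N ℓ)) *
        fourier (blockReg n ℓ) (ℓ * (n + 1)) (blockMod (2 ^ precision κ n N ℓ) N) a ψ := by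
  set w := precision κ n N ℓ with hw
  set md : Fin ℓ × Fin (n + 1) → ℕ := blockMod (2 ^ w) N with hmd
  set reg := blockReg n ℓ with hreg
  have hl := isLayout_blockReg n ℓ
  set fac := fun p => phaseAmp w (a p / md p - C p / 2 ^ w)
  refine Reaches.seq (Q := fun M' ψ' => M' = M.write 6 0 0 ∧ ψ' = ψ)
    (reaches_assign ⟨rfl, rfl⟩) ?_
  rintro _ _ ⟨h₁, h₂⟩
  rw [h₁, h₂]
  have hM0 : (M.write 6 0 0) 0 = params κ n N ℓ := hM
  refine reaches_loop (K := ℓ * (n + 1)) (by rw [prm_six hM0]; rfl)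
    (fun j M' ψ' => AgreeOff {5, 6, 7, 8, 9, 10} M M' ∧ M' 6 0 = j ∧
      (∀ p, reg p < j → M' 5 (reg p) = C p) ∧ AncZero reg (ℓ * (n + 1)) md ψ' ∧
      fourier reg (ℓ * (n + 1)) md a ψ' =
        (∏ p with reg p < j, fac p) * fourier reg (ℓ * (n + 1)) md a ψ) ?_ ?_ ?_
  · refine ⟨(AgreeOff.refl _ _).write (by decide) _ _, write_same _ _ _ _, by simp, hψ, by simp⟩
  · rintro j hj M₁ ψ₁ ⟨hA, h6, h5, hz, hf⟩
    obtain ⟨p, rfl⟩ := exists_blockReg_eq hj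
    have hM₁ : M₁ 0 = params κ n N ℓ := by rw [hA 0 (by decide), hM]
    refine Reaches.seq (Q := fun M' ψ' => M' = M₁.write 7 0 (md p) ∧ ψ' = ψ₁) ?_ ?_
    · have hcond : (var 6 % (prm 1 + int 1) : Expr).eval M₁ = (p.2 : ℕ) := by
        rw [Expr.eval_mod, Expr.eval_add, prm_one hM₁]
        simp only [Expr.eval_cell, Expr.eval_const, Int.toNat_zero, h6]
        exact_mod_cast blockReg_mod n ℓ p
      refine reaches_ifPos (fun h => reaches_assign ⟨?_, rfl⟩) (fun h => reaches_assign ⟨?_, rfl⟩)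
      · rw [hcond] at h
        rw [prm_two hM₁, hmd, blockMod, if_neg]
        · rfl
        · intro h0
          rw [h0] at h
          simp at h
      · rw [hcond] at h
        rw [prm_five hM₁, hmd, blockMod, if_pos]
        · rfl
        · apply Fin.ext
          simpa using h
    rintro _ _ ⟨h₃, h₄⟩
    rw [h₃, h₄]
    have hmdle : md p ≤ 2 ^ w := by
      rw [hmd, blockMod]
      split_ifs
      · exact le_rfl
      · exact (N_lt_two_pow_precision κ n N ℓ).le
    refine Reaches.seq (reaches_phaseEstimation (w := w) hl
      (QMem.of_params (M := M₁.write 7 0 (md p)) hM₁) (p := p)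
      (by rw [write_of_ne _ _ _ _ (by norm_num), h6])
      (write_same _ _ _ _) hmdle (hC p) a (precision_pos κ n N ℓ) hz) ?_
    rintro M₂ ψ₂ ⟨hA₂, h8, hz₂, hf₂⟩
    have hM₂ : M₂ 0 = params κ n N ℓ := by rw [hA₂ 0 (by decide)]; exact hM₁
    have h6₂ : M₂ 6 0 = reg p := by
      rw [hA₂ 6 (by decide), write_of_ne _ _ _ _ (by norm_num), h6]
    have h5₂ : M₂ 5 = M₁ 5 := by
      rw [hA₂ 5 (by decide)]
      rfl
    have hA' : AgreeOff {5, 6, 7, 8, 9, 10} M M₂ :=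
      (hA.write (by decide) _ _).trans (hA₂.mono (by decide))
    refine Reaches.seq (Q := fun M' ψ' => M' = M₂.write 5 (reg p) (C p) ∧ ψ' = ψ₂)
      (reaches_assign ⟨?_, rfl⟩) ?_
    · simp only [Expr.eval_cell, Expr.eval_const, Int.toNat_zero, h6₂, h8, Int.toNat_natCast]
    rintro _ _ ⟨h₇, h₈⟩
    rw [h₇, h₈]
    refine reaches_assign ⟨(hA'.write (by decide) _ _).write (by decide) _ _, ?_, ?_, hz₂, ?_⟩
    · rw [Expr.eval_mod, prm_five (M := M₂.write 5 (reg p) (C p)) hM₂, Expr.eval_add]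
      simp only [Expr.eval_cell, Expr.eval_const, Int.toNat_zero,
        write_of_ne _ _ _ _ (show 6 ≠ 5 by norm_num), h6₂]
      rw [write_same]
      exact_mod_cast emod_precision (k := reg p + 1) (lt_of_le_of_lt hj
        (lt_two_pow_precision κ n N ℓ))
    · intro q hq
      rw [write_of_ne _ _ _ _ (by norm_num)]
      by_cases hqp : q = p
      · rw [hqp, write_same]
      · have : reg q ≠ reg p := hl.inj.ne hqp
        have h1 := h5 q (lt_of_le_of_ne (Nat.lt_succ_iff.1 hq) this)
        rw [← h1, ← h5₂]
        simp [Mem.write, this]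
    · have : Finset.univ.filter (fun q => reg q < reg p + 1) =
          insert p (Finset.univ.filter fun q => reg q < reg p) := by
        ext q
        simp only [Finset.mem_filter, Finset.mem_univ, true_and, Finset.mem_insert]
        constructor
        · intro h
          by_cases hqp : q = p
          · exact Or.inl hqp
          · have : reg q ≠ reg p := hl.inj.ne hqp
            exact Or.inr (lt_of_le_of_ne (Nat.lt_succ_iff.1 h) this)
        · rintro (rfl | h)
          · exact Nat.lt_succ_self _
          · exact Nat.lt_succ_of_lt h
      rw [hf₂, hf, this, Finset.prod_insert (by simp), mul_assoc]
  · rintro M₁ ψ₁ ⟨hA, -, h5, hz, hf⟩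
    refine ⟨hA, fun p => h5 p (hl.lt p), hz, ?_⟩
    rw [hf, Finset.filter_true_of_mem fun p _ => hl.lt p]

end Measure

/-! ### Decoding the integers -/

/-- The code of the representative in `{-W/2, ..., W/2 - 1}` of a residue modulo `W`. -/
def code (W z : ℕ) : ℕ := if 2 * z < W then 2 * z else 2 * (W - z) - 1

/-- The representative in `{-W/2, ..., W/2 - 1}` of a residue modulo `W`. -/
def centered (W z : ℕ) : ℤ := if 2 * z < W then z else z - W

theorem code_lt {W z : ℕ} (hz : z < W) : code W z < W := by
  rw [code]
  split_ifs <;> omega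

theorem sub_two_mul_emod_two_mul_code {W z : ℕ} (hz : z < W) :
    (1 - 2 * ((code W z : ℤ) % 2)) * ((code W z + 1) / 2) = centered W z := by
  rw [code, centered]
  split_ifs with h
  · have h1 : ((2 * z : ℕ) : ℤ) % 2 = 0 := by omega
    have h2 : (((2 * z : ℕ) : ℤ) + 1) / 2 = z := by omega
    rw [h1, h2]
    ring
  · have h1 : ((2 * (W - z) - 1 : ℕ) : ℤ) % 2 = 1 := by omega
    have h2 : (((2 * (W - z) - 1 : ℕ) : ℤ) + 1) / 2 = W - z := by omega
    rw [h1, h2]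
    ring

theorem centered_emod_toNat {W z : ℕ} (hz : z < W) : (centered W z % (W : ℤ)).toNat = z := by
  have h : (z : ℤ) % W = z := Int.emod_eq_of_lt (by omega) (by omega)
  rw [centered]
  split_ifs
  · rw [h, Int.toNat_natCast]
  · rw [Int.sub_emod_right, h, Int.toNat_natCast]

theorem intEquivNat_centered {W z : ℕ} (hz : z < W) : Equiv.intEquivNat (centered W z) = code W z := by
  rw [centered, code]
  split_ifs with h
  · rfl
  · obtain ⟨k, hk⟩ : ∃ k : ℕ, (z : ℤ) - W = Int.negSucc k := ⟨W - z - 1, by omega⟩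
    rw [hk]
    change 2 * k + 1 = _
    omega

/-- The case distinction is done by arithmetic: the quotient of `z` by W/2 is 0 for nonnegative and
1 for negative representatives. -/
theorem encode_eq_code {w z : ℕ} (hw : 0 < w) (hz : z < 2 ^ w) :
    (1 - (z : ℤ) / ((2 ^ w : ℕ) / 2)) * (2 * z) +
      z / ((2 ^ w : ℕ) / 2) * (2 * ((2 ^ w : ℕ) - z) - 1) = code (2 ^ w) z := by
  obtain ⟨w, rfl⟩ := Nat.exists_eq_succ_of_ne_zero hw.ne'
  rw [Nat.succ_eq_add_one, pow_succ] at *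
  have hH : 0 < 2 ^ w := by positivity
  generalize 2 ^ w = H at *
  have e : ((H * 2 : ℕ) : ℤ) / 2 = H := by omega
  rw [e, code]
  split_ifs with h
  · rw [Int.ediv_eq_zero_of_lt (by omega) (by omega)]
    push_cast
    ring
  · have : (z : ℤ) / H = 1 := by
      rw [Int.ediv_eq_iff_of_pos (by omega)]
      constructor <;> omega
    rw [this]
    push_cast
    omega

section Decode

variable {ι : Type*} [Fintype ι] [DecidableEq ι] {reg : ι → ℕ} {u w : ℕ}
variable {κ n N ℓ : ℕ} [NeZero N] {r : ℝ} {O : Oracle n N ℓ}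

theorem reaches_decodeStep (hl : IsLayout reg u) {M : Mem} (hM : QMem u w M) (hw : 0 < w)
    (h5 : (prm 5).eval M = (2 ^ w : ℕ)) {p : ι} (hp : M 6 0 = reg p) {ψ : QState}
    {Q : Mem → QState → Prop}
    (hQ : ∀ ψ', (∀ v a, v p < 2 ^ w →
      ψ' (st reg u v a 0) = ψ (st reg u (Function.update v p (code (2 ^ w) (v p))) a 0)) → Q M ψ') :
    Reaches r O decodeStep M ψ Q := by
  refine reaches_inPlace hl hM hp fun ψ' hψ' => hQ ψ' fun v a hv => ?_
  have hc := code_lt hv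
  have e : ((2 : ℤ) ^ w) = ((2 ^ w : ℕ) : ℤ) := by push_cast; rfl
  refine hψ' v a _ hv ?_ ?_
  · simp only [decodeExpr, QExpr.eval_mul, QExpr.eval_sub, QExpr.eval_div, QExpr.eval_mod,
      QExpr.eval_add, QExpr.eval_cl, Expr.eval_const, eval_dataReg hl hM hp,
      Function.update_self, Nat.mod_eq_of_lt hc]
    rw [sub_two_mul_emod_two_mul_code hv, e]
    exact centered_emod_toNat hv
  · simp only [encodeExpr, QExpr.eval_mul, QExpr.eval_sub, QExpr.eval_div,
      QExpr.eval_add, QExpr.eval_cl, Expr.eval_const, eval_scratchReg hl hM,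
      Nat.mod_eq_of_lt hv, Expr.eval_div, h5]
    rw [encode_eq_code hw hv, e, Int.emod_eq_of_lt (by positivity) (by exact_mod_cast hc),
      Int.toNat_natCast]

/-- The register contents before decoding of the first `k` integers. -/
def encodeUpTo (W k : ℕ) (v : Fin ℓ × Fin (n + 1) → ℕ) : Fin ℓ × Fin (n + 1) → ℕ :=
  fun p => if (p.1 : ℕ) < k ∧ p.2 = 0 then code W (v p) else v p

theorem encodeUpTo_zero (W : ℕ) (v : Fin ℓ × Fin (n + 1) → ℕ) : encodeUpTo W 0 v = v := by
  funext p
  simp [encodeUpTo]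

theorem encodeUpTo_update {W k : ℕ} (hk : k < ℓ) (v : Fin ℓ × Fin (n + 1) → ℕ) :
    encodeUpTo W k (Function.update v (⟨k, hk⟩, 0) (code W (v (⟨k, hk⟩, 0)))) =
      encodeUpTo W (k + 1) v := by
  funext q
  by_cases hq : q = (⟨k, hk⟩, 0)
  · subst hq
    simp [encodeUpTo]
  · rw [encodeUpTo, encodeUpTo, Function.update_of_ne hq]
    have : ((q.1 : ℕ) < k ∧ q.2 = 0) ↔ ((q.1 : ℕ) < k + 1 ∧ q.2 = 0) := by
      refine ⟨fun h => ⟨h.1.trans (Nat.lt_succ_self k), h.2⟩, fun h => ⟨?_, h.2⟩⟩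
      refine lt_of_le_of_ne (Nat.lt_succ_iff.1 h.1) fun h3 => hq (Prod.ext (Fin.ext h3) h.2)
    simp only [this]

theorem block_advance (κ N : ℕ) {k : ℕ} (hk : k < ℓ) :
    (((k * (n + 1) : ℕ) : ℤ) + (n + 1)) % (2 ^ precision κ n N ℓ : ℕ) =
      ((k + 1) * (n + 1) : ℕ) := by
  have h : (k + 1) * (n + 1) ≤ ℓ * (n + 1) := Nat.mul_le_mul_right _ hk
  have e : ((k * (n + 1) : ℕ) : ℤ) + (n + 1) = ((k + 1) * (n + 1) : ℕ) := by
    push_cast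
    ring
  rw [e]
  exact emod_precision (h.trans_lt (lt_two_pow_precision κ n N ℓ))

theorem reaches_decodeAll {M : Mem} (hM : M 0 = params κ n N ℓ) (ψ : QState) :
    Reaches r O decodeAll M ψ fun M' ψ' => AgreeOff {6} M M' ∧
      ∀ v ∈ grid (blockMod (2 ^ precision κ n N ℓ) N), ∀ a,
        ψ' (st (blockReg n ℓ) (ℓ * (n + 1)) v a 0) = ψ (st (blockReg n ℓ) (ℓ * (n + 1))
          (encodeUpTo (2 ^ precision κ n N ℓ) ℓ v) a 0) := by
  set w := precision κ n N ℓ with hw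
  set md : Fin ℓ × Fin (n + 1) → ℕ := blockMod (2 ^ w) N with hmd
  set reg := blockReg n ℓ with hreg
  have hl := isLayout_blockReg n ℓ
  refine Reaches.seq (Q := fun M' ψ' => M' = M.write 6 0 0 ∧ ψ' = ψ)
    (reaches_assign ⟨rfl, rfl⟩) ?_
  rintro _ _ ⟨h₁, h₂⟩
  rw [h₁, h₂]
  have hM0 : (M.write 6 0 0) 0 = params κ n N ℓ := hM
  refine reaches_loop (K := ℓ) (by rw [prm_three hM0]; rfl)
    (fun k M' ψ' => AgreeOff {6} M M' ∧ M' 6 0 = (k * (n + 1) : ℕ) ∧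
      ∀ v ∈ grid md, ∀ a, ψ' (st reg (ℓ * (n + 1)) v a 0) =
        ψ (st reg (ℓ * (n + 1)) (encodeUpTo (2 ^ w) k v) a 0)) ?_ ?_ ?_
  · refine ⟨(AgreeOff.refl _ _).write (by decide) _ _, by rw [write_same]; simp, fun v _ a => ?_⟩
    rw [encodeUpTo_zero]
  · rintro k hk M₁ ψ₁ ⟨hA, h6, hψ⟩
    have hM₁ : M₁ 0 = params κ n N ℓ := by rw [hA 0 (by decide), hM]
    have hQ := QMem.of_params hM₁
    set p : Fin ℓ × Fin (n + 1) := (⟨k, hk⟩, 0) with hp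
    have hregp : M₁ 6 0 = reg p := by rw [h6, hreg, blockReg]; simp [hp]
    have hmdp : md p = 2 ^ w := by simp [hmd, blockMod, hp]
    refine Reaches.seq (Q := fun M' ψ' => M' = M₁ ∧ ∀ v a, v p < 2 ^ w →
      ψ' (st reg (ℓ * (n + 1)) v a 0) =
        ψ₁ (st reg (ℓ * (n + 1)) (Function.update v p (code (2 ^ w) (v p))) a 0))
      (reaches_decodeStep hl hQ (precision_pos _ _ _ _) (prm_five hM₁) hregp
        fun ψ' hψ' => ⟨rfl, hψ'⟩) ?_
    rintro _ ψ₂ ⟨h₃, h₄⟩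
    rw [h₃]
    refine reaches_assign ⟨hA.write (by decide) _ _, ?_, fun v hv a => ?_⟩
    · rw [Expr.eval_mod, prm_five hM₁, Expr.eval_add, Expr.eval_add, prm_one hM₁]
      simp only [Expr.eval_cell, Expr.eval_const, Int.toNat_zero, h6]
      rw [write_same]
      exact block_advance κ N hk
    · have hvp : v p < 2 ^ w := hmdp ▸ lt_of_mem_grid hv p
      rw [h₄ v a hvp, hψ _ (update_mem_grid hv (by rw [hmdp]; exact code_lt hvp))]
      rw [encodeUpTo_update hk]
  · rintro M₁ ψ₁ ⟨hA, -, hψ⟩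
    exact ⟨hA, hψ⟩

end Decode

/-! ### The weight of the measurement outcomes -/

theorem norm_chi {ι : Type*} [Fintype ι] (md a v : ι → ℕ) : ‖chi md a v‖ = 1 := by
  rw [chi, norm_prod]
  exact Finset.prod_eq_one fun p _ => norm_ee _

section Box

variable {ι : Type*} [Fintype ι] [DecidableEq ι] {reg : ι → ℕ} {u : ℕ} {md : ι → ℕ}

/-- The basis states of the data registers, all other registers being `0`. -/
def box (reg : ι → ℕ) (u : ℕ) (md : ι → ℕ) : Finset Basis :=
  (grid md).image fun v => st reg u v 0 0

theorem box_apply (hl : IsLayout reg u) : ∀ x ∈ box reg u md, x u = 0 := by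
  intro x hx
  obtain ⟨v, -, rfl⟩ := Finset.mem_image.1 hx
  exact st_ancilla hl _ _ _

theorem AncZero.fresh (hl : IsLayout reg u) {ψ : QState} (h : AncZero reg u md ψ) :
    Fresh (box reg u md) u ψ := by
  intro x hx
  obtain ⟨v, hv, rfl⟩ := Finset.mem_image.1 hx
  rw [st_update_ancilla hl]
  exact h v hv

/-- Cauchy–Schwarz, since characters have modulus one. A single Fourier coefficient already bounds
the weight of a branch from below, so Parseval is not needed and the other coefficients may be
ignored. -/
theorem sq_norm_fourier_le (hl : IsLayout reg u) (a : ι → ℕ) (ψ : QState) :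
    ‖fourier reg u md a ψ‖ ^ 2 ≤ (∏ p, (md p : ℝ)) * wt (box reg u md) ψ := by
  have h1 : ‖fourier reg u md a ψ‖ ≤ ∑ v ∈ grid md, ‖ψ (st reg u v 0 0)‖ := by
    refine (norm_sum_le _ _).trans (Finset.sum_le_sum fun v _ => ?_)
    rw [norm_mul, norm_chi, mul_one]
  have h2 : wt (box reg u md) ψ = ∑ v ∈ grid md, ‖ψ (st reg u v 0 0)‖ ^ 2 :=
    Finset.sum_image fun v _ v' _ h => st_injective hl 0 0 h
  have h3 : ((grid md).card : ℝ) = ∏ p, (md p : ℝ) := by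
    rw [Fintype.card_piFinset]
    simp
  rw [h2, ← h3]
  exact (pow_le_pow_left₀ (norm_nonneg _) h1 2).trans sq_sum_le_card_mul_sum_sq

end Box

/-! ### The initial state -/

section Initial

variable {n N ℓ : ℕ}

theorem edcpBasis_eq_st (x : Fin ℓ → Fin n → ZMod N) (s : Fin n → ZMod N) (j : Fin ℓ → ℤ) :
    edcpBasis x s j = st (blockReg n ℓ) (ℓ * (n + 1)) (fun p => Fin.cases (Equiv.intEquivNat (j p.1))
      (fun i => (x p.1 i + (j p.1 : ZMod N) * s i).val) p.2) 0 0 := by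
  rw [edcpBasis, st, Finsupp.single_zero, Finsupp.single_zero, add_zero, add_zero,
    Fintype.sum_prod_type]
  refine Finset.sum_congr rfl fun k _ => ?_
  rw [Fin.sum_univ_succ]
  congr 1
  refine Finset.sum_congr rfl fun i _ => ?_
  simp only [blockReg, Fin.val_succ, Fin.cases_succ]
  congr 1
  ring

theorem edcpBasis_block (x : Fin ℓ → Fin n → ZMod N) (s : Fin n → ZMod N) (j : Fin ℓ → ℤ)
    (k : Fin ℓ) : edcpBasis x s j (k * (n + 1)) = Equiv.intEquivNat (j k) := by
  rw [edcpBasis_eq_st]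
  exact st_reg (isLayout_blockReg n ℓ) _ 0 0 (k, 0)

/-- The amplitudes of the state in terms of the coordinates. -/
theorem edcpState_edcpBasis (f : ℤ → ℝ) (x : Fin ℓ → Fin n → ZMod N) (s : Fin n → ZMod N)
    (j : Fin ℓ → ℤ) : edcpState f x s (edcpBasis x s j) =
      ∏ k : Fin ℓ, ((f (j k) / Real.sqrt (∑' i : ℤ, f i ^ 2) : ℝ) : ℂ) := by
  rw [edcpState, if_pos]
  · simp only [edcpBasis_block, Equiv.symm_apply_apply]
  · congr 1
    funext k
    rw [edcpBasis_block, Equiv.symm_apply_apply]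

theorem edcpState_eq_zero {f : ℤ → ℝ} {x : Fin ℓ → Fin n → ZMod N} {s : Fin n → ZMod N} {y : Basis}
    (h : ∀ j, y ≠ edcpBasis x s j) : edcpState f x s y = 0 := if_neg (h _)

/-- The support is parametrized injectively by the integers j_k. A finite set of such tuples lies in
a product of finite sets, over which the sum of the squared norms factors. -/
theorem sqSummable_edcpState {f : ℤ → ℝ} (hf : Summable fun j => f j ^ 2)
    (x : Fin ℓ → Fin n → ZMod N) (s : Fin n → ZMod N) : SqSummable (edcpState f x s) := by
  classical
  set q := Real.sqrt (∑' i : ℤ, f i ^ 2)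
  have hq : Summable fun j => (f j / q) ^ 2 := by
    simp only [div_pow]
    exact hf.div_const _
  have hnorm : ∀ j, ‖edcpState f x s (edcpBasis x s j)‖ ^ 2 = ∏ k, (f (j k) / q) ^ 2 := by
    intro j
    rw [edcpState_edcpBasis, norm_prod, ← Finset.prod_pow]
    refine Finset.prod_congr rfl fun k _ => ?_
    rw [Complex.norm_real, Real.norm_eq_abs, sq_abs]
  have hinj : Function.Injective (edcpBasis x s) := by
    intro j j' h
    funext k
    apply Equiv.intEquivNat.injective
    rw [← edcpBasis_block x s j k, h, edcpBasis_block]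
  refine (hinj.summable_iff (f := fun y => ‖edcpState f x s y‖ ^ 2) fun y hy => by
    rw [edcpState_eq_zero fun j hj => hy ⟨j, hj.symm⟩, norm_zero, zero_pow two_ne_zero]).1 ?_
  refine summable_of_sum_le (f := fun j => ‖edcpState f x s (edcpBasis x s j)‖ ^ 2)
    (c := (∑' j, (f j / q) ^ 2) ^ ℓ) (fun y => sq_nonneg _) fun S => ?_
  calc ∑ j ∈ S, ‖edcpState f x s (edcpBasis x s j)‖ ^ 2 = ∑ j ∈ S, ∏ k, (f (j k) / q) ^ 2 :=
        Finset.sum_congr rfl fun j _ => hnorm j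
    _ ≤ ∑ j ∈ Fintype.piFinset fun k => S.image fun j => j k, ∏ k, (f (j k) / q) ^ 2 := by
        refine Finset.sum_le_sum_of_subset_of_nonneg (fun j hj => ?_)
          fun _ _ _ => Finset.prod_nonneg fun _ _ => sq_nonneg _
        exact Fintype.mem_piFinset.2 fun k => Finset.mem_image_of_mem _ hj
    _ = ∏ k : Fin ℓ, ∑ i ∈ S.image fun j => j k, (f i / q) ^ 2 :=
        (Finset.prod_univ_sum (fun k : Fin ℓ => S.image fun j => j k)
          fun _ i => (f i / q) ^ 2).symm
    _ ≤ ∏ k : Fin ℓ, ∑' j, (f j / q) ^ 2 := Finset.prod_le_prod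
        (fun k _ => Finset.sum_nonneg fun _ _ => sq_nonneg _)
        fun k _ => Summable.sum_le_tsum (f := fun j => (f j / q) ^ 2) _ (fun _ _ => sq_nonneg _) hq
    _ = (∑' j, (f j / q) ^ 2) ^ ℓ := by
        rw [Finset.prod_const, Finset.card_univ, Fintype.card_fin]

theorem ancZero_edcpState {W : ℕ} (f : ℤ → ℝ) (x : Fin ℓ → Fin n → ZMod N)
    (s : Fin n → ZMod N) {ψ : QState} (hψ : ∀ v ∈ grid (blockMod W N),
      ψ (st (blockReg n ℓ) (ℓ * (n + 1)) v 1 0) =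
        edcpState f x s (st (blockReg n ℓ) (ℓ * (n + 1)) (encodeUpTo W ℓ v) 1 0)) :
    AncZero (blockReg n ℓ) (ℓ * (n + 1)) (blockMod W N) ψ := by
  intro v hv
  have hl := isLayout_blockReg n ℓ
  rw [hψ v hv]
  refine edcpState_eq_zero fun j hj => ?_
  rw [edcpBasis_eq_st] at hj
  have := congrArg (fun y : Basis => y (ℓ * (n + 1))) hj
  rw [st_ancilla hl, st_ancilla hl] at this
  exact one_ne_zero this

/-- The sum over the decoded integers in the Fourier coefficient of one EDCP state. -/
def truncSum (f : ℤ → ℝ) (W : ℕ) (θ : ℝ) : ℂ :=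
  ∑ z ∈ Finset.range W, ((f (centered W z) / Real.sqrt (∑' i : ℤ, f i ^ 2) : ℝ) : ℂ) *
    ee (centered W z * θ)

variable [NeZero N]

theorem ee_nat_mul_val_div (a : ℕ) (y : ℤ) :
    ee (a * ((y : ZMod N)).val / N) = ee (a * y / N) := by
  have hN : (N : ℝ) ≠ 0 := Nat.cast_ne_zero.2 (NeZero.ne N)
  have h : (((y : ZMod N)).val : ℤ) = y % N := ZMod.val_intCast y
  have h2 : (((y : ZMod N)).val : ℝ) = y - N * (y / N : ℤ) := by
    have : (y % N : ℤ) = y - N * (y / N) := by rw [Int.emod_def]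
    rw [← Int.cast_natCast (R := ℝ), h, this]
    push_cast
    ring
  rw [h2]
  refine ee_congr (-(a * (y / N))) ?_
  push_cast
  field_simp
  ring

theorem ee_nat_mul_add_val_div (a : ℕ) (x s : ZMod N) (j : ℤ) :
    ee (a * (x + j * s).val / N) = ee (a * x.val / N) * ee (j * (a * s.val / N)) := by
  have : x + j * s = ((x.val + j * s.val : ℤ) : ZMod N) := by simp
  rw [this, ee_nat_mul_val_div, ← ee_add]
  congr 1
  push_cast
  ring

/-- For fixed j the coset register contributes e(⟨a,x⟩/N) e(j⟨a,s⟩/N). The first factor is a phase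
common to all j, so the offsets disappear from the norm, and the sum over all tuples factors into
one truncated Gaussian sum per block. -/
theorem norm_fourier_edcpState {W : ℕ} (f : ℤ → ℝ) (x : Fin ℓ → Fin n → ZMod N)
    (s : Fin n → ZMod N) (a : Fin ℓ × Fin (n + 1) → ℕ) {ψ : QState}
    (hψ : ∀ v ∈ grid (blockMod W N), ψ (st (blockReg n ℓ) (ℓ * (n + 1)) v 0 0) =
      edcpState f x s (st (blockReg n ℓ) (ℓ * (n + 1)) (encodeUpTo W ℓ v) 0 0)) :
    ‖fourier (blockReg n ℓ) (ℓ * (n + 1)) (blockMod W N) a ψ‖ =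
      ∏ k, ‖truncSum f W (a (k, 0) / W + ∑ i, (a (k, Fin.succ i) : ℝ) * (s i).val / N)‖ := by
  have hl := isLayout_blockReg n ℓ
  set nrm := Real.sqrt (∑' i : ℤ, f i ^ 2) with hnrm
  set V : (Fin ℓ → ℕ) → Fin ℓ × Fin (n + 1) → ℕ := fun z p =>
    Fin.cases (z p.1) (fun i => (x p.1 i + (centered W (z p.1) : ZMod N) * s i).val) p.2 with hV
  have hVenc : ∀ z : Fin ℓ → ℕ, (∀ k, z k < W) →
      st (blockReg n ℓ) (ℓ * (n + 1)) (encodeUpTo W ℓ (V z)) 0 0 =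
        edcpBasis x s fun k => centered W (z k) := by
    intro z hz
    rw [edcpBasis_eq_st]
    congr 1
    funext ⟨k, i⟩
    refine Fin.cases ?_ (fun i => ?_) i
    · simp [encodeUpTo, hV, intEquivNat_centered (hz k)]
    · simp [encodeUpTo, hV]
  have key : fourier (blockReg n ℓ) (ℓ * (n + 1)) (blockMod W N) a ψ =
      ∑ z ∈ Fintype.piFinset fun _ : Fin ℓ => Finset.range W, ∏ k,
        (((f (centered W (z k)) / nrm : ℝ) : ℂ) * (ee (a (k, 0) * z k / W) *
          ∏ i : Fin n, ee (a (k, i.succ) * (x k i + (centered W (z k) : ZMod N) * s i).val / N))) := by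
    rw [fourier]
    symm
    -- Inside the grid only the contents `V z` have nonzero amplitude: the coset coordinates are
    -- determined by the integers.
    refine Finset.sum_of_injOn V ?_ ?_ ?_ ?_
    · intro z _ z' _ h
      funext k
      exact congrFun h (k, 0)
    · intro z hz
      rw [Finset.mem_coe, Fintype.mem_piFinset] at hz ⊢
      rintro ⟨k, i⟩
      refine Fin.cases ?_ (fun i => ?_) i
      · simpa [hV, blockMod] using hz k
      · simpa [hV, blockMod] using ZMod.val_lt _
    · intro v hv hv'
      rw [hψ v hv, edcpState_eq_zero, zero_mul]
      intro j hj
      apply hv'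
      have hvk : ∀ k, v (k, 0) < W := fun k => by
        simpa [blockMod] using Fintype.mem_piFinset.1 hv (k, 0)
      refine ⟨fun k => v (k, 0), by simpa [Fintype.mem_piFinset] using hvk, ?_⟩
      rw [edcpBasis_eq_st] at hj
      have hj' := st_injective hl 0 0 hj
      have hjk : ∀ k, j k = centered W (v (k, 0)) := fun k => by
        have := congrFun hj' (k, 0)
        apply Equiv.intEquivNat.injective
        rw [intEquivNat_centered (hvk k)]
        simpa [encodeUpTo] using this.symm
      funext ⟨k, i⟩
      refine Fin.cases rfl (fun i => ?_) i
      have := congrFun hj' (k, i.succ)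
      rw [hjk] at this
      simpa [encodeUpTo, hV] using this.symm
    · intro z hz
      have hz' : ∀ k, z k < W := by simpa [Fintype.mem_piFinset] using hz
      have hVg : V z ∈ grid (blockMod W N) := by
        rw [Fintype.mem_piFinset]
        rintro ⟨k, i⟩
        refine Fin.cases ?_ (fun i => ?_) i
        · simpa [hV, blockMod] using hz' k
        · simpa [hV, blockMod] using ZMod.val_lt _
      rw [hψ _ hVg, hVenc z hz', edcpState_edcpBasis, chi, Fintype.prod_prod_type,
        ← Finset.prod_mul_distrib]
      refine Finset.prod_congr rfl fun k _ => ?_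
      rw [Fin.prod_univ_succ]
      simp [hV, blockMod, hnrm]
  rw [key, ← Finset.prod_univ_sum (fun _ : Fin ℓ => Finset.range W)
    (fun k z => (((f (centered W z) / nrm : ℝ) : ℂ) * (ee (a (k, 0) * z / W) *
      ∏ i : Fin n, ee (a (k, i.succ) * (x k i + (centered W z : ZMod N) * s i).val / N)))), norm_prod]
  refine Finset.prod_congr rfl fun k _ => ?_
  -- The phase of the offset is inserted as a factor of norm one.
  have hprod : ‖∏ i : Fin n, ee (a (k, i.succ) * (x k i).val / N)‖ = 1 := by
    rw [norm_prod]
    exact Finset.prod_eq_one fun _ _ => norm_ee _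
  rw [truncSum, ← one_mul ‖∑ z ∈ Finset.range W, _ * ee (centered W z * _)‖, ← hprod, ← norm_mul,
    Finset.mul_sum]
  congr 1
  refine Finset.sum_congr rfl fun z hz => ?_
  have hz' : z < W := Finset.mem_range.1 hz
  have hW : (W : ℝ) ≠ 0 := Nat.cast_ne_zero.2 (by omega)
  have h1 : ee (a (k, 0) * z / W) = ee (centered W z * (a (k, 0) / W)) := by
    rw [centered]
    split_ifs
    · congr 1
      push_cast
      ring
    · refine ee_congr (a (k, 0)) ?_
      push_cast
      field_simp
      ring
  have h2 : ∀ (t : Finset (Fin n)) (y : Fin n → ℝ), ee (∑ i ∈ t, y i) = ∏ i ∈ t, ee (y i) := by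
    intro t y
    induction t using Finset.induction_on with
    | empty => simp [ee]
    | insert i t hi ih => rw [Finset.sum_insert hi, Finset.prod_insert hi, ee_add, ih]
  simp only [ee_nat_mul_add_val_div]
  rw [Finset.prod_mul_distrib, mul_add, ee_add, h1, Finset.mul_sum, h2]
  ring

end Initial

/-! ### The success probability in terms of the classical part -/

section Success

variable {κ n N ℓ : ℕ} {r : ℝ}

/-- The outcomes of the measurements. -/
abbrev Outcome (n ℓ W : ℕ) : Type := Fin ℓ → Fin (n + 1) → Fin W

/-- The memory before the classical part holds the parameters and the outcomes. -/
structure HasOutcome (κ n N ℓ : ℕ) (C : Outcome n ℓ (2 ^ precision κ n N ℓ)) (M : Mem) : Prop where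
  params : M 0 = params κ n N ℓ
  outcome : ∀ (k : Fin ℓ) (i : Fin (n + 1)), M 5 (k * (n + 1) + i) = (C k i : ℕ)

/-- Indicator of the event that the output is `s`. -/
def outputs (s : Fin n → ZMod N) (M : Mem) : ℝ :=
  if (fun i : Fin n => (M 3 i : ZMod N)) = s then 1 else 0

theorem outputs_nonneg (s : Fin n → ZMod N) (M : Mem) : 0 ≤ outputs s M := by
  rw [outputs]
  split_ifs <;> norm_num

/-- Lower bound for the probability of the outcome `C` for the block of one EDCP state, in terms
of the frequencies `a` of the Fourier coefficient. -/
def blockWeight (w N : ℕ) (f : ℤ → ℝ) (s : Fin n → ZMod N) (C : Fin (n + 1) → Fin (2 ^ w))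
    (a : Fin n → ℕ) : ℝ :=
  1 / (2 ^ w * N ^ n) *
    (∏ i, ‖phaseAmp w (a i / N - (C i.succ : ℕ) / 2 ^ w)‖ ^ 2) *
    ‖truncSum f (2 ^ w) ((C 0 : ℕ) / 2 ^ w + ∑ i, (a i : ℝ) * (s i).val / N)‖ ^ 2

theorem phaseAmp_zero (w : ℕ) : phaseAmp w 0 = 1 := by
  rw [phaseAmp]
  refine Finset.prod_eq_one fun i _ => ?_
  simp only [ee, mul_zero, Complex.ofReal_zero, zero_mul, Complex.exp_zero]
  norm_num

theorem blockWeight_nonneg (w N : ℕ) (f : ℤ → ℝ) (s : Fin n → ZMod N)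
    (C : Fin (n + 1) → Fin (2 ^ w)) (a : Fin n → ℕ) : 0 ≤ blockWeight w N f s C a :=
  mul_nonneg (mul_nonneg (by positivity) (Finset.prod_nonneg fun _ _ => sq_nonneg _)) (sq_nonneg _)

/-- The frequencies for all registers. -/
def frequency {w : ℕ} (C : Outcome n ℓ (2 ^ w)) (a : (Fin (n + 1) → Fin (2 ^ w)) → Fin n → ℕ)
    (p : Fin ℓ × Fin (n + 1)) : ℕ :=
  Fin.cases (C p.1 0 : ℕ) (fun i => a (C p.1) i) p.2

/-- The registers of the integers have the modulus 2^w itself, so there the outcome serves as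
frequency and its `phaseAmp` factor is 1. Only the coordinates modulo `N` carry a rounding factor.
-/
theorem prod_blockWeight_le [NeZero N] {w : ℕ} (C : Outcome n ℓ (2 ^ w)) (f : ℤ → ℝ)
    (s : Fin n → ZMod N) (a : (Fin (n + 1) → Fin (2 ^ w)) → Fin n → ℕ) {ψ : QState}
    (h : ‖fourier (blockReg n ℓ) (ℓ * (n + 1)) (blockMod (2 ^ w) N) (frequency C a) ψ‖ =
      (∏ p : Fin ℓ × Fin (n + 1), ‖phaseAmp w (frequency C a p / blockMod (2 ^ w) N p -
        (C p.1 p.2 : ℕ) / 2 ^ w)‖) *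
      ∏ k, ‖truncSum f (2 ^ w) (frequency C a (k, 0) / (2 ^ w : ℕ) +
        ∑ i, (frequency C a (k, Fin.succ i) : ℝ) * (s i).val / N)‖) :
    ∏ k, blockWeight w N f s (C k) (a (C k)) ≤
      wt (box (blockReg n ℓ) (ℓ * (n + 1)) (blockMod (2 ^ w) N)) ψ := by
  have hN : (0 : ℝ) < N := Nat.cast_pos.2 (NeZero.pos N)
  have hprod : ∏ p : Fin ℓ × Fin (n + 1), (blockMod (2 ^ w) N p : ℝ) = (2 ^ w * N ^ n) ^ ℓ := by
    rw [Fintype.prod_prod_type]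
    simp [Fin.prod_univ_succ, blockMod]
  have hwt := sq_norm_fourier_le (md := blockMod (2 ^ w) N) (isLayout_blockReg n ℓ)
    (frequency C a) ψ
  rw [hprod, h, ← div_le_iff₀' (by positivity)] at hwt
  refine le_trans (le_of_eq ?_) hwt
  rw [Fintype.prod_prod_type, ← Finset.prod_mul_distrib, ← Finset.prod_pow]
  have : ((2 : ℝ) ^ w * N ^ n) ^ ℓ = ∏ k : Fin ℓ, (2 ^ w * N ^ n : ℝ) := by simp
  rw [this, ← Finset.prod_div_distrib]
  refine Finset.prod_congr rfl fun k _ => ?_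
  rw [blockWeight, Fin.prod_univ_succ]
  simp only [frequency, blockMod, Fin.cases_zero, Fin.cases_succ, if_true, Fin.succ_ne_zero,
    if_false, Nat.cast_pow, Nat.cast_ofNat, sub_self, phaseAmp_zero, norm_one, one_mul, mul_pow,
    Finset.prod_pow]
  ring

/-- Each tuple of outcomes has a branch of its own, and the weights of these branches may be added.
The frequency `a` at which a branch is tested can be any function of the outcomes; for each branch
the classical part then contributes its own lower bound `Γ`. -/
theorem le_edcpSuccess_reduction [NeZero N] (hf : Summable fun j => rho r j ^ 2) (O : Oracle n N ℓ)
    (x : Fin ℓ → Fin n → ZMod N) (s : Fin n → ZMod N)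
    (a : (Fin (n + 1) → Fin (2 ^ precision κ n N ℓ)) → Fin n → ℕ)
    (Γ : Outcome n ℓ (2 ^ precision κ n N ℓ) → ℝ)
    (hΓ : ∀ C M, HasOutcome κ n N ℓ C M → Γ C ≤ postprocess.wp r O (outputs s) M) :
    ∑ C, (∏ k, blockWeight (precision κ n N ℓ) N (rho r) s (C k) (a (C k))) * Γ C ≤
      edcpSuccess reduction κ r O x s := by
  classical
  have hl := isLayout_blockReg n ℓ
  set B := box (blockReg n ℓ) (ℓ * (n + 1)) (blockMod (2 ^ precision κ n N ℓ) N) with hB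
  set G := gain B (ℓ * (n + 1)) (outputs s) with hG
  obtain ⟨T, hT⟩ := exists_setup_bound
  obtain ⟨t, -, hsetup⟩ := hT κ r O (edcpState (rho r) x s)
  have hsq : SqSummable (edcpState (rho r) x s) := sqSummable_edcpState hf x s
  set c₀ := initConfig κ r x s with hc₀
  have h1 : reduction.expect r O G c₀ ≤ edcpSuccess reduction κ r O x s := by
    rw [Prog.expect, edcpSuccess]
    refine Multiset.sum_map_le_sum_map _ _ fun c hc => ?_
    have hcs : SqSummable c.amp := SqSummable.run (c := c₀) reduction hsq c hc
    have hle : wt B c.amp ≤ ∑' y, ‖c.amp y‖ ^ 2 := 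
      Summable.sum_le_tsum (f := fun y => ‖c.amp y‖ ^ 2) B (fun _ _ => sq_nonneg _) hcs
    rw [hG, gain, outputs]
    have h0 : 0 ≤ ∑' y, ‖c.amp y‖ ^ 2 := tsum_nonneg fun _ => sq_nonneg _
    split_ifs <;> simp_all
  have h2 : ∀ C : Outcome n ℓ (2 ^ precision κ n N ℓ), ∃ c ∈ (setup.seq (decodeAll.seq measureAll)).run r O c₀,
      HasOutcome κ n N ℓ C c.mem ∧ (∏ k, blockWeight (precision κ n N ℓ) N (rho r) s (C k) (a (C k))) * Γ C ≤
        gain B (ℓ * (n + 1)) (postprocess.wp r O (outputs s)) c := by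
    intro C
    have hM0 : paramMem κ n N ℓ 0 = params κ n N ℓ := rfl
    have hdec := reaches_decodeAll (r := r) (O := O) hM0 (edcpState (rho r) x s)
    obtain ⟨c, hc, hA, h5, hz, hf'⟩ := hdec.seq (q := measureAll)
      (Q' := fun M' ψ' => M' 0 = params κ n N ℓ ∧ (∀ p, M' 5 (blockReg n ℓ p) = (C p.1 p.2 : ℕ)) ∧
        AncZero (blockReg n ℓ) (ℓ * (n + 1)) (blockMod (2 ^ precision κ n N ℓ) N) ψ' ∧
        ‖fourier (blockReg n ℓ) (ℓ * (n + 1)) (blockMod (2 ^ precision κ n N ℓ) N) (frequency C a) ψ'‖ =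
          (∏ p : Fin ℓ × Fin (n + 1), ‖phaseAmp (precision κ n N ℓ) (frequency C a p / blockMod (2 ^ precision κ n N ℓ) N p - (C p.1 p.2 : ℕ) / 2 ^ precision κ n N ℓ)‖) *
            ∏ k, ‖truncSum (rho r) (2 ^ precision κ n N ℓ) (frequency C a (k, 0) / (2 ^ precision κ n N ℓ : ℕ) +
              ∑ i, (frequency C a (k, Fin.succ i) : ℝ) * (s i).val / N)‖)
      (fun M₁ ψ₁ h₁ => by
        have hM₁ : M₁ 0 = params κ n N ℓ := h₁.1 0 (by decide)
        refine (reaches_measureAll hM₁ (C := fun p => (C p.1 p.2 : ℕ)) (fun p => (C p.1 p.2).isLt) (frequency C a)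
          (ancZero_edcpState (rho r) x s fun v hv => h₁.2 v hv 1)).mono ?_
        rintro M₂ ψ₂ ⟨hA, h5, hz, hf⟩
        refine ⟨(hA 0 (by decide)).trans hM₁, h5, hz, ?_⟩
        rw [hf, norm_mul, norm_prod,
          norm_fourier_edcpState (rho r) x s (frequency C a) fun v hv => h₁.2 v hv 0]) t
    have hO : HasOutcome κ n N ℓ C c.mem := ⟨hA, fun k i => h5 (k, i)⟩
    refine ⟨c, ?_, hO, ?_⟩
    · change c ∈ (setup.run r O c₀).bind ((decodeAll.seq measureAll).run r O)
      rw [hc₀, initConfig_eq, hsetup, Multiset.singleton_bind]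
      exact hc
    · have h6 : c.mem 0 6 = (ℓ * (n + 1) : ℕ) := by rw [hA]; rfl
      rw [gain, if_pos ⟨h6, hz.fresh hl⟩]
      rw [mul_comm]
      exact mul_le_mul (hΓ C _ hO) (prod_blockWeight_le C _ _ _ hf')
        (Finset.prod_nonneg fun k _ => blockWeight_nonneg _ _ _ _ _ _)
        (CProg.wp_nonneg _ (outputs_nonneg s) _)
  choose c hc hOut hle using h2
  calc ∑ C, (∏ k, blockWeight (precision κ n N ℓ) N (rho r) s (C k) (a (C k))) * Γ C
      ≤ ∑ C, postprocess.compile.expect r O G (c C) := Finset.sum_le_sum fun C _ =>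
        (hle C).trans (CProg.le_expect_compile (box_apply hl) postprocess keepsParams_postprocess
          (outputs_nonneg s) (c C))
    _ ≤ (setup.seq (decodeAll.seq measureAll)).expect r O (postprocess.compile.expect r O G) c₀ := by
        -- Branches of different outcomes differ because the outcomes are recorded in array `5`.
        refine sum_le_expect (fun d => Prog.expect_nonneg (fun c => ?_) d) c (fun C C' h => ?_) hc
        · exact gain_nonneg _ _ (outputs_nonneg s) c
        · funext k i
          have h1 := (hOut C).outcome k i
          rw [h, (hOut C').outcome k i] at h1
          exact Fin.ext (by exact_mod_cast h1.symm)
    _ = reduction.expect r O G c₀ := by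
        have h (p q : Prog) (F : Config → ℝ) :
            (p.seq q).expect r O F = p.expect r O (q.expect r O F) :=
          funext (Prog.expect_seq p q F)
        simp only [reduction, mainPart, h]
    _ ≤ _ := h1

end Success

/-! ### Lower bounds for expectations of classical programs -/

section Loops

variable {n N m : ℕ} [NeZero N] {r : ℝ} {O : Oracle n N m}

/-- If one run of `p` samples the next entry with weights `w k`, then the loop samples all of
them. -/
theorem sum_le_iterate_wp {X : Type*} [Fintype X] {p : CProg} {K : ℕ} {w : ℕ → X → ℝ}
    (hw : ∀ k x, 0 ≤ w k x) (I : ∀ k, (Fin k → X) → Mem → Prop)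
    (step : ∀ k < K, ∀ g M, I k g M → ∀ (G : Mem → ℝ) (F : X → ℝ), (∀ M, 0 ≤ G M) →
      (∀ x, 0 ≤ F x) → (∀ x M', I (k + 1) (Fin.snoc g x) M' → F x ≤ G M') →
      ∑ x, w k x * F x ≤ p.wp r O G M) {M : Mem} (h0 : I 0 Fin.elim0 M) {G : Mem → ℝ}
    (hG : ∀ M, 0 ≤ G M) {F : (Fin K → X) → ℝ} (hF : ∀ g, 0 ≤ F g)
    (h : ∀ g M', I K g M' → F g ≤ G M') :
    ∑ g, (∏ k : Fin K, w k (g k)) * F g ≤ (p.wp r O)^[K] G M := by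
  induction K generalizing G with
  | zero =>
    rw [Fintype.sum_unique]
    have : (default : Fin 0 → X) = Fin.elim0 := Subsingleton.elim _ _
    simpa [this] using h _ M h0
  | succ K ih =>
    -- The last round is absorbed into the function whose expectation is taken; the induction
    -- hypothesis then handles the earlier rounds, with the entry of the last round already summed
    -- out.
    rw [Function.iterate_succ_apply]
    refine le_trans (le_of_eq ?_) (ih (fun k hk => step k (hk.trans (Nat.lt_succ_self K)))
      (fun M => p.wp_nonneg hG M) (F := fun g => ∑ x, w K x * F (Fin.snoc g x))
      (fun g => Finset.sum_nonneg fun x _ => mul_nonneg (hw _ _) (hF _)) fun g M' hI =>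
        step K (Nat.lt_succ_self K) g M' hI G _ hG (fun x => hF _) fun x M'' => h _ M'')
    rw [← (Fin.snocEquiv fun _ => X).sum_comp, Fintype.sum_prod_type, Finset.sum_comm]
    refine Finset.sum_congr rfl fun g _ => ?_
    rw [Finset.mul_sum]
    refine Finset.sum_congr rfl fun x _ => ?_
    rw [Fin.prod_univ_castSucc, ← mul_assoc]
    simp [Fin.snocEquiv]

theorem le_iterate_wp {p : CProg} {K : ℕ} (I : ℕ → Mem → Prop)
    (step : ∀ k < K, ∀ M, I k M → ∀ (G : Mem → ℝ) (c : ℝ),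
      (∀ M', I (k + 1) M' → c ≤ G M') → c ≤ p.wp r O G M) {M : Mem} (h0 : I 0 M) {G : Mem → ℝ}
    {c : ℝ} (h : ∀ M', I K M' → c ≤ G M') : c ≤ (p.wp r O)^[K] G M := by
  induction K generalizing G with
  | zero => exact h M h0
  | succ K ih =>
    rw [Function.iterate_succ_apply]
    exact ih (fun k hk => step k (hk.trans (Nat.lt_succ_self K))) fun M' hI =>
      step K (Nat.lt_succ_self K) M' hI G c h

end Loops

theorem sum_range_two_mul (f : ℕ → ℝ) (m : ℕ) :
    ∑ u ∈ Finset.range (2 * m), f u = ∑ u ∈ Finset.range m, (f (2 * u) + f (2 * u + 1)) := by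
  induction m with
  | zero => simp
  | succ m ih =>
    rw [show 2 * (m + 1) = 2 * m + 1 + 1 by ring, Finset.sum_range_succ, Finset.sum_range_succ, ih,
      Finset.sum_range_succ, add_assoc]

theorem sum_range_mul_mod (f : ℕ → ℝ) (P q : ℕ) :
    ∑ u ∈ Finset.range (P * q), f (u % P) = q * ∑ u ∈ Finset.range P, f u := by
  induction q with
  | zero => simp
  | succ q ih =>
    rw [Nat.mul_succ, Finset.sum_range_add, ih]
    have : ∑ u ∈ Finset.range P, f ((P * q + u) % P) = ∑ u ∈ Finset.range P, f u := by
      refine Finset.sum_congr rfl fun u hu => ?_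
      rw [Nat.mul_add_mod, Nat.mod_eq_of_lt (Finset.mem_range.1 hu)]
    rw [this]
    push_cast
    ring

theorem sum_range_natCast_zmod {N : ℕ} [NeZero N] (f : ZMod N → ℝ) :
    ∑ u ∈ Finset.range N, f u = ∑ x, f x := by
  refine Finset.sum_nbij' (fun u => (u : ZMod N)) ZMod.val (by simp)
    (fun x _ => Finset.mem_range.2 (ZMod.val_lt x)) (fun u hu => ?_) (by simp) (by simp)
  exact ZMod.val_cast_of_lt (Finset.mem_range.1 hu)

/-- Each residue class modulo `N` has at least ⌊W/N⌋ members below W; the incomplete last period is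
discarded. This is the loss of drawing residues from random bits. -/
theorem mul_sum_le_sum_range_natCast_zmod {N : ℕ} [NeZero N] {f : ZMod N → ℝ} (hf : ∀ x, 0 ≤ f x)
    (W : ℕ) : (W / N : ℕ) * ∑ x, f x ≤ ∑ u ∈ Finset.range W, f u := by
  have h := sum_range_mul_mod (fun u => f u) N (W / N)
  simp only [ZMod.natCast_mod] at h
  rw [sum_range_natCast_zmod] at h
  rw [← h]
  exact Finset.sum_le_sum_of_subset_of_nonneg
    (Finset.range_subset_range.2 (Nat.mul_div_le W N)) fun _ _ _ => hf _

/-! ### Uniform numbers and the random shift of the secret -/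

section Samplers

variable {κ n N ℓ : ℕ}

/-- The increment of a counter. -/
theorem eval_succ_mod {M : Mem} (hM : M 0 = params κ n N ℓ) {i : ℕ} (h6 : M 6 0 = i)
    (hi : i < n) (hℓ : 0 < ℓ) : ((var 6 + int 1) % prm 5).eval M = (i + 1 : ℕ) := by
  rw [Expr.eval_mod, prm_five hM, Expr.eval_add]
  simp only [Expr.eval_cell, Expr.eval_const, Int.toNat_zero, h6]
  have h1 : n + 1 ≤ ℓ * (n + 1) := Nat.le_mul_of_pos_left _ hℓ
  exact_mod_cast emod_precision (k := i + 1) ((show i + 1 < n + 1 by omega).trans_le h1 |>.trans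
    (lt_two_pow_precision κ n N ℓ))

variable [NeZero N] {r : ℝ} {O : Oracle n N ℓ}

/-- The coins are the binary digits, the most significant one first. With j ≤ w digits the value
stays below W, so the remainder in the program never acts. -/
theorem sum_le_wp_uniform {M : Mem} (hM : M 0 = params κ n N ℓ) {G : Mem → ℝ}
    {F : ℕ → ℝ} (h : ∀ u : ℕ, u < 2 ^ precision κ n N ℓ → ∀ M', AgreeOff {10, 17} M M' → M' 17 0 = u →
      F u ≤ G M') :
    1 / 2 ^ precision κ n N ℓ * ∑ u ∈ Finset.range (2 ^ precision κ n N ℓ), F u ≤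
      uniform.wp r O G M := by
  have key : ∀ j ≤ precision κ n N ℓ, ∀ (G : Mem → ℝ) (F : ℕ → ℝ),
      (∀ u : ℕ, u < 2 ^ j → ∀ M', AgreeOff {10, 17} M M' → M' 17 0 = u → F u ≤ G M') →
      1 / 2 ^ j * ∑ u ∈ Finset.range (2 ^ j), F u ≤
        (((CProg.coin 10).seq (.assign 17 (int 0) ((int 2 * var 17 + var 10) % prm 5))).wp r O)^[j]
          G (M.write 17 0 0) := by
    intro j
    induction j with
    | zero =>
      intro _ G F h
      simpa using h 0 (by norm_num) (M.write 17 0 0)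
        ((AgreeOff.refl _ _).write (by decide) _ _) (write_same _ _ _ _)
    | succ j ih =>
      intro hj G F h
      rw [Function.iterate_succ_apply]
      refine le_trans (le_of_eq ?_) (ih (by omega) _ (fun u => 1 / 2 * (F (2 * u) + F (2 * u + 1))) ?_)
      · rw [show (2 : ℕ) ^ (j + 1) = 2 * 2 ^ j from pow_succ' 2 j, sum_range_two_mul, ← Finset.mul_sum,
          pow_succ']
        field_simp
      · intro u hu M' hA h17
        have hM' : M' 0 = params κ n N ℓ := by rw [hA 0 (by decide), hM]
        have hb : ∀ b : ℕ, b < 2 → F (2 * u + b) ≤ G ((M'.write 10 0 b).write 17 0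
            ((2 * u + b : ℕ) : ℤ)) := by
          intro b hb
          refine h _ ?_ _ ((hA.write (by decide) _ _).write (by decide) _ _) (write_same _ _ _ _)
          rw [pow_succ]
          omega
        have hval : ∀ b : ℕ, b < 2 → ((2 : ℤ) * u + b) % (2 ^ precision κ n N ℓ : ℕ) =
            ((2 * u + b : ℕ) : ℤ) := by
          intro b hb
          have : 2 ^ (j + 1) ≤ 2 ^ precision κ n N ℓ := Nat.pow_le_pow_right two_pos hj
          rw [pow_succ] at this
          exact_mod_cast emod_precision (k := 2 * u + b) (by omega)
        have e : ∀ b : ℕ, b < 2 → ((int 2 * var 17 + var 10) % prm 5).eval (M'.write 10 0 b) =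
            ((2 * u + b : ℕ) : ℤ) := by
          intro b hb
          rw [Expr.eval_mod, prm_five (M := M'.write 10 0 b) hM', Expr.eval_add, Expr.eval_mul]
          simp only [Expr.eval_cell, Expr.eval_const, Int.toNat_zero, write_same,
            write_of_ne _ _ _ _ (show 17 ≠ 10 by norm_num), h17]
          exact hval b hb
        have h0 := hb 0 (by norm_num)
        have h1 := hb 1 (by norm_num)
        have e0 := e 0 (by norm_num)
        have e1 := e 1 (by norm_num)
        simp only [Nat.cast_zero, Nat.cast_one] at h0 h1 e0 e1
        simp only [CProg.wp, e0, e1, Expr.eval_const, Int.toNat_zero]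
        rw [add_zero] at *
        linarith
  have := key _ le_rfl G F h
  simpa only [uniform, CProg.wp, prm_four (M := M.write 17 0 0) hM, Expr.eval_const, Int.toNat_zero,
    Int.toNat_natCast] using this

theorem sum_le_wp_sampleShift (hℓ : 0 < ℓ) {M : Mem} (hM : M 0 = params κ n N ℓ) {G : Mem → ℝ}
    (hG : ∀ M, 0 ≤ G M) {F : (Fin n → ZMod N) → ℝ} (hF : ∀ t, 0 ≤ F t)
    (h : ∀ t M', AgreeOff {4, 6, 10, 17} M M' → (∀ i : Fin n, M' 4 i = (t i).val) → F t ≤ G M') :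
    ∑ t, ((2 ^ precision κ n N ℓ / N : ℕ) / 2 ^ precision κ n N ℓ : ℝ) ^ n * F t ≤
      sampleShift.wp r O G M := by
  have hK : ((prm 1).eval (M.write 6 0 0)).toNat = n := by
    rw [prm_one (M := M.write 6 0 0) hM, Int.toNat_natCast]
  change _ ≤ (CProg.wp r O _)^[((prm 1).eval (M.write 6 0 0)).toNat] G (M.write 6 0 0)
  rw [hK]
  have := sum_le_iterate_wp (r := r) (O := O) (X := ZMod N) (K := n)
    (p := uniform.seq ((CProg.assign 4 (var 6) (var 17 % prm 2)).seq
      (.assign 6 (int 0) ((var 6 + int 1) % prm 5))))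
    (w := fun _ _ => ((2 ^ precision κ n N ℓ / N : ℕ) / 2 ^ precision κ n N ℓ : ℝ))
    (fun _ _ => by positivity)
    (fun k g M' => AgreeOff {4, 6, 10, 17} M M' ∧ M' 6 0 = k ∧ ∀ i : Fin k, M' 4 i = (g i).val)
    ?_ (M := M.write 6 0 0) ?_ hG hF fun t M' hI => h t M' hI.1 hI.2.2
  · simpa only [Finset.prod_const, Finset.card_univ, Fintype.card_fin] using this
  · rintro k hk g M₁ ⟨hA, h6, h4⟩ G F hG hF h
    have hM₁ : M₁ 0 = params κ n N ℓ := by rw [hA 0 (by decide), hM]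
    have := sum_le_wp_uniform (r := r) (O := O) hM₁ (F := fun u => F (u : ZMod N))
      (G := ((CProg.assign 4 (var 6) (var 17 % prm 2)).seq
        (.assign 6 (int 0) ((var 6 + int 1) % prm 5))).wp r O G) ?_
    · refine le_trans ?_ this
      rw [← Finset.mul_sum, div_mul_eq_mul_div, one_div_mul_eq_div]
      gcongr
      exact mul_sum_le_sum_range_natCast_zmod hF _
    · intro u hu M₂ hA₂ h17
      have hM₂ : M₂ 0 = params κ n N ℓ := by rw [hA₂ 0 (by decide), hM₁]
      have h6₂ : M₂ 6 0 = k := by rw [hA₂ 6 (by decide), h6]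
      have e1 : (var 17 % prm 2).eval M₂ = ((u : ZMod N).val : ℤ) := by
        rw [Expr.eval_mod, prm_two hM₂]
        simp only [Expr.eval_cell, Expr.eval_const, Int.toNat_zero, h17, ZMod.val_natCast]
        push_cast
        rfl
      have e2 : ((var 6).eval M₂).toNat = k := by
        simp only [Expr.eval_cell, Expr.eval_const, Int.toNat_zero, h6₂, Int.toNat_natCast]
      simp only [CProg.wp, e1, e2]
      rw [eval_succ_mod (M := M₂.write 4 k _) hM₂ h6₂ hk hℓ]
      refine h _ _ ⟨?_, write_same _ _ _ _, ?_⟩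
      · exact ((hA.trans (hA₂.mono (by decide))).write (by decide) _ _).write (by decide) _ _
      · intro i
        rw [write_of_ne _ _ _ _ (by norm_num)]
        refine Fin.lastCases ?_ (fun i => ?_) i
        · simp [write_same]
        · rw [Fin.snoc_castSucc, ← h4 i, ← hA₂ 4 (by decide)]
          have : (i : ℕ) ≠ k := i.isLt.ne
          simp [Mem.write, this]
  · exact ⟨(AgreeOff.refl _ _).write (by decide) _ _, write_same _ _ _ _, fun i => i.elim0⟩

end Samplers

/-! ### The size of the window of the rejection sampler -/

section Window

variable {κ n N ℓ : ℕ}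

/-- The logarithm of the size of the window. -/
def winExp (κ N : ℕ) (r : ℝ) : ℕ := Nat.clog 2 ⌈4 * κ * N / r⌉₊

theorem le_two_pow_winExp (κ N : ℕ) (r : ℝ) : 4 * κ * N / r ≤ 2 ^ winExp κ N r := by
  have h := (Nat.le_pow_clog (b := 2) one_lt_two ⌈4 * κ * N / r⌉₊)
  have := Nat.ceil_le.1 h
  push_cast at this
  exact this

theorem two_pow_lt_of_lt_winExp {κ N e : ℕ} {r : ℝ} (h : e < winExp κ N r) :
    (2 : ℝ) ^ e < 4 * κ * N / r := by
  by_contra hlt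
  have : ⌈4 * κ * N / r⌉₊ ≤ 2 ^ e := Nat.ceil_le.2 (by exact_mod_cast not_lt.1 hlt)
  exact absurd (Nat.clog_le_of_le_pow this) (not_le.2 h)

theorem winExp_lt_precision (κ n ℓ : ℕ) {N : ℕ} {r : ℝ} (hr : 1 < r) :
    winExp κ N r < precision κ n N ℓ := by
  refine lt_of_le_of_lt (Nat.clog_le_of_le_pow (y := 2 + κ + N.size) (Nat.ceil_le.2 ?_))
    (by rw [precision]; omega)
  have h1 : (κ : ℝ) ≤ 2 ^ κ := by exact_mod_cast Nat.lt_two_pow_self.le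
  have h2 : (N : ℝ) ≤ 2 ^ N.size := by exact_mod_cast (Nat.lt_size_self N).le
  rw [div_le_iff₀ (by linarith)]
  push_cast
  rw [pow_add, pow_add]
  calc (4 : ℝ) * κ * N ≤ 2 ^ 2 * 2 ^ κ * 2 ^ N.size := by
        norm_num
        gcongr
    _ ≤ 2 ^ 2 * 2 ^ κ * 2 ^ N.size * r := le_mul_of_one_le_right (by positivity) hr.le

variable [NeZero N] {r : ℝ} {O : Oracle n N ℓ}

/-- After k rounds the variable is 2^min(k, E), where E is the final exponent. Since E is less than
the number of rounds, the loop reaches it, and the reduction modulo W never takes effect. -/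
theorem le_wp_window (hr : 1 < r) {M : Mem} (hM : M 0 = params κ n N ℓ) {G : Mem → ℝ} {c : ℝ}
    (h : ∀ M', AgreeOff {11} M M' → M' 11 0 = (2 ^ winExp κ N r : ℕ) → c ≤ G M') :
    c ≤ window.wp r O G M := by
  have hK : ((prm 4).eval (M.write 11 0 1)).toNat = precision κ n N ℓ := by
    rw [prm_four (M := M.write 11 0 1) hM, Int.toNat_natCast]
  change c ≤ (CProg.wp r O _)^[((prm 4).eval (M.write 11 0 1)).toNat] G (M.write 11 0 1)
  rw [hK]
  have hlt := winExp_lt_precision κ n ℓ (N := N) hr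
  refine le_iterate_wp (fun k M' => AgreeOff {11} M M' ∧
    M' 11 0 = (2 ^ min k (winExp κ N r) : ℕ)) ?_ ?_ ?_
  · rintro k - M₁ ⟨hA, h11⟩ G c h
    have hM₁ : M₁ 0 = params κ n N ℓ := by rw [hA 0 (by decide), hM]
    have e0 : (prm 0).eval M₁ = κ := by simp [hM₁, params]
    have e : ((.int (int 4) * .int (prm 0) * .int (prm 2) / .param - .int (var 11) :
        RExpr).eval M₁ r) = 4 * κ * N / r - 2 ^ min k (winExp κ N r) := by
      simp only [RExpr.eval_sub, RExpr.eval_div, RExpr.eval_mul, RExpr.eval_int, RExpr.eval_param,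
        e0, prm_two hM₁]
      simp only [Expr.eval_cell, Expr.eval_const, Int.toNat_zero, h11]
      push_cast
      rfl
    simp only [CProg.wp, e]
    split_ifs with hpos
    · have hk : k < winExp κ N r := by
        by_contra hk
        rw [min_eq_right (not_lt.1 hk)] at hpos
        linarith [le_two_pow_winExp κ N r]
      refine h _ ⟨hA.write (by decide) _ _, ?_⟩
      rw [Expr.eval_const, Int.toNat_zero, write_same, Expr.eval_mod, prm_five hM₁, Expr.eval_mul]
      simp only [Expr.eval_cell, Expr.eval_const, Int.toNat_zero, h11]
      rw [min_eq_left hk.le, min_eq_left (Nat.succ_le_of_lt hk), pow_succ']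
      have h2 : 2 * 2 ^ k < 2 ^ precision κ n N ℓ := by
        rw [← pow_succ']
        exact Nat.pow_lt_pow_right one_lt_two (by omega)
      exact_mod_cast emod_precision h2
    · have hk : winExp κ N r ≤ k := by
        by_contra hk
        rw [min_eq_left (not_le.1 hk).le] at hpos
        exact hpos (sub_pos.2 (two_pow_lt_of_lt_winExp (not_le.1 hk)))
      refine h _ ⟨hA, ?_⟩
      rw [h11, min_eq_right hk, min_eq_right (hk.trans (Nat.le_succ k))]
  · exact ⟨(AgreeOff.refl _ _).write (by decide) _ _, by rw [write_same]; simp⟩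
  · rintro M' ⟨hA, h11⟩
    rw [min_eq_right hlt.le] at h11
    exact h M' hA h11

end Window

/-! ### The rejection sampler -/

section Rejection

/-- The candidate of the rejection sampler for the outcome `C` and the random number `u`. -/
def cand (W N P C u : ℕ) : ℤ := (-(C * N : ℤ)) / W - P / 2 + u

/-- The distance of the candidate from the centre. -/
def candPos (W N P C u : ℕ) : ℝ := cand W N P C u + C * N / W

/-- The acceptance probability. -/
def acceptProb (r : ℝ) (W N P C u : ℕ) : ℝ :=
  Real.exp (-2 * Real.pi * candPos W N P C u ^ 2 * r ^ 2 / N ^ 2)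

theorem acceptProb_nonneg (r : ℝ) (W N P C u : ℕ) : 0 ≤ acceptProb r W N P C u := (Real.exp_pos _).le

theorem acceptProb_le_one (r : ℝ) (W N P C u : ℕ) : acceptProb r W N P C u ≤ 1 := by
  rw [acceptProb, Real.exp_le_one_iff]
  have : 0 ≤ 2 * Real.pi * candPos W N P C u ^ 2 * r ^ 2 / N ^ 2 := by positivity
  calc _ = -(2 * Real.pi * candPos W N P C u ^ 2 * r ^ 2 / N ^ 2) := by ring
    _ ≤ 0 := by linarith

/-- The probability that one round accepts. -/
def roundProb (r : ℝ) (W N P C : ℕ) : ℝ := 1 / P * ∑ u ∈ Finset.range P, acceptProb r W N P C u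

/-- The probability that the rejection sampler with `T` rounds accepts a candidate that is congruent
to `b`. -/
def sampleProb (r : ℝ) (W N P T C : ℕ) (b : ZMod N) : ℝ :=
  (1 / P * ∑ u ∈ Finset.range P, if (cand W N P C u : ZMod N) = b then acceptProb r W N P C u else 0) *
    ∑ i ∈ Finset.range T, (1 - roundProb r W N P C) ^ i

theorem roundProb_le_one (r : ℝ) (W N P C : ℕ) : roundProb r W N P C ≤ 1 := by
  rw [roundProb]
  rcases Nat.eq_zero_or_pos P with rfl | hP
  · simp
  · rw [one_div_mul_eq_div, div_le_one (by exact_mod_cast hP)]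
    refine (Finset.sum_le_sum fun u _ => acceptProb_le_one r W N P C u).trans ?_
    simp

theorem sampleProb_nonneg (r : ℝ) (W N P T C : ℕ) (b : ZMod N) : 0 ≤ sampleProb r W N P T C b := by
  refine mul_nonneg (mul_nonneg (by positivity) (Finset.sum_nonneg fun u _ => ?_))
    (Finset.sum_nonneg fun i _ => pow_nonneg (sub_nonneg.2 (roundProb_le_one _ _ _ _ _)) _)
  split_ifs
  · exact acceptProb_nonneg _ _ _ _ _ _
  · exact le_rfl

variable {κ n N ℓ : ℕ} [NeZero N] {r : ℝ} {O : Oracle n N ℓ}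

/-- A round either accepts, with the weight of the candidate, or passes on to whatever value `c` the
remaining rounds guarantee. Keeping `c` free makes the bound iterable. -/
theorem le_wp_rejectionRound {M : Mem} (hM : M 0 = params κ n N ℓ) {e C : ℕ}
    (he : e ≤ precision κ n N ℓ) (h11 : M 11 0 = (2 ^ e : ℕ)) (h5 : M 5 (M 12 0).toNat = C)
    {G : Mem → ℝ} {F : ZMod N → ℝ} {c : ℝ}
    (hacc : ∀ b M', AgreeOff {10, 15, 16, 17} M M' → M' 15 0 = 1 → (M' 16 0 : ZMod N) = b →
      F b ≤ G M')
    (hrej : ∀ M', AgreeOff {10, 17} M M' → c ≤ G M') :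
    (1 / (2 ^ e : ℕ) * ∑ u ∈ Finset.range (2 ^ e),
      acceptProb r (2 ^ precision κ n N ℓ) N (2 ^ e) C u *
        F (cand (2 ^ precision κ n N ℓ) N (2 ^ e) C u : ZMod N)) +
      (1 - roundProb r (2 ^ precision κ n N ℓ) N (2 ^ e) C) * c ≤ rejectionRound.wp r O G M := by
  set W := 2 ^ precision κ n N ℓ with hW
  set P := 2 ^ e with hP
  have hP0 : 0 < P := by positivity
  have hN : (N : ℝ) ≠ 0 := Nat.cast_ne_zero.2 (NeZero.ne N)
  set f : ℕ → ℝ := fun u => acceptProb r W N P C u * F (cand W N P C u : ZMod N) +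
    (1 - acceptProb r W N P C u) * c with hf
  refine le_trans (le_of_eq ?_) (sum_le_wp_uniform (r := r) (O := O) hM (F := fun u => f (u % P)) ?_)
  -- The window size divides W, so reducing the uniform number modulo the window stays exactly
  -- uniform.
  · have hsplit : 2 ^ precision κ n N ℓ = P * 2 ^ (precision κ n N ℓ - e) := by
      rw [hP, ← pow_add, Nat.add_sub_cancel' he]
    rw [hsplit, sum_range_mul_mod]
    have h3 : (2 : ℝ) ^ precision κ n N ℓ = P * (2 ^ (precision κ n N ℓ - e) : ℕ) := by
      exact_mod_cast hsplit
    have hP1 : (P : ℝ) ≠ 0 := by positivity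
    have hq : ((2 ^ (precision κ n N ℓ - e) : ℕ) : ℝ) ≠ 0 := by positivity
    rw [h3, hf, roundProb, Finset.sum_add_distrib, ← Finset.sum_mul, Finset.sum_sub_distrib]
    simp only [Finset.sum_const, Finset.card_range, nsmul_eq_mul, mul_one]
    field_simp
  · intro u hu M₁ hA h17
    have hM₁ : M₁ 0 = params κ n N ℓ := by rw [hA 0 (by decide), hM]
    have ec : candidate.eval M₁ = cand W N P C (u % P) := by
      simp only [candidate, Expr.eval_add, Expr.eval_sub, Expr.eval_div, Expr.eval_mod, Expr.eval_neg,
        Expr.eval_mul, prm_two hM₁, prm_five hM₁]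
      simp only [Expr.eval_cell, Expr.eval_const, Int.toNat_zero, h17, hA 5 (by decide),
        hA 12 (by decide), hA 11 (by decide), h5, h11]
      rw [cand]
      push_cast
      rfl
    have e5 : (Expr.cell 5 (var 12)).eval M₁ = C := by
      simp only [Expr.eval_cell, Expr.eval_const, Int.toNat_zero, hA 5 (by decide),
        hA 12 (by decide), h5]
    have et : RExpr.eval M₁ r (.exp (.int (int 0) - .int (int 2) * .pi *
        (.int (candidate * prm 5 + .cell 5 (var 12) * prm 2) * .param / .int (prm 2 * prm 5)) *
        (.int (candidate * prm 5 + .cell 5 (var 12) * prm 2) * .param / .int (prm 2 * prm 5)))) =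
        acceptProb r W N P C (u % P) := by
      simp only [RExpr.eval_exp, RExpr.eval_sub, RExpr.eval_mul, RExpr.eval_int, RExpr.eval_pi,
        RExpr.eval_div, RExpr.eval_param, Expr.eval_add, Expr.eval_mul, ec, e5, prm_two hM₁,
        prm_five hM₁, Expr.eval_const]
      rw [acceptProb, candPos]
      have hW0 : ((2 : ℝ) ^ precision κ n N ℓ) ≠ 0 := by positivity
      congr 1
      push_cast [hW]
      field_simp
      ring
    have hp0 := acceptProb_nonneg r W N P C (u % P)
    have hp1 := acceptProb_le_one r W N P C (u % P)
    simp only [CProg.wp, et, bernProb_eq hp0 hp1]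
    have ev : ∀ z : ℤ, (var 10).eval (M₁.write 10 0 z) = z := fun z => by
      simp only [Expr.eval_cell, Expr.eval_const, Int.toNat_zero, write_same]
    rw [ev, ev, if_pos one_pos, if_neg (lt_irrefl 0)]
    refine add_le_add (mul_le_mul_of_nonneg_left ?_ hp0)
      (mul_le_mul_of_nonneg_left ?_ (sub_nonneg.2 hp1))
    · refine hacc _ _ ?_ ?_ ?_
      · exact (((hA.mono (by decide)).write (by decide) _ _).write (by decide) _ _).write
          (by decide) _ _
      · rw [write_of_ne _ _ _ _ (by norm_num)]
        exact write_same _ _ _ _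
      · change ((((M₁.write 10 0 1).write 15 0 1).write 16 0 (candidate.eval M₁ % (prm 2).eval M₁)
          16 0 : ℤ) : ZMod N) = _
        rw [write_same, ec, prm_two hM₁, ZMod.intCast_mod]
    · exact hrej _ (hA.write (by decide) _ _)

/-- The candidate accepted in a given round has the same law in all rounds, so the total is a
truncated geometric series. The case that no round accepts is counted as zero. -/
theorem sum_le_wp_rejection {M : Mem} (hM : M 0 = params κ n N ℓ) {e C : ℕ}
    (he : e ≤ precision κ n N ℓ) (h11 : M 11 0 = (2 ^ e : ℕ)) (h5 : M 5 (M 12 0).toNat = C)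
    {G : Mem → ℝ} (hG : ∀ M, 0 ≤ G M) {F : ZMod N → ℝ}
    (h : ∀ b M', AgreeOff {10, 15, 16, 17} M M' → (M' 16 0 : ZMod N) = b → F b ≤ G M') :
    ∑ b, sampleProb r (2 ^ precision κ n N ℓ) N (2 ^ e) (32 * (κ * κ)) C b * F b ≤
      rejection.wp r O G M := by
  set W := 2 ^ precision κ n N ℓ with hW
  set P := 2 ^ e with hP
  set body := CProg.ifPos (var 15) .skip rejectionRound with hbody
  set M₀ := (M.write 15 0 0).write 16 0 0 with hM₀
  have hA₀ : AgreeOff {10, 15, 16, 17} M M₀ :=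
    ((AgreeOff.refl _ _).write (by decide) _ _).write (by decide) _ _
  have hK : ((prm 7).eval M₀).toNat = 32 * (κ * κ) := by
    rw [prm_seven (M := M₀) hM, Int.toNat_natCast]
  change _ ≤ (body.wp r O)^[((prm 7).eval M₀).toNat] G M₀
  rw [hK]
  -- Once the flag in variable `15` is set, the remaining rounds do nothing.
  have hdone : ∀ j (M' : Mem), M' 15 0 = 1 → (body.wp r O)^[j] G M' = G M' := by
    intro j
    induction j with
    | zero => intro M' _; rfl
    | succ j ih =>
      intro M' h1
      rw [Function.iterate_succ_apply', hbody, CProg.wp, if_pos, CProg.wp]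
      · exact ih M' h1
      · simp only [Expr.eval_cell, Expr.eval_const, Int.toNat_zero, h1]
        norm_num
  set S := 1 / (P : ℝ) * ∑ u ∈ Finset.range P, acceptProb r W N P C u *
    F (cand W N P C u : ZMod N) with hS
  have key : ∀ j (M' : Mem), AgreeOff {10, 15, 16, 17} M M' → M' 15 0 = 0 →
      S * ∑ i ∈ Finset.range j, (1 - roundProb r W N P C) ^ i ≤ (body.wp r O)^[j] G M' := by
    intro j
    induction j with
    | zero => intro M' _ _; simpa using hG M'
    | succ j ih =>
      intro M' hA h0
      rw [Function.iterate_succ_apply', hbody, CProg.wp, if_neg]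
      · have := le_wp_rejectionRound (r := r) (O := O) (G := (body.wp r O)^[j] G) (F := F)
          (c := S * ∑ i ∈ Finset.range j, (1 - roundProb r W N P C) ^ i)
          (M := M') (by rw [hA 0 (by decide), hM]) he (by rw [hA 11 (by decide), h11])
          (C := C) (by rw [hA 5 (by decide), hA 12 (by decide), h5]) ?_ ?_
        · refine le_trans (le_of_eq ?_) this
          rw [← hP, ← hW, ← hS, Finset.sum_range_succ', pow_zero]
          simp only [pow_succ, ← Finset.sum_mul]
          ring
        · intro b M'' hA' h15 h16
          rw [hdone j M'' h15]
          exact h b M'' (hA.trans hA') h16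
        · intro M'' hA'
          exact ih M'' (hA.trans (hA'.mono (by decide))) (by rw [hA' 15 (by decide), h0])
      · simp only [Expr.eval_cell, Expr.eval_const, Int.toNat_zero, h0]
        norm_num
  refine le_trans (le_of_eq ?_) (key _ M₀ hA₀ ?_)
  · simp only [sampleProb]
    rw [hS]
    have e1 : ∀ b : ZMod N, (1 / (P : ℝ) * ∑ u ∈ Finset.range P,
        if (cand W N P C u : ZMod N) = b then acceptProb r W N P C u else 0) *
        (∑ i ∈ Finset.range (32 * (κ * κ)), (1 - roundProb r W N P C) ^ i) * F b =
        (1 / (P : ℝ) * ∑ i ∈ Finset.range (32 * (κ * κ)), (1 - roundProb r W N P C) ^ i) *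
        ∑ u ∈ Finset.range P,
          if (cand W N P C u : ZMod N) = b then acceptProb r W N P C u * F b else 0 := by
      intro b
      simp only [← ite_zero_mul]
      rw [← Finset.sum_mul]
      ring
    simp only [e1]
    rw [← Finset.mul_sum, Finset.sum_comm]
    simp only [Finset.sum_ite_eq, Finset.mem_univ, if_true]
    ring
  · rw [hM₀, write_of_ne _ _ _ _ (by norm_num), write_same]

end Rejection

/-- The multiple of `1 / N` closest to the outcome of the measurement of a coordinate. -/
def freq {n : ℕ} (N w : ℕ) (C : Fin (n + 1) → Fin (2 ^ w)) (i : Fin n) : ℕ :=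
  (2 * (C i.succ : ℕ) * N + 2 ^ w) / (2 * 2 ^ w)

/-! ### The LWE samples, the oracle call and the output -/

section Postprocess

variable {κ n N ℓ : ℕ} [NeZero N] {r : ℝ} {O : Oracle n N ℓ}

theorem Mem.write_of_index_ne (M : Mem) {a i j : ℕ} (z : ℤ) (h : j ≠ i) :
    M.write a i z a j = M a j := by simp [Mem.write, h]

theorem le_wp_vectorPart {M : Mem} {C : Outcome n ℓ (2 ^ precision κ n N ℓ)}
    (hM : HasOutcome κ n N ℓ C M) {t : Fin n → ZMod N} (h4 : ∀ i : Fin n, M 4 i = (t i).val)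
    (k : Fin ℓ) (h12 : M 12 0 = (k * (n + 1) : ℕ)) {G : Mem → ℝ} {c : ℝ}
    (h : ∀ M', AgreeOff {1, 6, 14} M M' → (∀ j < k * (n + 1), M' 1 j = M 1 j) →
      (∀ i : Fin n, (M' 1 (k * (n + 1) + i) : ZMod N) = freq N (precision κ n N ℓ) (C k) i) →
      (M' 14 0 : ZMod N) = ∑ i, (freq N (precision κ n N ℓ) (C k) i : ZMod N) * t i → c ≤ G M') :
    c ≤ vectorPart.wp r O G M := by
  set M₀ := (M.write 14 0 0).write 6 0 0 with hM₀
  have hA₀ : AgreeOff {1, 6, 14} M M₀ :=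
    ((AgreeOff.refl _ _).write (by decide) _ _).write (by decide) _ _
  have hK : ((prm 1).eval M₀).toNat = n := by
    rw [prm_one (M := M₀) hM.params, Int.toNat_natCast]
  change _ ≤ (CProg.wp r O _)^[((prm 1).eval M₀).toNat] G M₀
  rw [hK]
  refine le_iterate_wp (fun j M' => AgreeOff {1, 6, 14} M M' ∧ M' 6 0 = j ∧
    (∀ j < k * (n + 1), M' 1 j = M 1 j) ∧
    (∀ i : Fin n, (i : ℕ) < j →
      (M' 1 (k * (n + 1) + i) : ZMod N) = freq N (precision κ n N ℓ) (C k) i) ∧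
    (M' 14 0 : ZMod N) = ∑ i ∈ Finset.univ.filter fun i : Fin n => (i : ℕ) < j,
      (freq N (precision κ n N ℓ) (C k) i : ZMod N) * t i) ?_ ?_ ?_
  · rintro j hj M₁ ⟨hA, h6, h1, hf, h14⟩ G c hG
    have hM₁ : M₁ 0 = params κ n N ℓ := by rw [hA 0 (by decide), hM.params]
    have h12₁ : M₁ 12 0 = (k * (n + 1) : ℕ) := by rw [hA 12 (by decide), h12]
    have h5₁ : M₁ 5 (k * (n + 1) + 1 + j) = (C k ⟨j + 1, by omega⟩ : ℕ) := by
      rw [hA 5 (by decide), ← hM.outcome k ⟨j + 1, by omega⟩]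
      congr 1
      ring
    have h4₁ : M₁ 4 j = (t ⟨j, hj⟩).val := by rw [hA 4 (by decide), ← h4 ⟨j, hj⟩]
    have ei : ((var 12 + var 6).eval M₁).toNat = k * (n + 1) + j := by
      rw [Expr.eval_add]
      simp only [Expr.eval_cell, Expr.eval_const, Int.toNat_zero, h12₁, h6]
      exact_mod_cast Int.toNat_natCast (k * (n + 1) + j)
    have ei5 : ((var 12 + int 1 + var 6).eval M₁).toNat = k * (n + 1) + 1 + j := by
      rw [Expr.eval_add, Expr.eval_add]
      simp only [Expr.eval_cell, Expr.eval_const, Int.toNat_zero, h12₁, h6]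
      exact_mod_cast Int.toNat_natCast (k * (n + 1) + 1 + j)
    set f := freq N (precision κ n N ℓ) (C k) ⟨j, hj⟩ with hfdef
    have ef : (((int 2 * .cell 5 (var 12 + int 1 + var 6) * prm 2 + prm 5) / (int 2 * prm 5)) %
        prm 2 : Expr).eval M₁ = (f : ℤ) % N := by
      simp only [Expr.eval_mod, Expr.eval_div, Expr.eval_add, Expr.eval_mul, Expr.eval_const,
        prm_two hM₁, prm_five hM₁]
      rw [Expr.eval_cell, ei5, h5₁, hfdef, freq]
      push_cast
      rfl
    change c ≤ G (Mem.write (Mem.write (M₁.write 1 ((var 12 + var 6).eval M₁).toNat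
      (Expr.eval M₁ (((int 2 * .cell 5 (var 12 + int 1 + var 6) * prm 2 + prm 5) /
        (int 2 * prm 5)) % prm 2))) 14 0 _) 6 0 _)
    rw [ef, ei]
    set M₂ := M₁.write 1 (k * (n + 1) + j) ((f : ℤ) % N) with hM₂
    have hp₂ : M₂ 0 = params κ n N ℓ := hM₁
    have h6₂ : M₂ 6 0 = j := h6
    have ei₂ : ((var 12 + var 6).eval M₂).toNat = k * (n + 1) + j := ei
    have e14 : ((var 14 + .cell 1 (var 12 + var 6) * .cell 4 (var 6)) % prm 2 : Expr).eval M₂ =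
        (M₁ 14 0 + ((f : ℤ) % N) * (t ⟨j, hj⟩).val) % N := by
      rw [Expr.eval_mod, Expr.eval_add, Expr.eval_mul, prm_two hp₂, Expr.eval_cell M₂ 1, ei₂]
      simp only [Expr.eval_cell, Expr.eval_const, Int.toNat_zero, h6₂, Int.toNat_natCast]
      rw [hM₂, write_same, write_of_ne _ _ _ _ (by norm_num), write_of_ne _ _ _ _ (by norm_num), h4₁]
    rw [e14]
    set M₃ := M₂.write 14 0 ((M₁ 14 0 + ((f : ℤ) % N) * (t ⟨j, hj⟩).val) % N) with hM₃
    have e6 : ((var 6 + int 1) % prm 5).eval M₃ = (j + 1 : ℕ) :=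
      eval_succ_mod (M := M₃) hp₂ h6 hj (Fin.pos k)
    change c ≤ G (M₃.write 6 0 (((var 6 + int 1) % prm 5).eval M₃))
    rw [e6]
    refine hG _ ⟨?_, write_same _ _ _ _, ?_, ?_, ?_⟩
    · exact ((hA.write (by decide) _ _).write (by decide) _ _).write (by decide) _ _
    · intro j' hj'
      rw [write_of_ne _ _ _ _ (by norm_num), hM₃, write_of_ne _ _ _ _ (by norm_num), hM₂,
        Mem.write_of_index_ne _ _ (by omega), h1 j' hj']
    · intro i hi
      rw [write_of_ne _ _ _ _ (by norm_num), hM₃, write_of_ne _ _ _ _ (by norm_num), hM₂]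
      by_cases hij : (i : ℕ) = j
      · have hi' : i = ⟨j, hj⟩ := Fin.ext hij
        rw [hi', write_same, ZMod.intCast_mod, hfdef, Int.cast_natCast]
      · rw [Mem.write_of_index_ne _ _ (by omega), hf i (by omega)]
    · rw [write_of_ne _ _ _ _ (by norm_num), hM₃, write_same, ZMod.intCast_mod]
      have hins : Finset.univ.filter (fun i : Fin n => (i : ℕ) < j + 1) =
          insert ⟨j, hj⟩ (Finset.univ.filter fun i : Fin n => (i : ℕ) < j) := by
        ext i
        simp only [Finset.mem_filter, Finset.mem_univ, true_and, Finset.mem_insert, Fin.ext_iff]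
        omega
      rw [hins, Finset.sum_insert (by simp), ← h14]
      push_cast
      simp [add_comm, hfdef]
  · refine ⟨hA₀, write_same _ _ _ _, fun _ _ => rfl, fun i hi => absurd hi (Nat.not_lt_zero _), ?_⟩
    rw [hM₀, write_of_ne _ _ _ _ (by norm_num), write_same]
    simp
  · rintro M' ⟨hA, -, h1, hf, h14⟩
    refine h M' hA h1 (fun i => hf i i.isLt) ?_
    rw [h14, Finset.filter_true_of_mem fun i _ => i.isLt]

theorem sum_le_wp_sampleAll {M : Mem} {C : Outcome n ℓ (2 ^ precision κ n N ℓ)}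
    (hM : HasOutcome κ n N ℓ C M) {t : Fin n → ZMod N} (h4 : ∀ i : Fin n, M 4 i = (t i).val)
    {e : ℕ} (he : e ≤ precision κ n N ℓ) (h11 : M 11 0 = (2 ^ e : ℕ)) {G : Mem → ℝ}
    (hG : ∀ M, 0 ≤ G M) {F : (Fin ℓ → ZMod N) → ℝ} (hF : ∀ b, 0 ≤ F b)
    (h : ∀ b M', AgreeOff {1, 6, 10, 12, 14, 15, 16, 17} M M' →
      readQuery n N ℓ M' = (fun k => (fun i => (freq N (precision κ n N ℓ) (C k) i : ZMod N),
        b k + ∑ i, (freq N (precision κ n N ℓ) (C k) i : ZMod N) * t i)) → F b ≤ G M') :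
    ∑ b, (∏ k, sampleProb r (2 ^ precision κ n N ℓ) N (2 ^ e) (32 * (κ * κ)) (C k 0) (b k)) * F b ≤
      sampleAll.wp r O G M := by
  set M₀ := M.write 12 0 0 with hM₀
  have hK : ((prm 3).eval M₀).toNat = ℓ := by
    rw [prm_three (M := M₀) hM.params, Int.toNat_natCast]
  change _ ≤ (CProg.wp r O _)^[((prm 3).eval M₀).toNat] G M₀
  rw [hK]
  -- The lemma on iterated sampling indexes its weights by all naturals; beyond the number of
  -- samples they are set to `0`.
  set w : ℕ → ZMod N → ℝ := fun k b => if hk : k < ℓ then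
    sampleProb r (2 ^ precision κ n N ℓ) N (2 ^ e) (32 * (κ * κ)) (C ⟨k, hk⟩ 0) b else 0 with hw
  have hw0 : ∀ k b, 0 ≤ w k b := by
    intro k b
    rw [hw]
    dsimp only
    split_ifs
    · exact sampleProb_nonneg _ _ _ _ _ _ _
    · exact le_rfl
  set a := fun k : Fin ℓ => freq N (precision κ n N ℓ) (C k) with ha
  refine le_trans (le_of_eq ?_) (sum_le_iterate_wp hw0 (fun k g M' =>
    AgreeOff {1, 6, 10, 12, 14, 15, 16, 17} M M' ∧ M' 12 0 = (k * (n + 1) : ℕ) ∧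
    ∀ (j : Fin ℓ) (hj : (j : ℕ) < k), (∀ i : Fin n, (M' 1 (j * (n + 1) + i) : ZMod N) = a j i) ∧
      (M' 1 (j * (n + 1) + n) : ZMod N) = g ⟨j, hj⟩ + ∑ i, (a j i : ZMod N) * t i)
    ?_ ?_ hG hF ?_)
  · refine Finset.sum_congr rfl fun b _ => ?_
    congr 1
    refine Finset.prod_congr rfl fun k _ => ?_
    rw [hw]
    simp
  · rintro k hk g M₁ ⟨hA, h12, hq⟩ G F hG hF h
    set k' : Fin ℓ := ⟨k, hk⟩ with hk'
    have hM₁ : HasOutcome κ n N ℓ C M₁ :=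
      ⟨by rw [hA 0 (by decide), hM.params], by rw [hA 5 (by decide)]; exact hM.outcome⟩
    refine le_wp_vectorPart (r := r) (O := O) hM₁ (t := t)
      (by rw [hA 4 (by decide)]; exact h4) k' h12 fun M₂ hA₂ h1₂ hf₂ h14₂ => ?_
    have hM₂ : M₂ 0 = params κ n N ℓ := by rw [hA₂ 0 (by decide), hM₁.params]
    have h12₂ : M₂ 12 0 = (k * (n + 1) : ℕ) := by rw [hA₂ 12 (by decide), h12]
    refine le_trans (le_of_eq ?_) (sum_le_wp_rejection (r := r) (O := O) hM₂ he
      (by rw [hA₂ 11 (by decide), hA 11 (by decide), h11]) (C := (C k' 0 : ℕ)) ?_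
      (CProg.wp_nonneg _ hG) (F := F) ?_)
    · refine Finset.sum_congr rfl fun b _ => ?_
      rw [hw]
      simp [hk, hk']
    · rw [h12₂, Int.toNat_natCast, hA₂ 5 (by decide), ← hM₁.outcome k' 0]
      rfl
    · intro b M₃ hA₃ h16
      have hM₃ : M₃ 0 = params κ n N ℓ := by rw [hA₃ 0 (by decide), hM₂]
      have h12₃ : M₃ 12 0 = (k * (n + 1) : ℕ) := by rw [hA₃ 12 (by decide), h12₂]
      have ei : ((var 12 + prm 1).eval M₃).toNat = k * (n + 1) + n := by
        rw [Expr.eval_add, prm_one hM₃]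
        simp only [Expr.eval_cell, Expr.eval_const, Int.toNat_zero, h12₃]
        exact_mod_cast Int.toNat_natCast (k * (n + 1) + n)
      change F b ≤ G (Mem.write (M₃.write 1 ((var 12 + prm 1).eval M₃).toNat
        (((var 16 + var 14) % prm 2).eval M₃)) 12 0 _)
      rw [ei]
      set z := ((var 16 + var 14) % prm 2).eval M₃ with hz
      have hzv : (z : ZMod N) = b + ∑ i, (a k' i : ZMod N) * t i := by
        rw [hz, Expr.eval_mod, prm_two hM₃, ZMod.intCast_mod, Expr.eval_add]
        simp only [Expr.eval_cell, Expr.eval_const, Int.toNat_zero]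
        rw [Int.cast_add, h16, hA₃ 14 (by decide), h14₂]
      set M₄ := M₃.write 1 (k * (n + 1) + n) z with hM₄
      have hp₄ : M₄ 0 = params κ n N ℓ := hM₃
      have e12 : ((var 12 + (prm 1 + int 1)) % prm 5).eval M₄ = ((k + 1) * (n + 1) : ℕ) := by
        rw [Expr.eval_mod, prm_five hp₄, Expr.eval_add, Expr.eval_add, prm_one hp₄]
        simp only [Expr.eval_cell, Expr.eval_const, Int.toNat_zero]
        rw [hM₄, write_of_ne _ _ _ _ (by norm_num), h12₃]
        exact block_advance κ N hk
      rw [e12]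
      refine h b _ ⟨?_, write_same _ _ _ _, ?_⟩
      · exact (((hA.trans (hA₂.mono (by decide))).trans (hA₃.mono (by decide))).write
          (by decide) _ _).write (by decide) _ _
      · intro j hj
        have h1 : ∀ i, i ≠ k * (n + 1) + n → (M₄.write 12 0 ((k + 1) * (n + 1) : ℕ)) 1 i = M₂ 1 i := by
          intro i hi
          rw [write_of_ne _ _ _ _ (by norm_num), hM₄, Mem.write_of_index_ne _ _ hi,
            hA₃ 1 (by decide)]
        rcases Nat.lt_succ_iff_lt_or_eq.1 hj with hjk | hjk
        · have hle : (j : ℕ) * (n + 1) + (n + 1) ≤ k * (n + 1) := by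
            have := Nat.mul_le_mul_right (n + 1) (Nat.succ_le_of_lt hjk)
            rwa [Nat.succ_mul] at this
          refine ⟨fun i => ?_, ?_⟩
          · rw [h1 _ (by omega), h1₂ _ (by change _ < k * (n + 1); omega), (hq j hjk).1 i]
          · rw [h1 _ (by omega), h1₂ _ (by change _ < k * (n + 1); omega), (hq j hjk).2]
            congr 1
            have : (⟨j, hj⟩ : Fin (k + 1)) = Fin.castSucc ⟨j, hjk⟩ := rfl
            rw [this, Fin.snoc_castSucc]
        · have hj' : j = k' := Fin.ext hjk
          subst hj'
          refine ⟨fun i => ?_, ?_⟩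
          · change ((M₄.write 12 0 ((k + 1) * (n + 1) : ℕ)) 1 (k * (n + 1) + i) : ZMod N) = _
            rw [h1 _ (by omega)]
            exact hf₂ i
          · change ((M₄.write 12 0 ((k + 1) * (n + 1) : ℕ)) 1 (k * (n + 1) + n) : ZMod N) = _
            rw [write_of_ne _ _ _ _ (by norm_num), hM₄, write_same, hzv]
            congr 1
            have : (⟨k', hj⟩ : Fin (k + 1)) = Fin.last k := rfl
            rw [this, Fin.snoc_last]
  · refine ⟨(AgreeOff.refl _ _).write (by decide) _ _, by rw [hM₀, write_same]; simp, ?_⟩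
    intro j hj
    exact absurd hj (Nat.not_lt_zero _)
  · rintro b M' ⟨hA, -, hq⟩
    refine h b M' hA ?_
    funext k
    rw [readQuery]
    exact Prod.ext (funext fun i => (hq k k.isLt).1 i) (hq k k.isLt).2

theorem le_wp_output (hℓ : 0 < ℓ) {M : Mem} (hM : M 0 = params κ n N ℓ) {s : Fin n → ZMod N}
    (h : ∀ i : Fin n, (M 2 i - M 4 i : ZMod N) = s i) : 1 ≤ output.wp r O (outputs s) M := by
  have hK : ((prm 1).eval (M.write 6 0 0)).toNat = n := by
    rw [prm_one (M := M.write 6 0 0) hM, Int.toNat_natCast]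
  change _ ≤ (CProg.wp r O _)^[((prm 1).eval (M.write 6 0 0)).toNat] _ (M.write 6 0 0)
  rw [hK]
  refine le_iterate_wp (fun j M' => AgreeOff {3, 6} M M' ∧ M' 6 0 = j ∧
    ∀ i : Fin n, (i : ℕ) < j → (M' 3 i : ZMod N) = s i) ?_ ?_ ?_
  · rintro j hj M₁ ⟨hA, h6, h3⟩ G c hG
    have hM₁ : M₁ 0 = params κ n N ℓ := by rw [hA 0 (by decide), hM]
    have ei : ((var 6).eval M₁).toNat = j := by
      simp only [Expr.eval_cell, Expr.eval_const, Int.toNat_zero, h6, Int.toNat_natCast]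
    change c ≤ G (Mem.write (M₁.write 3 ((var 6).eval M₁).toNat
      (((.cell 2 (var 6) - .cell 4 (var 6)) % prm 2 : Expr).eval M₁)) 6 0 _)
    rw [ei]
    set z := ((.cell 2 (var 6) - .cell 4 (var 6)) % prm 2 : Expr).eval M₁ with hz
    have hzv : (z : ZMod N) = s ⟨j, hj⟩ := by
      rw [hz, Expr.eval_mod, prm_two hM₁, ZMod.intCast_mod, Expr.eval_sub, Expr.eval_cell _ 2,
        Expr.eval_cell _ 4, ei, Int.cast_sub, hA 2 (by decide), hA 4 (by decide)]
      exact h ⟨j, hj⟩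
    rw [eval_succ_mod (M := M₁.write 3 j z) hM₁ h6 hj hℓ]
    refine hG _ ⟨(hA.write (by decide) _ _).write (by decide) _ _, write_same _ _ _ _, ?_⟩
    intro i hi
    rw [write_of_ne _ _ _ _ (by norm_num)]
    by_cases hij : (i : ℕ) = j
    · have hi' : i = ⟨j, hj⟩ := Fin.ext hij
      rw [hi', write_same, hzv]
    · rw [Mem.write_of_index_ne _ _ hij, h3 i (by omega)]
  · exact ⟨(AgreeOff.refl _ _).write (by decide) _ _, write_same _ _ _ _,
      fun i hi => absurd hi (Nat.not_lt_zero _)⟩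
  · rintro M' ⟨-, -, h3⟩
    rw [outputs, if_pos (funext fun i => h3 i i.isLt)]

/-- Lower bound for the success probability of the classical part. -/
def classicalSuccess (κ : ℕ) (r : ℝ) (O : Oracle n N ℓ) (s : Fin n → ZMod N)
    (C : Outcome n ℓ (2 ^ precision κ n N ℓ)) : ℝ :=
  ∑ t, ((2 ^ precision κ n N ℓ / N : ℕ) / 2 ^ precision κ n N ℓ : ℝ) ^ n *
    ∑ b : Fin ℓ → ZMod N,
      (∏ k, sampleProb r (2 ^ precision κ n N ℓ) N (2 ^ winExp κ N r) (32 * (κ * κ)) (C k 0) (b k)) *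
      (O (fun k => (fun i => (freq N (precision κ n N ℓ) (C k) i : ZMod N),
        b k + ∑ i, (freq N (precision κ n N ℓ) (C k) i : ZMod N) * t i)) (s + t)).toReal

theorem classicalSuccess_le_wp_postprocess (hℓ : 0 < ℓ) (hr : 1 < r) (s : Fin n → ZMod N)
    (C : Outcome n ℓ (2 ^ precision κ n N ℓ)) {M : Mem} (hM : HasOutcome κ n N ℓ C M) :
    classicalSuccess κ r O s C ≤ postprocess.wp r O (outputs s) M := by
  have hO : ∀ q t, 0 ≤ (O q t).toReal := fun _ _ => ENNReal.toReal_nonneg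
  have hG := outputs_nonneg s
  refine sum_le_wp_sampleShift hℓ hM.params (CProg.wp_nonneg _ (CProg.wp_nonneg _
    (CProg.wp_nonneg _ (CProg.wp_nonneg _ hG))))
    (fun t => Finset.sum_nonneg fun b _ => mul_nonneg (Finset.prod_nonneg fun k _ =>
      sampleProb_nonneg _ _ _ _ _ _ _) (hO _ _)) fun t M₁ hA₁ h4 => ?_
  refine le_wp_window hr (by rw [hA₁ 0 (by decide), hM.params]) fun M₂ hA₂ h11 => ?_
  have hA : AgreeOff {4, 6, 10, 11, 17} M M₂ :=
    (hA₁.mono (by decide)).trans (hA₂.mono (by decide))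
  have hM₂ : HasOutcome κ n N ℓ C M₂ :=
    ⟨by rw [hA 0 (by decide), hM.params], by rw [hA 5 (by decide)]; exact hM.outcome⟩
  have h4₂ : ∀ i : Fin n, M₂ 4 i = (t i).val := by rw [hA₂ 4 (by decide)]; exact h4
  refine sum_le_wp_sampleAll hM₂ h4₂ (winExp_lt_precision κ n ℓ hr).le h11
    (CProg.wp_nonneg _ (CProg.wp_nonneg _ hG)) (fun b => hO _ _) fun b M₃ hA₃ hq => ?_
  rw [CProg.wp, hq]
  -- Only the answer s + t is counted; subtracting the stored shift turns it into s.
  refine le_trans ?_ (Finset.single_le_sum (fun t' _ => mul_nonneg (hO _ t')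
    (CProg.wp_nonneg _ hG _)) (Finset.mem_univ (s + t)))
  refine le_mul_of_one_le_right (hO _ _) (le_wp_output (κ := κ) hℓ ?_ fun i => ?_)
  · change M₃ 0 = _
    rw [hA₃ 0 (by decide), hM₂.params]
  · have e2 : writeAnswer M₃ (s + t) 2 i = ((s + t) i).val := by simp [writeAnswer]
    have e4 : writeAnswer M₃ (s + t) 4 i = (t i).val := by
      rw [← h4₂ i, ← hA₃ 4 (by decide)]
      rfl
    rw [e2, e4]
    simp

end Postprocess

/-! ### Gaussian sums -/

/-- The Gaussian function `exp (-π x² / s²)`. -/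
def gauss (s x : ℝ) : ℝ := Real.exp (-Real.pi * x ^ 2 / s ^ 2)

/-- The sum of the Gaussian function over a translate of the integers. -/
def gaussSum (s x : ℝ) : ℝ := ∑' n : ℤ, gauss s (n + x)

theorem gauss_pos (s x : ℝ) : 0 < gauss s x := Real.exp_pos _

theorem rho_eq_gauss (s : ℝ) (j : ℤ) : rho s j = gauss s j := rfl

theorem summable_gauss {s : ℝ} (hs : 0 < s) (x : ℝ) : Summable fun n : ℤ => gauss s (n + x) := by
  have h := HurwitzKernelBounds.summable_f_int 0 x (t := 1 / s ^ 2) (by positivity)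
  refine h.congr fun j => ?_
  simp only [HurwitzKernelBounds.f_int, gauss, pow_zero, one_mul]
  congr 1
  ring

theorem gaussSum_pos {s : ℝ} (hs : 0 < s) (x : ℝ) : 0 < gaussSum s x :=
  (summable_gauss hs x).tsum_pos (fun _ => (gauss_pos _ _).le) 0 (gauss_pos _ _)

/-- Poisson summation. The Fourier transform of the EDCP amplitudes is again a Gaussian sum, in
particular real and positive, which allows relative error estimates. -/
theorem tsum_rho_mul_ee {s : ℝ} (hs : 0 < s) (θ : ℝ) :
    ∑' j : ℤ, (rho s j : ℂ) * ee (j * θ) = ((s * gaussSum (1 / s) θ : ℝ) : ℂ) := by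
  have ha : 0 < ((1 / s ^ 2 : ℝ) : ℂ).re := by
    rw [Complex.ofReal_re]
    positivity
  have h := Complex.tsum_exp_neg_quadratic ha (Complex.I * θ)
  have h1 : ∀ j : ℤ, Complex.exp (-Real.pi * ((1 / s ^ 2 : ℝ) : ℂ) * j ^ 2 +
      2 * Real.pi * (Complex.I * θ) * j) = (rho s j : ℂ) * ee (j * θ) := by
    intro j
    rw [rho, ee, Complex.ofReal_exp, ← Complex.exp_add]
    congr 1
    push_cast
    ring
  have hs' : (s : ℂ) ≠ 0 := Complex.ofReal_ne_zero.2 hs.ne'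
  have h2 : ∀ j : ℤ, Complex.exp (-Real.pi / ((1 / s ^ 2 : ℝ) : ℂ) *
      (j + Complex.I * (Complex.I * θ)) ^ 2) = (gauss (1 / s) ((-j : ℤ) + θ) : ℂ) := by
    intro j
    rw [gauss, Complex.ofReal_exp]
    congr 1
    have : (j : ℂ) + Complex.I * (Complex.I * θ) = j - θ := by
      rw [← mul_assoc, Complex.I_mul_I]
      ring
    rw [this]
    push_cast
    field_simp
    ring
  have h3 : (1 : ℂ) / ((1 / s ^ 2 : ℝ) : ℂ) ^ (1 / 2 : ℂ) = s := by
    have : ((1 / s ^ 2 : ℝ) : ℂ) ^ (1 / 2 : ℂ) = ((1 / s : ℝ) : ℂ) := by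
      have e : (1 / 2 : ℂ) = ((1 / 2 : ℝ) : ℂ) := by push_cast; rfl
      rw [e, ← Complex.ofReal_cpow (by positivity), ← Real.sqrt_eq_rpow, Real.sqrt_div zero_le_one,
        Real.sqrt_one, Real.sqrt_sq hs.le]
    rw [this]
    push_cast
    field_simp
  simp only [h1, h2, h3] at h
  rw [h, gaussSum, Complex.ofReal_mul, Complex.ofReal_tsum,
    ← (Equiv.neg ℤ).tsum_eq fun n : ℤ => (gauss (1 / s) (n + θ) : ℂ)]
  rfl

theorem norm_rho_mul_ee (s : ℝ) (j : ℤ) (θ : ℝ) : ‖(rho s j : ℂ) * ee (j * θ)‖ = rho s j := by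
  rw [norm_mul, norm_ee, mul_one, Complex.norm_real, Real.norm_of_nonneg (rho_pos s j).le]

theorem exp_neg_pi_le : Real.exp (-Real.pi) ≤ 1 / 4 := by
  rw [Real.exp_neg, one_div]
  refine inv_anti₀ (by norm_num) ?_
  linarith [Real.add_one_le_exp Real.pi, Real.pi_gt_three]

theorem exp_neg_pi_mul_sq_le {s : ℝ} (hs : 1 ≤ s) : Real.exp (-Real.pi * s ^ 2) ≤ 1 / 4 := by
  refine le_trans (Real.exp_le_exp.2 ?_) exp_neg_pi_le
  nlinarith [Real.pi_pos, one_le_pow₀ hs (n := 2)]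

/-- With q = exp(-π s²) the tail on each side is at most the geometric series q/(1 - q), because j²
≥ j. As q ≤ 1/4, this is at most (3/2)q. -/
theorem tsum_rho_inv_le {s : ℝ} (hs : 1 ≤ s) :
    ∑' j : ℤ, rho (1 / s) j ≤ 1 + 3 * Real.exp (-Real.pi * s ^ 2) := by
  have hs0 : 0 < s := by linarith
  set q := Real.exp (-Real.pi * s ^ 2) with hq
  have hq0 : 0 < q := Real.exp_pos _
  have hq1 : q ≤ 1 / 4 := exp_neg_pi_mul_sq_le hs
  have hval : ∀ j : ℤ, rho (1 / s) j = Real.exp (-Real.pi * s ^ 2 * (j : ℝ) ^ 2) := by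
    intro j
    rw [rho]
    congr 1
    field_simp
  have hle : ∀ n : ℕ, rho (1 / s) ((n : ℤ) + 1) ≤ q * q ^ n := by
    intro n
    rw [hval, hq, ← pow_succ', ← Real.exp_nat_mul]
    refine Real.exp_le_exp.2 ?_
    push_cast
    have h1 : (n : ℝ) + 1 ≤ ((n : ℝ) + 1) ^ 2 := by nlinarith [(Nat.cast_nonneg n : (0 : ℝ) ≤ n)]
    have h2 : 0 < Real.pi * s ^ 2 := by positivity
    nlinarith
  have hneg : ∀ j : ℤ, rho (1 / s) (-j) = rho (1 / s) j := by
    intro j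
    simp [rho]
  have hgeo : Summable fun n : ℕ => q * q ^ n :=
    (summable_geometric_of_lt_one hq0.le (by linarith)).mul_left q
  have hsum : Summable fun n : ℕ => rho (1 / s) ((n : ℤ) + 1) :=
    Summable.of_nonneg_of_le (fun _ => (rho_pos _ _).le) hle hgeo
  have hB : ∑' n : ℕ, rho (1 / s) ((n : ℤ) + 1) ≤ q / (1 - q) := by
    refine (hsum.tsum_le_tsum hle hgeo).trans (le_of_eq ?_)
    rw [tsum_mul_left, tsum_geometric_of_lt_one hq0.le (by linarith)]
    rfl
  have hsum0 : Summable fun n : ℕ => rho (1 / s) (n : ℤ) := by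
    refine (summable_nat_add_iff 1).1 ?_
    exact_mod_cast hsum
  have h0 : ∑' n : ℕ, rho (1 / s) (n : ℤ) = 1 + ∑' n : ℕ, rho (1 / s) ((n : ℤ) + 1) := by
    rw [hsum0.tsum_eq_zero_add]
    congr 1
    · simp [rho]
  have h4 : q / (1 - q) ≤ 3 / 2 * q := by
    rw [div_le_iff₀ (by linarith)]
    nlinarith
  rw [tsum_of_nat_of_neg_add_one hsum0 (by simpa only [hneg] using hsum), h0]
  simp only [hneg]
  linarith

/-- A wide Gaussian has almost the same sum over every translate of ℤ. In the Poisson dual the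
frequency 0 contributes `s`, and all others together contribute at most the tail bounded in
`tsum_rho_inv_le`, times `s`. -/
theorem abs_gaussSum_sub_le {s : ℝ} (hs : 1 ≤ s) (x : ℝ) :
    |gaussSum s x - s| ≤ 3 * Real.exp (-Real.pi * s ^ 2) * s := by
  have hs0 : 0 < s := by linarith
  have hs1 : 0 < 1 / s := by positivity
  have h := tsum_rho_mul_ee hs1 x
  rw [one_div_one_div] at h
  have hsum : Summable fun j : ℤ => (rho (1 / s) j : ℂ) * ee (j * x) :=
    Summable.of_norm (by simpa only [norm_rho_mul_ee] using summable_rho hs1.ne')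
  have h1 : ((1 / s * (gaussSum s x - s) : ℝ) : ℂ) =
      ∑' j : ℤ, if j = 0 then 0 else (rho (1 / s) j : ℂ) * ee (j * x) := by
    rw [hsum.tsum_eq_add_tsum_ite 0] at h
    have e0 : (rho (1 / s) 0 : ℂ) * ee ((0 : ℤ) * x) = 1 := by simp [rho, ee]
    rw [e0] at h
    have : ((1 / s * (gaussSum s x - s) : ℝ) : ℂ) = ((1 / s * gaussSum s x : ℝ) : ℂ) - 1 := by
      rw [← Complex.ofReal_one, ← Complex.ofReal_sub]
      congr 1
      field_simp
    rw [this, ← h]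
    ring
  have hr := summable_rho hs1.ne'
  have h2 : ‖((1 / s * (gaussSum s x - s) : ℝ) : ℂ)‖ ≤ 3 * Real.exp (-Real.pi * s ^ 2) := by
    have hi : Summable fun j : ℤ => if j = 0 then 0 else rho (1 / s) j := by
      refine Summable.of_nonneg_of_le (fun j => ?_) (fun j => ?_) hr
      · split_ifs
        · exact le_rfl
        · exact (rho_pos _ _).le
      · split_ifs
        · exact (rho_pos _ _).le
        · exact le_rfl
    have hn : ∀ j : ℤ, ‖if j = 0 then 0 else (rho (1 / s) j : ℂ) * ee (j * x)‖ =
        if j = 0 then 0 else rho (1 / s) j := by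
      intro j
      split_ifs
      · exact norm_zero
      · exact norm_rho_mul_ee _ _ _
    rw [h1]
    refine (norm_tsum_le_tsum_norm (by simpa only [hn] using hi)).trans ?_
    simp only [hn]
    have h3 := hr.tsum_eq_add_tsum_ite 0
    have h4 := tsum_rho_inv_le hs
    have e0 : rho (1 / s) 0 = 1 := by simp [rho]
    linarith
  rw [Complex.norm_real, Real.norm_eq_abs, abs_mul, abs_of_pos hs1, one_div_mul_eq_div,
    div_le_iff₀ hs0] at h2
  exact h2

theorem gaussSum_le {s : ℝ} (hs : 1 ≤ s) (x : ℝ) :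
    gaussSum s x ≤ (1 + 3 * Real.exp (-Real.pi * s ^ 2)) * s := by
  linarith [(abs_le.1 (abs_gaussSum_sub_le hs x)).2]

theorem le_gaussSum {s : ℝ} (hs : 1 ≤ s) (x : ℝ) :
    (1 - 3 * Real.exp (-Real.pi * s ^ 2)) * s ≤ gaussSum s x := by
  linarith [(abs_le.1 (abs_gaussSum_sub_le hs x)).1]

theorem gaussSum_sqrt_two_mul_le {s : ℝ} (hs : 1 ≤ s) (x : ℝ) :
    gaussSum (Real.sqrt 2 * s) x ≤ 3 * s := by
  have h2 : Real.sqrt 2 ≤ 3 / 2 := by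
    rw [Real.sqrt_le_left (by norm_num)]
    norm_num
  have h1 : 1 ≤ Real.sqrt 2 := Real.one_le_sqrt.2 (by norm_num)
  have h3 : 1 ≤ Real.sqrt 2 * s := by nlinarith
  refine (gaussSum_le h3 x).trans ?_
  have h4 := exp_neg_pi_mul_sq_le h3
  have h5 : 0 < Real.exp (-Real.pi * (Real.sqrt 2 * s) ^ 2) := Real.exp_pos _
  nlinarith

/-- The exponent is halved: one half is at most -πB²/(2s²) outside `F`, the other half is a Gaussian
of width √2 s, whose whole sum is at most 3s. -/
theorem tsum_compl_gauss_le {s B : ℝ} (hs : 1 ≤ s) (hB : 0 ≤ B) (x : ℝ) {F : Finset ℤ}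
    (hF : ∀ m ∉ F, B ≤ |(m : ℝ) + x|) :
    ∑' m : ((F : Set ℤ)ᶜ : Set ℤ), gauss s ((m : ℤ) + x) ≤
      3 * Real.exp (-Real.pi * B ^ 2 / (2 * s ^ 2)) * s := by
  have hs0 : 0 < s := by linarith
  have h2 : (0 : ℝ) < Real.sqrt 2 := by positivity
  have hle : ∀ m : ((F : Set ℤ)ᶜ : Set ℤ), gauss s ((m : ℤ) + x) ≤
      Real.exp (-Real.pi * B ^ 2 / (2 * s ^ 2)) * gauss (Real.sqrt 2 * s) ((m : ℤ) + x) := by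
    rintro ⟨m, hm⟩
    rw [gauss, gauss, ← Real.exp_add]
    refine Real.exp_le_exp.2 ?_
    have h := hF m hm
    have hsq : B ^ 2 ≤ ((m : ℝ) + x) ^ 2 := by
      rw [← sq_abs ((m : ℝ) + x)]
      exact pow_le_pow_left₀ hB h 2
    rw [mul_pow, Real.sq_sqrt (by norm_num), ← add_div, div_le_div_iff₀ (by positivity)
      (by positivity)]
    have : 0 < Real.pi * s ^ 2 := by positivity
    nlinarith
  have hsum := summable_gauss (mul_pos h2 hs0) x
  have hsum' : Summable fun m : ((F : Set ℤ)ᶜ : Set ℤ) => gauss (Real.sqrt 2 * s) ((m : ℤ) + x) :=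
    hsum.comp_injective Subtype.val_injective
  have hsub : Summable fun m : ((F : Set ℤ)ᶜ : Set ℤ) =>
      Real.exp (-Real.pi * B ^ 2 / (2 * s ^ 2)) * gauss (Real.sqrt 2 * s) ((m : ℤ) + x) :=
    hsum'.mul_left _
  have hg : Summable fun m : ((F : Set ℤ)ᶜ : Set ℤ) => gauss s ((m : ℤ) + x) :=
    (summable_gauss hs0 x).comp_injective Subtype.val_injective
  refine (Summable.tsum_le_tsum hle hg hsub).trans ?_
  rw [Summable.tsum_mul_left _ hsum']
  have h3 := hsum.tsum_subtype_le (fun n : ℤ => gauss (Real.sqrt 2 * s) (n + x)) ((F : Set ℤ)ᶜ)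
    (fun _ => (gauss_pos _ _).le)
  have h4 := gaussSum_sqrt_two_mul_le hs x
  have h5 : 0 < Real.exp (-Real.pi * B ^ 2 / (2 * s ^ 2)) := Real.exp_pos _
  calc _ ≤ Real.exp (-Real.pi * B ^ 2 / (2 * s ^ 2)) * (3 * s) :=
        mul_le_mul_of_nonneg_left (h3.trans h4) h5.le
    _ = _ := by ring

theorem gaussSum_sub_le_sum {s B : ℝ} (hs : 1 ≤ s) (hB : 0 ≤ B) (x : ℝ) {F : Finset ℤ}
    (hF : ∀ m ∉ F, B ≤ |(m : ℝ) + x|) :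
    gaussSum s x - 3 * Real.exp (-Real.pi * B ^ 2 / (2 * s ^ 2)) * s ≤
      ∑ m ∈ F, gauss s (m + x) := by
  have h := (summable_gauss (by linarith : 0 < s) x).sum_add_tsum_compl (s := F)
  have h2 := tsum_compl_gauss_le hs hB x hF
  rw [gaussSum]
  linarith

theorem norm_tsum_sub_sum_le {s B : ℝ} (hs : 1 ≤ s) (hB : 0 ≤ B) (θ : ℝ) {F : Finset ℤ}
    (hF : ∀ m ∉ F, B ≤ |(m : ℝ)|) :
    ‖∑' j : ℤ, (rho s j : ℂ) * ee (j * θ) - ∑ j ∈ F, (rho s j : ℂ) * ee (j * θ)‖ ≤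
      3 * Real.exp (-Real.pi * B ^ 2 / (2 * s ^ 2)) * s := by
  have hs0 : s ≠ 0 := by linarith
  have hsum : Summable fun j : ℤ => (rho s j : ℂ) * ee (j * θ) :=
    Summable.of_norm (by simpa only [norm_rho_mul_ee] using summable_rho hs0)
  rw [← hsum.sum_add_tsum_compl (s := F), add_sub_cancel_left]
  refine (norm_tsum_le_tsum_norm ?_).trans ?_
  · simp only [norm_rho_mul_ee]
    exact (summable_rho hs0).subtype _
  · simp only [norm_rho_mul_ee]
    have := tsum_compl_gauss_le hs hB 0 (F := F) (by simpa using hF)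
    simpa only [rho_eq_gauss, add_zero] using this

/-- Some integer translate of θ has modulus at most 1/2. This lower bound, tiny but uniform in θ,
turns the absolute truncation error into a relative one. -/
theorem exp_le_gaussSum {r : ℝ} (hr : 0 < r) (θ : ℝ) :
    Real.exp (-Real.pi * r ^ 2 / 4) ≤ gaussSum (1 / r) θ := by
  have hsum := summable_gauss (show 0 < 1 / r by positivity) θ
  refine le_trans ?_ (hsum.le_tsum (-round θ) fun _ _ => (gauss_pos _ _).le)
  rw [gauss]
  refine Real.exp_le_exp.2 ?_
  have h := abs_sub_round θ
  have h1 : (((-round θ : ℤ) : ℝ) + θ) ^ 2 ≤ 1 / 4 := by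
    have : (((-round θ : ℤ) : ℝ) + θ) ^ 2 = |θ - round θ| ^ 2 := by
      rw [sq_abs]
      push_cast
      ring
    rw [this]
    nlinarith [abs_nonneg (θ - round θ)]
  rw [one_div, inv_pow, div_inv_eq_mul]
  have : 0 < Real.pi * r ^ 2 := by positivity
  nlinarith

/-- The squares of the terms of the right-hand sum are the terms on the left; the nonnegative mixed
products are dropped. -/
theorem gaussSum_le_sq {r : ℝ} (hr : 0 < r) (θ : ℝ) :
    gaussSum (1 / (Real.sqrt 2 * r)) θ ≤ gaussSum (1 / r) θ ^ 2 := by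
  have hsum := summable_gauss (show 0 < 1 / r by positivity) θ
  have hsum2 := summable_gauss (show 0 < 1 / (Real.sqrt 2 * r) by positivity) θ
  have hle : ∀ n : ℤ, gauss (1 / r) (n + θ) ≤ gaussSum (1 / r) θ :=
    fun n => hsum.le_tsum n fun _ _ => (gauss_pos _ _).le
  have hsq : ∀ n : ℤ, gauss (1 / (Real.sqrt 2 * r)) (n + θ) =
      gauss (1 / r) (n + θ) * gauss (1 / r) (n + θ) := by
    intro n
    rw [gauss, gauss, ← Real.exp_add]
    congr 1
    rw [div_pow, div_pow, mul_pow, Real.sq_sqrt (by norm_num)]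
    field_simp
    ring
  rw [sq]
  conv_rhs => rw [gaussSum, ← tsum_mul_left]
  refine hsum2.tsum_le_tsum (fun n => ?_) (hsum.mul_left _)
  rw [hsq]
  exact mul_le_mul_of_nonneg_right (hle n) (gauss_pos _ _).le

theorem tsum_rho_sq (r : ℝ) : ∑' j : ℤ, rho r j ^ 2 = gaussSum (r / Real.sqrt 2) 0 := by
  rw [gaussSum]
  refine tsum_congr fun j => ?_
  rw [rho, gauss, ← Real.exp_nat_mul, add_zero]
  congr 1
  rw [div_pow, Real.sq_sqrt (by norm_num)]
  rw [div_div_eq_mul_div]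
  push_cast
  ring

theorem summable_rho_sq {r : ℝ} (hr : 0 < r) : Summable fun j => rho r j ^ 2 := by
  have h := summable_gauss (show 0 < r / Real.sqrt 2 by positivity) 0
  refine h.congr fun j => ?_
  rw [rho, gauss, ← Real.exp_nat_mul, add_zero]
  congr 1
  rw [div_pow, Real.sq_sqrt (by norm_num)]
  rw [div_div_eq_mul_div]
  push_cast
  ring

/-! ### The Fourier transform of a truncated EDCP state -/

theorem centered_injOn (W : ℕ) : Set.InjOn (centered W) (Finset.range W) := by
  intro z hz z' hz' h
  rw [Finset.mem_coe, Finset.mem_range] at hz hz'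
  rw [centered, centered] at h
  split_ifs at h <;> omega

theorem le_abs_of_notMem_centered {J : ℕ} {m : ℤ}
    (hm : m ∉ (Finset.range (2 * J)).image (centered (2 * J))) : (J : ℝ) ≤ |(m : ℝ)| := by
  by_contra h
  have h' : |m| < J := by
    rw [not_le] at h
    exact_mod_cast h
  rw [abs_lt] at h'
  refine hm (Finset.mem_image.2 ?_)
  rcases le_or_gt 0 m with h0 | h0
  · refine ⟨m.toNat, Finset.mem_range.2 (by omega), ?_⟩
    rw [centered]
    split_ifs <;> omega
  · refine ⟨(m + 2 * J).toNat, Finset.mem_range.2 (by omega), ?_⟩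
    rw [centered]
    split_ifs <;> omega

/-- Bound for the relative truncation error. -/
def truncError (r : ℝ) (J : ℕ) : ℝ := 6 * Real.exp (-Real.pi * (J ^ 2 / (2 * r ^ 2) - r ^ 2 / 4))

/-- The full sum is r times a Gaussian sum, at least r·exp(-πr²/4), and cutting at |j| ≥ J costs at
most the fraction ε/2 of it. Squaring gives the factor 1 - ε, and dropping mixed products leaves the
Gaussian sum of width 1/(√2 r). The bound must be relative because it is used pointwise in θ, also
where the amplitude is minute. -/
theorem le_sq_norm_truncSum {r : ℝ} (hr : 1 ≤ r) (J : ℕ) (θ : ℝ) :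
    (1 - truncError r J) * (r ^ 2 / gaussSum (r / Real.sqrt 2) 0) *
      gaussSum (1 / (Real.sqrt 2 * r)) θ ≤ ‖truncSum (rho r) (2 * J) θ‖ ^ 2 := by
  have hr0 : 0 < r := by linarith
  set H := gaussSum (1 / r) θ with hH
  set S := ∑ j ∈ (Finset.range (2 * J)).image (centered (2 * J)), (rho r j : ℂ) * ee (j * θ) with hS
  set Z := gaussSum (r / Real.sqrt 2) 0 with hZ
  have hZ0 : 0 < Z := gaussSum_pos (by positivity) 0
  have htr : ‖truncSum (rho r) (2 * J) θ‖ ^ 2 = ‖S‖ ^ 2 / Z := by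
    have : truncSum (rho r) (2 * J) θ = S / (Real.sqrt Z : ℝ) := by
      rw [truncSum, hS, Finset.sum_image (centered_injOn _), Finset.sum_div, tsum_rho_sq]
      refine Finset.sum_congr rfl fun z _ => ?_
      push_cast
      ring
    rw [this, norm_div, div_pow, Complex.norm_real, Real.norm_of_nonneg (Real.sqrt_nonneg _),
      Real.sq_sqrt hZ0.le]
  have hH0 : Real.exp (-Real.pi * r ^ 2 / 4) ≤ H := exp_le_gaussSum hr0 θ
  set ε := truncError r J with hε
  have hε0 : 0 < ε := by
    rw [hε, truncError]
    positivity
  have hS1 : r * H * (1 - ε / 2) ≤ ‖S‖ := by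
    have h1 := norm_tsum_sub_sum_le hr (Nat.cast_nonneg J) θ
      (F := (Finset.range (2 * J)).image (centered (2 * J)))
      (fun m hm => le_abs_of_notMem_centered hm)
    rw [tsum_rho_mul_ee hr0] at h1
    have h2 : r * H ≤ ‖(((r * H : ℝ) : ℂ) - S)‖ + ‖S‖ := by
      have := norm_add_le (((r * H : ℝ) : ℂ) - S) S
      rw [sub_add_cancel, Complex.norm_real] at this
      exact (le_abs_self _).trans this
    have h3 : 3 * Real.exp (-Real.pi * (J : ℝ) ^ 2 / (2 * r ^ 2)) * r ≤ r * H * (ε / 2) := by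
      have : Real.exp (-Real.pi * (J : ℝ) ^ 2 / (2 * r ^ 2)) =
          Real.exp (-Real.pi * r ^ 2 / 4) *
            Real.exp (-Real.pi * (J ^ 2 / (2 * r ^ 2) - r ^ 2 / 4)) := by
        rw [← Real.exp_add]
        congr 1
        ring
      rw [this, hε, truncError]
      have h4 := mul_le_mul_of_nonneg_right hH0
        (Real.exp_pos (-Real.pi * (J ^ 2 / (2 * r ^ 2) - r ^ 2 / 4))).le
      nlinarith
    linarith
  rw [htr, le_div_iff₀ hZ0]
  have hsq := gaussSum_le_sq hr0 θ
  have hpos : 0 < gaussSum (1 / (Real.sqrt 2 * r)) θ := gaussSum_pos (by positivity) θ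
  have hH1 : 0 < H := gaussSum_pos (by positivity) θ
  have e : (1 - ε) * (r ^ 2 / Z) * gaussSum (1 / (Real.sqrt 2 * r)) θ * Z =
      (1 - ε) * (r ^ 2 * gaussSum (1 / (Real.sqrt 2 * r)) θ) := by
    field_simp
  rw [e]
  rcases le_or_gt 1 ε with h1 | h1
  · exact le_trans (mul_nonpos_of_nonpos_of_nonneg (by linarith) (by positivity)) (sq_nonneg _)
  · calc (1 - ε) * (r ^ 2 * gaussSum (1 / (Real.sqrt 2 * r)) θ)
        ≤ (1 - ε) * (r ^ 2 * H ^ 2) := by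
          refine mul_le_mul_of_nonneg_left (mul_le_mul_of_nonneg_left hsq (by positivity))
            (by linarith)
      _ ≤ (1 - ε / 2) ^ 2 * (r ^ 2 * H ^ 2) := by
          refine mul_le_mul_of_nonneg_right ?_ (by positivity)
          nlinarith
      _ = (r * H * (1 - ε / 2)) ^ 2 := by ring
      _ ≤ ‖S‖ ^ 2 := pow_le_pow_left₀ (mul_nonneg (by positivity) (by linarith)) hS1 2

/-! ### The rejection sampler -/

section Window

variable {r : ℝ} {W N P C : ℕ}

theorem acceptProb_eq_gauss (r : ℝ) (W N P C u : ℕ) :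
    acceptProb r W N P C u = gauss (N / (Real.sqrt 2 * r)) (cand W N P C u + C * N / W) := by
  rw [acceptProb, gauss, candPos]
  congr 1
  rw [div_pow, mul_pow, Real.sq_sqrt (by norm_num), div_div_eq_mul_div]
  ring

theorem cand_injective (W N P C : ℕ) : Function.Injective (cand W N P C) := by
  intro u u' h
  rw [cand, cand] at h
  omega

/-- The sum of the acceptance probabilities of the candidates in the class of `b`. -/
def windowSum (r : ℝ) (W N P C : ℕ) (b : ZMod N) : ℝ :=
  ∑ u ∈ Finset.range P, if (cand W N P C u : ZMod N) = b then acceptProb r W N P C u else 0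

theorem windowSum_nonneg (r : ℝ) (W N P C : ℕ) (b : ZMod N) : 0 ≤ windowSum r W N P C b := by
  refine Finset.sum_nonneg fun u _ => ?_
  split_ifs
  · exact acceptProb_nonneg _ _ _ _ _ _
  · exact le_rfl

theorem sum_windowSum [NeZero N] (r : ℝ) (W P C : ℕ) (hP : 0 < P) :
    ∑ b : ZMod N, windowSum r W N P C b = P * roundProb r W N P C := by
  simp only [windowSum, roundProb]
  rw [Finset.sum_comm]
  simp only [Finset.sum_ite_eq, Finset.mem_univ, if_true]
  have : (P : ℝ) ≠ 0 := by positivity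
  field_simp

theorem mul_roundProb_eq (hP : 0 < P) : P * roundProb r W N P C =
    ∑ m ∈ (Finset.range P).image (cand W N P C), gauss (N / (Real.sqrt 2 * r)) (m + C * N / W) := by
  rw [roundProb, Finset.sum_image fun _ _ _ _ h => cand_injective _ _ _ _ h]
  simp only [acceptProb_eq_gauss]
  have : (P : ℝ) ≠ 0 := by positivity
  field_simp

theorem mul_roundProb_le (hP : 0 < P) (hσ : 1 ≤ N / (Real.sqrt 2 * r)) :
    P * roundProb r W N P C ≤ (1 + 3 * Real.exp (-Real.pi * (N / (Real.sqrt 2 * r)) ^ 2)) *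
      (N / (Real.sqrt 2 * r)) := by
  rw [mul_roundProb_eq hP]
  refine le_trans ?_ (gaussSum_le hσ (C * N / W))
  exact (summable_gauss (by linarith) _).sum_le_tsum _ fun _ _ => (gauss_pos _ _).le

/-- The window consists of P' integers on either side of ⌊-CN/W⌋. Rounding the centre down costs up
to one unit at the right end, so every integer outside the window is at distance at least P' - 1. -/
theorem le_mul_roundProb {P' : ℕ} (hW : 0 < W) (hP' : 1 ≤ P') (hσ : 1 ≤ N / (Real.sqrt 2 * r)) :
    (1 - 3 * Real.exp (-Real.pi * (N / (Real.sqrt 2 * r)) ^ 2) -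
      3 * Real.exp (-Real.pi * (P' - 1 : ℝ) ^ 2 / (2 * (N / (Real.sqrt 2 * r)) ^ 2))) *
      (N / (Real.sqrt 2 * r)) ≤ (2 * P' : ℕ) * roundProb r W N (2 * P') C := by
  rw [mul_roundProb_eq (by omega)]
  have h1 := le_gaussSum hσ (C * N / W)
  have hB : (0 : ℝ) ≤ P' - 1 := sub_nonneg.2 (by exact_mod_cast hP')
  have h2 := gaussSum_sub_le_sum hσ hB (C * N / W)
    (F := (Finset.range (2 * P')).image (cand W N (2 * P') C)) ?_
  · linarith
  · intro m hm
    set f : ℤ := (-(C * N : ℤ)) / W with hf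
    have hW' : (0 : ℝ) < W := by exact_mod_cast hW
    have hWz : (0 : ℤ) < W := by exact_mod_cast hW
    have hm' : m < f - P' ∨ f + P' ≤ m := by
      by_contra hcon
      push Not at hcon
      refine hm (Finset.mem_image.2 ⟨(m - f + P').toNat, Finset.mem_range.2 (by omega), ?_⟩)
      rw [cand]
      omega
    have hf1 : (f : ℝ) ≤ -(C * N / W) := by
      have : f * W ≤ -(C * N : ℤ) := Int.ediv_mul_le _ hWz.ne'
      have h3 : (f : ℝ) * W ≤ -(C * N) := by exact_mod_cast this
      rw [← neg_div, le_div_iff₀ hW']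
      exact h3
    have hf2 : -(C * N / W : ℝ) < f + 1 := by
      have : -(C * N : ℤ) < (f + 1) * W := Int.lt_ediv_add_one_mul_self _ hWz
      have h3 : (-(C * N) : ℝ) < (f + 1) * W := by exact_mod_cast this
      rw [← neg_div, div_lt_iff₀ hW']
      exact h3
    rcases hm' with h | h
    · have h3 : (m : ℝ) + 1 ≤ f - P' := by exact_mod_cast h
      rw [abs_of_nonpos (by linarith)]
      linarith
    · have h3 : (f : ℝ) + P' ≤ m := by exact_mod_cast h
      rw [abs_of_nonneg (by linarith)]
      linarith

/-- Lower bound for the probability to accept one of the proposed candidates. -/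
theorem le_sampleProb {T : ℕ} {a : ℝ} (hP : 0 < P) (hσ : 1 ≤ N / (Real.sqrt 2 * r)) (ha : 0 < a)
    (haA : a ≤ roundProb r W N P C) (b : ZMod N) :
    (1 - Real.exp (-(a * T))) / ((1 + 3 * Real.exp (-Real.pi * (N / (Real.sqrt 2 * r)) ^ 2)) *
      (N / (Real.sqrt 2 * r))) * windowSum r W N P C b ≤ sampleProb r W N P T C b := by
  set A := roundProb r W N P C with hA
  have hA0 : 0 < A := ha.trans_le haA
  have hA1 : A ≤ 1 := roundProb_le_one _ _ _ _ _
  have hPr : (0 : ℝ) < P := by exact_mod_cast hP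
  have hgeo : ∑ i ∈ Finset.range T, (1 - A) ^ i = (1 - (1 - A) ^ T) / A := by
    rw [eq_div_iff hA0.ne']
    have := mul_neg_geom_sum (1 - A) T
    linarith
  have hpow : (1 - A) ^ T ≤ Real.exp (-(a * T)) := by
    calc (1 - A) ^ T ≤ Real.exp (-A) ^ T :=
          pow_le_pow_left₀ (by linarith) (Real.one_sub_le_exp_neg A) T
      _ = Real.exp (-(A * T)) := by rw [← Real.exp_nat_mul]; congr 1; ring
      _ ≤ Real.exp (-(a * T)) := by
          refine Real.exp_le_exp.2 (neg_le_neg ?_)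
          exact mul_le_mul_of_nonneg_right haA (Nat.cast_nonneg T)
  have hle1 : Real.exp (-(a * T)) ≤ 1 := Real.exp_le_one_iff.2 (by
    have : 0 ≤ a * T := by positivity
    linarith)
  rw [sampleProb, ← windowSum, hgeo]
  have hU := mul_roundProb_le (W := W) (C := C) hP hσ
  rw [← hA] at hU
  -- Given acceptance, the law is the window sum divided by P·A. Replacing P·A by the bound for the
  -- full Gaussian mass makes the constant independent of the measured `C`.
  have h1 : (1 - Real.exp (-(a * T))) / ((1 + 3 * Real.exp (-Real.pi * (N / (Real.sqrt 2 * r)) ^ 2)) *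
      (N / (Real.sqrt 2 * r))) ≤ (1 - (1 - A) ^ T) / (P * A) := by
    refine div_le_div₀ (by linarith) (by linarith) (by positivity) hU
  calc _ ≤ (1 - (1 - A) ^ T) / (P * A) * windowSum r W N P C b :=
        mul_le_mul_of_nonneg_right h1 (windowSum_nonneg _ _ _ _ _ _)
    _ = _ := by field_simp

end Window

/-! ### The distribution of the phase estimates -/

theorem phaseAmp_succ (w : ℕ) (θ : ℝ) :
    phaseAmp (w + 1) θ = 1 / 2 * (1 + ee (2 ^ w * θ)) * phaseAmp w θ := by
  rw [phaseAmp, Finset.prod_range_succ', phaseAmp, mul_comm]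
  congr 1
  refine Finset.prod_congr rfl fun i hi => ?_
  rw [Finset.mem_range] at hi
  have : w + 1 - 1 - (i + 1) = w - 1 - i := by omega
  rw [this]

theorem phaseAmp_add_int (w : ℕ) (θ : ℝ) (k : ℤ) : phaseAmp w (θ + k) = phaseAmp w θ := by
  refine Finset.prod_congr rfl fun i _ => ?_
  rw [ee_congr (2 ^ (w - 1 - i) * k) (x := 2 ^ (w - 1 - i) * (θ + k)) (y := 2 ^ (w - 1 - i) * θ)]
  push_cast
  ring

/-- The product telescopes through (1 - z)(1 + z) = 1 - z². This is the Dirichlet kernel of ordinary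
phase estimation. -/
theorem one_sub_ee_mul_phaseAmp (w : ℕ) (θ : ℝ) :
    (1 - ee θ) * (2 ^ w * phaseAmp w θ) = 1 - ee (2 ^ w * θ) := by
  induction w with
  | zero => simp [phaseAmp]
  | succ w ih =>
    have h : ee (2 ^ (w + 1) * θ) = ee (2 ^ w * θ) * ee (2 ^ w * θ) := by
      rw [← ee_add]
      congr 1
      ring
    rw [phaseAmp_succ, h]
    linear_combination (1 + ee (2 ^ w * θ)) * ih

/-- For the representative φ of θ in [-1/2, 1/2] one has |1 - e(φ)| = 2|sin(πφ)|, and concavity of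
the sine gives |sin(πφ)| ≥ 2|φ|. -/
theorem four_mul_le_norm_one_sub_ee {θ δ : ℝ} (h : ∀ k : ℤ, δ ≤ |θ - k|) :
    4 * δ ≤ ‖1 - ee θ‖ := by
  set φ := θ - round θ with hφ
  have e1 : ee θ = ee φ := ee_congr (round θ) (by rw [hφ]; ring)
  have h1 : |φ| ≤ 1 / 2 := abs_sub_round θ
  have h2 : ‖1 - ee θ‖ = 2 * |Real.sin (Real.pi * φ)| := by
    rw [e1, norm_sub_rev, ee, mul_comm, Complex.norm_exp_I_mul_ofReal_sub_one, norm_mul,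
      Real.norm_eq_abs, Real.norm_eq_abs, abs_two]
    congr 3
    ring
  have h3 := Real.mul_abs_le_abs_sin (x := Real.pi * φ) (by
    rw [abs_mul, abs_of_pos Real.pi_pos]
    nlinarith [Real.pi_pos])
  rw [abs_mul, abs_of_pos Real.pi_pos] at h3
  have h4 : 2 / Real.pi * (Real.pi * |φ|) = 2 * |φ| := by
    field_simp
  have := h (round θ)
  rw [h2]
  linarith

theorem norm_phaseAmp_le {w : ℕ} {θ δ : ℝ} (hδ : 0 < δ) (h : ∀ k : ℤ, δ ≤ |θ - k|) :
    ‖phaseAmp w θ‖ ≤ 1 / (2 * δ * 2 ^ w) := by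
  have h1 := four_mul_le_norm_one_sub_ee h
  have h2 := congrArg norm (one_sub_ee_mul_phaseAmp w θ)
  rw [norm_mul, norm_mul, norm_pow, Complex.norm_ofNat] at h2
  have h3 : ‖1 - ee (2 ^ w * θ)‖ ≤ 2 := by
    refine (norm_sub_le _ _).trans ?_
    rw [norm_one, norm_ee]
    norm_num
  rw [le_div_iff₀ (by positivity)]
  have h4 : 4 * δ * (2 ^ w * ‖phaseAmp w θ‖) ≤ 2 := by
    refine le_trans ?_ (h2.trans_le h3)
    exact mul_le_mul_of_nonneg_right h1 (by positivity)
  linarith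

/-- The outcome probabilities of phase estimation add up to one. Splitting the outcomes by parity
isolates the digit measured first, with factors ½(1 ± z) for a unit number z; the parallelogram law
adds their squared norms to 1. -/
theorem sum_sq_norm_phaseAmp (w : ℕ) (y : ℝ) :
    ∑ c ∈ Finset.range (2 ^ w), ‖phaseAmp w (y - c / 2 ^ w)‖ ^ 2 = 1 := by
  induction w generalizing y with
  | zero => simp [phaseAmp]
  | succ w ih =>
    have h0 : ∀ c : ℕ, phaseAmp (w + 1) (y - (2 * c : ℕ) / 2 ^ (w + 1)) =
        1 / 2 * (1 + ee (2 ^ w * y)) * phaseAmp w (y - c / 2 ^ w) := by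
      intro c
      rw [phaseAmp_succ, ee_congr (-c) (x := 2 ^ w * (y - (2 * c : ℕ) / 2 ^ (w + 1)))
        (y := 2 ^ w * y)]
      · congr 3
        push_cast
        field_simp
        ring
      · push_cast
        field_simp
        ring
    have h1 : ∀ c : ℕ, phaseAmp (w + 1) (y - (2 * c + 1 : ℕ) / 2 ^ (w + 1)) =
        1 / 2 * (1 - ee (2 ^ w * y)) * phaseAmp w ((y - 1 / 2 ^ (w + 1)) - c / 2 ^ w) := by
      intro c
      have e1 : ee (2 ^ w * (y - (2 * c + 1 : ℕ) / 2 ^ (w + 1))) = -ee (2 ^ w * y) := by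
        rw [ee_congr (-c - 1) (y := 2 ^ w * y + 1 / 2), ee_add, ee_half, mul_neg_one]
        push_cast
        field_simp
        ring
      have e2 : y - (2 * c + 1 : ℕ) / 2 ^ (w + 1) = (y - 1 / 2 ^ (w + 1)) - c / 2 ^ w := by
        push_cast
        field_simp
        ring
      rw [phaseAmp_succ, e1, e2, sub_eq_add_neg (1 : ℂ)]
    rw [pow_succ', sum_range_two_mul, Finset.sum_add_distrib]
    simp only [h0, h1, norm_mul, mul_pow, ← Finset.mul_sum, ih, mul_one]
    have h2 := parallelogram_law_with_norm ℝ (1 : ℂ) (ee (2 ^ w * y))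
    rw [norm_one, norm_ee] at h2
    rw [norm_div, norm_one, Complex.norm_ofNat]
    linarith

/-- The multiple of `1 / N` next to `c / 2 ^ w`. -/
def roundFreq (N w c : ℕ) : ℕ := (2 * c * N + 2 ^ w) / (2 * 2 ^ w)

theorem abs_roundFreq_sub_le {N : ℕ} (hN : 0 < N) (w c : ℕ) :
    |(roundFreq N w c : ℝ) / N - c / 2 ^ w| ≤ 1 / (2 * N) := by
  have hN' : (0 : ℝ) < N := by exact_mod_cast hN
  have h1 : roundFreq N w c * (2 * 2 ^ w) ≤ 2 * c * N + 2 ^ w := Nat.div_mul_le_self _ _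
  have h2 : 2 * c * N + 2 ^ w < (roundFreq N w c + 1) * (2 * 2 ^ w) :=
    Nat.lt_mul_of_div_lt (Nat.lt_succ_self _) (by positivity)
  have h1' : (roundFreq N w c : ℝ) * (2 * 2 ^ w) ≤ 2 * c * N + 2 ^ w := by exact_mod_cast h1
  have h2' : (2 : ℝ) * c * N + 2 ^ w < (roundFreq N w c + 1) * (2 * 2 ^ w) := by exact_mod_cast h2
  have hw : (0 : ℝ) < 2 ^ w := by positivity
  have e : (roundFreq N w c : ℝ) / N - c / 2 ^ w =
      (roundFreq N w c * (2 * 2 ^ w) - 2 * c * N) / 2 ^ w * (1 / (2 * N)) := by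
    field_simp
  rw [e, abs_mul, abs_of_pos (show (0 : ℝ) < 1 / (2 * N) by positivity), abs_div, abs_of_pos hw]
  refine mul_le_of_le_one_left (by positivity) ?_
  rw [div_le_one hw, abs_le]
  constructor <;> nlinarith

/-- The numerators differ by a nonzero integer even modulo `N`, so the fractions are at least 1/N
apart, of which the rounding accounts for at most 1/(2N). -/
theorem le_abs_sub_of_ne {N : ℕ} [NeZero N] (w c : ℕ) {y : ZMod N}
    (h : (roundFreq N w c : ZMod N) ≠ y) (k : ℤ) :
    1 / (2 * N : ℝ) ≤ |(y.val : ℝ) / N - c / 2 ^ w - k| := by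
  have hN : 0 < N := NeZero.pos N
  have hN' : (0 : ℝ) < N := by exact_mod_cast hN
  have h1 := abs_roundFreq_sub_le hN w c
  have h2 : (y.val : ℤ) - k * N - roundFreq N w c ≠ 0 := by
    intro h0
    apply h
    have := congrArg (Int.cast : ℤ → ZMod N) h0
    push_cast at this
    rw [ZMod.natCast_zmod_val, ZMod.natCast_self, mul_zero, sub_zero, sub_eq_zero] at this
    exact this.symm
  have h3 : (1 : ℝ) ≤ |(y.val : ℝ) - k * N - roundFreq N w c| := by
    exact_mod_cast Int.one_le_abs h2
  have e : (y.val : ℝ) / N - c / 2 ^ w - k = (y.val - k * N - roundFreq N w c) / N +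
      (roundFreq N w c / N - c / 2 ^ w) := by
    field_simp
    ring
  have h4 : 1 / (N : ℝ) ≤ |((y.val : ℝ) - k * N - roundFreq N w c) / N| := by
    rw [abs_div, abs_of_pos hN']
    exact div_le_div_of_nonneg_right h3 hN'.le
  have h5 := abs_sub_abs_le_abs_sub (((y.val : ℝ) - k * N - roundFreq N w c) / N)
    (-((roundFreq N w c : ℝ) / N - c / 2 ^ w))
  rw [abs_neg, sub_neg_eq_add] at h5
  have h6 : 1 / (N : ℝ) = 2 * (1 / (2 * N)) := by field_simp
  rw [e]
  linarith

/-- The total weight of the outcomes that are rounded to `y`. -/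
def freqWeight (N w : ℕ) (y : ZMod N) : ℝ :=
  ∑ c : Fin (2 ^ w), if (roundFreq N w c : ZMod N) = y then
    ‖phaseAmp w (roundFreq N w c / N - (c : ℕ) / 2 ^ w)‖ ^ 2 else 0

theorem freqWeight_nonneg (N w : ℕ) (y : ZMod N) : 0 ≤ freqWeight N w y := by
  refine Finset.sum_nonneg fun c _ => ?_
  split_ifs
  · positivity
  · exact le_rfl

/-- The rounded frequency can be `N` instead of `0`, so it agrees with `y.val` only modulo `N`;
`phaseAmp` does not notice because it has period 1. -/
theorem freqWeight_add_eq_one {N : ℕ} [NeZero N] (w : ℕ) (y : ZMod N) :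
    freqWeight N w y + (∑ c : Fin (2 ^ w), if (roundFreq N w c : ZMod N) = y then 0 else
      ‖phaseAmp w ((y.val : ℝ) / N - (c : ℕ) / 2 ^ w)‖ ^ 2) = 1 := by
  rw [← sum_sq_norm_phaseAmp w ((y.val : ℝ) / N), ← Fin.sum_univ_eq_sum_range
    (fun c : ℕ => ‖phaseAmp w ((y.val : ℝ) / N - c / 2 ^ w)‖ ^ 2), freqWeight,
    ← Finset.sum_add_distrib]
  refine Finset.sum_congr rfl fun c _ => ?_
  split_ifs with h
  · rw [add_zero]
    have hN : (N : ℝ) ≠ 0 := by exact_mod_cast NeZero.ne N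
    have h1 : ((roundFreq N w c : ℤ) : ZMod N) = ((y.val : ℤ) : ZMod N) := by
      push_cast
      rw [h, ZMod.natCast_zmod_val]
    rw [ZMod.intCast_eq_intCast_iff_dvd_sub] at h1
    obtain ⟨k, hk⟩ := h1
    have hk' : (y.val : ℝ) - roundFreq N w c = N * k := by exact_mod_cast hk
    have : (y.val : ℝ) / N - (c : ℕ) / 2 ^ w =
        (roundFreq N w c / N - (c : ℕ) / 2 ^ w) + k := by
      field_simp
      linear_combination 2 ^ w * hk'
    rw [this, phaseAmp_add_int]
  · rw [zero_add]

theorem freqWeight_le_one {N : ℕ} [NeZero N] (w : ℕ) (y : ZMod N) : freqWeight N w y ≤ 1 := by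
  rw [← freqWeight_add_eq_one w y]
  refine le_add_of_nonneg_right (Finset.sum_nonneg fun c _ => ?_)
  split_ifs
  · exact le_rfl
  · positivity

/-- An outcome that does not round to `y` is at distance at least 1/(2N), so its weight is at most
(N/2^w)². There are at most 2^w such outcomes. -/
theorem le_freqWeight {N : ℕ} [NeZero N] (w : ℕ) (y : ZMod N) :
    1 - N ^ 2 / 2 ^ w ≤ freqWeight N w y := by
  have hN : (0 : ℝ) < N := by exact_mod_cast NeZero.pos N
  have h : (∑ c : Fin (2 ^ w), if (roundFreq N w c : ZMod N) = y then 0 else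
      ‖phaseAmp w ((y.val : ℝ) / N - (c : ℕ) / 2 ^ w)‖ ^ 2) ≤
      ∑ _c : Fin (2 ^ w), ((N : ℝ) / 2 ^ w) ^ 2 := by
    refine Finset.sum_le_sum fun c _ => ?_
    split_ifs with h
    · positivity
    · refine pow_le_pow_left₀ (norm_nonneg _) ?_ 2
      refine (norm_phaseAmp_le (by positivity) (le_abs_sub_of_ne w c h)).trans (le_of_eq ?_)
      field_simp
  rw [Finset.sum_const, Finset.card_univ, Fintype.card_fin, nsmul_eq_mul] at h
  have e : ((2 ^ w : ℕ) : ℝ) * ((N : ℝ) / 2 ^ w) ^ 2 = N ^ 2 / 2 ^ w := by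
    push_cast
    field_simp
  rw [e] at h
  linarith [freqWeight_add_eq_one w y]

/-! ### The joint distribution of the error -/

/-- Every integer is uniquely kW + c with 0 ≤ c < W, so the translates of ℤ by c/W fill (1/W)ℤ,
which is then rescaled. -/
theorem sum_gaussSum_div {s : ℝ} (hs : 0 < s) {W : ℕ} [NeZero W] (δ : ℝ) :
    ∑ c : Fin W, gaussSum s ((c : ℕ) / W + δ) = gaussSum (W * s) (W * δ) := by
  have hW : (0 : ℝ) < W := by exact_mod_cast NeZero.pos W
  have hsum := summable_gauss (show 0 < W * s by positivity) (W * δ)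
  obtain ⟨E, hE⟩ : ∃ E : ℤ × Fin W ≃ ℤ, ∀ k c, E (k, c) = k * W + (c : ℕ) :=
    ⟨(Int.divModEquiv W).symm, fun _ _ => rfl⟩
  have hval : ∀ (k : ℤ) (c : Fin W), gauss (W * s) ((E (k, c) : ℤ) + W * δ) =
      gauss s (k + ((c : ℕ) / W + δ)) := by
    intro k c
    rw [gauss, gauss, hE]
    congr 1
    push_cast
    field_simp
    ring
  have hsum' : Summable fun p : ℤ × Fin W => gauss (W * s) ((E p : ℤ) + W * δ) :=
    E.summable_iff.2 hsum
  rw [gaussSum, ← E.tsum_eq, hsum'.tsum_prod]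
  simp only [tsum_fintype, hval]
  rw [Summable.tsum_finsetSum fun c _ => summable_gauss hs _]
  rfl

/-- The mass that the discrete Gaussian function of width `N / r` gives to the class of `β`. -/
def errorWeight (N : ℕ) (r : ℝ) (β : ZMod N) : ℝ :=
  ∑' e : ℤ, if (e : ZMod N) = β then rho (N / r) e else 0

theorem summable_ite_of_nonneg {ι : Type*} {f : ι → ℝ} (hf : Summable f) (h0 : ∀ i, 0 ≤ f i)
    (p : ι → Prop) [DecidablePred p] : Summable fun i => if p i then f i else 0 := by
  refine Summable.of_nonneg_of_le (fun i => ?_) (fun i => ?_) hf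
  · split_ifs
    · exact h0 i
    · exact le_rfl
  · split_ifs
    · exact le_rfl
    · exact h0 i

section

variable {N W P : ℕ} [NeZero N] [NeZero W] {r : ℝ}

theorem errorWeight_nonneg (N : ℕ) (r : ℝ) (β : ZMod N) : 0 ≤ errorWeight N r β := by
  refine tsum_nonneg fun e => ?_
  split_ifs
  · exact (rho_pos _ _).le
  · exact le_rfl

/-- Completing the square: 2x² + 2(x + e/N)² = e²/N² + 4(x + e/(2N))². The quantum error and the
sampler's error combine to an LWE error of width N/r, and the remaining factor depends on `e` only
through a translation. -/
theorem gauss_mul_gauss (hr : 0 < r) (x : ℝ) (e : ℤ) :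
    gauss (1 / (Real.sqrt 2 * r)) x * gauss (N / (Real.sqrt 2 * r)) (e + N * x) =
      rho (N / r) e * gauss (1 / (2 * r)) (x + e / (2 * N)) := by
  have hN : (N : ℝ) ≠ 0 := by exact_mod_cast NeZero.ne N
  rw [gauss, gauss, gauss, rho, ← Real.exp_add, ← Real.exp_add]
  congr 1
  have h2 : Real.sqrt 2 ^ 2 = 2 := Real.sq_sqrt (by norm_num)
  simp only [div_pow, mul_pow, h2, one_pow]
  field_simp
  ring

/-- Both factors are sums of Gaussians, and the window may be enlarged to the whole class of `b`. In
the double sum the terms pair up as in `gauss_mul_gauss`, with x = k + θ and the error e as new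
variable. Summability is recorded for the later exchange with the sum over the outcomes. -/
theorem gaussSum_mul_windowSum_le (hr : 0 < r) (c : ℕ) (A : ℤ) (b : ZMod N) :
    gaussSum (1 / (Real.sqrt 2 * r)) (c / W + A / N) * windowSum r W N P c b ≤
      ∑' e : ℤ, (if (e : ZMod N) = b - A then rho (N / r) e else 0) *
        gaussSum (1 / (2 * r)) (c / W + (A / N + e / (2 * N))) ∧
    Summable fun e : ℤ => (if (e : ZMod N) = b - A then rho (N / r) e else 0) *
        gaussSum (1 / (2 * r)) (c / W + (A / N + e / (2 * N))) := by
  have hN : (0 : ℝ) < N := by exact_mod_cast NeZero.pos N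
  have hW : (0 : ℝ) < W := by exact_mod_cast NeZero.pos W
  have h2 : (0 : ℝ) < Real.sqrt 2 := by positivity
  obtain ⟨θ, hθ⟩ : ∃ θ : ℝ, θ = c / W + A / N := ⟨_, rfl⟩
  obtain ⟨f, hf⟩ : ∃ f : ℤ → ℝ, f = fun k : ℤ => gauss (1 / (Real.sqrt 2 * r)) (k + θ) := ⟨_, rfl⟩
  obtain ⟨g, hg⟩ : ∃ g : ℤ → ℝ, g = fun m : ℤ => if (m : ZMod N) = b then
    gauss (N / (Real.sqrt 2 * r)) (m + c * N / W) else 0 := ⟨_, rfl⟩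
  have hfs : Summable f := hf ▸ summable_gauss (by positivity) θ
  have hgs : Summable g := hg ▸ summable_ite_of_nonneg (summable_gauss (by positivity) _)
    (fun _ => (gauss_pos _ _).le) _
  have hf0 : 0 ≤ f := fun k => by rw [hf]; exact (gauss_pos _ _).le
  have hg0 : 0 ≤ g := fun k => by
    rw [hg]
    dsimp only [Pi.zero_apply]
    split_ifs
    · exact (gauss_pos _ _).le
    · exact le_rfl
  have hfg := hfs.mul_of_nonneg hgs hf0 hg0
  have hwin : windowSum r W N P c b ≤ ∑' m, g m := by
    have : windowSum r W N P c b = ∑ m ∈ (Finset.range P).image (cand W N P c), g m := by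
      rw [Finset.sum_image fun _ _ _ _ h => cand_injective _ _ _ _ h, windowSum]
      simp only [acceptProb_eq_gauss, hg]
    rw [this]
    exact hgs.sum_le_tsum _ fun m _ => hg0 m
  -- The candidate is written as m = e + A + kN, so that m + cN/W = e + N(k + θ), and m lies in the
  -- class of `b` exactly when e lies in that of b - A.
  let E : ℤ × ℤ ≃ ℤ × ℤ :=
    { toFun := fun p => (p.2, p.1 + A + p.2 * N)
      invFun := fun p => (p.2 - A - p.1 * N, p.1)
      left_inv := fun p => Prod.ext (by simp; ring) (by simp)
      right_inv := fun p => Prod.ext (by simp) (by simp; ring) }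
  have hE : ∀ e k : ℤ, f (E (e, k)).1 * g (E (e, k)).2 =
      (if (e : ZMod N) = b - A then rho (N / r) e else 0) *
        gauss (1 / (2 * r)) (k + (c / W + (A / N + e / (2 * N)))) := by
    intro e k
    have hiff : ((e + A + k * N : ℤ) : ZMod N) = b ↔ (e : ZMod N) = b - A := by
      push_cast
      rw [ZMod.natCast_self, mul_zero, add_zero, eq_sub_iff_add_eq]
    simp only [E, Equiv.coe_fn_mk, hf, hg, hiff]
    split_ifs with h
    · rw [show ((e + A + k * N : ℤ) : ℝ) + c * N / W = e + N * (k + θ) by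
        rw [hθ]
        push_cast
        field_simp
        ring, gauss_mul_gauss hr, hθ]
      congr 2
      ring
    · rw [mul_zero, zero_mul]
  have hs2 : Summable fun p => f (E p).1 * g (E p).2 := E.summable_iff.2 hfg
  have htot : (∑' k, f k) * ∑' m, g m = ∑' e : ℤ, ∑' k : ℤ, f (E (e, k)).1 * g (E (e, k)).2 := by
    rw [hfs.tsum_mul_tsum hgs hfg, ← E.tsum_eq, hs2.tsum_prod]
  have hin : ∀ e : ℤ, ∑' k : ℤ, f (E (e, k)).1 * g (E (e, k)).2 =
      (if (e : ZMod N) = b - A then rho (N / r) e else 0) *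
        gaussSum (1 / (2 * r)) (c / W + (A / N + e / (2 * N))) := by
    intro e
    simp only [hE, tsum_mul_left]
    rfl
  constructor
  · simp only [← hin]
    rw [← htot, ← hθ]
    have : gaussSum (1 / (Real.sqrt 2 * r)) θ = ∑' k, f k := by rw [hf, gaussSum]
    rw [this]
    exact mul_le_mul_of_nonneg_left hwin (tsum_nonneg hf0)
  · simp only [← hin]
    exact hs2.prod

/-- Summed over the outcomes, the leftover Gaussian becomes one of width W/(2r) over a translate of
ℤ, hence almost independent of the error. Only the mass of the error class remains. -/
theorem sum_gaussSum_mul_windowSum_le (hr : 0 < r) (hW : 1 ≤ W / (2 * r)) (A : ℤ) (b : ZMod N) :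
    ∑ c : Fin W, gaussSum (1 / (Real.sqrt 2 * r)) ((c : ℕ) / W + A / N) * windowSum r W N P c b ≤
      (1 + 3 * Real.exp (-Real.pi * (W / (2 * r)) ^ 2)) * (W / (2 * r)) *
        errorWeight N r (b - A) := by
  have hN : (0 : ℝ) < N := by exact_mod_cast NeZero.pos N
  have hs : 0 < (N : ℝ) / r := by positivity
  have hD := summable_ite_of_nonneg (summable_rho hs.ne') (fun e => (rho_pos _ e).le)
    fun e : ℤ => (e : ZMod N) = b - A
  refine (Finset.sum_le_sum fun (c : Fin W) _ => (gaussSum_mul_windowSum_le (P := P) (W := W) hr (c : ℕ) A b).1).trans ?_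
  rw [← Summable.tsum_finsetSum fun (c : Fin W) _ => (gaussSum_mul_windowSum_le (P := P) (W := W) hr (c : ℕ) A b).2,
    errorWeight, mul_comm _ (tsum _), ← tsum_mul_right]
  refine Summable.tsum_le_tsum (fun e => ?_)
    (summable_sum fun (c : Fin W) _ => (gaussSum_mul_windowSum_le (P := P) (W := W) hr (c : ℕ) A b).2)
    (hD.mul_right _)
  rw [← Finset.mul_sum, sum_gaussSum_div (by positivity)]
  refine mul_le_mul_of_nonneg_left ?_ ?_
  · rw [mul_one_div]
    exact gaussSum_le hW _
  · split_ifs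
    · exact (rho_pos _ _).le
    · exact le_rfl

theorem sum_gaussSum_mul_le (hr : 0 < r) (hW : 1 ≤ W / (Real.sqrt 2 * r)) (A : ℝ) {p : ℕ → ℝ} {a : ℝ}
    (ha : 0 ≤ a) (hp : ∀ c, a ≤ p c) :
    (1 - 3 * Real.exp (-Real.pi * (W / (Real.sqrt 2 * r)) ^ 2)) * (W / (Real.sqrt 2 * r)) * a ≤
      ∑ c : Fin W, gaussSum (1 / (Real.sqrt 2 * r)) ((c : ℕ) / W + A) * p c := by
  have h1 := le_gaussSum hW (W * A)
  have h2 : (0 : ℝ) < Real.sqrt 2 := by positivity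
  have h3 := sum_gaussSum_div (W := W) (show 0 < 1 / (Real.sqrt 2 * r) by positivity) A
  rw [mul_one_div] at h3
  rw [← h3] at h1
  refine (mul_le_mul_of_nonneg_right h1 ha).trans ?_
  rw [Finset.sum_mul]
  refine Finset.sum_le_sum fun c _ => ?_
  exact mul_le_mul_of_nonneg_left (hp c) (gaussSum_pos (by positivity) _).le

end

/-! ### LWE samples -/

section Lwe

variable {n N : ℕ} [NeZero N] {r : ℝ}

theorem toReal_discreteGaussian {s : ℝ} (hs : 0 < s) (e : ℤ) :
    (discreteGaussian s e).toReal = rho s e / gaussSum s 0 := by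
  rw [discreteGaussian, dif_neg hs.ne', PMF.normalize_apply, ENNReal.toReal_mul, ENNReal.toReal_inv,
    ENNReal.toReal_ofReal (rho_pos _ _).le, div_eq_mul_inv,
    ← ENNReal.ofReal_tsum_of_nonneg (f := rho s) (fun i => (rho_pos s i).le) (summable_rho hs.ne'),
    ENNReal.toReal_ofReal (tsum_nonneg fun i => (rho_pos s i).le)]
  simp [gaussSum, rho_eq_gauss]

theorem lweSample_eq_bind (α : ℝ) (s : Fin n → ZMod N) :
    lweSample n N α s = (PMF.uniformOfFintype (Fin n → ZMod N)).bind fun a =>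
      (discreteGaussian (α * N)).map fun e : ℤ => (a, ∑ i, a i * s i + (e : ZMod N)) := by
  rw [lweSample]
  congr 1
  funext a
  exact PMF.map_comp (Int.cast : ℤ → ZMod N) (discreteGaussian (α * N))
    fun e => (a, ∑ i, a i * s i + e)

theorem toReal_lweSample (hr : 0 < r) (s a : Fin n → ZMod N) (b : ZMod N) :
    (lweSample n N (1 / r) s (a, b)).toReal =
      1 / N ^ n * (errorWeight N r (b - ∑ i, a i * s i) / gaussSum (N / r) 0) := by
  have hN : (0 : ℝ) < N := by exact_mod_cast NeZero.pos N
  have hs : 0 < (N : ℝ) / r := by positivity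
  have e1 : 1 / r * (N : ℝ) = N / r := by ring
  rw [lweSample_eq_bind, PMF.bind_apply, tsum_eq_single a, e1]
  · rw [ENNReal.toReal_mul, PMF.uniformOfFintype_apply, ENNReal.toReal_inv, PMF.map_apply,
      ENNReal.tsum_toReal_eq]
    · congr 1
      · simp [ZMod.card]
      · rw [errorWeight, ← tsum_div_const]
        refine tsum_congr fun e : ℤ => ?_
        have hiff : (a, b) = (a, ∑ i, a i * s i + (e : ZMod N)) ↔
            (e : ZMod N) = b - ∑ i, a i * s i := by
          rw [Prod.mk.injEq, eq_sub_iff_add_eq, add_comm]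
          exact ⟨fun h => h.2.symm, fun h => ⟨rfl, h.symm⟩⟩
        simp only [hiff]
        split_ifs with h
        · exact toReal_discreteGaussian hs e
        · simp
    · intro e
      split_ifs
      · exact PMF.apply_ne_top _ _
      · exact ENNReal.zero_ne_top
  · intro a' ha'
    rw [PMF.map_apply]
    refine mul_eq_zero_of_right _ (ENNReal.tsum_eq_zero.2 fun e => if_neg fun h => ha' ?_)
    exact (congrArg Prod.fst h).symm

theorem sum_toReal_lweSample (α : ℝ) (s : Fin n → ZMod N) :
    ∑ p, (lweSample n N α s p).toReal = 1 := by
  rw [← ENNReal.toReal_sum fun p _ => PMF.apply_ne_top _ _, ← tsum_fintype (L := .unconditional _),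
    PMF.tsum_coe, ENNReal.toReal_one]

theorem lweSample_shift (hr : 0 < r) (s t a : Fin n → ZMod N) (b : ZMod N) :
    (lweSample n N (1 / r) (s + t) (a, b + ∑ i, a i * t i)).toReal =
      (lweSample n N (1 / r) s (a, b)).toReal := by
  rw [toReal_lweSample hr, toReal_lweSample hr]
  congr 3
  simp only [Pi.add_apply, mul_add, Finset.sum_add_distrib]
  ring

end Lwe

/-! ### Product measures -/

section Product

variable {ℓ : ℕ} {X Y : Type*} [Fintype X] [Fintype Y]

theorem sum_prod_comp [DecidableEq Y] (β : X → ℝ) (ψ : X → Y) (F : (Fin ℓ → Y) → ℝ) :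
    ∑ z : Fin ℓ → X, (∏ k, β (z k)) * F (fun k => ψ (z k)) =
      ∑ q : Fin ℓ → Y, (∏ k, ∑ x, if ψ x = q k then β x else 0) * F q := by
  simp only [Finset.prod_univ_sum, Fintype.piFinset_univ, Finset.sum_mul]
  rw [Finset.sum_comm]
  refine Finset.sum_congr rfl fun z _ => ?_
  rw [Finset.sum_eq_single fun k => ψ (z k)]
  · simp
  · intro q _ hq
    obtain ⟨k, hk⟩ : ∃ k, ψ (z k) ≠ q k := by
      by_contra! h
      exact hq (funext fun k => (h k).symm)
    rw [Finset.prod_eq_zero (Finset.mem_univ k) (if_neg hk), zero_mul]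
  · exact fun h => (h (Finset.mem_univ _)).elim

/-- Almost equal distributions have almost equal powers. -/
theorem sum_prod_sub_le {L Q : Y → ℝ} {η : ℝ} (hη : 0 ≤ η) (hQ0 : ∀ y, 0 ≤ Q y) (hL0 : ∀ y, 0 ≤ L y)
    (hQ : ∀ y, Q y ≤ (1 + η) * L y) (hL : ∑ y, L y = 1) {f : (Fin ℓ → Y) → ℝ} (hf0 : ∀ q, 0 ≤ f q)
    (hf1 : ∀ q, f q ≤ 1) :
    ∑ q : Fin ℓ → Y, (∏ k, L (q k)) * f q - ((1 + η) ^ ℓ - (∑ y, Q y) ^ ℓ) ≤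
      ∑ q : Fin ℓ → Y, (∏ k, Q (q k)) * f q := by
  have h1 : ∀ q : Fin ℓ → Y, ∏ k, Q (q k) ≤ (1 + η) ^ ℓ * ∏ k, L (q k) := by
    intro q
    refine (Finset.prod_le_prod (fun k _ => hQ0 (q k)) fun k _ => hQ (q k)).trans (le_of_eq ?_)
    rw [Finset.prod_mul_distrib, Finset.prod_const, Finset.card_univ, Fintype.card_fin]
  -- The gap between the dominating multiple of the power of `L` and the power of `Q` is pointwise
  -- nonnegative, and its total is the asserted loss. Since f takes values in [0, 1], replacing one
  -- measure by the other cannot cost more.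
  have h2 : (1 + η) ^ ℓ - (∑ y, Q y) ^ ℓ =
      ∑ q : Fin ℓ → Y, ((1 + η) ^ ℓ * (∏ k, L (q k)) - ∏ k, Q (q k)) := by
    rw [Finset.sum_sub_distrib, ← Finset.mul_sum, ← Fintype.sum_pow, ← Fintype.sum_pow, hL]
    simp
  rw [h2, ← Finset.sum_sub_distrib]
  refine Finset.sum_le_sum fun q _ => ?_
  have h3 : 0 ≤ ∏ k, L (q k) := Finset.prod_nonneg fun k _ => hL0 _
  have h4 : (1 : ℝ) ≤ (1 + η) ^ ℓ := one_le_pow₀ (by linarith)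
  have h5 := mul_nonneg (sub_nonneg.2 (h1 q)) (sub_nonneg.2 (hf1 q))
  have h6 := mul_nonneg (mul_nonneg (sub_nonneg.2 h4) h3) (hf0 q)
  nlinarith

end Product

/-! ### From the distribution of one sample to the success of the reduction -/

section Combine

theorem oracle_toReal_le_one {n N ℓ : ℕ} (O : Oracle n N ℓ) (q : Fin ℓ → (Fin n → ZMod N) × ZMod N)
    (t : Fin n → ZMod N) : (O q t).toReal ≤ 1 :=
  ENNReal.toReal_le_of_le_ofReal zero_le_one (by
    rw [ENNReal.ofReal_one]
    exact PMF.coe_le_one _ _)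

variable {n N ℓ : ℕ} [NeZero N] {r : ℝ}

theorem sum_lweSample_shift (hr : 0 < r) (s t : Fin n → ZMod N)
    (F : (Fin ℓ → (Fin n → ZMod N) × ZMod N) → ℝ) :
    ∑ q : Fin ℓ → (Fin n → ZMod N) × ZMod N, (∏ k, (lweSample n N (1 / r) s (q k)).toReal) *
        F (fun k => ((q k).1, (q k).2 + ∑ i, (q k).1 i * t i)) =
      ∑ q, (∏ k, (lweSample n N (1 / r) (s + t) (q k)).toReal) * F q := by
  let e : (Fin n → ZMod N) × ZMod N ≃ (Fin n → ZMod N) × ZMod N :=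
    { toFun := fun p => (p.1, p.2 + ∑ i, p.1 i * t i)
      invFun := fun p => (p.1, p.2 - ∑ i, p.1 i * t i)
      left_inv := fun p => by simp
      right_inv := fun p => by simp }
  rw [← (Equiv.arrowCongr (Equiv.refl (Fin ℓ)) e).sum_comp
    fun q => (∏ k, (lweSample n N (1 / r) (s + t) (q k)).toReal) * F q]
  refine Finset.sum_congr rfl fun q _ => ?_
  congr 1
  exact Finset.prod_congr rfl fun k _ => (lweSample_shift hr s t (q k).1 (q k).2).symm

theorem lweSuccess_eq (α : ℝ) (O : Oracle n N ℓ) :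
    (N : ℝ) ^ n * lweSuccess n N ℓ α O =
      ∑ s, ∑ q, (∏ k, (lweSample n N α s (q k)).toReal) * (O q s).toReal := by
  have hN : (N : ℝ) ≠ 0 := by exact_mod_cast NeZero.ne N
  rw [lweSuccess, Finset.mul_sum]
  refine Finset.sum_congr rfl fun s _ => ?_
  rw [PMF.uniformOfFintype_apply, ENNReal.toReal_inv, ← mul_assoc]
  simp [ZMod.card, hN]

/-- The vector part of a sample. -/
def freqVec (N w : ℕ) (C : Fin (n + 1) → Fin (2 ^ w)) (i : Fin n) : ZMod N := freq N w C i

/-- The joint weight of an outcome and of the value of the sampler. -/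
def jointWeight (w P T : ℕ) (r : ℝ) (s : Fin n → ZMod N)
    (p : (Fin (n + 1) → Fin (2 ^ w)) × ZMod N) : ℝ :=
  blockWeight w N (rho r) s p.1 (freq N w p.1) * sampleProb r (2 ^ w) N P T (p.1 0) p.2

/-- If the samples are almost distributed as LWE samples, then the success probability is almost that
of the oracle. -/
theorem sum_lweSample_sub_le {w P T : ℕ} (hr : 0 < r)
    (O : Oracle n N ℓ) (s t : Fin n → ZMod N) {η : ℝ} (hη : 0 ≤ η)
    {β : (Fin (n + 1) → Fin (2 ^ w)) × ZMod N → ℝ} (hβ0 : ∀ p, 0 ≤ β p)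
    (hβ : ∀ p, β p ≤ jointWeight w P T r s p)
    (hQ : ∀ y, (∑ p, if (freqVec N w p.1, p.2) = y then β p else 0) ≤
      (1 + η) * (lweSample n N (1 / r) s y).toReal) :
    ∑ q, (∏ k, (lweSample n N (1 / r) (s + t) (q k)).toReal) * (O q (s + t)).toReal -
      ((1 + η) ^ ℓ - (∑ p, β p) ^ ℓ) ≤
    ∑ z : Fin ℓ → (Fin (n + 1) → Fin (2 ^ w)) × ZMod N, (∏ k, jointWeight w P T r s (z k)) *
      (O (fun k => (freqVec N w (z k).1,
        (z k).2 + ∑ i, freqVec N w (z k).1 i * t i)) (s + t)).toReal := by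
  rw [← sum_lweSample_shift hr s t fun q => (O q (s + t)).toReal]
  obtain ⟨Q, hQQ⟩ : ∃ Q : (Fin n → ZMod N) × ZMod N → ℝ,
      ∀ y, Q y = ∑ p, if (freqVec N w p.1, p.2) = y then β p else 0 := ⟨_, fun _ => rfl⟩
  obtain ⟨F, hF⟩ : ∃ F : (Fin ℓ → (Fin n → ZMod N) × ZMod N) → ℝ,
      ∀ q, F q = (O (fun k => ((q k).1, (q k).2 + ∑ i, (q k).1 i * t i)) (s + t)).toReal :=
    ⟨_, fun _ => rfl⟩
  have hF0 : ∀ q, 0 ≤ F q := fun q => by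
    rw [hF]
    exact ENNReal.toReal_nonneg
  have h1 := sum_prod_comp (ℓ := ℓ) β (fun p => (freqVec N w p.1, p.2)) F
  have h2 := sum_prod_sub_le (ℓ := ℓ) (L := fun p => (lweSample n N (1 / r) s p).toReal)
    (Q := Q) hη (fun y => by
      rw [hQQ]
      refine Finset.sum_nonneg fun p _ => ?_
      split_ifs
      · exact hβ0 p
      · exact le_rfl) (fun _ => ENNReal.toReal_nonneg) (fun y => by
      rw [hQQ]
      exact hQ y) (sum_toReal_lweSample _ s) (f := F) hF0 fun q => by
      rw [hF]
      exact oracle_toReal_le_one O _ _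
  have h3 : ∑ y, Q y = ∑ p, β p := by
    simp only [hQQ]
    rw [Finset.sum_comm]
    simp
  rw [h3] at h2
  simp only [← hQQ] at h1
  refine le_trans (le_of_eq (by simp only [hF])) (h2.trans (h1.symm.le.trans ?_))
  refine Finset.sum_le_sum fun z _ => ?_
  rw [← hF fun k => (freqVec N w (z k).1, (z k).2)]
  exact mul_le_mul_of_nonneg_right (Finset.prod_le_prod (fun k _ => hβ0 _) fun k _ => hβ _) (hF0 _)

/-- For fixed s the secret s + t runs through all of ℤ_N^n with the shift t. Exchanging the sums
over t and over the outcomes therefore recovers the average over secrets in `lweSuccess`; the power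
in front is the nonuniformity of the sampled shift. -/
theorem le_sum_blockWeight {w P T : ℕ} (hr : 0 < r)
    (O : Oracle n N ℓ) (s : Fin n → ZMod N) {η : ℝ} (hη : 0 ≤ η)
    {β : (Fin (n + 1) → Fin (2 ^ w)) × ZMod N → ℝ} (hβ0 : ∀ p, 0 ≤ β p)
    (hβ : ∀ p, β p ≤ jointWeight w P T r s p)
    (hQ : ∀ y, (∑ p, if (freqVec N w p.1, p.2) = y then β p else 0) ≤
      (1 + η) * (lweSample n N (1 / r) s y).toReal) :
    ((2 ^ w / N : ℕ) / 2 ^ w * N : ℝ) ^ n *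
      (lweSuccess n N ℓ (1 / r) O - ((1 + η) ^ ℓ - (∑ p, β p) ^ ℓ)) ≤
    ∑ C : Fin ℓ → Fin (n + 1) → Fin (2 ^ w),
      (∏ k, blockWeight w N (rho r) s (C k) (freq N w (C k))) *
      ∑ t, ((2 ^ w / N : ℕ) / 2 ^ w : ℝ) ^ n * ∑ b : Fin ℓ → ZMod N,
        (∏ k, sampleProb r (2 ^ w) N P T (C k 0) (b k)) *
        (O (fun k => (fun i => (freq N w (C k) i : ZMod N),
          b k + ∑ i, (freq N w (C k) i : ZMod N) * t i)) (s + t)).toReal := by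
  obtain ⟨τ, hτ⟩ : ∃ τ : ℝ, τ = (2 ^ w / N : ℕ) / 2 ^ w := ⟨_, rfl⟩
  have hτ0 : 0 ≤ τ := by
    rw [hτ]
    positivity
  rw [← hτ]
  have hrhs : ∀ t : Fin n → ZMod N, ∑ C : Fin ℓ → Fin (n + 1) → Fin (2 ^ w), ∑ b : Fin ℓ → ZMod N,
      (∏ k, blockWeight w N (rho r) s (C k) (freq N w (C k))) * (τ ^ n *
        ((∏ k, sampleProb r (2 ^ w) N P T (C k 0) (b k)) *
        (O (fun k => (fun i => (freq N w (C k) i : ZMod N),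
          b k + ∑ i, (freq N w (C k) i : ZMod N) * t i)) (s + t)).toReal)) =
      τ ^ n * ∑ z : Fin ℓ → (Fin (n + 1) → Fin (2 ^ w)) × ZMod N, (∏ k, jointWeight w P T r s (z k)) *
        (O (fun k => (freqVec N w (z k).1,
          (z k).2 + ∑ i, freqVec N w (z k).1 i * t i)) (s + t)).toReal := by
    intro t
    rw [← (Equiv.arrowProdEquivProdArrow (Fin ℓ) (fun _ => Fin (n + 1) → Fin (2 ^ w))
      (fun _ => ZMod N)).symm.sum_comp, Fintype.sum_prod_type, Finset.mul_sum]
    refine Finset.sum_congr rfl fun C _ => ?_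
    rw [Finset.mul_sum]
    refine Finset.sum_congr rfl fun b _ => ?_
    simp only [jointWeight, Equiv.arrowProdEquivProdArrow_symm_apply, Finset.prod_mul_distrib]
    unfold freqVec
    ring
  simp only [Finset.mul_sum]
  rw [Finset.sum_comm]
  simp only [hrhs]
  rw [mul_pow, mul_assoc, mul_sub, lweSuccess_eq, ← Finset.mul_sum]
  refine mul_le_mul_of_nonneg_left ?_ (pow_nonneg hτ0 n)
  refine le_trans (le_of_eq ?_)
    (Finset.sum_le_sum fun t _ => sum_lweSample_sub_le hr O s t hη hβ0 hβ hQ)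
  rw [Finset.sum_sub_distrib, Finset.sum_const, Finset.card_univ, Fintype.card_fun, ZMod.card,
    Fintype.card_fin, nsmul_eq_mul, Nat.cast_pow]
  congr 1
  exact (Equiv.sum_comp (Equiv.addLeft s) fun s' => ∑ q, (∏ k, (lweSample n N (1 / r) s' (q k)).toReal) *
    (O q s').toReal).symm

theorem le_edcpSuccess {κ w P : ℕ} (hw : w = precision κ n N ℓ) (hP : P = 2 ^ winExp κ N r)
    (hℓ : 0 < ℓ) (hr : 1 < r) (O : Oracle n N ℓ) (x : Fin ℓ → Fin n → ZMod N) (s : Fin n → ZMod N)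
    {η : ℝ} (hη : 0 ≤ η) {β : (Fin (n + 1) → Fin (2 ^ w)) × ZMod N → ℝ} (hβ0 : ∀ p, 0 ≤ β p)
    (hβ : ∀ p, β p ≤ jointWeight w P (32 * (κ * κ)) r s p)
    (hQ : ∀ y, (∑ p, if (freqVec N w p.1, p.2) = y then β p else 0) ≤
      (1 + η) * (lweSample n N (1 / r) s y).toReal) :
    ((2 ^ w / N : ℕ) / 2 ^ w * N : ℝ) ^ n *
      (lweSuccess n N ℓ (1 / r) O - ((1 + η) ^ ℓ - (∑ p, β p) ^ ℓ)) ≤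
        edcpSuccess reduction κ r O x s := by
  subst hw hP
  have hr0 : 0 < r := by linarith
  refine le_trans ?_ (le_edcpSuccess_reduction (summable_rho_sq hr0) O x s
    (fun C => freq N _ C) (classicalSuccess κ r O s)
    fun C M hM => classicalSuccess_le_wp_postprocess hℓ hr s C hM)
  exact le_sum_blockWeight hr0 O s hη hβ0 hβ hQ

end Combine

/-! ### The distribution of the samples -/

section Block

variable {n N w P T : ℕ} {r Λ Γ γ : ℝ} {s : Fin n → ZMod N}

/-- The weight of the outcomes of the phase estimation. -/
def tailWeight (N w : ℕ) (C : Fin n → Fin (2 ^ w)) : ℝ :=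
  ∏ i, ‖phaseAmp w ((roundFreq N w (C i) : ℝ) / N - (C i : ℕ) / 2 ^ w)‖ ^ 2

theorem tailWeight_nonneg (N w : ℕ) (C : Fin n → Fin (2 ^ w)) : 0 ≤ tailWeight N w C :=
  Finset.prod_nonneg fun _ _ => by positivity

/-- Rounding acts coordinatewise, so outcomes with prescribed frequencies form a product set. -/
theorem sum_tailWeight_ite (w : ℕ) (y : Fin n → ZMod N) :
    (∑ C : Fin n → Fin (2 ^ w), if (fun i => (roundFreq N w (C i) : ZMod N)) = y then
      tailWeight N w C else 0) = ∏ i, freqWeight N w (y i) := by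
  simp only [freqWeight]
  rw [Finset.prod_univ_sum, Fintype.piFinset_univ]
  refine Finset.sum_congr rfl fun C _ => ?_
  split_ifs with h
  · refine Finset.prod_congr rfl fun i _ => ?_
    rw [if_pos (congrFun h i)]
  · obtain ⟨i, hi⟩ : ∃ i, (roundFreq N w (C i) : ZMod N) ≠ y i := by
      by_contra! h'
      exact h (funext h')
    exact (Finset.prod_eq_zero (Finset.mem_univ i) (if_neg hi)).symm

theorem le_sum_tailWeight [NeZero N] {w : ℕ} (hN : (N : ℝ) ^ 2 / 2 ^ w ≤ 1) :
    ((1 - (N : ℝ) ^ 2 / 2 ^ w)) ^ n * N ^ n ≤ ∑ C : Fin n → Fin (2 ^ w), tailWeight N w C := by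
  have h1 : ∑ C : Fin n → Fin (2 ^ w), tailWeight N w C =
      ∑ y : Fin n → ZMod N, ∏ i, freqWeight N w (y i) := by
    simp only [← sum_tailWeight_ite]
    rw [Finset.sum_comm]
    simp
  rw [h1, ← Fintype.sum_pow, ← mul_pow]
  refine pow_le_pow_left₀ (mul_nonneg (by linarith) (Nat.cast_nonneg N)) ?_ n
  calc (1 - (N : ℝ) ^ 2 / 2 ^ w) * N = ∑ _y : ZMod N, (1 - (N : ℝ) ^ 2 / 2 ^ w) := by
        rw [Finset.sum_const, Finset.card_univ, ZMod.card, nsmul_eq_mul, mul_comm]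
    _ ≤ _ := Finset.sum_le_sum fun y _ => le_freqWeight w y

/-- The inner product of the rounded frequencies with the secret. -/
def freqInner (N w : ℕ) (s : Fin n → ZMod N) (C : Fin n → Fin (2 ^ w)) : ℤ :=
  ∑ i, (roundFreq N w (C i) : ℤ) * (s i).val

theorem freqInner_cast [NeZero N] (w : ℕ) (s : Fin n → ZMod N) (C : Fin n → Fin (2 ^ w)) :
    (freqInner N w s C : ZMod N) = ∑ i, (roundFreq N w (C i) : ZMod N) * s i := by
  rw [freqInner]
  push_cast
  simp only [ZMod.natCast_zmod_val]

/-- The weight of a block, for the exact Gaussian distributions. -/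
def idealWeight (w P : ℕ) (r Λ : ℝ) (s : Fin n → ZMod N)
    (p : (Fin (n + 1) → Fin (2 ^ w)) × ZMod N) : ℝ :=
  1 / N ^ n * tailWeight N w (fun i => p.1 i.succ) * (Λ / 2 ^ w) *
    (gaussSum (1 / (Real.sqrt 2 * r)) ((p.1 0 : ℕ) / (2 ^ w : ℕ) +
      (freqInner N w s fun i => p.1 i.succ : ℤ) / N) * windowSum r (2 ^ w) N P (p.1 0) p.2)

theorem idealWeight_nonneg (hr : 0 < r) (hΛ : 0 ≤ Λ) (p : (Fin (n + 1) → Fin (2 ^ w)) × ZMod N) :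
    0 ≤ idealWeight w P r Λ s p := by
  have h1 := tailWeight_nonneg N w fun i => p.1 i.succ
  have h2 := windowSum_nonneg r (2 ^ w) N P (p.1 0) p.2
  have h3 : 0 ≤ gaussSum (1 / (Real.sqrt 2 * r)) ((p.1 0 : ℕ) / (2 ^ w : ℕ) +
      (freqInner N w s fun i => p.1 i.succ : ℤ) / N) := (gaussSum_pos (by positivity) _).le
  rw [idealWeight]
  positivity

/-- The amplitude estimate with constant Γ and the sampler estimate with constant γ are pointwise
and can be multiplied. What results involves exact Gaussian sums only. -/
theorem idealWeight_le_jointWeight (hr : 0 < r) (hγ0 : 0 ≤ γ)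
    (hΓ : ∀ θ, Γ * gaussSum (1 / (Real.sqrt 2 * r)) θ ≤ ‖truncSum (rho r) (2 ^ w) θ‖ ^ 2)
    (hγ : ∀ c (b : ZMod N), γ * windowSum r (2 ^ w) N P c b ≤ sampleProb r (2 ^ w) N P T c b)
    (p : (Fin (n + 1) → Fin (2 ^ w)) × ZMod N) :
    idealWeight w P r (Γ * γ) s p ≤ jointWeight w P T r s p := by
  have h1 := tailWeight_nonneg N w fun i => p.1 i.succ
  have hθ : ((p.1 0 : ℕ) : ℝ) / (2 ^ w : ℕ) + (freqInner N w s fun i => p.1 i.succ : ℤ) / N =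
      ((p.1 0 : ℕ) / 2 ^ w + ∑ i, (freq N w p.1 i : ℝ) * (s i).val / N) := by
    rw [freqInner, ← Finset.sum_div]
    push_cast
    rfl
  have h2 := hΓ (((p.1 0 : ℕ) : ℝ) / (2 ^ w : ℕ) + (freqInner N w s fun i => p.1 i.succ : ℤ) / N)
  have h3 := hγ (p.1 0) p.2
  have h4 := windowSum_nonneg r (2 ^ w) N P (p.1 0) p.2
  have h5 : 0 ≤ gaussSum (1 / (Real.sqrt 2 * r)) ((p.1 0 : ℕ) / (2 ^ w : ℕ) +
      (freqInner N w s fun i => p.1 i.succ : ℤ) / N) := (gaussSum_pos (by positivity) _).le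
  have h6 := mul_le_mul h2 h3 (by positivity) (by positivity)
  have h7 : 0 ≤ 1 / (2 ^ w * (N : ℝ) ^ n) * tailWeight N w (fun i => p.1 i.succ) := by positivity
  have h8 := mul_le_mul_of_nonneg_left h6 h7
  rw [hθ] at h8
  rw [idealWeight, jointWeight, blockWeight, hθ]
  refine le_trans (le_of_eq ?_) (h8.trans (le_of_eq ?_))
  · field_simp
  · rw [tailWeight]
    simp only [freq, roundFreq]
    ring

theorem sum_cons {W : ℕ} (F : (Fin (n + 1) → Fin W) → ℝ) :
    ∑ C, F C = ∑ C' : Fin n → Fin W, ∑ c : Fin W, F (Fin.cons c C') := by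
  rw [← (Fin.consEquiv fun _ : Fin (n + 1) => Fin W).sum_comp, Fintype.sum_prod_type,
    Finset.sum_comm]
  rfl

theorem idealWeight_cons (C' : Fin n → Fin (2 ^ w)) (c : Fin (2 ^ w)) (b : ZMod N) :
    idealWeight w P r Λ s (Fin.cons c C', b) = 1 / N ^ n * tailWeight N w C' * (Λ / 2 ^ w) *
      (gaussSum (1 / (Real.sqrt 2 * r)) ((c : ℕ) / (2 ^ w : ℕ) + (freqInner N w s C' : ℤ) / N) *
        windowSum r (2 ^ w) N P c b) := by
  simp only [idealWeight, Fin.cons_zero, Fin.cons_succ]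

/-- Over the outcomes with a given vector part, the phase estimation weights sum to at most 1 and
the sum over the integer's register gives `errorWeight`, that is, the LWE probability up to
normalization. The constant in front is shown to be close to 1 in `upper_const_le`. -/
theorem sum_idealWeight_ite_le [NeZero N] (hr : 0 < r) (hΛ : 0 ≤ Λ) (hW : 1 ≤ (2 ^ w : ℕ) / (2 * r))
    (y : (Fin n → ZMod N) × ZMod N) :
    (∑ p, if (freqVec N w p.1, p.2) = y then idealWeight w P r Λ s p else 0) ≤
      Λ * ((1 + 3 * Real.exp (-Real.pi * ((2 ^ w : ℕ) / (2 * r)) ^ 2)) / (2 * r)) *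
        gaussSum (N / r) 0 * (lweSample n N (1 / r) s y).toReal := by
  obtain ⟨y, b⟩ := y
  have hN : (0 : ℝ) < N := by exact_mod_cast NeZero.pos N
  set U := 1 + 3 * Real.exp (-Real.pi * ((2 ^ w : ℕ) / (2 * r)) ^ 2) with hU
  have hU0 : 0 < U := by positivity
  set D := errorWeight N r (b - ∑ i, y i * s i) with hD
  have hD0 : 0 ≤ D := errorWeight_nonneg _ _ _
  have h1 : (∑ p, if (freqVec N w p.1, p.2) = (y, b) then idealWeight w P r Λ s p else 0) =
      ∑ C' : Fin n → Fin (2 ^ w), if (fun i => (roundFreq N w (C' i) : ZMod N)) = y then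
        1 / N ^ n * tailWeight N w C' * (Λ / 2 ^ w) * ∑ c : Fin (2 ^ w),
          gaussSum (1 / (Real.sqrt 2 * r)) ((c : ℕ) / (2 ^ w : ℕ) + (freqInner N w s C' : ℤ) / N) *
            windowSum r (2 ^ w) N P c b else 0 := by
    rw [Fintype.sum_prod_type, sum_cons]
    refine Finset.sum_congr rfl fun C' _ => ?_
    have hv : ∀ c : Fin (2 ^ w), freqVec N w (Fin.cons c C') =
        fun i => (roundFreq N w (C' i) : ZMod N) := by
      intro c
      funext i
      simp only [freqVec, freq, roundFreq, Fin.cons_succ]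
    simp only [hv, Prod.mk.injEq]
    split_ifs with h
    · simp only [h, true_and, Finset.sum_ite_eq', Finset.mem_univ, if_true, idealWeight_cons,
        Finset.mul_sum]
    · simp only [h, false_and, if_false, Finset.sum_const_zero]
  have h2 : ∀ C' : Fin n → Fin (2 ^ w), (if (fun i => (roundFreq N w (C' i) : ZMod N)) = y then
        1 / N ^ n * tailWeight N w C' * (Λ / 2 ^ w) * ∑ c : Fin (2 ^ w),
          gaussSum (1 / (Real.sqrt 2 * r)) ((c : ℕ) / (2 ^ w : ℕ) + (freqInner N w s C' : ℤ) / N) *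
            windowSum r (2 ^ w) N P c b else 0) ≤
      1 / N ^ n * (Λ * (U / (2 * r)) * D) *
        (if (fun i => (roundFreq N w (C' i) : ZMod N)) = y then tailWeight N w C' else 0) := by
    intro C'
    split_ifs with h
    · have h3 := sum_gaussSum_mul_windowSum_le (W := 2 ^ w) (P := P) hr hW (freqInner N w s C') b
      have h4 : b - (freqInner N w s C' : ZMod N) = b - ∑ i, y i * s i := by
        rw [freqInner_cast]
        subst h
        rfl
      rw [h4, ← hD, ← hU] at h3
      have h5 := tailWeight_nonneg N w C'
      have h6 : 0 ≤ 1 / (N : ℝ) ^ n * tailWeight N w C' * (Λ / 2 ^ w) := by positivity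
      refine (mul_le_mul_of_nonneg_left h3 h6).trans (le_of_eq ?_)
      push_cast
      field_simp
    · rw [mul_zero]
  have h3 : ∏ i, freqWeight N w (y i) ≤ 1 :=
    Finset.prod_le_one (fun i _ => freqWeight_nonneg _ _ _) fun i _ => freqWeight_le_one _ _
  rw [h1]
  refine (Finset.sum_le_sum fun C' _ => h2 C').trans ?_
  rw [← Finset.mul_sum, sum_tailWeight_ite, toReal_lweSample hr, ← hD]
  have h4 : 0 < gaussSum (N / r) 0 := gaussSum_pos (by positivity) 0
  refine (mul_le_of_le_one_right (by positivity) h3).trans (le_of_eq ?_)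
  field_simp

/-- Summing over the sampled value turns the window sum into the acceptance mass, which is bounded
below uniformly; the remaining Gaussian sum over the outcomes is almost constant, and the rounding
of n coordinates costs a factor (1 - N²/2^w)^n. -/
theorem le_sum_idealWeight [NeZero N] {a : ℝ} (hr : 0 < r) (hP : 0 < P) (hΛ : 0 ≤ Λ)
    (hW : 1 ≤ (2 ^ w : ℕ) / (Real.sqrt 2 * r)) (hN : (N : ℝ) ^ 2 / 2 ^ w ≤ 1) (ha0 : 0 ≤ a)
    (ha : ∀ c, a ≤ P * roundProb r (2 ^ w) N P c) :
    (1 - (N : ℝ) ^ 2 / 2 ^ w) ^ n *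
      (Λ * ((1 - 3 * Real.exp (-Real.pi * ((2 ^ w : ℕ) / (Real.sqrt 2 * r)) ^ 2)) /
        (Real.sqrt 2 * r)) * a) ≤ ∑ p, idealWeight w P r Λ s p := by
  have hN0 : (0 : ℝ) < N := by exact_mod_cast NeZero.pos N
  set V := 1 - 3 * Real.exp (-Real.pi * ((2 ^ w : ℕ) / (Real.sqrt 2 * r)) ^ 2) with hV
  have hV0 : 0 ≤ V := by
    have := exp_neg_pi_mul_sq_le hW
    rw [hV]
    linarith
  have h1 : ∑ p, idealWeight w P r Λ s p = ∑ C' : Fin n → Fin (2 ^ w),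
      1 / N ^ n * tailWeight N w C' * (Λ / 2 ^ w) * ∑ c : Fin (2 ^ w),
        gaussSum (1 / (Real.sqrt 2 * r)) ((c : ℕ) / (2 ^ w : ℕ) + (freqInner N w s C' : ℤ) / N) *
          (P * roundProb r (2 ^ w) N P c) := by
    rw [Fintype.sum_prod_type, sum_cons]
    refine Finset.sum_congr rfl fun C' _ => ?_
    simp only [idealWeight_cons, ← Finset.mul_sum, sum_windowSum r _ _ _ hP]
  rw [h1]
  have h2 : ∀ C' : Fin n → Fin (2 ^ w), 1 / N ^ n * (Λ * (V / (Real.sqrt 2 * r)) * a) *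
      tailWeight N w C' ≤ 1 / N ^ n * tailWeight N w C' * (Λ / 2 ^ w) * ∑ c : Fin (2 ^ w),
        gaussSum (1 / (Real.sqrt 2 * r)) ((c : ℕ) / (2 ^ w : ℕ) + (freqInner N w s C' : ℤ) / N) *
          (P * roundProb r (2 ^ w) N P c) := by
    intro C'
    have h3 := sum_gaussSum_mul_le (W := 2 ^ w) hr hW ((freqInner N w s C' : ℤ) / N)
      (p := fun c => P * roundProb r (2 ^ w) N P c) ha0 ha
    have h5 := tailWeight_nonneg N w C'
    have h6 : 0 ≤ 1 / (N : ℝ) ^ n * tailWeight N w C' * (Λ / 2 ^ w) := by positivity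
    refine le_trans (le_of_eq ?_) (mul_le_mul_of_nonneg_left h3 h6)
    rw [← hV]
    push_cast
    field_simp
  refine le_trans ?_ (Finset.sum_le_sum fun C' _ => h2 C')
  rw [← Finset.mul_sum]
  refine le_trans (le_of_eq ?_) (mul_le_mul_of_nonneg_left (le_sum_tailWeight hN) (by positivity))
  field_simp

end Block

/-! ### The loss of the reduction -/

/-- The first power is at most exp(4εℓ) ≤ 1 + 8εℓ, the second at least 1 - 8εℓ by Bernoulli. -/
theorem pow_sub_pow_le {ε m : ℝ} {ℓ : ℕ} (hε0 : 0 ≤ ε) (hε : ε ≤ 1 / 8) (hℓ : 4 * ε * ℓ ≤ 1)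
    (hm : 1 - 8 * ε ≤ m) : (1 + 4 * ε) ^ ℓ - m ^ ℓ ≤ 16 * ε * ℓ := by
  have h1 : (1 + 4 * ε) ^ ℓ ≤ 1 + 8 * ε * ℓ := by
    have h0 : (0 : ℝ) ≤ 4 * ε * ℓ := by positivity
    have h2 : (1 + 4 * ε) ^ ℓ ≤ Real.exp (4 * ε * ℓ) := by
      rw [mul_comm (4 * ε), Real.exp_nat_mul]
      refine pow_le_pow_left₀ (by positivity) ?_ ℓ
      linarith [Real.add_one_le_exp (4 * ε)]
    have h3 := Real.abs_exp_sub_one_le (x := 4 * ε * ℓ) (by rwa [abs_of_nonneg h0])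
    rw [abs_of_nonneg h0] at h3
    linarith [(abs_le.1 h3).2]
  have h2 : 1 - 8 * ε * ℓ ≤ m ^ ℓ := by
    refine le_trans ?_ (pow_le_pow_left₀ (by linarith) hm ℓ)
    have := one_add_mul_le_pow (a := -(8 * ε)) (by linarith) ℓ
    rw [← sub_eq_add_neg] at this
    linarith
  linarith

theorem le_mul_of_one_sub {ε a b x y : ℝ} (hx : (1 - x * ε) ≤ a) (hy : 1 - y * ε ≤ b) (hε : 0 ≤ ε)
    (hx0 : 0 ≤ x) (hy0 : 0 ≤ y) (hx1 : 0 ≤ 1 - x * ε) (hy1 : 0 ≤ 1 - y * ε) :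
    1 - (x + y) * ε ≤ a * b := by
  have h1 := mul_le_mul hx hy hy1 (hx1.trans hx)
  have h2 : 0 ≤ x * ε * (y * ε) := by positivity
  linarith

theorem one_sub_le_inv {ε : ℝ} (hε : 0 ≤ ε) : 1 - 1 * ε ≤ 1 / (1 + ε) := by
  rw [le_div_iff₀ (by linarith)]
  nlinarith [mul_self_nonneg ε]

/-- Without errors the product is r√2 · √2/ν · 1/(2r) · ν = 1. With them it is at most (1 + ε)²/(1 -
ε), which is below 1 + 4ε for ε ≤ 1/8. -/
theorem upper_const_le {r σ ν ε U e₁ e₂ Z₁ Z₃ t : ℝ} (hr : 0 < r) (hν : 0 < ν)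
    (hσ : σ = ν / Real.sqrt 2) (hε0 : 0 ≤ ε) (hε : ε ≤ 1 / 8) (hU0 : 0 ≤ U) (hU : U ≤ 1 + ε)
    (he₁0 : 0 ≤ e₁) (he₁1 : e₁ ≤ 1) (he₂ : 0 ≤ e₂) (ht0 : 0 ≤ t)
    (hZ₁ : (1 - ε) * (r / Real.sqrt 2) ≤ Z₁) (hZ₃0 : 0 ≤ Z₃) (hZ₃ : Z₃ ≤ (1 + ε) * ν) :
    (1 - t) * (r ^ 2 / Z₁) * ((1 - e₁) / ((1 + e₂) * σ)) * (U / (2 * r)) * Z₃ ≤ 1 + 4 * ε := by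
  have h2 : (0 : ℝ) < Real.sqrt 2 := by positivity
  have hs2 : Real.sqrt 2 * Real.sqrt 2 = 2 := Real.mul_self_sqrt (by norm_num)
  have hσ0 : 0 < σ := by rw [hσ]; positivity
  have hr2 : 0 < r / Real.sqrt 2 := by positivity
  have hZ0 : 0 < (1 - ε) * (r / Real.sqrt 2) := mul_pos (by linarith) hr2
  have hZ1 : 0 < Z₁ := hZ0.trans_le hZ₁
  have hA : (1 - t) * (r ^ 2 / Z₁) ≤ r ^ 2 / ((1 - ε) * (r / Real.sqrt 2)) := by
    refine (mul_le_of_le_one_left (by positivity) (by linarith)).trans ?_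
    exact div_le_div_of_nonneg_left (by positivity) hZ0 hZ₁
  have hB : (1 - e₁) / ((1 + e₂) * σ) ≤ 1 / σ := by
    refine div_le_div₀ zero_le_one (by linarith) hσ0 ?_
    nlinarith
  have hB0 : 0 ≤ (1 - e₁) / ((1 + e₂) * σ) := div_nonneg (by linarith) (by positivity)
  have hC : U / (2 * r) ≤ (1 + ε) / (2 * r) := div_le_div_of_nonneg_right hU (by positivity)
  have hA0 : 0 ≤ r ^ 2 / ((1 - ε) * (r / Real.sqrt 2)) := by positivity
  calc _ ≤ r ^ 2 / ((1 - ε) * (r / Real.sqrt 2)) * (1 / σ) * ((1 + ε) / (2 * r)) * ((1 + ε) * ν) := by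
        gcongr
    _ = (1 + ε) ^ 2 / (1 - ε) := by
        have : 1 - ε ≠ 0 := by linarith
        rw [hσ]
        field_simp
        linear_combination hs2
    _ ≤ 1 + 4 * ε := by
        rw [div_le_iff₀ (by linarith)]
        nlinarith

/-- The product splits into seven factors near 1. Six of them lose at most ε, and the acceptance
mass loses 2ε, which makes 8ε. -/
theorem le_lower_const {r σ ε p V e₁ e₂ Z₁ t A : ℝ} (hr : 0 < r) (hσ : 0 < σ)
    (hε0 : 0 ≤ ε) (hε : ε ≤ 1 / 8) (hp : 1 - ε ≤ p) (hV : 1 - ε ≤ V)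
    (he₁ : e₁ ≤ ε) (he₂0 : 0 ≤ e₂) (he₂ : e₂ ≤ ε) (ht : t ≤ ε) (hZ0 : 0 < Z₁)
    (hZ₁ : Z₁ ≤ (1 + ε) * (r / Real.sqrt 2)) (hA : (1 - 2 * ε) * σ ≤ A) :
    1 - 8 * ε ≤ p * ((1 - t) * (r ^ 2 / Z₁) * ((1 - e₁) / ((1 + e₂) * σ)) *
      (V / (Real.sqrt 2 * r)) * A) := by
  have h2 : (0 : ℝ) < Real.sqrt 2 := by positivity
  have hs2 : Real.sqrt 2 ^ 2 = 2 := Real.sq_sqrt (by norm_num)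
  have g1 : 1 - 1 * ε ≤ Real.sqrt 2 * (r / 2 / Z₁) * 1 := by
    refine (one_sub_le_inv hε0).trans ?_
    rw [mul_one, ← mul_div_assoc, div_le_div_iff₀ (by linarith) hZ0, one_mul]
    refine hZ₁.trans (le_of_eq ?_)
    field_simp
    linear_combination -hs2
  have g2 : 1 - 1 * ε ≤ 1 / (1 + e₂) :=
    (one_sub_le_inv hε0).trans (one_div_le_one_div_of_le (by linarith) (by linarith))
  have g3 : 1 - 2 * ε ≤ A / σ := by rwa [le_div_iff₀ hσ]
  have k1 := le_mul_of_one_sub (x := 1) (y := 1) (by linarith) (by linarith : 1 - 1 * ε ≤ V) hε0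
    (by norm_num) (by norm_num) (by linarith) (by linarith) (a := p)
  have k2 := le_mul_of_one_sub k1 (by linarith : 1 - 1 * ε ≤ 1 - t) hε0
    (by norm_num) (by norm_num) (by linarith) (by linarith)
  have k3 := le_mul_of_one_sub k2 (by linarith : 1 - 1 * ε ≤ 1 - e₁) hε0
    (by norm_num) (by norm_num) (by linarith) (by linarith)
  have k4 := le_mul_of_one_sub k3 g1 hε0
    (by norm_num) (by norm_num) (by linarith) (by linarith)
  have k5 := le_mul_of_one_sub k4 g2 hε0
    (by norm_num) (by norm_num) (by linarith) (by linarith)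
  have k6 := le_mul_of_one_sub k5 g3 hε0
    (by norm_num) (by norm_num) (by linarith) (by linarith)
  refine le_trans (by linarith) (k6.trans (le_of_eq ?_))
  field_simp
  linear_combination (p * V * (1 - t) * (1 - e₁) * A) * hs2

section Loss

variable {κ n N ℓ : ℕ} [NeZero N] {r ε : ℝ}

/-- The reduction is almost as good as the oracle if all error terms are bounded by `ε`. -/
theorem le_edcpSuccess_of_error {w P' : ℕ} (hw : w + 1 = precision κ n N ℓ)
    (hP' : 2 * P' = 2 ^ winExp κ N r) (hℓ : 0 < ℓ)
    (hr : 1 < r) (hr2 : 1 ≤ r / Real.sqrt 2) (hσ : 1 ≤ N / (Real.sqrt 2 * r))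
    (hW : 1 ≤ (2 ^ (w + 1) : ℕ) / (2 * r)) (hε0 : 0 ≤ ε) (hε : ε ≤ 1 / 8) (hεℓ : 4 * ε * ℓ ≤ 1)
    (h₁ : 3 * Real.exp (-Real.pi * (r / Real.sqrt 2) ^ 2) ≤ ε)
    (h₂ : 3 * Real.exp (-Real.pi * (N / (Real.sqrt 2 * r)) ^ 2) ≤ ε)
    (h₃ : 3 * Real.exp (-Real.pi * (P' - 1 : ℝ) ^ 2 / (2 * (N / (Real.sqrt 2 * r)) ^ 2)) ≤ ε)
    (h₄ : 3 * Real.exp (-Real.pi * ((2 ^ (w + 1) : ℕ) / (2 * r)) ^ 2) ≤ ε)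
    (h₅ : truncError r (2 ^ w) ≤ ε)
    (h₆ : Real.exp (-(N / (Real.sqrt 2 * r) / (2 * (2 * P' : ℕ)) * (32 * (κ * κ) : ℕ))) ≤ ε)
    (h₇ : n * (N ^ 2 / 2 ^ (w + 1)) ≤ ε) (h₈ : (N : ℝ) ^ 2 / 2 ^ (w + 1) ≤ 1)
    (O : Oracle n N ℓ) (x : Fin ℓ → Fin n → ZMod N) (s : Fin n → ZMod N) :
    ((2 ^ (w + 1) / N : ℕ) / 2 ^ (w + 1) * N : ℝ) ^ n *
      (lweSuccess n N ℓ (1 / r) O - 16 * ε * ℓ) ≤ edcpSuccess reduction κ r O x s := by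
  have hr0 : 0 < r := by linarith only [hr]
  have hN : (0 : ℝ) < N := by exact_mod_cast NeZero.pos N
  have h2 : (0 : ℝ) < Real.sqrt 2 := by positivity
  have hs2 : Real.sqrt 2 ≤ 2 := by
    rw [Real.sqrt_le_left (by norm_num)]
    norm_num
  have hP0 : 0 < 2 * P' := hP' ▸ Nat.two_pow_pos _
  obtain ⟨σ, hσd⟩ : ∃ σ : ℝ, σ = N / (Real.sqrt 2 * r) := ⟨_, rfl⟩
  have hσ0 : 0 < σ := by rw [hσd]; positivity
  -- This is half of the ideal acceptance probability σ/P; since (1 - 2ε)σ ≥ σ/2, it is a valid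
  -- lower bound that does not depend on the outcome.
  obtain ⟨a, ha⟩ : ∃ a : ℝ, a = σ / (2 * (2 * P' : ℕ)) := ⟨_, rfl⟩
  have hP0' : (0 : ℝ) < (2 * P' : ℕ) := by exact_mod_cast hP0
  have ha0 : 0 < a := by rw [ha]; positivity
  have hmass : ∀ c, (1 - 2 * ε) * σ ≤ (2 * P' : ℕ) * roundProb r (2 ^ (w + 1)) N (2 * P') c := by
    intro c
    refine le_trans ?_ (le_mul_roundProb (W := 2 ^ (w + 1)) (C := c) (by positivity) (by omega) hσ)
    rw [← hσd] at h₂ h₃ ⊢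
    exact mul_le_mul_of_nonneg_right (by linarith only [h₂, h₃]) hσ0.le
  have hround : ∀ c, a ≤ roundProb r (2 ^ (w + 1)) N (2 * P') c := by
    intro c
    have h := hmass c
    rw [ha, div_le_iff₀ (by positivity)]
    nlinarith only [h, mul_nonneg hε0 hσ0.le, mul_le_mul_of_nonneg_right hε hσ0.le]
  -- `Γ` collects the truncation error and the normalization of the EDCP state; `γ` collects the
  -- failure probability and the normalization of the rejection sampler.
  obtain ⟨Γ, hΓd⟩ : ∃ Γ : ℝ, Γ = (1 - truncError r (2 ^ w)) *
    (r ^ 2 / gaussSum (r / Real.sqrt 2) 0) := ⟨_, rfl⟩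
  obtain ⟨γ, hγd⟩ : ∃ γ : ℝ, γ = (1 - Real.exp (-(a * (32 * (κ * κ) : ℕ)))) /
    ((1 + 3 * Real.exp (-Real.pi * σ ^ 2)) * σ) := ⟨_, rfl⟩
  have ht0 : 0 ≤ truncError r (2 ^ w) := by rw [truncError]; positivity
  have hZ0 : 0 < gaussSum (r / Real.sqrt 2) 0 := gaussSum_pos (by positivity) 0
  have he1 : Real.exp (-(a * (32 * (κ * κ) : ℕ))) ≤ ε := by rw [ha, hσd]; exact h₆
  have hΓ0 : 0 ≤ Γ := by
    rw [hΓd]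
    exact mul_nonneg (by linarith only [h₅, hε]) (by positivity)
  have hγ0 : 0 ≤ γ := by
    rw [hγd]
    exact div_nonneg (by linarith only [he1, hε]) (by positivity)
  have hΛ0 : 0 ≤ Γ * γ := mul_nonneg hΓ0 hγ0
  have hW2 : (2 ^ (w + 1) : ℕ) / (2 * r) ≤ (2 ^ (w + 1) : ℕ) / (Real.sqrt 2 * r) :=
    div_le_div_of_nonneg_left (by positivity) (by positivity)
      (mul_le_mul_of_nonneg_right hs2 hr0.le)
  have hV : 1 - ε ≤ 1 - 3 * Real.exp (-Real.pi * ((2 ^ (w + 1) : ℕ) / (Real.sqrt 2 * r)) ^ 2) := by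
    have : Real.exp (-Real.pi * ((2 ^ (w + 1) : ℕ) / (Real.sqrt 2 * r)) ^ 2) ≤
        Real.exp (-Real.pi * ((2 ^ (w + 1) : ℕ) / (2 * r)) ^ 2) := by
      refine Real.exp_le_exp.2 ?_
      have := pow_le_pow_left₀ (by positivity) hW2 2
      rw [neg_mul, neg_mul, neg_le_neg_iff]
      exact mul_le_mul_of_nonneg_left this Real.pi_pos.le
    linarith only [this, h₄]
  have hZ3 : gaussSum (N / r) 0 ≤ (1 + ε) * (N / r) := by
    have hle : σ ≤ N / r := by
      rw [hσd]
      refine div_le_div_of_nonneg_left hN.le hr0 ?_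
      exact le_mul_of_one_le_left hr0.le (Real.one_le_sqrt.2 (by norm_num))
    refine (gaussSum_le (hσ.trans (hσd ▸ hle)) 0).trans ?_
    refine mul_le_mul_of_nonneg_right ?_ (by positivity)
    have : Real.exp (-Real.pi * (N / r) ^ 2) ≤ Real.exp (-Real.pi * σ ^ 2) := by
      refine Real.exp_le_exp.2 ?_
      have := pow_le_pow_left₀ hσ0.le hle 2
      rw [neg_mul, neg_mul, neg_le_neg_iff]
      exact mul_le_mul_of_nonneg_left this Real.pi_pos.le
    rw [← hσd] at h₂
    linarith only [this, h₂]
  have hZ1 : (1 - ε) * (r / Real.sqrt 2) ≤ gaussSum (r / Real.sqrt 2) 0 :=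
    le_trans (mul_le_mul_of_nonneg_right (by linarith only [h₁]) (by positivity)) (le_gaussSum hr2 0)
  have hZ1' : gaussSum (r / Real.sqrt 2) 0 ≤ (1 + ε) * (r / Real.sqrt 2) :=
    (gaussSum_le hr2 0).trans (mul_le_mul_of_nonneg_right (by linarith only [h₁]) (by positivity))
  have hup : Γ * γ * ((1 + 3 * Real.exp (-Real.pi * ((2 ^ (w + 1) : ℕ) / (2 * r)) ^ 2)) / (2 * r)) *
      gaussSum (N / r) 0 ≤ 1 + 4 * ε := by
    rw [hΓd, hγd]
    exact upper_const_le hr0 (show 0 < N / r by positivity) (by rw [hσd]; field_simp) hε0 hε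
      (by positivity) (by linarith only [h₄]) (Real.exp_pos _).le (by linarith only [he1, hε])
      (by positivity) ht0
      hZ1 (gaussSum_pos (by positivity) 0).le hZ3
  have hN1 : 1 - ε ≤ (1 - (N : ℝ) ^ 2 / 2 ^ (w + 1)) ^ n := by
    have := one_add_mul_le_pow (a := -((N : ℝ) ^ 2 / 2 ^ (w + 1))) (by linarith only [h₈]) n
    rw [← sub_eq_add_neg] at this
    linarith only [this, h₇]
  have hlow : 1 - 8 * ε ≤ ∑ p, idealWeight (w + 1) (2 * P') r (Γ * γ) s p := by
    refine le_trans ?_ (le_sum_idealWeight (a := (1 - 2 * ε) * σ) hr0 hP0 hΛ0 (hW.trans hW2) h₈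
      (mul_nonneg (by linarith only [hε]) hσ0.le) hmass)
    rw [hΓd, hγd]
    rw [← hσd] at h₂
    exact le_lower_const hr0 hσ0 hε0 hε hN1 hV he1 (by positivity) h₂ h₅ hZ0 hZ1' le_rfl
  have hloss := pow_sub_pow_le hε0 hε hεℓ hlow
  refine le_trans ?_ (le_edcpSuccess hw hP' hℓ hr O x s (η := 4 * ε) (by linarith only [hε0])
    (idealWeight_nonneg (s := s) hr0 hΛ0)
    (idealWeight_le_jointWeight hr0 hγ0 (fun θ => ?_) (fun c b => ?_))
    (fun y => (sum_idealWeight_ite_le hr0 hΛ0 hW y).trans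
      (mul_le_mul_of_nonneg_right hup ENNReal.toReal_nonneg)))
  · exact mul_le_mul_of_nonneg_left (by linarith only [hloss]) (by positivity)
  · have := le_sq_norm_truncSum hr.le (2 ^ w) θ
    rw [← hΓd, ← pow_succ'] at this
    exact this
  · rw [hγd]
    have := le_sampleProb (T := 32 * (κ * κ)) hP0 hσ ha0 (hround c) b
    rw [← hσd] at this
    exact this

end Loss

/-! ### Asymptotics -/

/-- The summands of the precision are chosen for these factors: three times the size of `N` gives
N³, 2κ gives 4^κ, the size of ℓ(n+1) gives that number, and 8 gives 256. -/
theorem mul_le_two_pow_precision (κ n N ℓ : ℕ) :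
    N ^ 3 * 4 ^ κ * (ℓ * (n + 1)) * 256 ≤ 2 ^ precision κ n N ℓ := by
  have h1 : N ^ 3 ≤ (2 ^ N.size) ^ 3 := Nat.pow_le_pow_left (Nat.lt_size_self N).le 3
  have h2 := (Nat.lt_size_self (ℓ * (n + 1))).le
  have h3 : (2 : ℕ) ^ precision κ n N ℓ =
      (2 ^ N.size) ^ 3 * 4 ^ κ * 2 ^ (ℓ * (n + 1)).size * 256 := by
    rw [show (4 : ℕ) = 2 ^ 2 by rfl, show (256 : ℕ) = 2 ^ 8 by rfl, ← pow_mul, ← pow_mul, ← pow_add,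
      ← pow_add, ← pow_add, precision]
    congr 1
    ring
  rw [h3]
  gcongr

theorem exp_le_four_pow (κ : ℕ) : Real.exp κ ≤ 4 ^ κ := by
  rw [← Real.exp_one_pow]
  exact pow_le_pow_left₀ (Real.exp_pos 1).le (by linarith [Real.exp_one_lt_d9]) κ

section Bounds

variable {κ n N ℓ W : ℕ} {r A B δ : ℝ}

/-- All error terms are brought to the common form 6·exp(-δκ); the constant 6 is the one in
`truncError`. -/
theorem three_mul_exp_neg_le {x : ℝ} (h : δ * κ ≤ x) :
    3 * Real.exp (-x) ≤ 6 * Real.exp (-(δ * κ)) := by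
  have := Real.exp_le_exp.2 (neg_le_neg h)
  linarith [Real.exp_pos (-(δ * κ))]

theorem error_width (hA : 0 < A) (h : Real.sqrt κ ≤ A * r) (hδ : δ ≤ Real.pi / (2 * A ^ 2)) :
    3 * Real.exp (-Real.pi * (r / Real.sqrt 2) ^ 2) ≤ 6 * Real.exp (-(δ * κ)) := by
  have h1 : (κ : ℝ) ≤ A ^ 2 * r ^ 2 := by
    have := pow_le_pow_left₀ (Real.sqrt_nonneg _) h 2
    rwa [Real.sq_sqrt (Nat.cast_nonneg κ), mul_pow] at this
  rw [neg_mul]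
  refine three_mul_exp_neg_le ?_
  rw [div_pow, Real.sq_sqrt (by norm_num)]
  calc δ * κ ≤ Real.pi / (2 * A ^ 2) * (A ^ 2 * r ^ 2) :=
        mul_le_mul hδ h1 (Nat.cast_nonneg κ) (by positivity)
    _ = _ := by field_simp

theorem error_noise (hB : 0 < B) (hr : 0 < r) (h : Real.sqrt κ * r ≤ B * N)
    (hδ : δ ≤ Real.pi / (2 * B ^ 2)) :
    3 * Real.exp (-Real.pi * (N / (Real.sqrt 2 * r)) ^ 2) ≤ 6 * Real.exp (-(δ * κ)) := by
  have h1 : Real.sqrt κ ≤ B * (N / r) := by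
    rw [← mul_div_assoc, le_div_iff₀ hr]
    exact h
  have := error_width hB h1 hδ
  rwa [div_div, mul_comm r] at this

/-- The window gives P' ≥ 2κN/r, and κN/r ≥ 1 absorbs the unit lost by rounding the centre, so P' -
1 ≥ κN/r remains. -/
theorem error_window {P' : ℕ} (hκ : 1 ≤ κ) (hr : 0 < r) (hr2 : r ≤ N)
    (hP : 4 * κ * N / r ≤ (2 * P' : ℕ)) (hδ : δ ≤ 1) :
    3 * Real.exp (-Real.pi * (P' - 1 : ℝ) ^ 2 / (2 * (N / (Real.sqrt 2 * r)) ^ 2)) ≤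
      6 * Real.exp (-(δ * κ)) := by
  have hκ' : (1 : ℝ) ≤ κ := by exact_mod_cast hκ
  have hx : 1 ≤ N / r := by rwa [le_div_iff₀ hr, one_mul]
  obtain ⟨y, hy⟩ : ∃ y : ℝ, y = N / r := ⟨_, rfl⟩
  have e1 : 4 * κ * N / r = 4 * (κ * y) := by rw [hy]; ring
  have e2 : 2 * (N / (Real.sqrt 2 * r)) ^ 2 = y ^ 2 := by
    rw [hy, div_pow, div_pow, mul_pow, Real.sq_sqrt (by norm_num)]
    field_simp
  rw [← hy] at hx
  rw [e1] at hP
  push_cast at hP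
  have hy1 : 1 ≤ κ * y := by nlinarith
  have h1 : κ * y ≤ P' - 1 := by linarith
  rw [e2, neg_mul, neg_div]
  refine three_mul_exp_neg_le ?_
  rw [le_div_iff₀ (by positivity)]
  have h2 := pow_le_pow_left₀ (by positivity) h1 2
  have h3 := Real.pi_gt_three
  have h4 : δ * κ ≤ κ ^ 2 := by nlinarith
  calc δ * κ * y ^ 2 ≤ κ ^ 2 * y ^ 2 := mul_le_mul_of_nonneg_right h4 (by positivity)
    _ = 1 * (κ * y) ^ 2 := by ring
    _ ≤ Real.pi * (P' - 1 : ℝ) ^ 2 := mul_le_mul (by linarith) h2 (by positivity) (by linarith)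

theorem error_sum {W : ℝ} (hκ : 1 ≤ κ) (hr : 0 < r) (hr2 : r ≤ N) (hW : 256 * N ^ 3 * κ ≤ W)
    (hN : 1 ≤ N) (hδ : δ ≤ 1) :
    1 ≤ W / (2 * r) ∧
      3 * Real.exp (-Real.pi * (W / (2 * r)) ^ 2) ≤ 6 * Real.exp (-(δ * κ)) := by
  have hκ' : (1 : ℝ) ≤ κ := by exact_mod_cast hκ
  have hN' : (1 : ℝ) ≤ N := by exact_mod_cast hN
  have h1 : (κ : ℝ) ≤ W / (2 * r) := by
    rw [le_div_iff₀ (by positivity)]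
    have h3 : (N : ℝ) ≤ N ^ 3 := le_self_pow₀ hN' (by norm_num)
    have h4 : (κ : ℝ) * (2 * r) ≤ κ * (2 * N ^ 3) :=
      mul_le_mul_of_nonneg_left (by linarith) (by positivity)
    nlinarith [mul_nonneg (show (0 : ℝ) ≤ κ by linarith) (show (0 : ℝ) ≤ N ^ 3 by positivity)]
  refine ⟨hκ'.trans h1, ?_⟩
  rw [neg_mul]
  refine three_mul_exp_neg_le ?_
  have h2 := pow_le_pow_left₀ (by positivity) h1 2
  have h3 := Real.pi_gt_three
  calc δ * κ ≤ 1 * κ ^ 2 := by nlinarith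
    _ ≤ _ := mul_le_mul (by linarith) h2 (by positivity) (by linarith)

/-- J is so large that J²/(2r²) ≥ 2(Nκ)². Half of this pays for r²/4, the loss from comparing with
the smallest possible Gaussian sum; hence the cube of `N` in J. -/
theorem error_trunc {J : ℕ} (hκ : 1 ≤ κ) (hr : 0 < r) (hr2 : r ≤ N)
    (hJ : 128 * (N : ℝ) ^ 3 * κ ≤ J) (hN : 1 ≤ N) (hδ : δ ≤ 1) :
    truncError r J ≤ 6 * Real.exp (-(δ * κ)) := by
  have hκ' : (1 : ℝ) ≤ κ := by exact_mod_cast hκ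
  have hN' : (1 : ℝ) ≤ N := by exact_mod_cast hN
  rw [truncError, neg_mul]
  refine mul_le_mul_of_nonneg_left (Real.exp_le_exp.2 (neg_le_neg ?_)) (by norm_num)
  have h1 : 2 * (N * κ : ℝ) * r ≤ J := by
    have h3 : (N : ℝ) ^ 2 ≤ N ^ 3 := pow_le_pow_right₀ hN' (by norm_num)
    have h4 : 2 * (N * κ : ℝ) * r ≤ 2 * (N * κ : ℝ) * N :=
      mul_le_mul_of_nonneg_left hr2 (by positivity)
    have h5 : (N : ℝ) ^ 2 * κ ≤ N ^ 3 * κ := mul_le_mul_of_nonneg_right h3 (by positivity)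
    have h6 : 0 ≤ (N : ℝ) ^ 3 * κ := by positivity
    nlinarith
  have h2 : 2 * (N * κ : ℝ) ^ 2 ≤ J ^ 2 / (2 * r ^ 2) := by
    rw [le_div_iff₀ (by positivity)]
    have := pow_le_pow_left₀ (by positivity) h1 2
    linarith
  have h3 : r ^ 2 ≤ (N : ℝ) ^ 2 := pow_le_pow_left₀ hr.le hr2 2
  have h4 : (N : ℝ) ^ 2 ≤ (N * κ) ^ 2 := pow_le_pow_left₀ (by positivity) (by nlinarith) 2
  have h5 : (κ : ℝ) ≤ (N * κ) ^ 2 :=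
    (le_mul_of_one_le_left (by positivity) hN').trans
      (le_self_pow₀ (one_le_mul_of_one_le_of_one_le hN' hκ') (by norm_num))
  have h6 := Real.pi_gt_three
  have h7 : (N * κ : ℝ) ^ 2 ≤ J ^ 2 / (2 * r ^ 2) - r ^ 2 / 4 := by linarith
  calc δ * κ ≤ 1 * (N * κ) ^ 2 := by nlinarith
    _ ≤ _ := mul_le_mul (by linarith) h7 (by positivity) (by linarith)

/-- A round accepts with probability at least of order r/N · N/r divided by κ, that is, 1/κ up to a
constant, because the window is at most 8κN/r. Thus 32κ² rounds push the exponent to at least κ. -/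
theorem error_sampler {P : ℕ} (hP0 : 0 < P) (hr : 0 < r) (hN : 1 ≤ N)
    (hP : P ≤ 8 * κ * N / r) (hδ : δ ≤ 1) :
    Real.exp (-(N / (Real.sqrt 2 * r) / (2 * P) * (32 * (κ * κ) : ℕ))) ≤
      6 * Real.exp (-(δ * κ)) := by
  have hN' : (0 : ℝ) < N := by exact_mod_cast hN
  have hP' : (0 : ℝ) < P := by exact_mod_cast hP0
  have h2 : Real.sqrt 2 ≤ 2 := by
    rw [Real.sqrt_le_left (by norm_num)]
    norm_num
  have h0 : (0 : ℝ) < Real.sqrt 2 := by positivity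
  have hκ : (0 : ℝ) ≤ κ := Nat.cast_nonneg κ
  have h1 : (κ : ℝ) ≤ N / (Real.sqrt 2 * r) / (2 * P) * (32 * (κ * κ) : ℕ) := by
    rw [div_div, div_mul_eq_mul_div, le_div_iff₀ (by positivity)]
    push_cast
    have h3 : P * r ≤ 8 * κ * N := by rwa [le_div_iff₀ hr] at hP
    have h4 : Real.sqrt 2 * (P * r) ≤ 2 * (8 * κ * N) := mul_le_mul h2 h3 (by positivity) (by norm_num)
    nlinarith [mul_le_mul_of_nonneg_left h4 hκ]
  have h3 : Real.exp (-(N / (Real.sqrt 2 * r) / (2 * P) * (32 * (κ * κ) : ℕ))) ≤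
      Real.exp (-(δ * κ)) := Real.exp_le_exp.2 (neg_le_neg (by nlinarith))
  linarith [Real.exp_pos (-(δ * κ))]

theorem error_phase {W : ℝ} (hW : (N : ℝ) ^ 3 * 4 ^ κ * (ℓ * (n + 1)) * 256 ≤ W) (hN : 1 ≤ N)
    (hℓ : 0 < ℓ) (hδ : δ ≤ 1) :
    n * (N ^ 2 / W) ≤ 6 * Real.exp (-(δ * κ)) ∧ (N : ℝ) ^ 2 / W ≤ 1 ∧
      256 * (N : ℝ) ^ 3 * κ ≤ W := by
  have hN' : (1 : ℝ) ≤ N := by exact_mod_cast hN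
  have hℓ' : (1 : ℝ) ≤ ℓ := by exact_mod_cast hℓ
  have hn : (0 : ℝ) ≤ n := Nat.cast_nonneg n
  have h4 : (1 : ℝ) ≤ 4 ^ κ := one_le_pow₀ (by norm_num)
  have hκ : (κ : ℝ) ≤ 4 ^ κ := by
    have := Real.add_one_le_exp (κ : ℝ)
    linarith [exp_le_four_pow κ]
  have h23 : (N : ℝ) ^ 2 ≤ N ^ 3 := pow_le_pow_right₀ hN' (by norm_num)
  have hn1 : (n : ℝ) + 1 ≤ ℓ * (n + 1) := le_mul_of_one_le_left (by linarith) hℓ'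
  have h5 : (N : ℝ) ^ 3 * 4 ^ κ * (n + 1) ≤ W := by
    refine le_trans ?_ hW
    have h6 : (N : ℝ) ^ 3 * 4 ^ κ * (n + 1) ≤ N ^ 3 * 4 ^ κ * (ℓ * (n + 1)) :=
      mul_le_mul_of_nonneg_left hn1 (by positivity)
    have h7 : 0 ≤ (N : ℝ) ^ 3 * 4 ^ κ * (ℓ * (n + 1)) := by positivity
    linarith
  have hW0 : 0 < W := lt_of_lt_of_le (by positivity) h5
  refine ⟨?_, ?_, ?_⟩
  · have h6 : n * (N ^ 2 / W) ≤ Real.exp (-κ) := by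
      rw [← mul_div_assoc, div_le_iff₀ hW0, Real.exp_neg, inv_mul_eq_div,
        le_div_iff₀ (Real.exp_pos _)]
      calc n * (N : ℝ) ^ 2 * Real.exp κ ≤ (n + 1) * N ^ 3 * 4 ^ κ := by
            refine mul_le_mul ?_ (exp_le_four_pow κ) (Real.exp_pos _).le (by positivity)
            exact mul_le_mul (by linarith) h23 (by positivity) (by linarith)
        _ = (N : ℝ) ^ 3 * 4 ^ κ * (n + 1) := by ring
        _ ≤ W := h5
    have h7 : Real.exp (-κ) ≤ Real.exp (-(δ * κ)) := Real.exp_le_exp.2 (by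
      have : δ * κ ≤ 1 * κ := mul_le_mul_of_nonneg_right hδ (Nat.cast_nonneg κ)
      linarith)
    linarith [Real.exp_pos (-(δ * κ))]
  · rw [div_le_one hW0]
    refine h23.trans (le_trans ?_ h5)
    rw [mul_assoc]
    exact le_mul_of_one_le_right (by positivity) (one_le_mul_of_one_le_of_one_le h4 (by linarith))
  · refine le_trans ?_ hW
    have h6 : (N : ℝ) ^ 3 * κ ≤ N ^ 3 * 4 ^ κ := mul_le_mul_of_nonneg_left hκ (by positivity)
    have h7 : (N : ℝ) ^ 3 * 4 ^ κ * 1 ≤ N ^ 3 * 4 ^ κ * (ℓ * (n + 1)) :=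
      mul_le_mul_of_nonneg_left (by linarith) (by positivity)
    linarith

/-- ⌊W/N⌋ N/W ≥ 1 - N/W, and Bernoulli bounds the n-th power by 1 - nN/W ≥ 7/8. -/
theorem half_le_pow {W : ℕ} {ε : ℝ} (hN : 1 ≤ N) (hW0 : 0 < W) (hε : ε ≤ 1 / 8)
    (h : n * ((N : ℝ) ^ 2 / W) ≤ ε) (h' : (N : ℝ) ^ 2 / W ≤ 1) :
    1 / 2 ≤ ((W / N : ℕ) / (W : ℝ) * N : ℝ) ^ n := by
  have hN' : (1 : ℝ) ≤ N := by exact_mod_cast hN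
  have hW : (0 : ℝ) < W := by exact_mod_cast hW0
  have h2 : (N : ℝ) / W ≤ N ^ 2 / W :=
    div_le_div_of_nonneg_right (le_self_pow₀ hN' (by norm_num)) hW.le
  have h1 : 1 - (N : ℝ) / W ≤ (W / N : ℕ) / (W : ℝ) * N := by
    have h3 : W < (W / N + 1) * N := Nat.lt_mul_of_div_lt (Nat.lt_succ_self _) hN
    have h4 : (W : ℝ) ≤ ((W / N : ℕ) + 1) * N := by exact_mod_cast h3.le
    rw [one_sub_div hW.ne', div_mul_eq_mul_div]
    exact div_le_div_of_nonneg_right (by linarith) hW.le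
  have h3 := one_add_mul_le_pow (a := -((N : ℝ) / W)) (by linarith) n
  rw [← sub_eq_add_neg 1] at h3
  have h4 : n * ((N : ℝ) / W) ≤ n * (N ^ 2 / W) := mul_le_mul_of_nonneg_left h2 (Nat.cast_nonneg n)
  have h5 := pow_le_pow_left₀ (by linarith) h1 n
  linarith

end Bounds

theorem le_edcpSuccess_of_growth {κ n N ℓ : ℕ} [NeZero N] {r A B δ : ℝ} (hκ : 1 ≤ κ) (hℓ : 0 < ℓ)
    (hr : 1 < r) (hA : 0 < A) (hB : 0 < B) (hrA : Real.sqrt κ ≤ A * r)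
    (hNB : Real.sqrt κ * r ≤ B * N) (hκA : 2 * A ^ 2 ≤ κ) (hκB : 2 * B ^ 2 ≤ κ)
    (hδ : δ ≤ 1) (hδA : δ ≤ Real.pi / (2 * A ^ 2)) (hδB : δ ≤ Real.pi / (2 * B ^ 2))
    (hε : 6 * Real.exp (-(δ * κ)) ≤ 1 / 8) (hεℓ : 4 * (6 * Real.exp (-(δ * κ))) * ℓ ≤ 1)
    (O : Oracle n N ℓ) (x : Fin ℓ → Fin n → ZMod N) (s : Fin n → ZMod N)
    (hO : 16 * (6 * Real.exp (-(δ * κ))) * ℓ ≤ lweSuccess n N ℓ (1 / r) O) :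
    1 / 2 * (lweSuccess n N ℓ (1 / r) O - 16 * (6 * Real.exp (-(δ * κ))) * ℓ) ≤
      edcpSuccess reduction κ r O x s := by
  have hr0 : 0 < r := by linarith only [hr]
  have hN : 1 ≤ N := NeZero.pos N
  have h2 : (0 : ℝ) < Real.sqrt 2 := by positivity
  have hA2 : Real.sqrt 2 * A ≤ Real.sqrt κ := by
    refine Real.le_sqrt_of_sq_le ?_
    rw [mul_pow, Real.sq_sqrt (by norm_num)]
    exact hκA
  have hB2 : Real.sqrt 2 * B ≤ Real.sqrt κ := by
    refine Real.le_sqrt_of_sq_le ?_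
    rw [mul_pow, Real.sq_sqrt (by norm_num)]
    exact hκB
  have hr2 : 1 ≤ r / Real.sqrt 2 := by
    rw [le_div_iff₀ h2, one_mul]
    refine le_of_mul_le_mul_left ?_ hA
    linarith only [hA2, hrA]
  have hσ : 1 ≤ N / (Real.sqrt 2 * r) := by
    rw [le_div_iff₀ (by positivity), one_mul]
    refine le_of_mul_le_mul_left ?_ hB
    linarith only [mul_le_mul_of_nonneg_right hB2 hr0.le, hNB]
  have hrN : r ≤ N := by
    rw [le_div_iff₀ (by positivity), one_mul] at hσ
    exact (le_mul_of_one_le_left hr0.le (Real.one_le_sqrt.2 (by norm_num))).trans hσ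
  obtain ⟨w, hw⟩ : ∃ w, w + 1 = precision κ n N ℓ :=
    ⟨precision κ n N ℓ - 1, Nat.sub_add_cancel (precision_pos κ n N ℓ)⟩
  have hκ' : (1 : ℝ) ≤ κ := by exact_mod_cast hκ
  -- The window has at least two elements because 4κN/r ≥ 4; being a power of two it is then even,
  -- as its symmetric placement requires.
  have hwin0 : winExp κ N r ≠ 0 := by
    intro h
    have h1 := le_two_pow_winExp κ N r
    rw [h, pow_zero, div_le_iff₀ hr0] at h1
    nlinarith only [h1, hκ', hrN, hr]
  obtain ⟨e, he⟩ : ∃ e, winExp κ N r = e + 1 := Nat.exists_eq_succ_of_ne_zero hwin0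
  have hP1 : 4 * κ * N / r ≤ (2 * 2 ^ e : ℕ) := by
    have h1 := le_two_pow_winExp κ N r
    rw [he, pow_succ'] at h1
    exact_mod_cast h1
  have hP2 : ((2 * 2 ^ e : ℕ) : ℝ) ≤ 8 * κ * N / r := by
    have h1 := two_pow_lt_of_lt_winExp (κ := κ) (N := N) (r := r) (e := e) (by omega)
    have h3 : 8 * κ * N / r = 2 * (4 * κ * N / r) := by ring
    push_cast
    rw [h3]
    linarith only [h1]
  obtain ⟨W, hWd⟩ : ∃ W : ℕ, W = 2 ^ (w + 1) := ⟨_, rfl⟩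
  have hWp : (N : ℝ) ^ 3 * 4 ^ κ * (ℓ * (n + 1)) * 256 ≤ W := by
    rw [hWd, hw]
    exact_mod_cast mul_le_two_pow_precision κ n N ℓ
  have hWr : (W : ℝ) = 2 ^ (w + 1) := by
    rw [hWd]
    push_cast
    rfl
  obtain ⟨hph, hph1, hWκ⟩ := error_phase hWp hN hℓ hδ
  have hs := error_sum hκ hr0 hrN hWκ hN hδ
  have hJ : 128 * (N : ℝ) ^ 3 * κ ≤ (2 ^ w : ℕ) := by
    rw [hWr, pow_succ (2 : ℝ) w] at hWκ
    push_cast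
    linarith only [hWκ]
  have hhalf := half_le_pow (W := W) hN (by rw [hWd]; positivity) hε hph hph1
  refine le_trans ?_ (le_edcpSuccess_of_error hw (P' := 2 ^ e) (by rw [he, pow_succ'])
    hℓ hr hr2 hσ (hWd ▸ hs.1)
    (mul_nonneg (by norm_num) (Real.exp_pos _).le) hε hεℓ (error_width hA hrA hδA)
    (error_noise hB hr0 hNB hδB) (error_window hκ hr0 hrN hP1 hδ) (hWd ▸ hs.2)
    (error_trunc hκ hr0 hrN hJ hN hδ) (error_sampler (by positivity) hr0 hN hP2 hδ) (hWr ▸ hph)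
    (hWr ▸ hph1) O x s)
  rw [hWr, hWd] at hhalf
  exact mul_le_mul_of_nonneg_right hhalf (sub_nonneg.2 hO)

theorem tendsto_eval_mul_exp (T : Polynomial ℕ) {δ : ℝ} (hδ : 0 < δ) :
    Tendsto (fun κ : ℕ => ((T.eval κ : ℕ) : ℝ) * Real.exp (-(δ * κ))) atTop (nhds 0) := by
  have h1 := ((T.map (Nat.castRingHom ℝ)).comp
    (Polynomial.C (1 / δ) * Polynomial.X)).tendsto_div_exp_atTop
  have h2 : Tendsto (fun κ : ℕ => δ * (κ : ℝ)) atTop atTop :=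
    tendsto_natCast_atTop_atTop.const_mul_atTop hδ
  refine (h1.comp h2).congr fun κ => ?_
  have h3 : 1 / δ * (δ * (κ : ℝ)) = κ := by field_simp
  have h4 : (T.map (Nat.castRingHom ℝ)).eval (κ : ℝ) = (T.eval κ : ℕ) := by
    simp
  simp only [Function.comp_apply, Polynomial.eval_comp, Polynomial.eval_mul, Polynomial.eval_C,
    Polynomial.eval_X, h3, h4]
  rw [Real.exp_neg, div_eq_mul_inv]

theorem log_le_log_two_add_one {N : ℕ} (hN : 1 ≤ N) : Real.log N ≤ (Nat.log 2 N + 1 : ℕ) := by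
  have h1 : N < 2 ^ (Nat.log 2 N + 1) := Nat.lt_pow_succ_log_self one_lt_two N
  have h2 : (N : ℝ) ≤ 2 ^ (Nat.log 2 N + 1) := by exact_mod_cast h1.le
  refine (Real.log_le_log (by exact_mod_cast hN) h2).trans ?_
  rw [Real.log_pow]
  refine mul_le_of_le_one_right (Nat.cast_nonneg _) ?_
  linarith [Real.log_two_lt_d9]

/-- The loss is of order ℓ exp(-δκ), while the oracle's success is at least C/(n log N)^d, an
inverse polynomial in κ. For large κ the loss is at most half of that success. Together with the
factor 1/2 for the sampled shift this leaves C/4, with the same exponent d. -/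
theorem solvesGEDCP_reduction {n N ℓ : ℕ → ℕ} [∀ κ, NeZero (N κ)] {r : ℕ → ℝ}
    (hn : ∀ κ, 1 ≤ n κ) (hN : ∀ κ, 2 ≤ N κ) (hr : ∀ κ, 1 < r κ) (hpn : PolyBounded n)
    (hpN : PolyBounded fun κ => Nat.log 2 (N κ)) (hpℓ : PolyBounded ℓ)
    (hℓ : (fun κ : ℕ => (κ : ℝ)) =O[atTop] fun κ => (ℓ κ : ℝ))
    (hrκ : (fun κ : ℕ => Real.sqrt κ) =O[atTop] r)
    (hNr : (fun κ : ℕ => Real.sqrt κ * r κ) =O[atTop] fun κ => (N κ : ℝ))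
    (O : ∀ κ, Oracle (n κ) (N κ) (ℓ κ)) (hO : SolvesLWE n N ℓ (fun κ => 1 / r κ) O) :
    SolvesGEDCP n N ℓ r reduction O := by
  obtain ⟨C, hC, d, hCd⟩ := hO
  obtain ⟨A, hA, hrA⟩ := hrκ.exists_pos
  obtain ⟨B, hB, hNB⟩ := hNr.exists_pos
  obtain ⟨D, hD, hℓD⟩ := hℓ.exists_pos
  obtain ⟨Tn, hTn⟩ := hpn
  obtain ⟨TN, hTN⟩ := hpN
  obtain ⟨Tl, hTl⟩ := hpℓ
  -- The terms with A and B are the decay rates of the smoothing errors of the Gaussians of width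
  -- r/√2 and N/(√2 r); all other errors decay at rate at least 1.
  obtain ⟨δ, hδ0, hδ1, hδA, hδB⟩ : ∃ δ : ℝ, 0 < δ ∧ δ ≤ 1 ∧ δ ≤ Real.pi / (2 * A ^ 2) ∧
      δ ≤ Real.pi / (2 * B ^ 2) :=
    ⟨min 1 (min (Real.pi / (2 * A ^ 2)) (Real.pi / (2 * B ^ 2))),
      lt_min one_pos (lt_min (by positivity) (by positivity)), min_le_left _ _,
      (min_le_right _ _).trans (min_le_left _ _), (min_le_right _ _).trans (min_le_right _ _)⟩
  have ht0 := tendsto_eval_mul_exp 1 hδ0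
  have ht1 := tendsto_eval_mul_exp Tl hδ0
  have ht2 := tendsto_eval_mul_exp (Tl * (Tn * (TN + 1)) ^ d) hδ0
  refine ⟨C / 4, by positivity, d, ?_⟩
  -- With E = exp(-δκ) the constants are those needed below: 6E ≤ 1/8, 24ℓE ≤ 1, and 96ℓE at most
  -- half of C/(n log N)^d.
  filter_upwards [hCd, hrA.bound, hNB.bound, hℓD.bound, eventually_ge_atTop 1,
    tendsto_natCast_atTop_atTop.eventually_ge_atTop (2 * A ^ 2),
    tendsto_natCast_atTop_atTop.eventually_ge_atTop (2 * B ^ 2),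
    ht0.eventually_le_const (show (0 : ℝ) < 1 / 48 by norm_num),
    ht1.eventually_le_const (show (0 : ℝ) < 1 / 24 by norm_num),
    ht2.eventually_le_const (show (0 : ℝ) < C / 192 by positivity)]
    with κ hκO hκr hκN hκℓ hκ1 hκA hκB h0 h1 h2 s x
  have hr0 : 0 < r κ := by linarith only [hr κ]
  have hN1 : 1 ≤ N κ := by linarith only [hN κ]
  rw [Real.norm_of_nonneg (Real.sqrt_nonneg _), Real.norm_of_nonneg hr0.le] at hκr
  rw [Real.norm_of_nonneg (by positivity), Real.norm_of_nonneg (Nat.cast_nonneg _)] at hκN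
  -- Comparison with κ ≥ 1 excludes an empty list of samples.
  have hℓ0 : 0 < ℓ κ := by
    rw [Nat.pos_iff_ne_zero]
    intro h
    rw [h, Nat.cast_zero, norm_zero, mul_zero, norm_le_zero_iff, Nat.cast_eq_zero] at hκℓ
    omega
  obtain ⟨E, hE⟩ : ∃ E : ℝ, E = Real.exp (-(δ * κ)) := ⟨_, rfl⟩
  have hE0 : 0 < E := hE ▸ Real.exp_pos _
  rw [← hE] at h0 h1 h2
  simp only [Polynomial.eval_one, Nat.cast_one, one_mul] at h0
  have hlT : (ℓ κ : ℝ) ≤ (Tl.eval κ : ℕ) := by exact_mod_cast hTl κ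
  have hnT : (n κ : ℝ) ≤ (Tn.eval κ : ℕ) := by exact_mod_cast hTn κ
  have hNT : Real.log (N κ) ≤ (TN.eval κ + 1 : ℕ) :=
    (log_le_log_two_add_one hN1).trans (by exact_mod_cast Nat.succ_le_succ (hTN κ))
  have hlog : 0 < Real.log (N κ) := Real.log_pos (by exact_mod_cast hN κ)
  have hn0 : (0 : ℝ) < n κ := by exact_mod_cast hn κ
  obtain ⟨X, hX⟩ : ∃ X : ℝ, X = (n κ * Real.log (N κ)) ^ d := ⟨_, rfl⟩
  have hX0 : 0 < X := by rw [hX]; positivity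
  have hXT : X ≤ ((Tn.eval κ : ℕ) * (TN.eval κ + 1 : ℕ) : ℝ) ^ d := by
    rw [hX]
    exact pow_le_pow_left₀ (by positivity) (mul_le_mul hnT hNT hlog.le (Nat.cast_nonneg _)) d
  have hlE : (ℓ κ : ℝ) * E ≤ 1 / 24 := (mul_le_mul_of_nonneg_right hlT hE0.le).trans h1
  have hloss : (ℓ κ : ℝ) * X * E ≤ C / 192 := by
    refine le_trans (mul_le_mul_of_nonneg_right ?_ hE0.le) h2
    rw [Polynomial.eval_mul, Polynomial.eval_pow, Polynomial.eval_mul, Polynomial.eval_add,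
      Polynomial.eval_one]
    push_cast at hXT ⊢
    exact mul_le_mul hlT hXT hX0.le (Nat.cast_nonneg _)
  have hloss' : 16 * (6 * E) * ℓ κ ≤ C / X / 2 := by
    rw [div_div, le_div_iff₀ (by positivity)]
    linarith only [hloss]
  rw [← hX] at hκO ⊢
  have hCX : 0 < C / X := by positivity
  have hmain := le_edcpSuccess_of_growth (δ := δ) hκ1 hℓ0 (hr κ) hA hB hκr hκN hκA hκB hδ1 hδA hδB
    (by rw [← hE]; linarith only [h0]) (by rw [← hE]; linarith only [hlE]) (O κ) x s
    (by rw [← hE]; linarith only [hloss', hκO, hCX])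
  rw [← hE] at hmain
  refine le_trans ?_ hmain
  rw [div_right_comm]
  linarith only [hloss', hκO]

end QRed

end

theorem mainTheorem1 :
    ∃ R : QRed.Prog,
      ∀ (n N ℓ : ℕ → ℕ) [∀ κ, NeZero (N κ)] (r : ℕ → ℝ),
        (∀ κ, 1 ≤ n κ) → (∀ κ, 2 ≤ N κ) → (∀ κ, 1 < r κ) →
        QRed.PolyBounded n → QRed.PolyBounded (fun κ => Nat.log 2 (N κ)) → QRed.PolyBounded ℓ →
        ((fun κ : ℕ => (κ : ℝ)) =O[atTop] fun κ => (ℓ κ : ℝ)) →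
        ((fun κ : ℕ => Real.sqrt κ) =O[atTop] r) →
        ((fun κ : ℕ => Real.sqrt κ * r κ) =O[atTop] fun κ => (N κ : ℝ)) →
        QRed.IsReduction n N ℓ r (fun κ => 1 / r κ) R :=
  ⟨QRed.reduction, fun _ _ _ _ r hn hN hr hpn hpN hpℓ hℓ hrκ hNr =>
    ⟨QRed.runsInPolyTime_reduction r hpn hpN hpℓ,
      QRed.solvesGEDCP_reduction hn hN hr hpn hpN hpℓ hℓ hrκ hNr⟩⟩
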